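/- Let $(M,g)$ be a complete, non-compact Riemannian manifold, $\mu$ its Riemannian measure, $x_0\in M$ fixed, $r(x)=\mathrm{dist}(x_0,x)$, $B_R=\{r<R\}$, and $S=M\times(0,\infty)$. Let $p>1$, $m\ge 1$, $q>\max(p+m-2,1)$, let $f:[0,\infty)\to[0,K]$ be measurable for some $K>0$, let $a\in\mathrm{Lip}_{\mathrm{loc}}(M)$ with $a>0$ a.e., and put $d\mu_a=a\,d\mu$. Let $V\in L^1_{\mathrm{loc}}(S)$. A global nonnegative weak solution of $$\partial_t u\ \ge\ \frac1{a}\,\mathrm{div}\big(a\,u^{m-1}|\nabla u|^{p-2}f(|\nabla u|)\nabla u\big)+V u^q\quad\text{in } M\times(0,\infty)\qquad(\ast)$$ is a function $u\ge 0$ a.e. in $S$ which, with its weak gradient $\nabla u$ and weak time derivative $\partial_t u$, is in $L^1_{\mathrm{loc}}(S;d\mu\,dt)$, with $u^qV,\ u\,\partial_t u\in L^1_{\mathrm{loc}}(S;d\mu_a dt)$ and $u^{p+m-1},\ |\nabla u|^p u^{m-1}\in L^1_{\mathrm{loc}}(S;d\mu\,dt)$, such that for every nonnegative, compactly supported, locally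 Lipschitz $\psi$ on $S$ $$\int_0^\infty\!\!\int_M \psi u^qV\,d\mu_a dt\le\int_0^\infty\!\!\int_M\langle\nabla\psi,\nabla u\rangle u^{m-1}|\nabla u|^{p-2}f(|\nabla u|)\,d\mu_a dt-\int_0^\infty\!\!\int_M(\partial_t\psi)\,u\,d\mu_a dt .$$ (If $a>0$ everywhere, local integrability with respect to $d\mu\,dt$ and to $d\mu_a dt$ is the same thing.) Suppose that for some measurable $h:M\to\mathbb R$ and constants $C>0$, $\alpha,\sigma_1,\sigma_2,\delta_1,\delta_2\ge 0$ we have $V(x,t)\ge h(x)$ for a.e. $(x,t)\in S$, $0<h(x)\le C(1+r(x))^{\alpha}$ for a.e. $x\in M$, and, for all $R$ large enough, $$\int_{B_R}h^{-\frac1{q-1}}\,d\mu_a\le CR^{\sigma_1}(\log R)^{\delta_1},\qquad \int_{B_R}h^{-\frac{p+m-2}{q-p-m+2}}\,d\mu_a\le CR^{\sigma_2}(\log R)^{\delta_2}.$$ Assume further that (i) $\delta_1<\frac1{q-1}$ and $\delta_2<\frac{p+m-2}{q-p-m+2}$; (ii) $0\le\sigma_2<\frac{pq}{q-p-m+2}$;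 (iii) $\sigma_1\le\frac1{q-1}\Big(\frac{pq}{q-p-m+2}-\sigma_2\Big)$. Then there is no global nonnegative weak solution $u$ of $(\ast)$ that is nontrivial, i.e. every such $u$ vanishes a.e. in $M\times(0,\infty)$. -/

import Mathlib

open Set MeasureTheory Bundle
open scoped Manifold ContDiff ENNReal

noncomputable section

namespace ParabolicIneq

variable {N : ℕ} {M : Type*} [MetricSpace M] [ChartedSpace (EuclideanSpace ℝ (Fin N)) M]
  [RiemannianBundle (fun x : M ↦ TangentSpace (𝓡 N) x)]

/-- The coordinate vector field `∂ᵢ` of the chart around `c`, at the point with coordinates `y`: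
the image of the `i`-th standard basis vector under the differential of the inverse chart. -/
def coordVec (c : M) (i : Fin N) (y : EuclideanSpace ℝ (Fin N)) :
    TangentSpace (𝓡 N) ((chartAt (EuclideanSpace ℝ (Fin N)) c).symm y) :=
  mfderiv (𝓡 N) (𝓡 N) (chartAt (EuclideanSpace ℝ (Fin N)) c).symm y
    (EuclideanSpace.single i (1 : ℝ))

/-- The matrix `g_{ij} = ⟨∂ᵢ, ∂ⱼ⟩` of the Riemannian metric in the chart around `c`. -/
def metricMatrix (c : M) (y : EuclideanSpace ℝ (Fin N)) : Matrix (Fin N) (Fin N) ℝ :=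
  Matrix.of fun i j ↦ inner ℝ (coordVec c i y) (coordVec c j y)

variable [MeasurableSpace M]

/-- The measure `√(det g) dy` on the domain of the chart around `c`, as a measure on `M`. -/
def chartMeasure (c : M) : Measure M :=
  ((volume.restrict (chartAt (EuclideanSpace ℝ (Fin N)) c).target).withDensity
    fun y ↦ ENNReal.ofReal (Real.sqrt (metricMatrix c y).det)).map
      (chartAt (EuclideanSpace ℝ (Fin N)) c).symm

variable (N M) in
/-- The Riemannian measure `μ`. The chart measures agree on overlaps of chart domains, and their
supremum (in the lattice of measures on `M`) is the measure that restricts to each of them. -/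
def riemannianMeasure : Measure M := ⨆ c : M, chartMeasure (N := N) c

variable (N) in
/-- The weighted measure `dμ_a = a dμ`. -/
def weightedMeasure (a : M → ℝ) : Measure M :=
  (riemannianMeasure N M).withDensity fun x ↦ ENNReal.ofReal (a x)

variable (M) in
/-- The space-time cylinder `S = M × (0, ∞)`, as a subset of `M × ℝ`. -/
def cylinder : Set (M × ℝ) := univ ×ˢ Ioi 0

/-- `w ∈ L¹_loc(S; dm dt)` for a measure `m` on `M`. -/
def LocInt (w : M → ℝ → ℝ) (m : Measure M) : Prop :=
  LocallyIntegrableOn (fun z : M × ℝ ↦ w z.1 z.2) (cylinder M) (m.prod volume)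

/-- `u`, `∇u = G` and `∂ₜu = w` are locally integrable on `S`, and `G`, `w` are the weak
(distributional) spatial gradient and time derivative of `u`. In the chart around `c` this says
that, on the open set `target × (0, ∞)` of `ℝᴺ × ℝ`, the function `u` has the weak partial
derivatives `∂u/∂yᵢ = ⟨G, ∂ᵢ⟩` and `∂u/∂t = w`. -/
structure HasWeakDerivs (u : M → ℝ → ℝ) (G : (x : M) → ℝ → TangentSpace (𝓡 N) x)
    (w : M → ℝ → ℝ) : Prop where
  locInt (c : M) : LocallyIntegrableOn
    (fun y : EuclideanSpace ℝ (Fin N) × ℝ ↦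
      u ((chartAt (EuclideanSpace ℝ (Fin N)) c).symm y.1) y.2)
    ((chartAt (EuclideanSpace ℝ (Fin N)) c).target ×ˢ Ioi 0) volume
  locInt_grad (c : M) (i : Fin N) : LocallyIntegrableOn
    (fun y : EuclideanSpace ℝ (Fin N) × ℝ ↦
      inner ℝ (G ((chartAt (EuclideanSpace ℝ (Fin N)) c).symm y.1) y.2) (coordVec c i y.1))
    ((chartAt (EuclideanSpace ℝ (Fin N)) c).target ×ˢ Ioi 0) volume
  locInt_time (c : M) : LocallyIntegrableOn
    (fun y : EuclideanSpace ℝ (Fin N) × ℝ ↦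
      w ((chartAt (EuclideanSpace ℝ (Fin N)) c).symm y.1) y.2)
    ((chartAt (EuclideanSpace ℝ (Fin N)) c).target ×ˢ Ioi 0) volume
  grad (c : M) (i : Fin N) (η : EuclideanSpace ℝ (Fin N) × ℝ → ℝ) (hη : ContDiff ℝ ∞ η)
    (hc : HasCompactSupport η)
    (hs : tsupport η ⊆ (chartAt (EuclideanSpace ℝ (Fin N)) c).target ×ˢ Ioi 0) :
    ∫ y, u ((chartAt (EuclideanSpace ℝ (Fin N)) c).symm y.1) y.2 *
        fderiv ℝ η y (EuclideanSpace.single i (1 : ℝ), 0) =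
      -∫ y, inner ℝ (G ((chartAt (EuclideanSpace ℝ (Fin N)) c).symm y.1) y.2)
        (coordVec c i y.1) * η y
  time (c : M) (η : EuclideanSpace ℝ (Fin N) × ℝ → ℝ) (hη : ContDiff ℝ ∞ η)
    (hc : HasCompactSupport η)
    (hs : tsupport η ⊆ (chartAt (EuclideanSpace ℝ (Fin N)) c).target ×ˢ Ioi 0) :
    ∫ y, u ((chartAt (EuclideanSpace ℝ (Fin N)) c).symm y.1) y.2 * fderiv ℝ η y (0, 1) =
      -∫ y, w ((chartAt (EuclideanSpace ℝ (Fin N)) c).symm y.1) y.2 * η y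

/-- Nonnegative, compactly supported, locally Lipschitz test functions on `S`, extended by zero
to `M × ℝ`. -/
structure IsTestFunction (ψ : M → ℝ → ℝ) : Prop where
  lip : LocallyLipschitz fun z : M × ℝ ↦ ψ z.1 z.2
  compact : HasCompactSupport fun z : M × ℝ ↦ ψ z.1 z.2
  support : tsupport (fun z : M × ℝ ↦ ψ z.1 z.2) ⊆ cylinder M
  nonneg : ∀ x t, 0 ≤ ψ x t

variable (N) in
/-- Global (that is, on all of `M × (0, ∞)`) nonnegative weak solutions `u` of
`∂ₜu ≥ a⁻¹ div (a u^(m-1) |∇u|^(p-2) f(|∇u|) ∇u) + V u^q`.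
Here `⟨∇ψ, ∇u⟩` is written as the spatial differential of `ψ` applied to `∇u`; it exists at almost
every point, as does `∂ₜψ`, because `ψ` is locally Lipschitz.
The two energy conditions (on `u^(p+m-1)` and `|∇u|^p u^(m-1)`) are local integrability for `dμ dt`.
For continuous `a` this is the same as for `dμ_a dt` near every point where `a` is positive; it
matters only at zeros of `a`, where `dμ_a dt` does not control the energy. -/
def IsWeakSolution (p q m : ℝ) (f : ℝ → ℝ) (a : M → ℝ) (V : M → ℝ → ℝ) (u : M → ℝ → ℝ) : Prop :=
  (∀ᵐ z ∂((riemannianMeasure N M).prod volume).restrict (cylinder M), 0 ≤ u z.1 z.2) ∧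
  LocInt (fun x t ↦ u x t ^ q * V x t) (weightedMeasure N a) ∧
  ∃ (G : (x : M) → ℝ → TangentSpace (𝓡 N) x) (w : M → ℝ → ℝ),
    HasWeakDerivs u G w ∧
    LocInt (fun x t ↦ u x t ^ (p + m - 1)) (riemannianMeasure N M) ∧
    LocInt (fun x t ↦ ‖G x t‖ ^ p * u x t ^ (m - 1)) (riemannianMeasure N M) ∧
    LocInt (fun x t ↦ u x t * w x t) (weightedMeasure N a) ∧
    ∀ ψ : M → ℝ → ℝ, IsTestFunction ψ →
      ∫ z in cylinder M, ψ z.1 z.2 * u z.1 z.2 ^ q * V z.1 z.2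
          ∂((weightedMeasure N a).prod volume) ≤
        (∫ z in cylinder M,
          (show ℝ from mfderiv (𝓡 N) 𝓘(ℝ, ℝ) (fun x ↦ ψ x z.2) z.1 (G z.1 z.2)) *
            u z.1 z.2 ^ (m - 1) * ‖G z.1 z.2‖ ^ (p - 2) * f ‖G z.1 z.2‖
          ∂((weightedMeasure N a).prod volume)) -
        ∫ z in cylinder M, deriv (fun t ↦ ψ z.1 t) z.2 * u z.1 z.2
          ∂((weightedMeasure N a).prod volume)

end ParabolicIneq

end

/-! The proof is a nonlinear capacity argument at critical volume growth. Write `y = u + δ` and test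
the inequality with `φ y^(-β)`, where `φ = φ₀^k` is a cutoff and `β > 0` is small. Differentiating
the negative power produces the good term `-β φ y^(-β-1) u^(m-1) |∇u|^p f(|∇u|)`, and Young's
inequality uses it to swallow the term containing `∇φ`. Up to powers of `φ₀`, what remains is of
order `β^(1-p) |∇φ₀|^p y^(p+m-2-β)` from the flux and `|∂ₜφ₀| y^(1-β)` from time. Both powers of `y`
lie below `q - β`, so a second use of Young's inequality absorbs them into half of the source term
and leaves only negative powers of `h`.

The cutoff is logarithmic in the parabolic radius `ϱ = max(1, r, t^(1/θ))`: it is `2 - β log ϱ`,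
truncated, with `β = 1 / log R`. Its slopes `β/ϱ` and `β/(θ ϱ^θ)` live on the shell `R ≤ ϱ ≤ R²`.
The remainders are `β^(q/(q-e)) ϱ^(-μq/(q-e)) h^(-e/(q-e))` with `(e, μ) = (p+m-2, p)` and `(1, θ)`.
With `θ = pq/(q-p-m+2) - σ₂`, positive by (ii), the volume conditions and (iii) bound the integral
over each dyadic piece of the shell by a multiple of `(log R)^δᵢ`, and there are about `log R`
pieces. The total is `(log R)^(1 + δᵢ - q/(q-e))`, which tends to zero by (i). Exponents are shifted
by multiples of `β` throughout, but this costs only constants, since `ϱ^β ≤ e²` on the shell; the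
polynomial upper bound on `h` serves the same purpose. Fatou's lemma then gives `∫ u^q h dμ_a dt =
0`, so `u = 0` a.e. The carriers are `flux_le`, `exists_pointwise_estimate`,
`exists_lintegral_shell_le` and `exists_a_priori_estimate`.

The delicate point is that `φ (u+δ)^(-β)` is not Lipschitz, hence not admissible. In a chart
`(u+δ)^(-β)` is mollified. The flux is `u^((m-1)/p)` times a function in `L^(p')`, so the gradients
of the approximations must be bounded in `Lᵖ` with weight `u^((m-1)/p)`. The bound comes from `v =
u^κ`, `κ = (p+m-1)/p`, whose spatial weak gradient is in `Lᵖ`, and from `a^(κ-1)|b-a| ≤ |b^κ -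
a^κ|`: weighted oscillations of `u` are controlled by those of `v`. Time oscillations of `v` have no
rate, so the kernels are much narrower in time than in space. See `exists_lipschitz_approx`,
`local_weak_inequality` and `IsSolutionTriple.testedInequality`.

Geometry enters through three facts: charts are locally bi-Lipschitz for the Riemannian distance,
the Riemannian measure has a smooth positive density in each chart, and closed balls are compact
(Hopf–Rinow), so that the cutoff has compact support. -/

noncomputable section

namespace ParabolicIneq

/-! ### Differentials of charts and smoothness of the metric in coordinates -/

section Chart

variable {N : ℕ} {M : Type*} [MetricSpace M] [ChartedSpace (EuclideanSpace ℝ (Fin N)) M]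

/-- The coordinate space of the chart around `c` at which a point `y` is a legitimate coordinate:
the differential of the inverse chart. -/
def chartSymmDeriv (c : M) (y : EuclideanSpace ℝ (Fin N)) :
    EuclideanSpace ℝ (Fin N) →L[ℝ]
      TangentSpace (𝓡 N) ((chartAt (EuclideanSpace ℝ (Fin N)) c).symm y) :=
  mfderiv (𝓡 N) (𝓡 N) (chartAt (EuclideanSpace ℝ (Fin N)) c).symm y

/-- The differential of the chart around `c`. -/
def chartDeriv (c : M) (x : M) :
    TangentSpace (𝓡 N) x →L[ℝ] EuclideanSpace ℝ (Fin N) :=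
  mfderiv (𝓡 N) (𝓡 N) (chartAt (EuclideanSpace ℝ (Fin N)) c) x

section manifold
variable [IsManifold (𝓡 N) ∞ M]

theorem chartDeriv_chartSymmDeriv (c : M) {y : EuclideanSpace ℝ (Fin N)}
    (hy : y ∈ (chartAt (EuclideanSpace ℝ (Fin N)) c).target) (v : EuclideanSpace ℝ (Fin N)) :
    chartDeriv c ((chartAt (EuclideanSpace ℝ (Fin N)) c).symm y) (chartSymmDeriv c y v) = v := by
  have : IsManifold (𝓡 N) 1 M := IsManifold.of_le (n := ∞) (by exact_mod_cast le_top)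
  have he := mdifferentiable_of_mem_atlas (I := 𝓡 N)
    (chart_mem_atlas (EuclideanSpace ℝ (Fin N)) c)
  have h2 := he.comp_symm_deriv hy
  exact congrArg (fun L : EuclideanSpace ℝ (Fin N) →L[ℝ] EuclideanSpace ℝ (Fin N) ↦ L v) h2

theorem chartSymmDeriv_chartDeriv (c : M) {y : EuclideanSpace ℝ (Fin N)}
    (hy : y ∈ (chartAt (EuclideanSpace ℝ (Fin N)) c).target)
    (v : TangentSpace (𝓡 N) ((chartAt (EuclideanSpace ℝ (Fin N)) c).symm y)) :
    chartSymmDeriv c y (chartDeriv c ((chartAt (EuclideanSpace ℝ (Fin N)) c).symm y) v) = v := by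
  have : IsManifold (𝓡 N) 1 M := IsManifold.of_le (n := ∞) (by exact_mod_cast le_top)
  have he := mdifferentiable_of_mem_atlas (I := 𝓡 N)
    (chart_mem_atlas (EuclideanSpace ℝ (Fin N)) c)
  have h2 := he.symm_comp_deriv ((chartAt (EuclideanSpace ℝ (Fin N)) c).map_target hy)
  rw [(chartAt (EuclideanSpace ℝ (Fin N)) c).right_inv hy] at h2
  exact congrArg (fun L : TangentSpace (𝓡 N) _ →L[ℝ] TangentSpace (𝓡 N) _ ↦ L v) h2

/-- The tangent map of the smooth inverse chart, evaluated on a constant vector field. Smoothness as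
a section of the total space is the form required to pair two such fields by `inner_bundle`. -/
theorem contMDiffOn_chartSymmDeriv (c : M) (v : EuclideanSpace ℝ (Fin N)) :
    ContMDiffOn (𝓡 N) ((𝓡 N).prod 𝓘(ℝ, EuclideanSpace ℝ (Fin N))) ∞
      (fun y ↦ (⟨(chartAt (EuclideanSpace ℝ (Fin N)) c).symm y, chartSymmDeriv c y v⟩ :
        TotalSpace (EuclideanSpace ℝ (Fin N)) (fun x : M ↦ TangentSpace (𝓡 N) x)))
      (chartAt (EuclideanSpace ℝ (Fin N)) c).target := by
  have : IsManifold (𝓡 N) 1 M := IsManifold.of_le (n := ∞) (by exact_mod_cast le_top)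
  have h := (contMDiffOn_chart_symm (I := 𝓡 N) (n := ∞) (x := c)).contMDiffOn_tangentMapWithin
    (m := ∞) (by simp) (chartAt (EuclideanSpace ℝ (Fin N)) c).open_target.uniqueMDiffOn
  have hs := (contMDiff_vectorSpace_iff_contDiff (𝕜 := ℝ) (E := EuclideanSpace ℝ (Fin N))
    (n := ∞) (V := fun _ ↦ v)).2 contDiff_const
  have h3 := h.comp hs.contMDiffOn (s := (chartAt (EuclideanSpace ℝ (Fin N)) c).target)
    (fun y hy ↦ hy)
  refine h3.congr fun y hy ↦ ?_
  simp only [Function.comp, tangentMapWithin, chartSymmDeriv]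
  rw [mfderivWithin_of_mem_nhds ((chartAt (EuclideanSpace ℝ (Fin N)) c).open_target.mem_nhds hy)]
  rfl

end manifold

variable [RiemannianBundle (fun x : M ↦ TangentSpace (𝓡 N) x)] [IsManifold (𝓡 N) ∞ M]
    [IsContMDiffRiemannianBundle (𝓡 N) ∞ (EuclideanSpace ℝ (Fin N))
      (fun x : M ↦ TangentSpace (𝓡 N) x)]

theorem contDiffOn_inner_chartSymmDeriv (c : M) (v w : EuclideanSpace ℝ (Fin N)) :
    ContDiffOn ℝ ∞ (fun y ↦ inner ℝ (chartSymmDeriv c y v) (chartSymmDeriv c y w))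
      (chartAt (EuclideanSpace ℝ (Fin N)) c).target := by
  rw [← contMDiffOn_iff_contDiffOn]
  exact (contMDiffOn_chartSymmDeriv c v).inner_bundle (contMDiffOn_chartSymmDeriv c w)

end Chart

/-! ### The metric matrix, its determinant, and comparison with the Euclidean norm -/

section Metric
variable {N : ℕ} {M : Type*} [MetricSpace M] [ChartedSpace (EuclideanSpace ℝ (Fin N)) M]
  [RiemannianBundle (fun x : M ↦ TangentSpace (𝓡 N) x)]

theorem inner_chartSymmDeriv (c : M) (y v w : EuclideanSpace ℝ (Fin N)) :
    inner ℝ (chartSymmDeriv c y v) (chartSymmDeriv c y w) =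
      ∑ i, ∑ j, v i * (w j * metricMatrix c y i j) := by
  have hv (v : EuclideanSpace ℝ (Fin N)) :
      chartSymmDeriv c y v = ∑ i, v i • coordVec c i y := by
    conv_lhs => rw [← (EuclideanSpace.basisFun (Fin N) ℝ).sum_repr v]
    rw [map_sum]
    refine Finset.sum_congr rfl fun i _ ↦ ?_
    rw [map_smul, EuclideanSpace.basisFun_apply, EuclideanSpace.basisFun_repr]
    rfl
  rw [hv, hv, sum_inner]
  refine Finset.sum_congr rfl fun i _ ↦ ?_
  rw [inner_sum]
  refine Finset.sum_congr rfl fun j _ ↦ ?_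
  rw [real_inner_smul_left, real_inner_smul_right]
  rfl

variable [IsManifold (𝓡 N) ∞ M]
    [IsContMDiffRiemannianBundle (𝓡 N) ∞ (EuclideanSpace ℝ (Fin N))
      (fun x : M ↦ TangentSpace (𝓡 N) x)]

theorem contDiffOn_metricMatrix (c : M) (i j : Fin N) :
    ContDiffOn ℝ ∞ (fun y ↦ metricMatrix c y i j)
      (chartAt (EuclideanSpace ℝ (Fin N)) c).target :=
  contDiffOn_inner_chartSymmDeriv c (EuclideanSpace.single i 1) (EuclideanSpace.single j 1)

/-- The quadratic form at `v` is the squared Riemannian norm of the image of `v` under the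
differential of the inverse chart, and that differential is injective because the differential of
the chart is a left inverse. -/
theorem posDef_metricMatrix (c : M) {y : EuclideanSpace ℝ (Fin N)}
    (hy : y ∈ (chartAt (EuclideanSpace ℝ (Fin N)) c).target) : (metricMatrix c y).PosDef := by
  refine Matrix.PosDef.of_dotProduct_mulVec_pos ?_ fun v hv ↦ ?_
  · ext i j
    simp only [Matrix.conjTranspose_apply, star_trivial]
    exact real_inner_comm (coordVec c i y) (coordVec c j y)
  · have h := inner_chartSymmDeriv c y (WithLp.toLp 2 v) (WithLp.toLp 2 v)
    have h0 : chartSymmDeriv c y (WithLp.toLp 2 v) ≠ 0 := by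
      intro h0
      have := chartDeriv_chartSymmDeriv c hy (WithLp.toLp 2 v)
      rw [h0, map_zero] at this
      exact hv (by simpa using this.symm)
    have : star v ⬝ᵥ (metricMatrix c y).mulVec v =
        inner ℝ (chartSymmDeriv c y (WithLp.toLp 2 v)) (chartSymmDeriv c y (WithLp.toLp 2 v)) := by
      rw [h]
      simp only [dotProduct, Matrix.mulVec, star_trivial, Finset.mul_sum]
      refine Finset.sum_congr rfl fun i _ ↦ Finset.sum_congr rfl fun j _ ↦ ?_
      ring
    rw [this]
    exact real_inner_self_pos.2 h0

/-- The density of the Riemannian measure in the chart around `c`. -/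
def metricDensity (c : M) (y : EuclideanSpace ℝ (Fin N)) : ℝ :=
  Real.sqrt (metricMatrix c y).det

theorem metricDensity_pos (c : M) {y : EuclideanSpace ℝ (Fin N)}
    (hy : y ∈ (chartAt (EuclideanSpace ℝ (Fin N)) c).target) : 0 < metricDensity c y :=
  Real.sqrt_pos.2 (posDef_metricMatrix c hy).det_pos

theorem contDiffOn_det_metricMatrix (c : M) :
    ContDiffOn ℝ ∞ (fun y ↦ (metricMatrix c y).det)
      (chartAt (EuclideanSpace ℝ (Fin N)) c).target := by
  simp only [Matrix.det_apply]
  refine ContDiffOn.sum fun σ _ ↦ ContDiffOn.const_smul _ (contDiffOn_prod fun i _ ↦ ?_)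
  exact contDiffOn_metricMatrix c _ _

theorem contDiffOn_metricDensity (c : M) :
    ContDiffOn ℝ ∞ (metricDensity c) (chartAt (EuclideanSpace ℝ (Fin N)) c).target :=
  (contDiffOn_det_metricMatrix c).sqrt fun _ hy ↦ (posDef_metricMatrix c hy).det_pos.ne'

/-- On a compact set of coordinates the Riemannian norm and the Euclidean one are equivalent. -/
theorem exists_norm_chartSymmDeriv_bounds (c : M) {K : Set (EuclideanSpace ℝ (Fin N))}
    (hK : IsCompact K) (hKt : K ⊆ (chartAt (EuclideanSpace ℝ (Fin N)) c).target) :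
    ∃ C : ℝ, 0 < C ∧ ∀ y ∈ K, ∀ v, ‖chartSymmDeriv c y v‖ ≤ C * ‖v‖ ∧
      ‖v‖ ≤ C * ‖chartSymmDeriv c y v‖ := by
  -- By homogeneity in `v` both bounds reduce to `K` times the unit sphere, a compact set on which
  -- `Q` is continuous and positive: `C₁` bounds `Q` and `C₂` bounds its inverse.
  set Q : EuclideanSpace ℝ (Fin N) × EuclideanSpace ℝ (Fin N) → ℝ :=
    fun z ↦ ‖chartSymmDeriv c z.1 z.2‖ with hQ
  have hQs (z) : Q z = Real.sqrt (∑ i, ∑ j, z.2 i * (z.2 j * metricMatrix c z.1 i j)) := by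
    rw [hQ, ← inner_chartSymmDeriv]
    exact norm_eq_sqrt_real_inner _
  have hcont : ContinuousOn Q (K ×ˢ Metric.sphere 0 1) := by
    rw [funext hQs]
    refine ContinuousOn.sqrt (continuousOn_finsetSum _ fun i _ ↦ continuousOn_finsetSum _
      fun j _ ↦ ?_)
    have hm : ContinuousOn (fun z : EuclideanSpace ℝ (Fin N) × EuclideanSpace ℝ (Fin N) ↦
        metricMatrix c z.1 i j) (K ×ˢ Metric.sphere 0 1) :=
      (contDiffOn_metricMatrix c i j).continuousOn.comp continuousOn_fst
        fun z hz ↦ hKt hz.1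
    fun_prop
  have hc : IsCompact (K ×ˢ Metric.sphere (0 : EuclideanSpace ℝ (Fin N)) 1) :=
    hK.prod (isCompact_sphere _ _)
  obtain ⟨C₁, hC₁⟩ := hc.exists_bound_of_continuousOn hcont
  have hpos : ∀ z ∈ K ×ˢ Metric.sphere (0 : EuclideanSpace ℝ (Fin N)) 1, 0 < Q z := by
    rintro ⟨y, v⟩ ⟨hy, hv⟩
    refine norm_pos_iff.2 fun h0 ↦ ?_
    have := chartDeriv_chartSymmDeriv c (hKt hy) v
    simp only at h0
    rw [h0, map_zero] at this
    simp [← this] at hv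
  obtain ⟨C₂, hC₂⟩ := hc.exists_bound_of_continuousOn
    (hcont.inv₀ fun z hz ↦ (hpos z hz).ne')
  -- When `K` or the sphere is empty, `C₁` and `C₂` carry no sign; the `1` keeps the constant
  -- positive.
  refine ⟨max 1 (max C₁ C₂), by positivity, fun y hy v ↦ ?_⟩
  rcases eq_or_ne v 0 with rfl | hv
  · simp
  have hv' : 0 < ‖v‖ := norm_pos_iff.2 hv
  have hz : (y, ‖v‖⁻¹ • v) ∈ K ×ˢ Metric.sphere (0 : EuclideanSpace ℝ (Fin N)) 1 := by
    refine ⟨hy, ?_⟩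
    simp [norm_smul, hv'.ne']
  have h1 := hC₁ _ hz
  have h2 := hC₂ _ hz
  have h3 : Q (y, ‖v‖⁻¹ • v) = ‖v‖⁻¹ * ‖chartSymmDeriv c y v‖ := by
    simp only [hQ, map_smul, norm_smul, norm_inv, norm_norm]
  have hp := hpos _ hz
  rw [Real.norm_of_nonneg hp.le] at h1
  rw [Pi.inv_apply, Real.norm_of_nonneg (inv_nonneg.2 hp.le)] at h2
  rw [h3] at h1 h2 hp
  have h4 : C₁ ≤ max 1 (max C₁ C₂) := by simp
  have h5 : C₂ ≤ max 1 (max C₁ C₂) := by simp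
  constructor
  · calc _ = ‖v‖ * (‖v‖⁻¹ * ‖chartSymmDeriv c y v‖) := by field_simp
      _ ≤ ‖v‖ * max 1 (max C₁ C₂) := by gcongr; exact h1.trans h4
      _ = _ := mul_comm _ _
  · have h6 : 0 < ‖chartSymmDeriv c y v‖ := by
      by_contra h; push Not at h
      have := mul_nonpos_of_nonneg_of_nonpos (inv_nonneg.2 hv'.le) h
      linarith
    calc ‖v‖ = (‖v‖⁻¹ * ‖chartSymmDeriv c y v‖)⁻¹ * ‖chartSymmDeriv c y v‖ := by
          field_simp
      _ ≤ _ := by gcongr; exact h2.trans h5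

end Metric

/-! ### Charts are locally bi-Lipschitz for the Riemannian distance -/

section Lip
open Manifold
variable {N : ℕ} {M : Type*} [MetricSpace M] [ChartedSpace (EuclideanSpace ℝ (Fin N)) M]
  [RiemannianBundle (fun x : M ↦ TangentSpace (𝓡 N) x)]
  [IsManifold (𝓡 N) ∞ M]
  [IsContMDiffRiemannianBundle (𝓡 N) ∞ (EuclideanSpace ℝ (Fin N))
      (fun x : M ↦ TangentSpace (𝓡 N) x)]
  [IsRiemannianManifold (𝓡 N) M]

/-- The distance is the infimum of the lengths of `C¹` paths. The image of the coordinate segment is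
a competitor, whose speed is the differential of the inverse chart applied to `z - y`. -/
theorem edist_chart_symm_le (c : M) {y z : EuclideanSpace ℝ (Fin N)} {B : ℝ}
    (hseg : segment ℝ y z ⊆ (chartAt (EuclideanSpace ℝ (Fin N)) c).target)
    (hB : ∀ w ∈ segment ℝ y z, ‖chartSymmDeriv c w (z - y)‖ ≤ B) :
    edist ((chartAt (EuclideanSpace ℝ (Fin N)) c).symm y)
      ((chartAt (EuclideanSpace ℝ (Fin N)) c).symm z) ≤ ENNReal.ofReal B := by
  have : IsManifold (𝓡 N) 1 M := IsManifold.of_le (n := ∞) (by exact_mod_cast le_top)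
  rw [IsRiemannianManifold.out (I := 𝓡 N)]
  set e := chartAt (EuclideanSpace ℝ (Fin N)) c with he
  set η : ℝ → EuclideanSpace ℝ (Fin N) := fun t ↦ y + t • (z - y) with hη
  have hηs (t : ℝ) (ht : t ∈ Icc (0 : ℝ) 1) : η t ∈ segment ℝ y z := by
    rw [segment_eq_image']
    exact ⟨t, ht, rfl⟩
  have hηc : ContDiff ℝ 1 η := by fun_prop
  have hγ : ContMDiffOn 𝓘(ℝ, ℝ) (𝓡 N) 1 (e.symm ∘ η) (Icc 0 1) :=
    (contMDiffOn_chart_symm (I := 𝓡 N) (n := 1) (x := c)).comp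
      hηc.contMDiff.contMDiffOn fun t ht ↦ hseg (hηs t ht)
  refine (riemannianEDist_le_pathELength hγ (x := e.symm y) (y := e.symm z)
    (by simp [η]) (by simp [η]) zero_le_one).trans ?_
  rw [pathELength_eq_lintegral_mfderiv_Ioo]
  have hle : ∀ t ∈ Ioo (0 : ℝ) 1, ‖mfderiv 𝓘(ℝ, ℝ) (𝓡 N) (e.symm ∘ η) t 1‖ₑ
      ≤ ENNReal.ofReal B := by
    intro t ht
    have ht' := hηs t (Ioo_subset_Icc_self ht)
    have hd : MDifferentiableAt 𝓘(ℝ, ℝ) (𝓡 N) η t :=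
      (hηc.contMDiff.mdifferentiable one_ne_zero) t
    have hd2 := mdifferentiableAt_atlas_symm (I := 𝓡 N)
      (chart_mem_atlas (EuclideanSpace ℝ (Fin N)) c) (hseg ht')
    have h1 := mfderiv_comp t hd2 hd
    have h2 : mfderiv 𝓘(ℝ, ℝ) (𝓡 N) η t 1 = z - y := by
      rw [mfderiv_eq_fderiv]
      have : HasDerivAt η (z - y) t := by
        have h := ((hasDerivAt_id t).smul_const (z - y)).const_add y
        rwa [one_smul] at h
      exact this.deriv
    have h3 : mfderiv 𝓘(ℝ, ℝ) (𝓡 N) (e.symm ∘ η) t 1 = chartSymmDeriv c (η t) (z - y) := by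
      rw [← h2]
      exact congrArg (fun L : ℝ →L[ℝ] TangentSpace (𝓡 N) (e.symm (η t)) ↦ L 1) h1
    rw [h3, ← ofReal_norm]
    exact ENNReal.ofReal_le_ofReal (hB _ ht')
  calc _ ≤ ∫⁻ t in Ioo (0 : ℝ) 1, ENNReal.ofReal B := setLIntegral_mono' measurableSet_Ioo hle
    _ = _ := by simp

/-- The inverse of a chart is locally Lipschitz. -/
theorem exists_lipschitzOnWith_chart_symm (c : M) {y : EuclideanSpace ℝ (Fin N)}
    (hy : y ∈ (chartAt (EuclideanSpace ℝ (Fin N)) c).target) :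
    ∃ C : NNReal, ∃ s ∈ nhds y, LipschitzOnWith C (chartAt (EuclideanSpace ℝ (Fin N)) c).symm s := by
  obtain ⟨r, hr, hrt⟩ := Metric.nhds_basis_closedBall.mem_iff.1
    ((chartAt (EuclideanSpace ℝ (Fin N)) c).open_target.mem_nhds hy)
  obtain ⟨C, hC, hCb⟩ := exists_norm_chartSymmDeriv_bounds c (isCompact_closedBall y r) hrt
  refine ⟨C.toNNReal, Metric.closedBall y r, Metric.closedBall_mem_nhds _ hr, fun z hz w hw ↦ ?_⟩
  have hs := (convex_closedBall y r).segment_subset hz hw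
  refine (edist_chart_symm_le c (hs.trans hrt) fun v hv ↦ (hCb v (hs hv) _).1).trans ?_
  rw [ENNReal.ofReal_mul hC.le, edist_dist, dist_comm, dist_eq_norm]
  rfl

/-- Initial pieces of a path are no longer than the whole, so a nearly minimising path does not
leave the ball of radius `r`. This confinement is what keeps paths inside a chart domain. -/
theorem exists_path_of_edist_lt {x y : M} {r : ℝ≥0∞} (h : edist x y < r) :
    ∃ γ : ℝ → M, γ 0 = x ∧ γ 1 = y ∧ ContMDiffOn 𝓘(ℝ, ℝ) (𝓡 N) 1 γ (Icc 0 1) ∧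
      pathELength (𝓡 N) γ 0 1 < r ∧ ∀ t ∈ Icc (0 : ℝ) 1, edist x (γ t) < r := by
  rw [IsRiemannianManifold.out (I := 𝓡 N)] at h
  obtain ⟨γ, h0, h1, hγ, hl⟩ := exists_lt_of_riemannianEDist_lt h
  refine ⟨γ, h0, h1, hγ, hl, fun t ht ↦ ?_⟩
  rw [IsRiemannianManifold.out (I := 𝓡 N)]
  exact (riemannianEDist_le_pathELength (hγ.mono (Icc_subset_Icc_right ht.2)) h0 rfl
    ht.1).trans_lt ((pathELength_mono le_rfl ht.2).trans_lt hl)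

/-- Charts are locally Lipschitz. -/
theorem exists_lipschitzOnWith_chart (c : M) {x : M}
    (hx : x ∈ (chartAt (EuclideanSpace ℝ (Fin N)) c).source) :
    ∃ C : NNReal, ∃ s ∈ nhds x, LipschitzOnWith C (chartAt (EuclideanSpace ℝ (Fin N)) c) s := by
  have : IsManifold (𝓡 N) 1 M := IsManifold.of_le (n := ∞) (by exact_mod_cast le_top)
  set e := chartAt (EuclideanSpace ℝ (Fin N)) c with he
  obtain ⟨r, hr, hrt⟩ := Metric.nhds_basis_closedBall.mem_iff.1
    (e.open_target.mem_nhds (e.map_source hx))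
  obtain ⟨C, hC, hCb⟩ := exists_norm_chartSymmDeriv_bounds c (isCompact_closedBall (e x) r) hrt
  have hgood : e.source ∩ e ⁻¹' Metric.closedBall (e x) r ∈ nhds x :=
    Filter.inter_mem (e.open_source.mem_nhds hx)
      ((e.continuousAt hx).preimage_mem_nhds (Metric.closedBall_mem_nhds _ hr))
  obtain ⟨ρ, hρ, hρs⟩ := Metric.nhds_basis_eball.mem_iff.1 hgood
  have hbound : ∀ w ∈ e.source ∩ e ⁻¹' Metric.closedBall (e x) r, ∀ v : TangentSpace (𝓡 N) w,
      ‖chartDeriv c w v‖ₑ ≤ ENNReal.ofReal C * ‖v‖ₑ := by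
    rintro w ⟨hws, hwb⟩ v
    obtain ⟨u, hu, rfl⟩ : ∃ u ∈ Metric.closedBall (e x) r, e.symm u = w :=
      ⟨e w, hwb, e.left_inv hws⟩
    have h1 := (hCb u hu (chartDeriv c (e.symm u) v)).2
    rw [chartSymmDeriv_chartDeriv c (hrt hu)] at h1
    rw [← ofReal_norm, ← ofReal_norm, ← ENNReal.ofReal_mul hC.le]
    exact ENNReal.ofReal_le_ofReal h1
  -- Two points within `ρ / 3` of `x` are joined by a path of length below `2ρ / 3`; all of it stays
  -- within `ρ` of `x`, where the differential of the chart is bounded by `C`.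
  refine ⟨C.toNNReal, Metric.eball x (ρ / 3), Metric.eball_mem_nhds _ (ENNReal.div_pos hρ.ne' (by simp)),
    fun y hy z hz ↦ ?_⟩
  have key : ∀ s : ℝ≥0∞, edist y z < s → s ≤ ρ / 3 + ρ / 3 → edist (e y) (e z) ≤ C.toNNReal * s := by
    intro s hs hs2
    obtain ⟨γ, h0, h1, hγ, hl, hin⟩ := exists_path_of_edist_lt (N := N) hs
    have hγg : ∀ t ∈ Icc (0 : ℝ) 1, γ t ∈ e.source ∩ e ⁻¹' Metric.closedBall (e x) r := by
      intro t ht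
      apply hρs
      rw [Metric.mem_eball, edist_comm]
      calc edist x (γ t) ≤ edist x y + edist y (γ t) := edist_triangle _ _ _
        _ < ρ / 3 + (ρ / 3 + ρ / 3) :=
          ENNReal.add_lt_add (by rw [edist_comm]; exact hy) ((hin t ht).trans_le hs2)
        _ = ρ := by rw [← add_assoc, ENNReal.add_thirds]
    have hmd : ContMDiffOn 𝓘(ℝ, ℝ) (𝓡 N) 1 (e ∘ γ) (Icc 0 1) :=
      (contMDiffOn_chart (I := 𝓡 N) (n := 1) (x := c)).comp hγ fun t ht ↦ (hγg t ht).1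
    have hd : ContDiffOn ℝ 1 (e ∘ γ) (Icc 0 1) := contMDiffOn_iff_contDiffOn.1 hmd
    have hE := enorm_sub_le_lintegral_derivWithin_Icc_of_contDiffOn_Icc hd zero_le_one
    simp only [Function.comp, h0, h1] at hE
    rw [edist_comm, edist_eq_enorm_sub]
    refine hE.trans ?_
    calc _ ≤ ∫⁻ t in Icc (0 : ℝ) 1, ENNReal.ofReal C *
          ‖mfderivWithin 𝓘(ℝ, ℝ) (𝓡 N) γ (Icc 0 1) t 1‖ₑ := by
          refine setLIntegral_mono' measurableSet_Icc fun t ht ↦ ?_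
          refine le_trans (le_of_eq ?_) (hbound _ (hγg t ht) _)
          congr 1
          have hcomp : mfderivWithin 𝓘(ℝ, ℝ) (𝓡 N) (e ∘ γ) (Icc 0 1) t =
              (mfderiv (𝓡 N) (𝓡 N) e (γ t)).comp
                (mfderivWithin 𝓘(ℝ, ℝ) (𝓡 N) γ (Icc 0 1) t) := by
            apply mfderiv_comp_mfderivWithin
            · exact mdifferentiableAt_atlas (chart_mem_atlas _ c) (hγg t ht).1
            · exact hγ.mdifferentiableOn one_ne_zero t ht
            · rw [uniqueMDiffWithinAt_iff_uniqueDiffWithinAt]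
              exact uniqueDiffOn_Icc zero_lt_one _ ht
          have h4 := congrArg (fun L : ℝ →L[ℝ] EuclideanSpace ℝ (Fin N) ↦ L 1) hcomp
          rw [mfderivWithin_eq_fderivWithin] at h4
          exact h4
      _ = ENNReal.ofReal C * pathELength (𝓡 N) γ 0 1 := by
          rw [lintegral_const_mul' _ _ ENNReal.ofReal_ne_top,
            pathELength_eq_lintegral_mfderivWithin_Icc]
      _ ≤ _ := by
          gcongr
          exact le_rfl
  have hyz : edist y z < ρ / 3 + ρ / 3 :=
    (edist_triangle_right y z x).trans_lt (ENNReal.add_lt_add hy hz)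
  -- Path lengths only approach the distance, so `key` is available for `s` strictly larger than
  -- `edist y z`; continuity of `s ↦ C s` closes the gap.
  by_contra hcon
  push Not at hcon
  obtain ⟨s, hs1, hs2⟩ : ∃ s, edist y z < s ∧ s ≤ ρ / 3 + ρ / 3 ∧ ↑C.toNNReal * s < edist (e y) (e z) := by
    have hct : ContinuousAt (fun s : ℝ≥0∞ ↦ (C.toNNReal : ℝ≥0∞) * s) (edist y z) :=
      (ENNReal.continuous_const_mul (by simp)).continuousAt
    have hev := hct.eventually (gt_mem_nhds hcon)
    have hev2 := (hev.filter_mono (nhdsWithin_le_nhds (s := Ioi (edist y z)))).and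
      ((Ioo_mem_nhdsGT hyz))
    have : (nhdsWithin (edist y z) (Ioi (edist y z))).NeBot := by
      exact nhdsGT_neBot_of_exists_gt ⟨_, hyz⟩
    obtain ⟨s, hs⟩ := hev2.exists
    exact ⟨s, hs.2.1, hs.2.2.le, hs.1⟩
  exact absurd (key s hs1 hs2.1) (not_le.2 hs2.2)

end Lip

/-! ### Differentials of functions in charts and pointwise Lipschitz bounds -/

section Grad
open Manifold
variable {N : ℕ} {M : Type*} [MetricSpace M] [ChartedSpace (EuclideanSpace ℝ (Fin N)) M]
  [IsManifold (𝓡 N) ∞ M]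

theorem mdifferentiableAt_iff_chart (c : M) {ψ : M → ℝ} {y : EuclideanSpace ℝ (Fin N)}
    (hy : y ∈ (chartAt (EuclideanSpace ℝ (Fin N)) c).target) :
    MDifferentiableAt (𝓡 N) 𝓘(ℝ, ℝ) ψ ((chartAt (EuclideanSpace ℝ (Fin N)) c).symm y) ↔
      DifferentiableAt ℝ (fun z ↦ ψ ((chartAt (EuclideanSpace ℝ (Fin N)) c).symm z)) y := by
  have : IsManifold (𝓡 N) 1 M := IsManifold.of_le (n := ∞) (by exact_mod_cast le_top)
  set e := chartAt (EuclideanSpace ℝ (Fin N)) c with he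
  have hd2 := mdifferentiableAt_atlas_symm (I := 𝓡 N)
      (chart_mem_atlas (EuclideanSpace ℝ (Fin N)) c) hy
  have hd1 := mdifferentiableAt_atlas (I := 𝓡 N)
      (chart_mem_atlas (EuclideanSpace ℝ (Fin N)) c) (e.map_target hy)
  constructor
  · intro h
    rw [← mdifferentiableAt_iff_differentiableAt]
    exact h.comp y hd2
  · intro h
    rw [← mdifferentiableAt_iff_differentiableAt] at h
    have h' : MDifferentiableAt (𝓡 N) 𝓘(ℝ, ℝ) (fun z ↦ ψ (e.symm z)) (e (e.symm y)) := by
      rwa [e.right_inv hy]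
    refine (h'.comp (e.symm y) hd1).congr_of_eventuallyEq ?_
    filter_upwards [e.open_source.mem_nhds (e.map_target hy)] with z hz
    simp [Function.comp, e.left_inv hz]

/-- No differentiability is needed: the two sides are differentiable simultaneously, and otherwise
both derivatives are zero by convention. -/
theorem mfderiv_chart_symm_apply (c : M) {ψ : M → ℝ} {y : EuclideanSpace ℝ (Fin N)}
    (hy : y ∈ (chartAt (EuclideanSpace ℝ (Fin N)) c).target)
    (v : TangentSpace (𝓡 N) ((chartAt (EuclideanSpace ℝ (Fin N)) c).symm y)) :
    (show ℝ from mfderiv (𝓡 N) 𝓘(ℝ, ℝ) ψ ((chartAt (EuclideanSpace ℝ (Fin N)) c).symm y) v) =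
      fderiv ℝ (fun z ↦ ψ ((chartAt (EuclideanSpace ℝ (Fin N)) c).symm z)) y
        (chartDeriv c _ v) := by
  have : IsManifold (𝓡 N) 1 M := IsManifold.of_le (n := ∞) (by exact_mod_cast le_top)
  revert v
  set e := chartAt (EuclideanSpace ℝ (Fin N)) c with he
  intro v
  by_cases hd : MDifferentiableAt (𝓡 N) 𝓘(ℝ, ℝ) ψ (e.symm y)
  · have hd2 := mdifferentiableAt_atlas_symm (I := 𝓡 N)
      (chart_mem_atlas (EuclideanSpace ℝ (Fin N)) c) hy
    have h := mfderiv_comp y hd hd2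
    rw [mfderiv_eq_fderiv] at h
    have h' := congrArg (fun L : EuclideanSpace ℝ (Fin N) →L[ℝ] ℝ ↦
      L (chartDeriv c (e.symm y) v)) h
    refine Eq.trans ?_ h'.symm
    change _ = (mfderiv (𝓡 N) 𝓘(ℝ, ℝ) ψ (e.symm y)) (chartSymmDeriv c y (chartDeriv c _ v))
    rw [chartSymmDeriv_chartDeriv c hy]
  · have hd' := hd
    rw [mdifferentiableAt_iff_chart c hy] at hd'
    rw [mfderiv_zero_of_not_mdifferentiableAt hd, fderiv_zero_of_not_differentiableAt hd']
    rfl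

variable [RiemannianBundle (fun x : M ↦ TangentSpace (𝓡 N) x)]
  [IsContMDiffRiemannianBundle (𝓡 N) ∞ (EuclideanSpace ℝ (Fin N))
      (fun x : M ↦ TangentSpace (𝓡 N) x)]
  [IsRiemannianManifold (𝓡 N) M]

/-- Along the line `y + s w`, the distance to the base point is at most `s (‖w‖ + ε')` in the
Riemannian norm for small `s > 0`, because the metric coefficients are continuous. The right slope
of `ψ` is therefore at least `-C (‖w‖ + ε')`. A one-sided bound is enough, as it may be applied to
`w` and to `-w`. -/
theorem neg_le_fderiv_chart_symm (c : M) {ψ : M → ℝ} {y : EuclideanSpace ℝ (Fin N)}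
    (hy : y ∈ (chartAt (EuclideanSpace ℝ (Fin N)) c).target) {C : ℝ} (hC : 0 ≤ C)
    (h : ∀ᶠ x in nhds ((chartAt (EuclideanSpace ℝ (Fin N)) c).symm y),
      -(C * dist x ((chartAt (EuclideanSpace ℝ (Fin N)) c).symm y)) ≤
        ψ x - ψ ((chartAt (EuclideanSpace ℝ (Fin N)) c).symm y))
    (w : EuclideanSpace ℝ (Fin N)) :
    -(C * ‖chartSymmDeriv c y w‖) ≤
      fderiv ℝ (fun z ↦ ψ ((chartAt (EuclideanSpace ℝ (Fin N)) c).symm z)) y w := by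
  set e := chartAt (EuclideanSpace ℝ (Fin N)) c with he
  set F := fun z ↦ ψ (e.symm z) with hF
  by_cases hd : DifferentiableAt ℝ F y
  swap
  · rw [fderiv_zero_of_not_differentiableAt hd]
    simpa using by positivity
  refine le_of_forall_pos_le_add fun ε hε ↦ ?_
  have hline : HasDerivAt (fun s : ℝ ↦ F (y + s • w)) (fderiv ℝ F y w) 0 := by
    have h1 : HasDerivAt (fun s : ℝ ↦ y + s • w) w 0 := by
      have h := ((hasDerivAt_id (0 : ℝ)).smul_const w).const_add y
      rwa [one_smul] at h
    have h2 : HasFDerivAt F (fderiv ℝ F y) (y + (0 : ℝ) • w) := by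
      simpa using hd.hasFDerivAt
    exact h2.comp_hasDerivAt (0 : ℝ) h1
  obtain ⟨ε', hε', hCε⟩ : ∃ ε' > 0, C * ε' ≤ ε :=
    ⟨ε / (C + 1), by positivity, by
      rw [mul_div_assoc', div_le_iff₀ (by positivity)]; nlinarith⟩
  have hcn : ContinuousAt (fun z ↦ ‖chartSymmDeriv c z w‖) y := by
    have : (fun z ↦ ‖chartSymmDeriv c z w‖) =
        fun z ↦ Real.sqrt (inner ℝ (chartSymmDeriv c z w) (chartSymmDeriv c z w)) :=
      funext fun z ↦ norm_eq_sqrt_real_inner _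
    rw [this]
    exact ((contDiffOn_inner_chartSymmDeriv c w w).continuousOn.continuousAt
      (e.open_target.mem_nhds hy)).sqrt
  have hev : ∀ᶠ z in nhds y, z ∈ e.target ∧ ‖chartSymmDeriv c z w‖ < ‖chartSymmDeriv c y w‖ + ε' :=
    Filter.Eventually.and (e.open_target.mem_nhds hy) (hcn.eventually (gt_mem_nhds (by linarith)))
  obtain ⟨r, hr, hrb⟩ := Metric.eventually_nhds_iff_ball.1 hev
  have hline_cont : Filter.Tendsto (fun s : ℝ ↦ y + s • w) (nhds 0) (nhds y) := by
    have : ContinuousAt (fun s : ℝ ↦ y + s • w) 0 := by fun_prop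
    simpa [ContinuousAt] using this
  have hdist : ∀ᶠ s : ℝ in nhdsWithin 0 (Ioi 0),
      dist (e.symm (y + s • w)) (e.symm y) ≤ s * (‖chartSymmDeriv c y w‖ + ε') := by
    filter_upwards [nhdsWithin_le_nhds (hline_cont.eventually (Metric.ball_mem_nhds y hr)),
      self_mem_nhdsWithin] with s hs hs0
    have hs0' : (0 : ℝ) < s := hs0
    have hseg : segment ℝ y (y + s • w) ⊆ Metric.ball y r :=
      (convex_ball y r).segment_subset (Metric.mem_ball_self hr) hs
    have hE := edist_chart_symm_le c (y := y) (z := y + s • w)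
      (B := s * (‖chartSymmDeriv c y w‖ + ε'))
      (fun z hz ↦ (hrb z (hseg hz)).1) (fun z hz ↦ by
        rw [add_sub_cancel_left, map_smul, norm_smul, Real.norm_of_nonneg hs0'.le]
        exact mul_le_mul_of_nonneg_left (hrb z (hseg hz)).2.le hs0'.le)
    rw [dist_comm]
    rw [edist_dist] at hE
    exact (ENNReal.ofReal_le_ofReal_iff (by positivity)).1 hE
  have hsymm : ContinuousAt e.symm y := e.continuousAt_symm hy
  have hslope : ∀ᶠ s : ℝ in nhdsWithin 0 (Ioi 0),
      -(C * (‖chartSymmDeriv c y w‖ + ε')) ≤ s⁻¹ • (F (y + (0 + s) • w) - F (y + (0 : ℝ) • w)) := by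
    filter_upwards [hdist, self_mem_nhdsWithin,
      nhdsWithin_le_nhds ((hsymm.tendsto.comp hline_cont).eventually h)] with s hs hs0 hs2
    have hs0' : (0 : ℝ) < s := hs0
    have h3 : -(C * (s * (‖chartSymmDeriv c y w‖ + ε'))) ≤ F (y + s • w) - F y := by
      refine le_trans ?_ hs2
      have := mul_le_mul_of_nonneg_left hs hC
      simp only [Function.comp]
      linarith
    simp only [zero_add, zero_smul, add_zero, smul_eq_mul]
    rw [← div_eq_inv_mul, le_div_iff₀ hs0']
    linarith
  have := ge_of_tendsto (hline.tendsto_slope_zero_right) hslope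
  linarith

/-- A function with local one-sided Lipschitz constant `C` at `x` has differential bounded by `C`
at `x`. -/
theorem abs_mfderiv_le {ψ : M → ℝ} {x : M} {C : ℝ} (hC : 0 ≤ C)
    (h : ∀ᶠ y in nhds x, -(C * dist y x) ≤ ψ y - ψ x) (v : TangentSpace (𝓡 N) x) :
    |(show ℝ from mfderiv (𝓡 N) 𝓘(ℝ, ℝ) ψ x v)| ≤ C * ‖v‖ := by
  have key : ∀ c : M, x ∈ (chartAt (EuclideanSpace ℝ (Fin N)) c).source →
      |(show ℝ from mfderiv (𝓡 N) 𝓘(ℝ, ℝ) ψ x v)| ≤ C * ‖v‖ := by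
    intro c hx
    obtain ⟨y, hy, rfl⟩ : ∃ y ∈ (chartAt (EuclideanSpace ℝ (Fin N)) c).target,
        (chartAt (EuclideanSpace ℝ (Fin N)) c).symm y = x :=
      ⟨_, (chartAt (EuclideanSpace ℝ (Fin N)) c).map_source hx,
        (chartAt (EuclideanSpace ℝ (Fin N)) c).left_inv hx⟩
    rw [mfderiv_chart_symm_apply c hy]
    have h1 := neg_le_fderiv_chart_symm c hy hC h (chartDeriv c _ v)
    have h2 := neg_le_fderiv_chart_symm c hy hC h (-chartDeriv c _ v)
    rw [map_neg, norm_neg, map_neg] at h2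
    rw [chartSymmDeriv_chartDeriv c hy] at h1 h2
    exact abs_le.2 ⟨h1, by linarith⟩
  exact key x (mem_chart_source _ x)

end Grad

/-! ### Compactness of closed balls -/

section HopfRinow
open Manifold

/-- Walk from `x₀` along a path to `x` of length below `ρ + ε` and stop at distance `ρ - ε`: less
than `2ε` of length remains. This replaces minimising geodesics. -/
theorem exists_dist_le_of_dist_le (N : ℕ) {M : Type*} [MetricSpace M]
    [ChartedSpace (EuclideanSpace ℝ (Fin N)) M]
    [RiemannianBundle (fun x : M ↦ TangentSpace (𝓡 N) x)] [IsRiemannianManifold (𝓡 N) M]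
    [IsManifold (𝓡 N) ∞ M] [IsContMDiffRiemannianBundle (𝓡 N) ∞ (EuclideanSpace ℝ (Fin N))
      (fun x : M ↦ TangentSpace (𝓡 N) x)]
    {x₀ x : M} {ρ ε : ℝ} (hε : 0 < ε) (hρ : ε ≤ ρ)
    (h : dist x₀ x ≤ ρ) : ∃ z, dist x₀ z ≤ ρ - ε ∧ dist z x ≤ 2 * ε := by
  rcases le_or_gt (dist x₀ x) (ρ - ε) with h1 | h1
  · exact ⟨x, h1, by simpa using hε.le⟩
  have hlt : edist x₀ x < ENNReal.ofReal (ρ + ε) := by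
    rw [edist_dist]
    exact (ENNReal.ofReal_lt_ofReal_iff (by linarith)).2 (by linarith)
  obtain ⟨γ, h0, h1', hγ, hl, -⟩ := exists_path_of_edist_lt (N := N) hlt
  have hcont : ContinuousOn (fun t ↦ dist x₀ (γ t)) (Icc 0 1) :=
    (continuous_const.dist continuous_id).comp_continuousOn hγ.continuousOn
  obtain ⟨t, ht, htd⟩ := intermediate_value_Icc zero_le_one hcont
    (show ρ - ε ∈ Icc _ _ from ⟨by simp [h0, hρ], by simpa [h1'] using h1.le⟩)
  refine ⟨γ t, htd.le, ?_⟩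
  have e1 : edist x₀ (γ t) ≤ pathELength (𝓡 N) γ 0 t := by
    rw [IsRiemannianManifold.out (I := 𝓡 N)]
    exact riemannianEDist_le_pathELength (hγ.mono (Icc_subset_Icc_right ht.2)) h0 rfl ht.1
  have e2 : edist (γ t) x ≤ pathELength (𝓡 N) γ t 1 := by
    rw [IsRiemannianManifold.out (I := 𝓡 N)]
    exact riemannianEDist_le_pathELength (hγ.mono (Icc_subset_Icc_left ht.1)) rfl h1' ht.2
  have e3 : edist x₀ (γ t) + edist (γ t) x < ENNReal.ofReal (ρ + ε) :=
    (add_le_add e1 e2).trans_lt (by rwa [pathELength_add ht.1 ht.2])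
  rw [edist_dist, edist_dist, ← ENNReal.ofReal_add dist_nonneg dist_nonneg,
    ENNReal.ofReal_lt_ofReal_iff (by linarith)] at e3
  simp only at htd
  linarith

/-- **Hopf–Rinow**: closed balls of a complete Riemannian manifold are compact. -/
theorem isCompact_closedBall_of_complete (N : ℕ) {M : Type*} [MetricSpace M]
    [ChartedSpace (EuclideanSpace ℝ (Fin N)) M]
    [RiemannianBundle (fun x : M ↦ TangentSpace (𝓡 N) x)] [IsRiemannianManifold (𝓡 N) M]
    [IsManifold (𝓡 N) ∞ M] [IsContMDiffRiemannianBundle (𝓡 N) ∞ (EuclideanSpace ℝ (Fin N))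
      (fun x : M ↦ TangentSpace (𝓡 N) x)]
    [CompleteSpace M] (x₀ : M) (R : ℝ) :
    IsCompact (Metric.closedBall x₀ R) := by
  have : LocallyCompactSpace M :=
    ChartedSpace.locallyCompactSpace (EuclideanSpace ℝ (Fin N)) M
  by_contra hR
  -- Let `ρ` be the supremum of the radii of compact closed balls. The ball of radius `ρ` is totally
  -- bounded, since it is close to slightly smaller compact balls, hence compact by completeness;
  -- local compactness then yields a larger compact ball.
  set S := {r : ℝ | 0 ≤ r ∧ IsCompact (Metric.closedBall x₀ r)} with hS
  have hmono : ∀ r s, r ≤ s → IsCompact (Metric.closedBall x₀ s) →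
      IsCompact (Metric.closedBall x₀ r) := fun r s hrs hs ↦
    hs.of_isClosed_subset Metric.isClosed_closedBall (Metric.closedBall_subset_closedBall hrs)
  have h0 : (0 : ℝ) ∈ S := ⟨le_rfl, by simp⟩
  have hbdd : BddAbove S := ⟨R, fun r hr ↦ by
    by_contra hlt
    exact hR (hmono R r (not_le.1 hlt).le hr.2)⟩
  set ρ := sSup S with hρ
  have hρ0 : 0 ≤ ρ := le_csSup hbdd h0
  have hlt : ∀ r < ρ, IsCompact (Metric.closedBall x₀ r) := fun r hr ↦ by
    obtain ⟨s, hs, hrs⟩ := exists_lt_of_lt_csSup ⟨0, h0⟩ hr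
    exact hmono r s hrs.le hs.2
  have hcρ : IsCompact (Metric.closedBall x₀ ρ) := by
    rcases hρ0.eq_or_lt with h | hpos
    · rw [← h]; exact h0.2
    rw [isCompact_iff_totallyBounded_isComplete]
    refine ⟨?_, Metric.isClosed_closedBall.isComplete⟩
    rw [Metric.totallyBounded_iff]
    intro ε hε
    set η := min (ε / 4) ρ with hη
    have hη0 : 0 < η := lt_min (by linarith) hpos
    obtain ⟨t, ht, htc⟩ := Metric.totallyBounded_iff.1
      (hlt (ρ - η) (by linarith)).totallyBounded (ε / 4) (by linarith)
    refine ⟨t, ht, fun x hx ↦ ?_⟩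
    obtain ⟨z, hz1, hz2⟩ := exists_dist_le_of_dist_le N hη0 (min_le_right _ _)
      (by rw [dist_comm]; exact hx : dist x₀ x ≤ ρ)
    have := htc (show z ∈ Metric.closedBall x₀ (ρ - η) by rwa [Metric.mem_closedBall, dist_comm])
    simp only [mem_iUnion, Metric.mem_ball, exists_prop] at this ⊢
    obtain ⟨y, hy, hzy⟩ := this
    refine ⟨y, hy, ?_⟩
    have h4 : η ≤ ε / 4 := min_le_left _ _
    have := dist_triangle x z y
    rw [dist_comm x z] at this
    linarith
  -- Every point of the ball of radius `ρ + δ / 2` is within `δ` of the ball of radius `ρ`, so the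
  -- compact thickening contains the larger ball and contradicts the choice of `ρ`.
  obtain ⟨δ, hδ, hδc⟩ := hcρ.exists_isCompact_cthickening
  have hmem : ρ + δ / 2 ∈ S := by
    refine ⟨by positivity, hδc.of_isClosed_subset Metric.isClosed_closedBall fun x hx ↦ ?_⟩
    obtain ⟨z, hz1, hz2⟩ := exists_dist_le_of_dist_le N (half_pos hδ)
      (by linarith) (by rw [dist_comm]; exact hx : dist x₀ x ≤ ρ + δ / 2)
    refine Metric.mem_cthickening_of_dist_le x z δ _ ?_ ?_
    · rw [Metric.mem_closedBall, dist_comm]; linarith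
    · rw [dist_comm]; linarith
  have := le_csSup hbdd hmem
  linarith

end HopfRinow

/-! ### Push-forwards along maps that are embeddings on a set of full measure -/

section EmbeddingOn
variable {α β : Type*} [MeasurableSpace α] [MeasurableSpace β] {ν : Measure α} {T : Set α}
  {g : α → β}

/-- An inverse chart is an embedding only on the target of the chart, which carries the whole
measure. Factoring through the subtype makes the statements for measurable embeddings available, and
these need no measurability of the integrand. -/
theorem map_eq_map_restrict_comap (hT : MeasurableSet T) (hν : ν Tᶜ = 0) (hg : Measurable g) :
    ν.map g = (ν.comap ((↑) : T → α)).map (T.domRestrict g) := by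
  have h1 : ν.restrict T = ν := Measure.restrict_eq_self_of_ae_mem (by
    rw [ae_iff]; exact hν)
  conv_lhs => rw [← h1]
  rw [← map_comap_subtype_coe hT, Measure.map_map hg measurable_subtype_coe]
  rfl

theorem ae_map_iff_of_embeddingOn (hT : MeasurableSet T) (hν : ν Tᶜ = 0) (hg : Measurable g)
    (he : MeasurableEmbedding (T.domRestrict g)) {P : β → Prop} :
    (∀ᵐ x ∂ν.map g, P x) ↔ ∀ᵐ y ∂ν, P (g y) := by
  have h1 : ν.restrict T = ν := Measure.restrict_eq_self_of_ae_mem (by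
    rw [ae_iff]; exact hν)
  rw [map_eq_map_restrict_comap hT hν hg, he.ae_map_iff]
  conv_rhs => rw [← h1, ← map_comap_subtype_coe hT,
    (MeasurableEmbedding.subtype_coe hT).ae_map_iff]
  rfl

theorem integrable_map_iff_of_embeddingOn (hT : MeasurableSet T) (hν : ν Tᶜ = 0)
    (hg : Measurable g) (he : MeasurableEmbedding (T.domRestrict g)) {F : β → ℝ} :
    Integrable F (ν.map g) ↔ Integrable (fun y ↦ F (g y)) ν := by
  have h1 : ν.restrict T = ν := Measure.restrict_eq_self_of_ae_mem (by
    rw [ae_iff]; exact hν)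
  rw [map_eq_map_restrict_comap hT hν hg, he.integrable_map_iff]
  conv_rhs => rw [← h1, ← map_comap_subtype_coe hT,
    (MeasurableEmbedding.subtype_coe hT).integrable_map_iff]
  rfl

theorem integral_map_of_embeddingOn (hT : MeasurableSet T) (hν : ν Tᶜ = 0)
    (hg : Measurable g) (he : MeasurableEmbedding (T.domRestrict g)) (F : β → ℝ) :
    ∫ x, F x ∂(ν.map g) = ∫ y, F (g y) ∂ν := by
  have h1 : ν.restrict T = ν := Measure.restrict_eq_self_of_ae_mem (by
    rw [ae_iff]; exact hν)
  rw [map_eq_map_restrict_comap hT hν hg, he.integral_map]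
  conv_rhs => rw [← h1, ← map_comap_subtype_coe hT,
    (MeasurableEmbedding.subtype_coe hT).integral_map]
  rfl

end EmbeddingOn

/-! ### Change of charts for the metric and its density -/

section Overlap
variable {N : ℕ} {M : Type*} [MetricSpace M] [ChartedSpace (EuclideanSpace ℝ (Fin N)) M]
  [RiemannianBundle (fun x : M ↦ TangentSpace (𝓡 N) x)]

/-- The base points `e.symm y` and `e'.symm (e' (e.symm y))` are only propositionally equal, so
vectors over them have different types. They are compared in the model space, of which every tangent
space is a copy. -/
theorem inner_eq_of_eq {x x' : M} (h : x = x') (v w : TangentSpace (𝓡 N) x)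
    (v' w' : TangentSpace (𝓡 N) x') (hv : (show EuclideanSpace ℝ (Fin N) from v) = v')
    (hw : (show EuclideanSpace ℝ (Fin N) from w) = w') :
    inner ℝ v w = inner ℝ v' w' := by
  subst h
  change v = v' at hv
  change w = w' at hw
  rw [hv, hw]

variable [IsManifold (𝓡 N) ∞ M]

/-- The transition map between two charts. -/
def transition (c c' : M) (y : EuclideanSpace ℝ (Fin N)) : EuclideanSpace ℝ (Fin N) :=
  chartAt (EuclideanSpace ℝ (Fin N)) c' ((chartAt (EuclideanSpace ℝ (Fin N)) c).symm y)

theorem differentiableAt_transition (c c' : M) {y : EuclideanSpace ℝ (Fin N)}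
    (hy : y ∈ (chartAt (EuclideanSpace ℝ (Fin N)) c).target)
    (hy' : (chartAt (EuclideanSpace ℝ (Fin N)) c).symm y ∈
      (chartAt (EuclideanSpace ℝ (Fin N)) c').source) :
    DifferentiableAt ℝ (transition c c') y := by
  have : IsManifold (𝓡 N) 1 M := IsManifold.of_le (n := ∞) (by exact_mod_cast le_top)
  rw [← mdifferentiableAt_iff_differentiableAt]
  have hd2 := mdifferentiableAt_atlas_symm (I := 𝓡 N)
      (chart_mem_atlas (EuclideanSpace ℝ (Fin N)) c) hy
  have hd1 := mdifferentiableAt_atlas (I := 𝓡 N)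
      (chart_mem_atlas (EuclideanSpace ℝ (Fin N)) c') hy'
  exact hd1.comp y hd2

/-- The chain rule for `e'.symm ∘ transition c c'`, which coincides with `e.symm` near `y`. -/
theorem chartSymmDeriv_transition (c c' : M) {y : EuclideanSpace ℝ (Fin N)}
    (hy : y ∈ (chartAt (EuclideanSpace ℝ (Fin N)) c).target)
    (hy' : (chartAt (EuclideanSpace ℝ (Fin N)) c).symm y ∈
      (chartAt (EuclideanSpace ℝ (Fin N)) c').source) (v : EuclideanSpace ℝ (Fin N)) :
    (show EuclideanSpace ℝ (Fin N) from chartSymmDeriv c y v) =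
      chartSymmDeriv c' (transition c c' y) (fderiv ℝ (transition c c') y v) := by
  have : IsManifold (𝓡 N) 1 M := IsManifold.of_le (n := ∞) (by exact_mod_cast le_top)
  set e := chartAt (EuclideanSpace ℝ (Fin N)) c with he
  set e' := chartAt (EuclideanSpace ℝ (Fin N)) c' with he'
  have hd := differentiableAt_transition c c' hy hy'
  have hd' := hd
  rw [← mdifferentiableAt_iff_differentiableAt] at hd'
  have hd2 := mdifferentiableAt_atlas_symm (I := 𝓡 N)
      (chart_mem_atlas (EuclideanSpace ℝ (Fin N)) c') (e'.map_source hy')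
  have hcomp := mfderiv_comp y hd2 hd'
  rw [mfderiv_eq_fderiv] at hcomp
  have hev : e'.symm ∘ transition c c' =ᶠ[nhds y] e.symm := by
    have h1 : e.symm ⁻¹' e'.source ∈ nhds y :=
      (e.continuousAt_symm hy).preimage_mem_nhds (e'.open_source.mem_nhds hy')
    filter_upwards [h1] with z hz
    exact e'.left_inv hz
  have h2 := hev.mfderiv_eq (I := 𝓡 N) (I' := 𝓡 N)
  have h3 : (mfderiv (𝓡 N) (𝓡 N) (e'.symm ∘ transition c c') y :
      EuclideanSpace ℝ (Fin N) →L[ℝ] EuclideanSpace ℝ (Fin N)) = mfderiv (𝓡 N) (𝓡 N) e.symm y := h2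
  have h4 := congrArg (fun L : EuclideanSpace ℝ (Fin N) →L[ℝ] EuclideanSpace ℝ (Fin N) ↦ L v)
    (h3.symm.trans hcomp)
  exact h4

/-- The densities of the Riemannian measure in two charts differ by the Jacobian factor. -/
theorem metricDensity_transition (c c' : M) {y : EuclideanSpace ℝ (Fin N)}
    (hy : y ∈ (chartAt (EuclideanSpace ℝ (Fin N)) c).target)
    (hy' : (chartAt (EuclideanSpace ℝ (Fin N)) c).symm y ∈
      (chartAt (EuclideanSpace ℝ (Fin N)) c').source) :
    metricDensity c y =
      |(fderiv ℝ (transition c c') y).det| * metricDensity c' (transition c c' y) := by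
  set J := fderiv ℝ (transition c c') y with hJ
  set A := LinearMap.toMatrix (EuclideanSpace.basisFun (Fin N) ℝ).toBasis
    (EuclideanSpace.basisFun (Fin N) ℝ).toBasis (J : _ →ₗ[ℝ] _) with hA
  have hAij (i j) : A i j = J (EuclideanSpace.single j 1) i := by
    rw [hA, LinearMap.toMatrix_apply]
    simp
  -- The change of basis `Aᵀ G' A` multiplies the determinant by `(det J)²`, and the square root
  -- leaves `|det J|`.
  have hG : metricMatrix c y = A.transpose * metricMatrix c' (transition c c' y) * A := by
    ext i j
    have h1 : metricMatrix c y i j =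
        inner ℝ (chartSymmDeriv c' (transition c c' y) (J (EuclideanSpace.single i 1)))
          (chartSymmDeriv c' (transition c c' y) (J (EuclideanSpace.single j 1))) :=
      inner_eq_of_eq ((chartAt (EuclideanSpace ℝ (Fin N)) c').left_inv hy').symm _ _ _ _
        (chartSymmDeriv_transition c c' hy hy' _) (chartSymmDeriv_transition c c' hy hy' _)
    rw [h1, inner_chartSymmDeriv]
    simp only [Matrix.mul_apply, Matrix.transpose_apply, hAij, Finset.sum_mul]
    rw [Finset.sum_comm]
    refine Finset.sum_congr rfl fun k _ ↦ Finset.sum_congr rfl fun l _ ↦ ?_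
    ring
  have hdet : A.det = J.det := by
    rw [hA, LinearMap.det_toMatrix]
  unfold metricDensity
  rw [hG, Matrix.det_mul, Matrix.det_mul, Matrix.det_transpose, hdet,
    show J.det * (metricMatrix c' (transition c c' y)).det * J.det =
      J.det ^ 2 * (metricMatrix c' (transition c c' y)).det by ring,
    Real.sqrt_mul (sq_nonneg _), Real.sqrt_sq_eq_abs]

end Overlap

/-! ### The Riemannian measure in a chart -/

section ChartMap
variable {N : ℕ} {M : Type*} [MetricSpace M] [ChartedSpace (EuclideanSpace ℝ (Fin N)) M]

open Classical in
/-- The inverse chart, extended by a constant to a measurable map. -/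
def chartParam (c : M) (y : EuclideanSpace ℝ (Fin N)) : M :=
  (chartAt (EuclideanSpace ℝ (Fin N)) c).target.piecewise
    (chartAt (EuclideanSpace ℝ (Fin N)) c).symm (fun _ ↦ c) y

theorem chartParam_eq (c : M) {y : EuclideanSpace ℝ (Fin N)}
    (hy : y ∈ (chartAt (EuclideanSpace ℝ (Fin N)) c).target) :
    chartParam c y = (chartAt (EuclideanSpace ℝ (Fin N)) c).symm y := by
  classical
  exact piecewise_eq_of_mem _ _ _ hy

variable (N) in
/-- The coordinate domain of the chart around `c` in space-time. -/
def stDomain (c : M) : Set (EuclideanSpace ℝ (Fin N) × ℝ) :=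
  (chartAt (EuclideanSpace ℝ (Fin N)) c).target ×ˢ Ioi 0

theorem isOpen_stDomain (c : M) : IsOpen (stDomain N c) :=
  (chartAt (EuclideanSpace ℝ (Fin N)) c).open_target.prod isOpen_Ioi

variable (N) in
/-- The part of the cylinder over the domain of the chart around `c`. -/
def stSource (c : M) : Set (M × ℝ) :=
  (chartAt (EuclideanSpace ℝ (Fin N)) c).source ×ˢ Ioi 0

theorem isOpen_stSource (c : M) : IsOpen (stSource N c) :=
  (chartAt (EuclideanSpace ℝ (Fin N)) c).open_source.prod isOpen_Ioi

/-- The space-time parametrization `(y, t) ↦ (chart⁻¹ y, t)`. -/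
def stParam (c : M) (z : EuclideanSpace ℝ (Fin N) × ℝ) : M × ℝ :=
  ((chartAt (EuclideanSpace ℝ (Fin N)) c).symm z.1, z.2)

/-- The space-time chart `(x, t) ↦ (chart x, t)`. -/
def stChart (c : M) (z : M × ℝ) : EuclideanSpace ℝ (Fin N) × ℝ :=
  (chartAt (EuclideanSpace ℝ (Fin N)) c z.1, z.2)

theorem continuousOn_stParam (c : M) :
    ContinuousOn (stParam (N := N) c) (stDomain N c) := by
  refine ContinuousOn.prodMk ?_ continuousOn_snd
  exact (chartAt (EuclideanSpace ℝ (Fin N)) c).continuousOn_symm.comp continuousOn_fst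
    fun z hz ↦ hz.1

theorem continuousOn_stChart (c : M) : ContinuousOn (stChart (N := N) c) (stSource N c) := by
  refine ContinuousOn.prodMk ?_ continuousOn_snd
  exact (chartAt (EuclideanSpace ℝ (Fin N)) c).continuousOn.comp continuousOn_fst
    fun z hz ↦ hz.1

theorem mapsTo_stParam (c : M) : MapsTo (stParam (N := N) c) (stDomain N c) (stSource N c) :=
  fun _ hz ↦ ⟨(chartAt (EuclideanSpace ℝ (Fin N)) c).map_target hz.1, hz.2⟩

theorem mapsTo_stChart (c : M) : MapsTo (stChart (N := N) c) (stSource N c) (stDomain N c) :=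
  fun _ hz ↦ ⟨(chartAt (EuclideanSpace ℝ (Fin N)) c).map_source hz.1, hz.2⟩

theorem stChart_stParam (c : M) {z : EuclideanSpace ℝ (Fin N) × ℝ} (hz : z ∈ stDomain N c) :
    stChart c (stParam c z) = z :=
  Prod.ext ((chartAt (EuclideanSpace ℝ (Fin N)) c).right_inv hz.1) rfl

theorem stParam_stChart (c : M) {z : M × ℝ} (hz : z ∈ stSource N c) :
    stParam (N := N) c (stChart c z) = z :=
  Prod.ext ((chartAt (EuclideanSpace ℝ (Fin N)) c).left_inv hz.1) rfl

variable [MeasurableSpace M] [BorelSpace M]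

theorem measurable_chartParam (c : M) : Measurable (chartParam (N := N) c) := by
  classical
  exact (chartAt (EuclideanSpace ℝ (Fin N)) c).continuousOn_symm.measurable_piecewise
    continuousOn_const (chartAt (EuclideanSpace ℝ (Fin N)) c).open_target.measurableSet

variable [RiemannianBundle (fun x : M ↦ TangentSpace (𝓡 N) x)]

/-- The density of the Riemannian measure in a chart, extended by zero. -/
def chartDensity (c : M) (y : EuclideanSpace ℝ (Fin N)) : ℝ≥0∞ :=
  (chartAt (EuclideanSpace ℝ (Fin N)) c).target.indicator
    (fun y ↦ ENNReal.ofReal (metricDensity c y)) y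

/-- Nothing is known about the inverse chart off the target, not even measurability. The density is
supported on the target, so the push-forward does not change when the map is replaced by its
measurable extension. -/
theorem chartMeasure_eq (c : M) :
    chartMeasure (N := N) c = ((volume : Measure (EuclideanSpace ℝ (Fin N))).withDensity
      (chartDensity c)).map (chartParam c) := by
  have ht := (chartAt (EuclideanSpace ℝ (Fin N)) c).open_target.measurableSet
  have h1 : (volume.restrict (chartAt (EuclideanSpace ℝ (Fin N)) c).target).withDensity
      (fun y ↦ ENNReal.ofReal (Real.sqrt (metricMatrix c y).det)) =
      (volume : Measure (EuclideanSpace ℝ (Fin N))).withDensity (chartDensity c) :=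
    (withDensity_indicator ht _).symm
  rw [chartMeasure, h1]
  refine Measure.map_congr ?_
  have h2 : ∀ᵐ y ∂((volume.restrict (chartAt (EuclideanSpace ℝ (Fin N)) c).target).withDensity
      (fun y ↦ ENNReal.ofReal (Real.sqrt (metricMatrix c y).det))),
      y ∈ (chartAt (EuclideanSpace ℝ (Fin N)) c).target :=
    (withDensity_absolutelyContinuous _ _).ae_le (ae_restrict_mem ht)
  rw [h1] at h2
  filter_upwards [h2] with y hy
  exact (chartParam_eq c hy).symm

theorem chartMeasure_apply (c : M) {A : Set M} (hA : MeasurableSet A) :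
    chartMeasure (N := N) c A = ∫⁻ y in (chartAt (EuclideanSpace ℝ (Fin N)) c).target ∩ chartParam c ⁻¹' A,
      ENNReal.ofReal (metricDensity c y) := by
  have ht := (chartAt (EuclideanSpace ℝ (Fin N)) c).open_target.measurableSet
  have hm := measurable_chartParam (N := N) c hA
  rw [chartMeasure_eq, Measure.map_apply (measurable_chartParam c) hA, withDensity_apply _ hm]
  unfold chartDensity
  rw [lintegral_indicator ht, Measure.restrict_restrict ht]

theorem chartMeasure_source_compl (c : M) :
    chartMeasure (N := N) c (chartAt (EuclideanSpace ℝ (Fin N)) c).sourceᶜ = 0 := by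
  have hs := (chartAt (EuclideanSpace ℝ (Fin N)) c).open_source.measurableSet
  rw [chartMeasure_apply (N := N) c hs.compl]
  have : (chartAt (EuclideanSpace ℝ (Fin N)) c).target ∩
      chartParam c ⁻¹' (chartAt (EuclideanSpace ℝ (Fin N)) c).sourceᶜ = ∅ := by
    ext y
    simp only [mem_inter_iff, mem_preimage, mem_compl_iff, mem_empty_iff_false, iff_false, not_and,
      not_not]
    intro hy
    rw [chartParam_eq c hy]
    exact (chartAt (EuclideanSpace ℝ (Fin N)) c).map_target hy
  rw [this]; simp

theorem chartMeasure_inter_source (c : M) (A : Set M) :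
    chartMeasure (N := N) c (A ∩ (chartAt (EuclideanSpace ℝ (Fin N)) c).source) =
      chartMeasure (N := N) c A := by
  refine measure_congr (inter_ae_eq_left_of_ae_eq_univ ?_)
  rw [ae_eq_univ]
  exact chartMeasure_source_compl c

variable [IsManifold (𝓡 N) ∞ M]

/-- Change of variables along the transition map: its Jacobian is exactly the quotient of the two
densities. -/
theorem chartMeasure_overlap (c c' : M) {A : Set M} (hA : MeasurableSet A)
    (h : A ⊆ (chartAt (EuclideanSpace ℝ (Fin N)) c).source)
    (h' : A ⊆ (chartAt (EuclideanSpace ℝ (Fin N)) c').source) :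
    chartMeasure (N := N) c A = chartMeasure (N := N) c' A := by
  set e := chartAt (EuclideanSpace ℝ (Fin N)) c with he
  set e' := chartAt (EuclideanSpace ℝ (Fin N)) c' with he'
  have hm : MeasurableSet (e.target ∩ chartParam c ⁻¹' A) :=
    e.open_target.measurableSet.inter (measurable_chartParam c hA)
  rw [chartMeasure_apply (N := N) c hA, chartMeasure_apply (N := N) c' hA]
  have hmem : ∀ y ∈ e.target ∩ chartParam c ⁻¹' A, y ∈ e.target ∧ e.symm y ∈ A := by
    rintro y ⟨hy, hyA⟩
    rw [mem_preimage, chartParam_eq c hy] at hyA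
    exact ⟨hy, hyA⟩
  have himg : e'.target ∩ chartParam c' ⁻¹' A =
      transition c c' '' (e.target ∩ chartParam c ⁻¹' A) := by
    ext z
    constructor
    · rintro ⟨hz, hzA⟩
      rw [mem_preimage, chartParam_eq c' hz] at hzA
      refine ⟨e (e'.symm z), ⟨e.map_source (h hzA), ?_⟩, ?_⟩
      · rw [mem_preimage, chartParam_eq c (e.map_source (h hzA)), e.left_inv (h hzA)]
        exact hzA
      · change e' (e.symm (e (e'.symm z))) = z
        rw [e.left_inv (h hzA), e'.right_inv hz]
    · rintro ⟨y, hy, rfl⟩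
      obtain ⟨hy1, hy2⟩ := hmem y hy
      have ht : transition c c' y ∈ e'.target := e'.map_source (h' hy2)
      refine ⟨ht, ?_⟩
      rw [mem_preimage, chartParam_eq c' ht]
      change e'.symm (e' (e.symm y)) ∈ A
      rwa [e'.left_inv (h' hy2)]
  rw [himg, lintegral_image_eq_lintegral_abs_det_fderiv_mul volume hm
    (f' := fun y ↦ fderiv ℝ (transition c c') y)]
  · refine setLIntegral_congr_fun hm fun y hy ↦ ?_
    obtain ⟨hy1, hy2⟩ := hmem y hy
    rw [metricDensity_transition c c' hy1 (h' hy2), ENNReal.ofReal_mul (abs_nonneg _)]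
  · intro y hy
    obtain ⟨hy1, hy2⟩ := hmem y hy
    exact (differentiableAt_transition c c' hy1 (h' hy2)).hasFDerivAt.hasFDerivWithinAt
  · intro y hy z hz hyz
    obtain ⟨hy1, hy2⟩ := hmem y hy
    obtain ⟨hz1, hz2⟩ := hmem z hz
    have h3 := e'.injOn (h' hy2) (h' hz2) hyz
    exact e.symm.injOn hy1 hz1 h3

/-- The supremum of measures is compared with an explicit gluing. Cutting a countable cover by chart
domains into disjoint pieces gives `ν`, which agrees with every chart measure on its domain by the
overlap lemma. Hence `ν` bounds the supremum from above, while each chart measure bounds it from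
below. -/
theorem riemannianMeasure_restrict_source [SecondCountableTopology M] (c : M) :
    (riemannianMeasure N M).restrict (chartAt (EuclideanSpace ℝ (Fin N)) c).source =
      chartMeasure (N := N) c := by
  have hsm (c : M) := (chartAt (EuclideanSpace ℝ (Fin N)) c).open_source.measurableSet
  obtain ⟨s, hs, hsU⟩ := TopologicalSpace.countable_cover_nhds
    (fun x : M ↦ chart_source_mem_nhds (EuclideanSpace ℝ (Fin N)) x)
  have hne : s.Nonempty := by
    rw [nonempty_iff_ne_empty]
    rintro rfl
    have : c ∈ (univ : Set M) := mem_univ c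
    rw [← hsU] at this
    simp at this
  obtain ⟨d, rfl⟩ := hs.exists_eq_range hne
  set S : ℕ → Set M := fun n ↦ (chartAt (EuclideanSpace ℝ (Fin N)) (d n)).source with hS
  have hSU : ⋃ n, S n = univ := by rw [← hsU]; simp [S]
  have hDm (n) : MeasurableSet (disjointed S n) := MeasurableSet.disjointed (fun i ↦ hsm (d i)) n
  set ν : Measure M := Measure.sum fun n ↦ (chartMeasure (N := N) (d n)).restrict (disjointed S n)
    with hν
  have key : ∀ c' : M, ∀ A : Set M, MeasurableSet A →
      ν (A ∩ (chartAt (EuclideanSpace ℝ (Fin N)) c').source) = chartMeasure (N := N) c' A := by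
    intro c' A hA
    have hAm := hA.inter (hsm c')
    rw [hν, Measure.sum_apply _ hAm, ← chartMeasure_inter_source (N := N) c' A]
    have hdec : A ∩ (chartAt (EuclideanSpace ℝ (Fin N)) c').source =
        ⋃ n, (A ∩ (chartAt (EuclideanSpace ℝ (Fin N)) c').source) ∩ disjointed S n := by
      rw [← inter_iUnion, iUnion_disjointed, hSU, inter_univ]
    conv_rhs => rw [hdec]
    rw [measure_iUnion]
    · refine tsum_congr fun n ↦ ?_
      rw [Measure.restrict_apply hAm]
      exact chartMeasure_overlap (d n) c' (hAm.inter (hDm n))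
        (inter_subset_right.trans (disjointed_subset S n))
        (inter_subset_left.trans inter_subset_right)
    · intro i j hij
      exact ((disjoint_disjointed S) hij).mono inter_subset_right inter_subset_right
    · exact fun n ↦ hAm.inter (hDm n)
  have hle : riemannianMeasure N M ≤ ν := by
    refine iSup_le fun c' ↦ Measure.le_iff.2 fun A hA ↦ ?_
    rw [← key c' A hA]
    exact measure_mono inter_subset_left
  refine le_antisymm (Measure.le_iff.2 fun A hA ↦ ?_) (Measure.le_iff.2 fun A hA ↦ ?_)
  · rw [Measure.restrict_apply hA, ← key c A hA]
    exact hle _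
  · rw [Measure.restrict_apply hA, ← chartMeasure_inter_source (N := N) c A]
    exact le_iSup (fun c : M ↦ chartMeasure (N := N) c) c _

end ChartMap

/-! ### Integrals and null sets on the cylinder in space-time coordinates -/

section Transfer
variable {N : ℕ} {M : Type*} [MetricSpace M] [ChartedSpace (EuclideanSpace ℝ (Fin N)) M]
  [MeasurableSpace M] [BorelSpace M]
  [RiemannianBundle (fun x : M ↦ TangentSpace (𝓡 N) x)] [IsManifold (𝓡 N) ∞ M]
  [IsContMDiffRiemannianBundle (𝓡 N) ∞ (EuclideanSpace ℝ (Fin N))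
      (fun x : M ↦ TangentSpace (𝓡 N) x)]
  [SecondCountableTopology M]

instance isLocallyFiniteMeasure_riemannianMeasure :
    IsLocallyFiniteMeasure (riemannianMeasure N M) := by
  refine ⟨fun x ↦ ?_⟩
  set e := chartAt (EuclideanSpace ℝ (Fin N)) x with he
  have hx := mem_chart_source (EuclideanSpace ℝ (Fin N)) x
  obtain ⟨r, hr, hrt⟩ := Metric.nhds_basis_closedBall.mem_iff.1
    (e.open_target.mem_nhds (e.map_source hx))
  obtain ⟨C, hC⟩ := (isCompact_closedBall (e x) r).exists_bound_of_continuousOn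
    ((contDiffOn_metricDensity x).continuousOn.mono hrt)
  have hU : IsOpen (e.source ∩ e ⁻¹' Metric.ball (e x) r) :=
    e.continuousOn.isOpen_inter_preimage e.open_source Metric.isOpen_ball
  refine ⟨e.source ∩ e ⁻¹' Metric.ball (e x) r,
    hU.mem_nhds ⟨hx, Metric.mem_ball_self hr⟩, ?_⟩
  have h1 : riemannianMeasure N M (e.source ∩ e ⁻¹' Metric.ball (e x) r) =
      chartMeasure (N := N) x (e.source ∩ e ⁻¹' Metric.ball (e x) r) := by
    rw [← riemannianMeasure_restrict_source x, Measure.restrict_apply hU.measurableSet]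
    congr 1
    exact (inter_eq_left.2 inter_subset_left).symm
  rw [h1, chartMeasure_apply (N := N) x hU.measurableSet]
  have hsub : e.target ∩ chartParam x ⁻¹' (e.source ∩ e ⁻¹' Metric.ball (e x) r) ⊆
      Metric.closedBall (e x) r := by
    rintro y ⟨hy, -, hyb⟩
    rw [mem_preimage, chartParam_eq x hy, e.right_inv hy] at hyb
    exact Metric.ball_subset_closedBall hyb
  calc _ ≤ ∫⁻ y in Metric.closedBall (e x) r, ENNReal.ofReal (metricDensity x y) :=
        lintegral_mono_set hsub
    _ ≤ ∫⁻ y in Metric.closedBall (e x) r, ENNReal.ofReal C :=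
        setLIntegral_mono' Metric.isClosed_closedBall.measurableSet fun y hy ↦
          ENNReal.ofReal_le_ofReal ((le_abs_self _).trans (hC y hy))
    _ < ⊤ := by
        rw [setLIntegral_const]
        exact ENNReal.mul_lt_top ENNReal.ofReal_lt_top (isCompact_closedBall _ _).measure_lt_top

variable (N M) in
/-- The space-time measure `dμ dt` on `M × ℝ`. -/
def stMeasure : Measure (M × ℝ) := (riemannianMeasure N M).prod volume

/-- The density of `dμ dt` in space-time coordinates, extended by zero. -/
def stDensity (c : M) (z : EuclideanSpace ℝ (Fin N) × ℝ) : ℝ≥0∞ :=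
  (stDomain N c).indicator (fun z ↦ ENNReal.ofReal (metricDensity c z.1)) z

theorem measurable_chartDensity (c : M) : Measurable (chartDensity (N := N) c) := by
  classical
  have : chartDensity (N := N) c = (chartAt (EuclideanSpace ℝ (Fin N)) c).target.piecewise
      (fun y ↦ ENNReal.ofReal (metricDensity c y)) (fun _ ↦ 0) := by
    ext y
    simp only [chartDensity, indicator, piecewise]
  rw [this]
  refine ContinuousOn.measurable_piecewise ?_ continuousOn_const
    (chartAt (EuclideanSpace ℝ (Fin N)) c).open_target.measurableSet
  exact ENNReal.continuous_ofReal.comp_continuousOn (contDiffOn_metricDensity c).continuousOn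

theorem stDensity_eq (c : M) : stDensity (N := N) c =
    (univ ×ˢ Ioi 0).indicator fun z ↦ chartDensity c z.1 := by
  ext z
  by_cases h1 : z.1 ∈ (chartAt (EuclideanSpace ℝ (Fin N)) c).target <;>
  by_cases h2 : z.2 ∈ Ioi (0 : ℝ) <;>
  simp_all [stDensity, chartDensity, stDomain, indicator]

theorem measurable_stDensity (c : M) : Measurable (stDensity (N := N) c) := by
  rw [stDensity_eq]
  exact ((measurable_chartDensity c).comp measurable_fst).indicator
    (MeasurableSet.univ.prod measurableSet_Ioi)

/-- A measurable extension of the space-time parametrization. -/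
def stParamExt (c : M) : EuclideanSpace ℝ (Fin N) × ℝ → M × ℝ := Prod.map (chartParam c) id

theorem measurable_stParamExt (c : M) : Measurable (stParamExt (N := N) c) :=
  (measurable_chartParam c).prodMap measurable_id

theorem stParamExt_eq (c : M) {z : EuclideanSpace ℝ (Fin N) × ℝ} (hz : z ∈ stDomain N c) :
    stParamExt c z = stParam c z :=
  Prod.ext (chartParam_eq c hz.1) rfl

theorem measurableEmbedding_stParamExt (c : M) :
    MeasurableEmbedding ((stDomain N c).domRestrict (stParamExt c)) := by
  have hcont : Continuous ((stDomain N c).domRestrict (stParamExt c)) := by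
    rw [← continuousOn_iff_continuous_domRestrict]
    exact (continuousOn_stParam c).congr fun z hz ↦ stParamExt_eq c hz
  have hcont1 : Continuous fun z : stDomain N c ↦ stParam c z.1 :=
    continuousOn_iff_continuous_domRestrict.1 (continuousOn_stParam (N := N) c)
  have hcont2 : Continuous fun z : stSource N c ↦ stChart c z.1 :=
    continuousOn_iff_continuous_domRestrict.1 (continuousOn_stChart (N := N) c)
  let H : stDomain N c ≃ₜ stSource N c :=
    { toFun := fun z ↦ ⟨stParam c z, mapsTo_stParam c z.2⟩
      invFun := fun z ↦ ⟨stChart c z, mapsTo_stChart c z.2⟩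
      left_inv := fun z ↦ Subtype.ext (stChart_stParam c z.2)
      right_inv := fun z ↦ Subtype.ext (stParam_stChart c z.2)
      continuous_toFun := Continuous.subtype_mk hcont1 _
      continuous_invFun := Continuous.subtype_mk hcont2 _ }
  have h1 : (stDomain N c).domRestrict (stParamExt c) = Subtype.val ∘ H := by
    ext1 y
    exact stParamExt_eq c y.2
  rw [h1]
  exact (MeasurableEmbedding.subtype_coe (isOpen_stSource (N := N) c).measurableSet).comp
    H.measurableEmbedding

theorem stMeasure_restrict_stSource (c : M) :
    (stMeasure N M).restrict (stSource N c) =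
      ((volume : Measure (EuclideanSpace ℝ (Fin N) × ℝ)).withDensity (stDensity c)).map
        (stParamExt c) := by
  rw [stMeasure, stSource, ← Measure.prod_restrict, riemannianMeasure_restrict_source,
    chartMeasure_eq]
  have h1 : (volume : Measure ℝ).restrict (Ioi 0) =
    ((volume : Measure ℝ).restrict (Ioi 0)).map id := by simp
  rw [h1, Measure.map_prod_map _ _ (measurable_chartParam c) measurable_id,
    prod_withDensity_left (measurable_chartDensity c)]
  have h2 : ((volume : Measure (EuclideanSpace ℝ (Fin N))).prod (volume.restrict (Ioi (0 : ℝ)))) =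
      (volume : Measure (EuclideanSpace ℝ (Fin N) × ℝ)).restrict (univ ×ˢ Ioi 0) := by
    rw [Measure.volume_eq_prod, ← Measure.prod_restrict, Measure.restrict_univ]
  rw [h2, ← withDensity_indicator (MeasurableSet.univ.prod measurableSet_Ioi), ← stDensity_eq]
  rfl

theorem withDensity_stDensity_compl (c : M) :
    (volume : Measure (EuclideanSpace ℝ (Fin N) × ℝ)).withDensity (stDensity c)
      (stDomain N c)ᶜ = 0 := by
  have ht := (isOpen_stDomain (N := N) c).measurableSet
  rw [withDensity_apply _ ht.compl]
  rw [setLIntegral_congr_fun ht.compl (g := fun _ ↦ 0)]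
  · simp
  · intro y hy
    exact indicator_of_notMem hy _

theorem stDensity_toReal (c : M) {z : EuclideanSpace ℝ (Fin N) × ℝ} (hz : z ∈ stDomain N c) :
    (stDensity c z).toReal = metricDensity c z.1 := by
  rw [stDensity, indicator_of_mem hz, ENNReal.toReal_ofReal (metricDensity_pos c hz.1).le]

theorem stDensity_lt_top (c : M) (z : EuclideanSpace ℝ (Fin N) × ℝ) : stDensity c z < ⊤ := by
  unfold stDensity indicator
  split_ifs <;> simp

theorem toReal_stDensity_mul (c : M) (F : M × ℝ → ℝ) :
    (fun z ↦ (stDensity c z).toReal • F (stParamExt (N := N) c z)) =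
      (stDomain N c).indicator fun z ↦ metricDensity c z.1 * F (stParam c z) := by
  ext z
  by_cases hz : z ∈ stDomain N c
  · rw [indicator_of_mem hz, stDensity_toReal c hz, stParamExt_eq c hz, smul_eq_mul]
  · rw [indicator_of_notMem hz, stDensity, indicator_of_notMem hz]
    simp

theorem integrableOn_stSource_iff (c : M) {F : M × ℝ → ℝ} :
    IntegrableOn F (stSource N c) (stMeasure N M) ↔
      IntegrableOn (fun z ↦ metricDensity c z.1 * F (stParam c z)) (stDomain N c) := by
  rw [IntegrableOn, stMeasure_restrict_stSource, integrable_map_iff_of_embeddingOn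
    (isOpen_stDomain (N := N) c).measurableSet (withDensity_stDensity_compl c)
    (measurable_stParamExt c) (measurableEmbedding_stParamExt c),
    integrable_withDensity_iff_integrable_smul' (measurable_stDensity c)
      (Filter.Eventually.of_forall (stDensity_lt_top c)), toReal_stDensity_mul,
    integrable_indicator_iff (isOpen_stDomain (N := N) c).measurableSet]

theorem setIntegral_stSource (c : M) (F : M × ℝ → ℝ) :
    ∫ z in stSource N c, F z ∂(stMeasure N M) =
      ∫ z in stDomain N c, metricDensity c z.1 * F (stParam c z) := by
  rw [stMeasure_restrict_stSource, integral_map_of_embeddingOn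
    (isOpen_stDomain (N := N) c).measurableSet (withDensity_stDensity_compl c)
    (measurable_stParamExt c) (measurableEmbedding_stParamExt c),
    integral_withDensity_eq_integral_toReal_smul (measurable_stDensity c)
      (Filter.Eventually.of_forall (stDensity_lt_top c)), toReal_stDensity_mul,
    integral_indicator (isOpen_stDomain (N := N) c).measurableSet]

/-- The density is positive on the coordinate domain, so null sets correspond in both directions. -/
theorem ae_stSource_iff (c : M) {P : M × ℝ → Prop} :
    (∀ᵐ z ∂(stMeasure N M).restrict (stSource N c), P z) ↔
      ∀ᵐ z ∂(volume.restrict (stDomain N c)), P (stParam c z) := by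
  have ht := (isOpen_stDomain (N := N) c).measurableSet
  rw [stMeasure_restrict_stSource, ae_map_iff_of_embeddingOn
    (isOpen_stDomain (N := N) c).measurableSet (withDensity_stDensity_compl c)
    (measurable_stParamExt c) (measurableEmbedding_stParamExt c),
    ae_withDensity_iff (measurable_stDensity c), ae_restrict_iff' ht]
  refine Filter.eventually_congr (Filter.Eventually.of_forall fun z ↦ ?_)
  by_cases hz : z ∈ stDomain N c
  · have : stDensity c z ≠ 0 := by
      rw [stDensity, indicator_of_mem hz]
      simpa using metricDensity_pos c hz.1
    simp [hz, this, stParamExt_eq c hz]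
  · simp [hz, stDensity]

theorem aestronglyMeasurable_stSource (c : M) {F : M × ℝ → ℝ}
    (h : AEStronglyMeasurable (fun z ↦ F (stParam c z)) (volume.restrict (stDomain N c))) :
    AEStronglyMeasurable F ((stMeasure N M).restrict (stSource N c)) := by
  have ht := (isOpen_stDomain (N := N) c).measurableSet
  rw [stMeasure_restrict_stSource, map_eq_map_restrict_comap ht (withDensity_stDensity_compl c)
    (measurable_stParamExt c),
    (measurableEmbedding_stParamExt c).aestronglyMeasurable_map_iff]
  have h1 : ((volume : Measure (EuclideanSpace ℝ (Fin N) × ℝ)).withDensity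
      (stDensity c)).restrict (stDomain N c) ≪ volume.restrict (stDomain N c) :=
    (withDensity_absolutelyContinuous _ _).restrict _
  have h2 := h.mono_ac h1
  rw [← map_comap_subtype_coe ht,
    (MeasurableEmbedding.subtype_coe ht).aestronglyMeasurable_map_iff] at h2
  refine h2.congr (Filter.Eventually.of_forall fun z ↦ ?_)
  simp [stParamExt_eq c z.2]

theorem exists_countable_stSource_cover :
    ∃ s : Set M, s.Countable ∧ ⋃ c ∈ s, stSource N c = cylinder M := by
  obtain ⟨s, hs, hsU⟩ := TopologicalSpace.countable_cover_nhds
    (fun x : M ↦ chart_source_mem_nhds (EuclideanSpace ℝ (Fin N)) x)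
  refine ⟨s, hs, ?_⟩
  simp only [stSource, cylinder]
  rw [← hsU, iUnion_prod_const]
  simp only [iUnion_prod_const]

theorem ae_chart_of_cylinder {P : M × ℝ → Prop}
    (h : ∀ᵐ z ∂(stMeasure N M).restrict (cylinder M), P z) (c : M) :
    ∀ᵐ z ∂(volume.restrict (stDomain N c)), P (stParam c z) :=
  (ae_stSource_iff c).1 (ae_restrict_of_ae_restrict_of_subset
    (prod_mono (subset_univ _) subset_rfl) h)

theorem aestronglyMeasurable_cylinder_of_chart {F : M × ℝ → ℝ}
    (h : ∀ c : M, AEStronglyMeasurable (fun z ↦ F (stParam c z))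
      (volume.restrict (stDomain N c))) :
    AEStronglyMeasurable F ((stMeasure N M).restrict (cylinder M)) := by
  obtain ⟨s, hs, hsU⟩ := exists_countable_stSource_cover (N := N) (M := M)
  have := hs.to_subtype
  rw [← hsU, biUnion_eq_iUnion, aestronglyMeasurable_iUnion_iff]
  exact fun c ↦ aestronglyMeasurable_stSource c.1 (h c.1)

theorem setIntegral_cylinder_eq (c : M) {F : M × ℝ → ℝ}
    (hF : ∀ z, z ∉ stSource N c → F z = 0) :
    ∫ z in cylinder M, F z ∂(stMeasure N M) =
      ∫ z in stDomain N c, metricDensity c z.1 * F (stParam c z) := by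
  rw [← setIntegral_stSource]
  refine setIntegral_eq_of_subset_of_forall_sdiff_eq_zero ?_ (prod_mono (subset_univ _) subset_rfl)
    fun z hz ↦ hF z hz.2
  exact MeasurableSet.univ.prod measurableSet_Ioi

/-- On compact coordinate sets the density is bounded away from zero, so it can be divided out of
the transferred integral. -/
theorem locallyIntegrableOn_stParam (c : M) {F : M × ℝ → ℝ}
    (hF : LocallyIntegrableOn F (cylinder M) (stMeasure N M)) :
    LocallyIntegrableOn (fun z ↦ F (stParam c z)) (stDomain N c) := by
  rw [locallyIntegrableOn_iff (isOpen_stDomain c).isLocallyClosed]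
  intro K hK hKc
  have hKm := hKc.measurableSet
  have hK' : IsCompact (stParam c '' K) := hKc.image_of_continuousOn
    ((continuousOn_stParam c).mono hK)
  have hsub : stParam c '' K ⊆ stSource N c := by
    rintro _ ⟨z, hz, rfl⟩
    exact mapsTo_stParam c (hK hz)
  have h1 : IntegrableOn F (stParam c '' K) (stMeasure N M) :=
    hF.integrableOn_compact_subset (hsub.trans (prod_mono (subset_univ _) subset_rfl)) hK'
  have h2 : IntegrableOn ((stParam c '' K).indicator F) (stSource N c) (stMeasure N M) :=
    ((integrable_indicator_iff hK'.measurableSet).2 h1).integrableOn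
  rw [integrableOn_stSource_iff] at h2
  have h3 := h2.mono_set hK
  obtain ⟨C, hC⟩ := hKc.exists_bound_of_continuousOn (f := fun z ↦ (metricDensity c z.1)⁻¹)
    (((contDiffOn_metricDensity c).continuousOn.comp continuousOn_fst
      (fun z hz ↦ (hK hz).1)).inv₀ fun z hz ↦ (metricDensity_pos c (hK hz).1).ne')
  have h4 : IntegrableOn (fun z ↦ (metricDensity c z.1)⁻¹ *
      (metricDensity c z.1 * (stParam c '' K).indicator F (stParam c z))) K := by
    refine Integrable.bdd_mul h3 ?_ (c := C) ?_
    · exact (((contDiffOn_metricDensity c).continuousOn.comp continuousOn_fst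
        (fun z hz ↦ (hK hz).1)).inv₀ fun z hz ↦
          (metricDensity_pos c (hK hz).1).ne').aestronglyMeasurable hKm
    · filter_upwards [ae_restrict_mem hKm] with z hz using hC z hz
  refine h4.congr_fun (fun z hz ↦ ?_) hKm
  simp only
  rw [indicator_of_mem (mem_image_of_mem _ hz), ← mul_assoc,
    inv_mul_cancel₀ (metricDensity_pos c (hK hz).1).ne', one_mul]

end Transfer

/-! ### Convolution, translation moduli and mollifiers -/

section Mollify
open Filter Topology Convolution

/-- Jensen's inequality for averages, integrated in the second variable. -/
theorem lintegral_rpow_lintegral_mul_le {α β : Type*} [MeasurableSpace α] [MeasurableSpace β]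
    {μ : Measure α} {ν : Measure β} [SFinite μ] [SFinite ν] {p : ℝ} (hp : 1 ≤ p)
    {k : β → ℝ≥0∞} (hk : AEMeasurable k ν) {F : α → β → ℝ≥0∞}
    (hF : AEMeasurable (Function.uncurry F) (μ.prod ν)) :
    ∫⁻ z, (∫⁻ ζ, k ζ * F z ζ ∂ν) ^ p ∂μ ≤
      (∫⁻ ζ, k ζ ∂ν) ^ (p - 1) * ∫⁻ ζ, k ζ * ∫⁻ z, F z ζ ^ p ∂μ ∂ν := by
  have hp0 : 0 < p := by linarith
  have h1 : ∀ᵐ z ∂μ, (∫⁻ ζ, k ζ * F z ζ ∂ν) ^ p ≤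
      (∫⁻ ζ, k ζ ∂ν) ^ (p - 1) * ∫⁻ ζ, k ζ * F z ζ ^ p ∂ν := by
    filter_upwards [hF.aestronglyMeasurable.prodMk_left] with z hz'
    have hz : AEMeasurable (F z) ν := hz'.aemeasurable
    rcases hp.eq_or_lt with rfl | hp1
    · simp
    -- Hölder's inequality will be applied to the splitting `k F = k^(1 - 1/p) · (k F^p)^(1/p)`.
    have h2 : ∫⁻ ζ, k ζ * F z ζ ∂ν =
        ∫⁻ ζ, (k ζ) ^ (1 - 1 / p) * (k ζ * F z ζ ^ p) ^ (1 / p) ∂ν := by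
      refine lintegral_congr fun ζ ↦ ?_
      rw [ENNReal.mul_rpow_of_nonneg _ _ (by positivity), ← mul_assoc,
        ← ENNReal.rpow_add_of_nonneg _ _ (by rw [sub_nonneg, div_le_one hp0]; exact hp)
          (by positivity), ← ENNReal.rpow_mul]
      congr 1
      · simp
      · rw [mul_one_div_cancel hp0.ne', ENNReal.rpow_one]
    have h3 := ENNReal.lintegral_mul_norm_pow_le (μ := ν) hk
      (hk.mul (hz.pow_const p)) (p := 1 - 1 / p) (q := 1 / p)
      (by rw [sub_nonneg, div_le_one hp0]; exact hp) (by positivity) (by ring)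
    rw [h2]
    refine (ENNReal.rpow_le_rpow h3 hp0.le).trans_eq ?_
    rw [ENNReal.mul_rpow_of_nonneg _ _ hp0.le, ← ENNReal.rpow_mul, ← ENNReal.rpow_mul]
    congr 2
    · field_simp
    · rw [one_div_mul_cancel hp0.ne', ENNReal.rpow_one]
      rfl
  refine (lintegral_mono_ae h1).trans_eq ?_
  have hk2 : AEMeasurable (fun z : α × β ↦ k z.2) (μ.prod ν) := hk.comp_snd
  rw [lintegral_const_mul'' , lintegral_lintegral_swap (hk2.mul (hF.pow_const p))]
  · congr 1
    have : ∀ᵐ ζ ∂ν, AEMeasurable (fun z ↦ F z ζ) μ := by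
      filter_upwards [hF.prod_swap.aestronglyMeasurable.prodMk_left] with ζ hζ
      exact hζ.aemeasurable
    refine lintegral_congr_ae ?_
    filter_upwards [this] with ζ hζ
    exact lintegral_const_mul'' _ (hζ.pow_const p)
  · exact (hk2.mul (hF.pow_const p)).lintegral_prod_right'

variable {E : Type*} [NormedAddCommGroup E] [NormedSpace ℝ E] [FiniteDimensional ℝ E]
  [MeasurableSpace E] [BorelSpace E] {μ : Measure E} [μ.IsAddHaarMeasure]

variable (μ) in
/-- The `p`-th power of the `Lᵖ` modulus of continuity of `u` under the translation by `ζ`. -/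
def translationModulus (p : ℝ) (u : E → ℝ) (ζ : E) : ℝ≥0∞ :=
  ∫⁻ z, ‖u (z - ζ) - u z‖ₑ ^ p ∂μ

theorem measurePreserving_sub_const (ζ : E) : MeasurePreserving (fun z : E ↦ z - ζ) μ μ :=
  measurePreserving_sub_right μ ζ

theorem eLpNorm_sub_rpow {p : ℝ} (hp : 0 < p) (f : E → ℝ) :
    eLpNorm f (ENNReal.ofReal p) μ = (∫⁻ z, ‖f z‖ₑ ^ p ∂μ) ^ (1 / p) := by
  rw [eLpNorm_eq_lintegral_rpow_enorm_toReal (by simpa using hp) ENNReal.ofReal_ne_top,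
    ENNReal.toReal_ofReal hp.le]

/-- Continuity of translations in `Lᵖ` for finite `p`, read off from the continuity of composition
with measure-preserving maps. -/
theorem tendsto_translationModulus {p : ℝ} (hp : 1 ≤ p) {u : E → ℝ}
    (hu : MemLp u (ENNReal.ofReal p) μ) :
    Tendsto (translationModulus μ p u) (𝓝 0) (𝓝 0) := by
  have hp0 : 0 < p := by linarith
  have : Fact (1 ≤ ENNReal.ofReal p) := ⟨by simpa using hp⟩
  let g : C(E, C(E, E)) := ContinuousMap.curry ⟨fun z : E × E ↦ z.2 - z.1, by fun_prop⟩
  have hgm : ∀ ζ, MeasurePreserving (g ζ) μ μ := fun ζ ↦ measurePreserving_sub_const ζ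
  have hcont := (continuous_const (y := hu.toLp u) (X := E)).compMeasurePreservingLp
    g.continuous hgm ENNReal.ofReal_ne_top
  have h0 : Lp.compMeasurePreserving (g 0) (hgm 0) (hu.toLp u) = hu.toLp u := by
    rw [Lp.toLp_compMeasurePreserving]
    refine (MemLp.toLp_eq_toLp_iff _ _).2 (Filter.Eventually.of_forall fun z ↦ ?_)
    simp [g]
  have h1 : Tendsto (fun ζ ↦ edist (Lp.compMeasurePreserving (g ζ) (hgm ζ) (hu.toLp u))
      (hu.toLp u)) (𝓝 0) (𝓝 0) := by
    have := hcont.tendsto 0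
    rw [h0] at this
    rw [← tendsto_iff_edist_tendsto_0]
    exact this
  have h2 : ∀ ζ, edist (Lp.compMeasurePreserving (g ζ) (hgm ζ) (hu.toLp u)) (hu.toLp u) =
      (translationModulus μ p u ζ) ^ (1 / p) := by
    intro ζ
    rw [Lp.toLp_compMeasurePreserving, Lp.edist_toLp_toLp, eLpNorm_sub_rpow hp0]
    rfl
  simp_rw [h2] at h1
  have h3 := ((ENNReal.continuous_rpow_const (y := p)).tendsto 0).comp h1
  rw [ENNReal.zero_rpow_of_pos hp0] at h3
  refine h3.congr fun ζ ↦ ?_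
  simp only [Function.comp]
  rw [← ENNReal.rpow_mul, one_div_mul_cancel hp0.ne', ENNReal.rpow_one]

theorem aemeasurable_sub_translate {u : E → ℝ} (hu : AEStronglyMeasurable u μ) :
    AEMeasurable (fun z : E × E ↦ ‖u (z.1 - z.2) - u z.1‖ₑ) (μ.prod μ) := by
  have h1 : AEStronglyMeasurable (fun z : E × E ↦ u (z.1 - z.2)) (μ.prod μ) :=
    hu.comp_quasiMeasurePreserving (quasiMeasurePreserving_sub μ μ)
  exact (h1.sub hu.comp_fst).enorm

/-- The convolution `k ⋆ u`. -/
def moll (μ : Measure E) (k u : E → ℝ) (z : E) : ℝ := ∫ ζ, k ζ * u (z - ζ) ∂μ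

theorem moll_eq_convolution (k u : E → ℝ) :
    moll μ k u = (k ⋆[ContinuousLinearMap.lsmul ℝ ℝ, μ] u) := by
  ext z
  rfl

theorem integrable_moll_integrand {k u : E → ℝ} (hk : Continuous k) (hkc : HasCompactSupport k)
    (hu : LocallyIntegrable u μ) (z : E) : Integrable (fun ζ ↦ k ζ * u (z - ζ)) μ :=
  hkc.convolutionExists_left (ContinuousLinearMap.lsmul ℝ ℝ) hk hu z

theorem hasFDerivAt_moll {k u : E → ℝ} (hk : ContDiff ℝ 1 k) (hkc : HasCompactSupport k)
    (hu : LocallyIntegrable u μ) (z : E) :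
    HasFDerivAt (moll μ k u) (fderiv ℝ (moll μ k u) z) z := by
  rw [moll_eq_convolution]
  exact (hkc.hasFDerivAt_convolution_left (ContinuousLinearMap.lsmul ℝ ℝ) hk hu z
    ).differentiableAt.hasFDerivAt

theorem continuous_moll {k u : E → ℝ} (hk : ContDiff ℝ 1 k) (hkc : HasCompactSupport k)
    (hu : LocallyIntegrable u μ) : Continuous (moll μ k u) :=
  continuous_iff_continuousAt.2 fun z ↦ (hasFDerivAt_moll hk hkc hu z).continuousAt

theorem fderiv_moll {k u : E → ℝ} (hk : ContDiff ℝ 1 k) (hkc : HasCompactSupport k)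
    (hu : LocallyIntegrable u μ) (z e : E) :
    fderiv ℝ (moll μ k u) z e = moll μ (fun ζ ↦ fderiv ℝ k ζ e) u z := by
  rw [moll_eq_convolution,
    (hkc.hasFDerivAt_convolution_left (ContinuousLinearMap.lsmul ℝ ℝ) hk hu z).fderiv]
  have hex := (hkc.fderiv ℝ).convolutionExists_left
    ((ContinuousLinearMap.lsmul ℝ ℝ : ℝ →L[ℝ] ℝ →L[ℝ] ℝ).precompL E)
    (hk.continuous_fderiv one_ne_zero) hu z
  rw [convolution_def, ContinuousLinearMap.integral_apply hex]
  rfl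

/-- The mass of the kernel is left general: besides mollifiers of mass one, the identity is used for
derivatives of kernels, whose mass is zero. -/
theorem moll_sub {k u : E → ℝ} (hk : Continuous k) (hkc : HasCompactSupport k)
    (hu : LocallyIntegrable u μ) (z : E) (c : ℝ) :
    moll μ k u z - (∫ ζ, k ζ ∂μ) * c = ∫ ζ, k ζ * (u (z - ζ) - c) ∂μ := by
  rw [moll, ← integral_mul_const, ← integral_sub (integrable_moll_integrand hk hkc hu z)
    ((hk.integrable_of_hasCompactSupport hkc).mul_const c)]
  simp [mul_sub]

theorem enorm_moll_sub_le {k u : E → ℝ} (hk : Continuous k) (hkc : HasCompactSupport k)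
    (hu : LocallyIntegrable u μ) (z : E) (c : ℝ) :
    ‖moll μ k u z - (∫ ζ, k ζ ∂μ) * c‖ₑ ≤ ∫⁻ ζ, ‖k ζ‖ₑ * ‖u (z - ζ) - c‖ₑ ∂μ := by
  rw [moll_sub hk hkc hu]
  refine (enorm_integral_le_lintegral_enorm _).trans_eq ?_
  simp [enorm_mul]

/-- If a pointwise oscillation inequality relates `u` to `v`, then the convolution of `u` with a
kernel is controlled by the translation modulus of `v`. -/
theorem lintegral_moll_sub_le {p : ℝ} (hp : 1 ≤ p) {k u v c : E → ℝ} (hk : Continuous k)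
    (hkc : HasCompactSupport k) (hu : LocallyIntegrable u μ) (hv : AEStronglyMeasurable v μ)
    {S : Set E} (hS : Function.support k ⊆ S) {B : ℝ≥0∞}
    (hB : ∀ ζ ∈ S, translationModulus μ p v ζ ≤ B)
    (hc : ∀ᵐ z ∂μ, ∀ᵐ ζ ∂μ, ‖c z‖ₑ * ‖u (z - ζ) - u z‖ₑ ≤ ‖v (z - ζ) - v z‖ₑ) :
    ∫⁻ z, ‖c z * (moll μ k u z - (∫ ζ, k ζ ∂μ) * u z)‖ₑ ^ p ∂μ ≤
      (∫⁻ ζ, ‖k ζ‖ₑ ∂μ) ^ p * B := by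
  have hp0 : 0 < p := by linarith
  calc _ ≤ ∫⁻ z, (∫⁻ ζ, ‖k ζ‖ₑ * ‖v (z - ζ) - v z‖ₑ ∂μ) ^ p ∂μ := by
        refine lintegral_mono_ae ?_
        filter_upwards [hc] with z hz
        refine ENNReal.rpow_le_rpow ?_ hp0.le
        rw [enorm_mul]
        refine (mul_le_mul_right (enorm_moll_sub_le hk hkc hu z (u z)) _).trans ?_
        rw [← lintegral_const_mul' _ _ enorm_ne_top]
        refine lintegral_mono_ae ?_
        filter_upwards [hz] with ζ hζ
        rw [mul_left_comm]
        gcongr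
    _ ≤ (∫⁻ ζ, ‖k ζ‖ₑ ∂μ) ^ (p - 1) * ∫⁻ ζ, ‖k ζ‖ₑ * translationModulus μ p v ζ ∂μ :=
        lintegral_rpow_lintegral_mul_le hp hk.aestronglyMeasurable.enorm
          (aemeasurable_sub_translate hv)
    _ ≤ (∫⁻ ζ, ‖k ζ‖ₑ ∂μ) ^ (p - 1) * ∫⁻ ζ, ‖k ζ‖ₑ * B ∂μ := by
        refine mul_le_mul_right (lintegral_mono fun ζ ↦ ?_) _
        by_cases h : k ζ = 0
        · simp [h]
        · exact mul_le_mul_right (hB ζ (hS h)) _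
    _ = (∫⁻ ζ, ‖k ζ‖ₑ ∂μ) ^ p * B := by
        rw [lintegral_mul_const'' _ hk.aestronglyMeasurable.enorm, ← mul_assoc]
        congr 1
        nth_rewrite 2 [← ENNReal.rpow_one (∫⁻ ζ, ‖k ζ‖ₑ ∂μ)]
        rw [← ENNReal.rpow_add_of_nonneg _ _ (by linarith) zero_le_one]
        simp

/-- Integrals against a smooth compactly supported approximate identity. -/
structure IsMollifier (μ : Measure E) (k : E → ℝ) : Prop where
  smooth : ContDiff ℝ ∞ k
  compact : HasCompactSupport k
  nonneg : ∀ z, 0 ≤ k z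
  integral : ∫ z, k z ∂μ = 1

theorem IsMollifier.contDiff_one {k : E → ℝ} (hk : IsMollifier μ k) : ContDiff ℝ 1 k :=
  hk.smooth.of_le (by exact_mod_cast le_top)

theorem IsMollifier.lintegral_enorm {k : E → ℝ} (hk : IsMollifier μ k) :
    ∫⁻ z, ‖k z‖ₑ ∂μ = 1 := by
  have h1 : Integrable k μ := hk.smooth.continuous.integrable_of_hasCompactSupport hk.compact
  have h2 : ∀ z, ‖k z‖ₑ = ENNReal.ofReal (k z) := fun z ↦ by
    rw [Real.enorm_eq_ofReal (hk.nonneg z)]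
  simp_rw [h2]
  rw [← ofReal_integral_eq_lintegral_ofReal h1 (Eventually.of_forall hk.nonneg), hk.integral]
  simp

theorem IsMollifier.abs_moll_le {k u : E → ℝ} (hk : IsMollifier μ k)
    {B : ℝ} (hB : ∀ z, |u z| ≤ B) (z : E) : |moll μ k u z| ≤ B := by
  have h1 : Integrable k μ := hk.smooth.continuous.integrable_of_hasCompactSupport hk.compact
  rw [moll, ← Real.norm_eq_abs]
  refine (norm_integral_le_of_norm_le (h1.mul_const B) (Eventually.of_forall fun ζ ↦ ?_)).trans_eq ?_
  · rw [norm_mul, Real.norm_of_nonneg (hk.nonneg ζ)]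
    exact mul_le_mul_of_nonneg_left (hB _) (hk.nonneg ζ)
  · rw [integral_mul_const, hk.integral, one_mul]

theorem IsMollifier.moll_nonneg {k u : E → ℝ} (hk : IsMollifier μ k)
    (hu : ∀ z, 0 ≤ u z) (z : E) : 0 ≤ moll μ k u z :=
  integral_nonneg fun ζ ↦ mul_nonneg (hk.nonneg ζ) (hu _)

theorem lintegral_moll_le {p : ℝ} (hp : 1 ≤ p) {k w : E → ℝ} (hk : IsMollifier μ k)
    (hw : AEStronglyMeasurable w μ) :
    ∫⁻ z, ‖moll μ k w z‖ₑ ^ p ∂μ ≤ ∫⁻ z, ‖w z‖ₑ ^ p ∂μ := by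
  have hp0 : 0 < p := by linarith
  have hm : AEMeasurable (fun z : E × E ↦ ‖w (z.1 - z.2)‖ₑ) (μ.prod μ) :=
    (hw.comp_quasiMeasurePreserving (quasiMeasurePreserving_sub μ μ)).enorm
  calc _ ≤ ∫⁻ z, (∫⁻ ζ, ‖k ζ‖ₑ * ‖w (z - ζ)‖ₑ ∂μ) ^ p ∂μ := by
        refine lintegral_mono fun z ↦ ENNReal.rpow_le_rpow ?_ hp0.le
        refine (enorm_integral_le_lintegral_enorm _).trans_eq ?_
        simp [enorm_mul]
    _ ≤ (∫⁻ ζ, ‖k ζ‖ₑ ∂μ) ^ (p - 1) * ∫⁻ ζ, ‖k ζ‖ₑ * ∫⁻ z, ‖w (z - ζ)‖ₑ ^ p ∂μ ∂μ :=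
        lintegral_rpow_lintegral_mul_le hp hk.smooth.continuous.aestronglyMeasurable.enorm hm
    _ = ∫⁻ z, ‖w z‖ₑ ^ p ∂μ := by
        have : ∀ ζ, ∫⁻ z, ‖w (z - ζ)‖ₑ ^ p ∂μ = ∫⁻ z, ‖w z‖ₑ ^ p ∂μ := fun ζ ↦
          lintegral_sub_right_eq_self (fun z ↦ ‖w z‖ₑ ^ p) ζ
        simp_rw [this]
        rw [lintegral_mul_const'' _ hk.smooth.continuous.aestronglyMeasurable.enorm,
          hk.lintegral_enorm]
        simp

/-- Mollification converges in `Lᵖ` as the supports of the kernels shrink. -/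
theorem tendsto_lintegral_moll_sub {p : ℝ} (hp : 1 ≤ p) {k : ℕ → E → ℝ}
    (hk : ∀ n, IsMollifier μ (k n)) {r : ℕ → ℝ} (hr : Tendsto r atTop (𝓝 0))
    (hkr : ∀ n, Function.support (k n) ⊆ Metric.closedBall 0 (r n)) {u : E → ℝ}
    (hu : MemLp u (ENNReal.ofReal p) μ) :
    Tendsto (fun n ↦ ∫⁻ z, ‖moll μ (k n) u z - u z‖ₑ ^ p ∂μ) atTop (𝓝 0) := by
  have hu1 : LocallyIntegrable u μ := hu.locallyIntegrable (by simpa using hp)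
  rw [ENNReal.tendsto_nhds_zero]
  intro ε hε
  obtain ⟨ρ, hρ, hρε⟩ := Metric.nhds_basis_closedBall.mem_iff.1
    ((ENNReal.tendsto_nhds_zero.1 (tendsto_translationModulus hp hu)) ε hε)
  filter_upwards [hr.eventually (gt_mem_nhds hρ)] with n hn
  have := lintegral_moll_sub_le (c := fun _ ↦ 1) (v := u) (B := ε) hp (hk n).smooth.continuous
    (hk n).compact hu1 hu.1 (hkr n) (fun ζ hζ ↦ hρε (Metric.closedBall_subset_closedBall hn.le hζ))
    (by simp)
  simpa [(hk n).integral, (hk n).lintegral_enorm] using this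

theorem exists_subseq_tendsto_moll {k : ℕ → E → ℝ}
    (hk : ∀ n, IsMollifier μ (k n)) {r : ℕ → ℝ} (hr : Tendsto r atTop (𝓝 0))
    (hkr : ∀ n, Function.support (k n) ⊆ Metric.closedBall 0 (r n)) {u : E → ℝ}
    (hu : Integrable u μ) :
    ∃ ns : ℕ → ℕ, StrictMono ns ∧
      ∀ᵐ z ∂μ, Tendsto (fun i ↦ moll μ (k (ns i)) u z) atTop (𝓝 (u z)) := by
  refine TendstoInMeasure.exists_seq_tendsto_ae (μ := μ) (f := fun n ↦ moll μ (k n) u)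
    (tendstoInMeasure_of_tendsto_eLpNorm one_ne_zero (fun n ↦ ?_) hu.1 ?_)
  · exact (continuous_moll (hk n).contDiff_one (hk n).compact
      hu.locallyIntegrable).aestronglyMeasurable
  · have := tendsto_lintegral_moll_sub le_rfl hk hr hkr (u := u)
      (by simpa using memLp_one_iff_integrable.2 hu)
    simpa [eLpNorm_one_eq_lintegral_enorm] using this

end Mollify

/-! ### Weak directional derivatives on the whole space -/

section WeakDeriv
open Filter Topology

variable {E : Type*} [NormedAddCommGroup E] [NormedSpace ℝ E] [FiniteDimensional ℝ E]
  [MeasurableSpace E] [BorelSpace E] {μ : Measure E} [μ.IsAddHaarMeasure]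

/-- `w` is the weak derivative of `u` in the direction `e`, on the whole space. -/
def HasWeakLineDeriv (μ : Measure E) (u w : E → ℝ) (e : E) : Prop :=
  ∀ η : E → ℝ, ContDiff ℝ ∞ η → HasCompactSupport η →
    ∫ z, u z * fderiv ℝ η z e ∂μ = -∫ z, w z * η z ∂μ

/-- The reflected kernel `ζ ↦ k (z - ζ)` is itself an admissible test function in the definition of
the weak derivative. -/
theorem HasWeakLineDeriv.fderiv_moll {u w : E → ℝ} {e : E} (h : HasWeakLineDeriv μ u w e)
    (hu : LocallyIntegrable u μ) {k : E → ℝ} (hk : IsMollifier μ k) (z : E) :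
    fderiv ℝ (moll μ k u) z e = moll μ k w z := by
  rw [ParabolicIneq.fderiv_moll hk.contDiff_one hk.compact hu, moll, moll]
  have h1 := h (fun ζ ↦ k (z - ζ)) (hk.smooth.comp (contDiff_const.sub contDiff_id))
    (hk.compact.comp_homeomorph (Homeomorph.subLeft z))
  have h2 : ∀ ζ, fderiv ℝ (fun ζ ↦ k (z - ζ)) ζ e = -fderiv ℝ k (z - ζ) e := by
    intro ζ
    have h3 : HasFDerivAt (fun ζ ↦ k (z - ζ)) _ ζ :=
      ((hk.contDiff_one.differentiable one_ne_zero) (z - ζ)).hasFDerivAt.comp ζ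
        ((hasFDerivAt_const z ζ).sub (hasFDerivAt_id ζ))
    rw [h3.fderiv]
    simp
  simp_rw [h2, mul_neg, integral_neg, neg_inj] at h1
  rw [← integral_sub_left_eq_self (fun ζ ↦ fderiv ℝ k ζ e * u (z - ζ)) μ z,
    ← integral_sub_left_eq_self (fun ζ ↦ k ζ * w (z - ζ)) μ z]
  simp only [sub_sub_cancel]
  simp_rw [mul_comm (fderiv ℝ k _ e), mul_comm (k _)]
  exact h1

theorem exists_isMollifier (μ : Measure E) [μ.IsAddHaarMeasure] {r : ℝ} (hr : 0 < r) :
    ∃ k, IsMollifier μ k ∧ Function.support k ⊆ Metric.closedBall 0 r := by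
  let f : ContDiffBump (0 : E) := ⟨r / 2, r, by linarith, by linarith⟩
  refine ⟨f.normed μ, ⟨f.contDiff_normed, f.hasCompactSupport_normed, f.nonneg_normed,
    f.integral_normed⟩, ?_⟩
  rw [f.support_normed_eq]
  exact Metric.ball_subset_closedBall

theorem lipschitzWith_moll {k u : E → ℝ} (hk : ContDiff ℝ 1 k) (hkc : HasCompactSupport k)
    (hu : LocallyIntegrable u μ) {C : NNReal}
    (hC : ∀ z v, |moll μ (fun ζ ↦ fderiv ℝ k ζ v) u z| ≤ C * ‖v‖) :
    LipschitzWith C (moll μ k u) := by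
  refine lipschitzWith_of_nnnorm_fderiv_le
    (fun z ↦ (hasFDerivAt_moll hk hkc hu z).differentiableAt) fun z ↦ ?_
  rw [← NNReal.coe_le_coe, coe_nnnorm]
  refine ContinuousLinearMap.opNorm_le_bound _ C.2 fun v ↦ ?_
  rw [fderiv_moll hk hkc hu]
  exact hC z v

theorem exists_lipschitzWith_moll {k u : E → ℝ} (hk : ContDiff ℝ 1 k) (hkc : HasCompactSupport k)
    (hu : Integrable u μ) : ∃ C, LipschitzWith C (moll μ k u) := by
  obtain ⟨B, hB⟩ := (hkc.fderiv ℝ).exists_bound_of_continuous (hk.continuous_fderiv one_ne_zero)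
  have hB0 : 0 ≤ B := (norm_nonneg _).trans (hB 0)
  refine ⟨⟨B * ∫ z, ‖u z‖ ∂μ, by positivity⟩,
    lipschitzWith_moll hk hkc hu.locallyIntegrable fun z v ↦ ?_⟩
  rw [moll, ← Real.norm_eq_abs]
  refine (norm_integral_le_of_norm_le ((hu.comp_sub_left z).norm.const_mul (B * ‖v‖))
    (Eventually.of_forall fun ζ ↦ ?_)).trans_eq ?_
  · rw [norm_mul]
    gcongr
    exact (ContinuousLinearMap.le_opNorm _ _).trans (by gcongr; exact hB ζ)
  · rw [integral_const_mul, integral_sub_left_eq_self (fun x ↦ ‖u x‖) μ z]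
    change _ = B * _ * _
    ring

theorem exists_lipschitzWith_moll_of_bounded {k u : E → ℝ} (hk : ContDiff ℝ 1 k)
    (hkc : HasCompactSupport k) (hu : LocallyIntegrable u μ) {B : ℝ} (hB : ∀ z, |u z| ≤ B) :
    ∃ C, LipschitzWith C (moll μ k u) := by
  have hB0 : 0 ≤ B := (abs_nonneg _).trans (hB 0)
  have hint : Integrable (fun ζ ↦ ‖fderiv ℝ k ζ‖) μ :=
    ((hk.continuous_fderiv one_ne_zero).integrable_of_hasCompactSupport (hkc.fderiv ℝ)).norm
  refine ⟨⟨B * ∫ z, ‖fderiv ℝ k z‖ ∂μ, by positivity⟩,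
    lipschitzWith_moll hk hkc hu fun z v ↦ ?_⟩
  rw [moll, ← Real.norm_eq_abs]
  refine (norm_integral_le_of_norm_le (hint.mul_const (‖v‖ * B))
    (Eventually.of_forall fun ζ ↦ ?_)).trans_eq ?_
  · rw [norm_mul, ← mul_assoc]
    exact mul_le_mul (ContinuousLinearMap.le_opNorm _ _) (hB _) (norm_nonneg _) (by positivity)
  · rw [integral_mul_const]
    change _ = B * _ * _
    ring

/-- Chain rule for weak derivatives, tested with Lipschitz functions. -/
theorem HasWeakLineDeriv.integral_comp_mul_lineDeriv {u w : E → ℝ} {e : E}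
    (h : HasWeakLineDeriv μ u w e) (hu : Integrable u μ) (hw : Integrable w μ)
    {H H' : ℝ → ℝ} (hH : ∀ s, HasDerivAt H (H' s) s) (hH' : Continuous H') {L : ℝ}
    (hL : ∀ s, |H' s| ≤ L) {η : E → ℝ} {C : NNReal} (hη : LipschitzWith C η)
    (hηc : HasCompactSupport η) :
    ∫ z, H (u z) * lineDeriv ℝ η z e ∂μ = -∫ z, H' (u z) * w z * η z ∂μ := by
  have hL0 : 0 ≤ L := (abs_nonneg _).trans (hL 0)
  have hHlip : LipschitzWith L.toNNReal H := lipschitzWith_of_nnnorm_deriv_le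
    (fun s ↦ (hH s).differentiableAt) fun s ↦ by
      rw [(hH s).deriv, ← NNReal.coe_le_coe, Real.coe_toNNReal _ hL0]
      exact hL s
  choose k hk hkr using fun n : ℕ ↦ exists_isMollifier μ (Nat.one_div_pos_of_nat (n := n) (α := ℝ))
  have hr : Tendsto (fun n : ℕ ↦ 1 / ((n : ℝ) + 1)) atTop (𝓝 0) :=
    tendsto_one_div_add_atTop_nhds_zero_nat
  obtain ⟨ns, hns, hae⟩ := exists_subseq_tendsto_moll hk hr hkr hu
  have hconv : ∀ {f : E → ℝ}, Integrable f μ →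
      Tendsto (fun n ↦ ∫⁻ z, ‖moll μ (k (ns n)) f z - f z‖ₑ ∂μ) atTop (𝓝 0) := by
    intro f hf
    have := (tendsto_lintegral_moll_sub le_rfl hk hr hkr
      (by simpa using memLp_one_iff_integrable.2 hf)).comp hns.tendsto_atTop
    simpa [Function.comp_def] using this
  obtain ⟨B, hB⟩ := hηc.exists_bound_of_continuous hη.continuous
  have hηm : AEStronglyMeasurable η μ := hη.continuous.aestronglyMeasurable
  have hdm : AEStronglyMeasurable (fun z ↦ lineDeriv ℝ η z e) μ :=
    aestronglyMeasurable_lineDeriv hη.continuous μ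
  have hdb : ∀ z, ‖lineDeriv ℝ η z e‖ ≤ C * ‖e‖ := fun z ↦
    norm_lineDeriv_le_of_lipschitz ℝ hη
  have hcm : ∀ n, Continuous (moll μ (k n) u) := fun n ↦
    continuous_moll (hk n).contDiff_one (hk n).compact hu.locallyIntegrable
  have hcw : ∀ n, Continuous (moll μ (k n) w) := fun n ↦
    continuous_moll (hk n).contDiff_one (hk n).compact hw.locallyIntegrable
  -- the identity for the mollified functions
  have hid : ∀ n, ∫ z, H (moll μ (k n) u z) * lineDeriv ℝ η z e ∂μ =
      -∫ z, H' (moll μ (k n) u z) * moll μ (k n) w z * η z ∂μ := by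
    intro n
    obtain ⟨C₁, hC₁⟩ := exists_lipschitzWith_moll (hk n).contDiff_one (hk n).compact hu
    have h1 := (hHlip.comp hC₁).integral_lineDeriv_mul_eq (μ := μ) hη hηc e
    have h2 : ∀ z, lineDeriv ℝ (H ∘ moll μ (k n) u) z e =
        H' (moll μ (k n) u z) * moll μ (k n) w z := by
      intro z
      have h3 := (hH (moll μ (k n) u z)).comp_hasFDerivAt z
        (hasFDerivAt_moll (hk n).contDiff_one (hk n).compact hu.locallyIntegrable z)
      rw [h3.differentiableAt.lineDeriv_eq_fderiv, h3.fderiv]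
      simp [h.fderiv_moll hu.locallyIntegrable (hk n)]
    simp_rw [h2, lineDeriv_neg, neg_mul, integral_neg] at h1
    rw [h1, neg_neg]
    simp_rw [mul_comm (lineDeriv ℝ η _ e)]
    rfl
  -- limits
  have hd_zero : ∀ z, z ∉ tsupport η → lineDeriv ℝ η z e = 0 := by
    intro z hz
    have : η =ᶠ[𝓝 z] fun _ ↦ 0 := notMem_tsupport_iff_eventuallyEq.1 hz
    rw [this.lineDeriv_eq]
    simp [lineDeriv]
  have hdint : Integrable (fun z ↦ lineDeriv ℝ η z e) μ := by
    have h1 : IntegrableOn (fun z ↦ lineDeriv ℝ η z e) (tsupport η) μ :=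
      Measure.integrableOn_of_bounded hηc.measure_lt_top.ne hdm (M := (C : ℝ) * ‖e‖)
        (Eventually.of_forall hdb)
    exact (integrableOn_iff_integrable_of_support_subset fun z hz ↦ by
      by_contra h
      exact hz (hd_zero z h)).1 h1
  have hHd : ∀ s, H s = H 0 + (H s - H 0) := fun s ↦ by ring
  -- `H (f z)` need not be integrable when `H 0 ≠ 0`; the constant `H 0` is split off and multiplied
  -- by the compactly supported derivative of `η`.
  have hHint : ∀ {f : E → ℝ}, Integrable f μ →
      Integrable (fun z ↦ H (f z) * lineDeriv ℝ η z e) μ := by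
    intro f hf
    have h1 : Integrable (fun z ↦ (H (f z) - H 0) * lineDeriv ℝ η z e) μ := by
      refine Integrable.mul_bdd (c := C * ‖e‖) ?_ hdm (Eventually.of_forall hdb)
      refine (hf.norm.const_mul L).mono' ?_ (Eventually.of_forall fun z ↦ ?_)
      · exact (hHlip.continuous.comp_aestronglyMeasurable hf.1).sub aestronglyMeasurable_const
      · have := hHlip.dist_le_mul (f z) 0
        rwa [Real.dist_eq, dist_zero_right, Real.coe_toNNReal _ hL0] at this
    refine ((hdint.const_mul (H 0)).add h1).congr (Eventually.of_forall fun z ↦ ?_)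
    simp only [Pi.add_apply]
    ring
  have hmu : ∀ n, Integrable (moll μ (k n) u) μ := fun n ↦
    ⟨(hcm n).aestronglyMeasurable, by
      have := lintegral_moll_le le_rfl (hk n) hu.1
      simp only [ENNReal.rpow_one] at this
      exact this.trans_lt hu.2⟩
  have hmw : ∀ n, Integrable (moll μ (k n) w) μ := fun n ↦
    ⟨(hcw n).aestronglyMeasurable, by
      have := lintegral_moll_le le_rfl (hk n) hw.1
      simp only [ENNReal.rpow_one] at this
      exact this.trans_lt hw.2⟩
  have hlim1 : Tendsto (fun n ↦ ∫ z, H (moll μ (k (ns n)) u z) * lineDeriv ℝ η z e ∂μ) atTop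
      (𝓝 (∫ z, H (u z) * lineDeriv ℝ η z e ∂μ)) := by
    refine tendsto_integral_of_L1 _ (hHint hu).1
      (Eventually.of_forall fun n ↦ hHint (hmu (ns n))) ?_
    have h0 : Tendsto (fun n ↦ ENNReal.ofReal (L * ((C : ℝ) * ‖e‖)) *
        ∫⁻ z, ‖moll μ (k (ns n)) u z - u z‖ₑ ∂μ) atTop (𝓝 0) := by
      have := ENNReal.Tendsto.const_mul (a := ENNReal.ofReal (L * ((C : ℝ) * ‖e‖))) (hconv hu)
        (Or.inr ENNReal.ofReal_ne_top)
      rwa [mul_zero] at this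
    refine tendsto_of_tendsto_of_tendsto_of_le_of_le tendsto_const_nhds h0
      (fun _ ↦ zero_le) fun n ↦ ?_
    rw [← lintegral_const_mul' _ _ ENNReal.ofReal_ne_top]
    refine lintegral_mono fun z ↦ ?_
    rw [← sub_mul, ← ofReal_norm, ← ofReal_norm, ← ENNReal.ofReal_mul (by positivity), norm_mul]
    refine ENNReal.ofReal_le_ofReal ?_
    have := hHlip.dist_le_mul (moll μ (k (ns n)) u z) (u z)
    rw [Real.dist_eq, Real.dist_eq, Real.coe_toNNReal _ hL0] at this
    calc _ ≤ (L * |moll μ (k (ns n)) u z - u z|) * (C * ‖e‖) :=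
          mul_le_mul this (hdb z) (norm_nonneg _) (by positivity)
      _ = _ := by rw [Real.norm_eq_abs]; ring
  have hint2 : ∀ {f g : E → ℝ}, AEStronglyMeasurable f μ → Integrable g μ →
      Integrable (fun z ↦ H' (f z) * g z * η z) μ := by
    intro f g hf hg
    refine Integrable.mul_bdd (c := B) ?_ hηm (Eventually.of_forall hB)
    exact hg.bdd_mul (hH'.comp_aestronglyMeasurable hf) (Eventually.of_forall fun z ↦ hL _)
  -- With `uₙ`, `wₙ` the mollifications, split `H'(uₙ) wₙ` into `H'(uₙ) w`, which converges by
  -- domination and a.e. convergence of `uₙ`, and `H'(uₙ) (wₙ - w)`, which is small because `wₙ → w`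
  -- in `L¹` and `H'` is bounded.
  have hlim2 : Tendsto (fun n ↦ ∫ z, H' (moll μ (k (ns n)) u z) * moll μ (k (ns n)) w z * η z ∂μ)
      atTop (𝓝 (∫ z, H' (u z) * w z * η z ∂μ)) := by
    have hA : Tendsto (fun n ↦ ∫ z, H' (moll μ (k (ns n)) u z) * w z * η z ∂μ) atTop
        (𝓝 (∫ z, H' (u z) * w z * η z ∂μ)) := by
      refine tendsto_integral_of_dominated_convergence (fun z ↦ L * ‖w z‖ * B)
        (fun n ↦ (hint2 (hcm _).aestronglyMeasurable hw).1)
        ((hw.norm.const_mul L).mul_const B) (fun n ↦ Eventually.of_forall fun z ↦ ?_) ?_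
      · rw [norm_mul, norm_mul]
        exact mul_le_mul (mul_le_mul_of_nonneg_right (hL _) (norm_nonneg _)) (hB z)
          (norm_nonneg _) (by positivity)
      · filter_upwards [hae] with z hz
        exact (((hH'.tendsto _).comp hz).mul_const _).mul_const _
    have hB' : Tendsto (fun n ↦ ∫ z, H' (moll μ (k (ns n)) u z) * (moll μ (k (ns n)) w z - w z) *
        η z ∂μ) atTop (𝓝 0) := by
      have hB0 : 0 ≤ B := (norm_nonneg _).trans (hB 0)
      have h0 : Tendsto (fun n ↦ L * B *
          ∫ z, ‖moll μ (k (ns n)) w z - w z‖ ∂μ) atTop (𝓝 0) := by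
        have := (ENNReal.tendsto_toReal ENNReal.zero_ne_top).comp (hconv hw)
        have h2 := this.const_mul (L * B)
        simp only [ENNReal.toReal_zero, mul_zero] at h2
        refine h2.congr fun n ↦ ?_
        congr 1
        exact (integral_norm_eq_lintegral_enorm ((hmw _).sub hw).1).symm
      refine squeeze_zero_norm (fun n ↦ ?_) h0
      rw [← integral_const_mul]
      refine norm_integral_le_of_norm_le (((hmw _).sub hw).norm.const_mul _)
        (Eventually.of_forall fun z ↦ ?_)
      rw [norm_mul, norm_mul]
      calc _ ≤ L * ‖moll μ (k (ns n)) w z - w z‖ * B :=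
            mul_le_mul (mul_le_mul_of_nonneg_right (hL _) (norm_nonneg _)) (hB z)
              (norm_nonneg _) (by positivity)
        _ = _ := by ring
    have := hA.add hB'
    rw [add_zero] at this
    refine this.congr fun n ↦ ?_
    refine (integral_add (hint2 (hcm _).aestronglyMeasurable hw)
      (hint2 (hcm _).aestronglyMeasurable ((hmw _).sub hw))).symm.trans ?_
    refine integral_congr_ae (Eventually.of_forall fun z ↦ ?_)
    simp only [Pi.sub_apply]
    ring
  refine tendsto_nhds_unique hlim1 (hlim2.neg.congr fun n ↦ (hid (ns n)).symm)

theorem HasWeakLineDeriv.comp {u w : E → ℝ} {e : E}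
    (h : HasWeakLineDeriv μ u w e) (hu : Integrable u μ) (hw : Integrable w μ)
    {H H' : ℝ → ℝ} (hH : ∀ s, HasDerivAt H (H' s) s) (hH' : Continuous H') {L : ℝ}
    (hL : ∀ s, |H' s| ≤ L) :
    HasWeakLineDeriv μ (fun z ↦ H (u z)) (fun z ↦ H' (u z) * w z) e := by
  intro η hη hηc
  have hη1 : ContDiff ℝ 1 η := hη.of_le (by exact_mod_cast le_top)
  obtain ⟨C, hC⟩ := ContDiff.lipschitzWith_of_hasCompactSupport hηc hη1 one_ne_zero
  refine Eq.trans ?_ (h.integral_comp_mul_lineDeriv hu hw hH hH' hL hC hηc)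
  refine integral_congr_ae (Eventually.of_forall fun z ↦ ?_)
  simp only
  rw [((hη1.differentiable one_ne_zero) z).lineDeriv_eq_fderiv]

/-- The `Lᵖ` modulus of continuity is controlled by the weak derivative. -/
theorem HasWeakLineDeriv.translationModulus_le {u w : E → ℝ} {e : E}
    (h : HasWeakLineDeriv μ u w e) (hu : Integrable u μ) (hw : LocallyIntegrable w μ)
    {p : ℝ} (hp : 1 ≤ p) :
    translationModulus μ p u e ≤ ∫⁻ z, ‖w z‖ₑ ^ p ∂μ := by
  have hp0 : 0 < p := by linarith
  choose k hk hkr using fun n : ℕ ↦ exists_isMollifier μ (Nat.one_div_pos_of_nat (n := n) (α := ℝ))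
  have hr : Tendsto (fun n : ℕ ↦ 1 / ((n : ℝ) + 1)) atTop (𝓝 0) :=
    tendsto_one_div_add_atTop_nhds_zero_nat
  obtain ⟨ns, hns, hae⟩ := exists_subseq_tendsto_moll hk hr hkr hu
  have hcm : ∀ n, Continuous (moll μ (k n) u) := fun n ↦
    continuous_moll (hk n).contDiff_one (hk n).compact hu.locallyIntegrable
  have hcw : ∀ n, Continuous (moll μ (k n) w) := fun n ↦
    continuous_moll (hk n).contDiff_one (hk n).compact hw
  have hae2 : ∀ᵐ z ∂μ, Tendsto (fun i ↦ moll μ (k (ns i)) u (z - e)) atTop (𝓝 (u (z - e))) :=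
    (measurePreserving_sub_const (μ := μ) e).quasiMeasurePreserving.ae hae
  have hbound : ∀ n, translationModulus μ p (moll μ (k n) u) e ≤ ∫⁻ z, ‖w z‖ₑ ^ p ∂μ := by
    intro n
    -- For the smooth mollification, the increment is the integral of its derivative along the
    -- segment; Jensen's inequality and translation invariance give the bound, with no loss from
    -- mollifying `w`.
    have h1 : ∀ z, ‖moll μ (k n) u (z - e) - moll μ (k n) u z‖ₑ ≤
        ∫⁻ s in Icc (0 : ℝ) 1, 1 * ‖moll μ (k n) w (z - s • e)‖ₑ := by
      intro z
      have h2 : ∀ s ∈ uIcc (0 : ℝ) 1, HasDerivAt (fun s : ℝ ↦ moll μ (k n) u (z - s • e))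
          (-moll μ (k n) w (z - s • e)) s := by
        intro s _
        have h3 := (hasFDerivAt_moll (hk n).contDiff_one (hk n).compact hu.locallyIntegrable
          (z - s • e)).comp_hasDerivAt s (((hasDerivAt_id s).smul_const e).const_sub z)
        refine h3.congr_deriv ?_
        simp [h.fderiv_moll hu.locallyIntegrable (hk n)]
      have hc : Continuous fun s : ℝ ↦ -moll μ (k n) w (z - s • e) :=
        ((hcw n).comp (by fun_prop)).neg
      have h4 := intervalIntegral.integral_eq_sub_of_hasDerivAt h2 (hc.intervalIntegrable _ _)
      simp only [one_smul, zero_smul, sub_zero] at h4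
      rw [← h4, intervalIntegral.integral_of_le zero_le_one]
      refine (enorm_integral_le_lintegral_enorm _).trans ?_
      simp only [enorm_neg, one_mul]
      exact lintegral_mono_set Ioc_subset_Icc_self
    have hm : Measurable fun x : E × ℝ ↦ ‖moll μ (k n) w (x.1 - x.2 • e)‖ₑ :=
      ((hcw n).comp (by fun_prop)).enorm.measurable
    calc _ ≤ ∫⁻ z, (∫⁻ s in Icc (0 : ℝ) 1, 1 * ‖moll μ (k n) w (z - s • e)‖ₑ) ^ p ∂μ :=
          lintegral_mono fun z ↦ ENNReal.rpow_le_rpow (h1 z) hp0.le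
      _ ≤ (∫⁻ s in Icc (0 : ℝ) 1, 1) ^ (p - 1) *
          ∫⁻ s in Icc (0 : ℝ) 1, 1 * ∫⁻ z, ‖moll μ (k n) w (z - s • e)‖ₑ ^ p ∂μ :=
          lintegral_rpow_lintegral_mul_le hp aemeasurable_const hm.aemeasurable
      _ = ∫⁻ z, ‖moll μ (k n) w z‖ₑ ^ p ∂μ := by
          have : ∀ s : ℝ, ∫⁻ z, ‖moll μ (k n) w (z - s • e)‖ₑ ^ p ∂μ =
              ∫⁻ z, ‖moll μ (k n) w z‖ₑ ^ p ∂μ := fun s ↦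
            lintegral_sub_right_eq_self (fun z ↦ ‖moll μ (k n) w z‖ₑ ^ p) (s • e)
          simp [this]
      _ ≤ _ := lintegral_moll_le hp (hk n) hw.aestronglyMeasurable
  -- Fatou's lemma transfers the uniform bound to `u` itself.
  have hlim : ∀ᵐ z ∂μ, ‖u (z - e) - u z‖ₑ ^ p = liminf (fun i ↦
      ‖moll μ (k (ns i)) u (z - e) - moll μ (k (ns i)) u z‖ₑ ^ p) atTop := by
    filter_upwards [hae, hae2] with z h1 h2
    exact ((((continuous_enorm.tendsto _).comp (h2.sub h1)).ennrpow_const p).liminf_eq).symm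
  rw [translationModulus, lintegral_congr_ae hlim]
  refine (lintegral_liminf_le fun i ↦ ?_).trans ?_
  · exact (((hcm _).comp (continuous_id.sub continuous_const)).sub (hcm _)).enorm.measurable.pow_const p
  · refine (liminf_le_liminf (Eventually.of_forall fun i ↦ hbound (ns i))).trans_eq ?_
    exact liminf_const _

end WeakDeriv

/-! ### Lipschitz approximation with weighted gradient bounds -/

section Approx
open Filter Topology

instance isAddHaarMeasure_volume_prod {N : ℕ} :
    (volume : Measure (EuclideanSpace ℝ (Fin N) × ℝ)).IsAddHaarMeasure := by
  rw [Measure.volume_eq_prod]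
  infer_instance

section General

variable {E : Type*} [NormedAddCommGroup E] [NormedSpace ℝ E] [FiniteDimensional ℝ E]
  [MeasurableSpace E] [BorelSpace E] {μ : Measure E} [μ.IsAddHaarMeasure]

theorem exists_subseq_tendsto_moll_family {ι : Type*} [Fintype ι] {k : ℕ → E → ℝ}
    (hk : ∀ n, IsMollifier μ (k n)) {r : ℕ → ℝ} (hr : Tendsto r atTop (𝓝 0))
    (hkr : ∀ n, Function.support (k n) ⊆ Metric.closedBall 0 (r n)) {u : ι → E → ℝ}
    (hu : ∀ i, Integrable (u i) μ) :
    ∃ ns : ℕ → ℕ, StrictMono ns ∧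
      ∀ i, ∀ᵐ z ∂μ, Tendsto (fun j ↦ moll μ (k (ns j)) (u i) z) atTop (𝓝 (u i z)) := by
  classical
  suffices ∀ s : Finset ι, ∃ ns : ℕ → ℕ, StrictMono ns ∧
      ∀ i ∈ s, ∀ᵐ z ∂μ, Tendsto (fun j ↦ moll μ (k (ns j)) (u i) z) atTop (𝓝 (u i z)) by
    simpa using this Finset.univ
  intro s
  induction s using Finset.induction_on with
  | empty => exact ⟨id, strictMono_id, by simp⟩
  | insert a s _ ih =>
    obtain ⟨ns, hns, h⟩ := ih
    obtain ⟨ms, hms, h'⟩ := exists_subseq_tendsto_moll (fun n ↦ hk (ns n))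
      (hr.comp hns.tendsto_atTop) (fun n ↦ hkr (ns n)) (hu a)
    refine ⟨ns ∘ ms, hns.comp hms, fun i hi ↦ ?_⟩
    rcases Finset.mem_insert.1 hi with rfl | hi
    · exact h'
    · filter_upwards [h i hi] with z hz
      exact hz.comp hms.tendsto_atTop

/-- The convolution of `k` with the constant `1` is constant. It makes the mass term in
`lintegral_moll_sub_le` vanish for derivative kernels, so that only oscillations remain. -/
theorem integral_fderiv_eq_zero {k : E → ℝ} (hk : ContDiff ℝ 1 k) (hkc : HasCompactSupport k)
    (e : E) : ∫ z, fderiv ℝ k z e ∂μ = 0 := by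
  have h1 := fderiv_moll (μ := μ) hk hkc (u := fun _ ↦ 1) (locallyIntegrable_const 1) 0 e
  have h2 : moll μ k (fun _ ↦ 1) = fun _ ↦ ∫ z, k z ∂μ := by
    ext z; simp [moll]
  rw [h2] at h1
  simpa [moll] using h1.symm

/-- The kernel `r⁻ᵈ b(y/r)`. -/
def rescale (b : E → ℝ) (r : ℝ) (y : E) : ℝ :=
  (r ^ Module.finrank ℝ E)⁻¹ * b (r⁻¹ • y)

theorem isMollifier_rescale {b : E → ℝ} (hb : IsMollifier μ b) {r : ℝ} (hr : 0 < r) :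
    IsMollifier μ (rescale b r) where
  smooth := contDiff_const.mul (hb.smooth.comp (contDiff_const_smul _))
  compact := (hb.compact.comp_homeomorph
    (Homeomorph.smulOfNeZero r⁻¹ (inv_ne_zero hr.ne'))).mul_left
  nonneg z := mul_nonneg (by positivity) (hb.nonneg _)
  integral := by
    unfold rescale
    rw [integral_const_mul, Measure.integral_comp_smul μ b r⁻¹, hb.integral,
      abs_of_nonneg (by positivity)]
    have : r ^ Module.finrank ℝ E ≠ 0 := by positivity
    simp [inv_pow, this]

theorem support_rescale {b : E → ℝ} (hb : Function.support b ⊆ Metric.closedBall 0 1) {r : ℝ}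
    (hr : 0 < r) : Function.support (rescale b r) ⊆ Metric.closedBall 0 r := by
  intro y hy
  have h1 : r⁻¹ • y ∈ Metric.closedBall (0 : E) 1 := hb fun h ↦ hy (by simp [rescale, h])
  rw [mem_closedBall_zero_iff, norm_smul, norm_inv, Real.norm_of_nonneg hr.le,
    inv_mul_le_iff₀ hr, mul_one] at h1
  simpa using h1

theorem integral_norm_fderiv_rescale {b : E → ℝ} (hb : IsMollifier μ b) {r : ℝ} (hr : 0 < r)
    (e : E) : ∫ y, ‖fderiv ℝ (rescale b r) y e‖ ∂μ = r⁻¹ * ∫ y, ‖fderiv ℝ b y e‖ ∂μ := by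
  have h1 : ∀ y, ‖fderiv ℝ (rescale b r) y e‖ =
      (r ^ Module.finrank ℝ E)⁻¹ * r⁻¹ * ‖fderiv ℝ b (r⁻¹ • y) e‖ := by
    intro y
    have h2 : HasFDerivAt (fun y ↦ b (r⁻¹ • y)) _ y :=
      ((hb.contDiff_one.differentiable one_ne_zero) (r⁻¹ • y)).hasFDerivAt.comp y
        ((hasFDerivAt_id y).const_smul r⁻¹)
    have h3 := h2.const_mul ((r ^ Module.finrank ℝ E)⁻¹)
    have h4 : fderiv ℝ (rescale b r) y = _ := h3.fderiv
    rw [h4]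
    simp only [_root_.smul_apply, ContinuousLinearMap.comp_apply,
      ContinuousLinearMap.id_apply, map_smul, smul_eq_mul, norm_mul, norm_inv, norm_pow,
      Real.norm_of_nonneg hr.le]
    ring
  simp_rw [h1]
  rw [integral_const_mul, Measure.integral_comp_smul μ (fun y ↦ ‖fderiv ℝ b y e‖) r⁻¹,
    abs_of_nonneg (by positivity), smul_eq_mul]
  have : r ^ Module.finrank ℝ E ≠ 0 := by positivity
  rw [inv_pow, inv_inv]
  field_simp

end General

variable {N : ℕ}

local notation "𝕏" => EuclideanSpace ℝ (Fin N)

theorem IsMollifier.prod {b : 𝕏 → ℝ} {c : ℝ → ℝ} (hb : IsMollifier volume b)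
    (hc : IsMollifier volume c) :
    IsMollifier (volume : Measure (𝕏 × ℝ)) fun z ↦ b z.1 * c z.2 where
  smooth := (hb.smooth.comp contDiff_fst).mul (hc.smooth.comp contDiff_snd)
  compact := by
    refine HasCompactSupport.of_support_subset_isCompact
      (hb.compact.isCompact.prod hc.compact.isCompact) fun z hz ↦ ?_
    have hz' := mul_ne_zero_iff.1 hz
    exact ⟨subset_tsupport _ hz'.1, subset_tsupport _ hz'.2⟩
  nonneg z := mul_nonneg (hb.nonneg _) (hc.nonneg _)
  integral := by
    rw [Measure.volume_eq_prod, integral_prod_mul, hb.integral, hc.integral, one_mul]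

theorem fderiv_prod_mul {b : 𝕏 → ℝ} {c : ℝ → ℝ} (hb : ContDiff ℝ 1 b) (hc : ContDiff ℝ 1 c)
    (z : 𝕏 × ℝ) (e : 𝕏) :
    fderiv ℝ (fun z : 𝕏 × ℝ ↦ b z.1 * c z.2) z (e, 0) = fderiv ℝ b z.1 e * c z.2 := by
  have h1 : HasFDerivAt (fun z : 𝕏 × ℝ ↦ b z.1) _ z :=
    ((hb.differentiable one_ne_zero) z.1).hasFDerivAt.comp z hasFDerivAt_fst
  have h2 : HasFDerivAt (fun z : 𝕏 × ℝ ↦ c z.2) _ z :=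
    ((hc.differentiable one_ne_zero) z.2).hasFDerivAt.comp z hasFDerivAt_snd
  have h3 : fderiv ℝ (fun z : 𝕏 × ℝ ↦ b z.1 * c z.2) z = _ := (h1.mul h2).fderiv
  rw [h3]
  simp [mul_comm]

theorem HasWeakLineDeriv.sum_space {v : 𝕏 × ℝ → ℝ} {w : Fin N → 𝕏 × ℝ → ℝ}
    (hw : ∀ i, LocallyIntegrable (w i) (volume : Measure (𝕏 × ℝ)))
    (hv : LocallyIntegrable v (volume : Measure (𝕏 × ℝ)))
    (h : ∀ i, HasWeakLineDeriv volume v (w i) (EuclideanSpace.single i 1, 0)) (y : 𝕏) :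
    HasWeakLineDeriv volume v (fun z ↦ ∑ i, y i * w i z) (y, 0) := by
  intro η hη hηc
  have hy : ((y, 0) : 𝕏 × ℝ) = ∑ i, y i • (EuclideanSpace.single i (1 : ℝ), (0 : ℝ)) := by
    refine Prod.ext ?_ ?_
    · rw [Prod.fst_sum]
      ext j
      simp [Pi.single_apply]
    · rw [Prod.snd_sum]
      simp
  have hc1 : Continuous η := hη.continuous
  have hc2 : ∀ e, Continuous fun z ↦ fderiv ℝ η z e := fun e ↦
    ((hη.of_le (by exact_mod_cast le_top) : ContDiff ℝ 1 η).continuous_fderiv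
      one_ne_zero).clm_apply continuous_const
  have hI1 : ∀ i, Integrable (fun z ↦ w i z * η z) (volume : Measure (𝕏 × ℝ)) := fun i ↦ by
    have := (hw i).integrable_smul_right_of_hasCompactSupport hc1 hηc
    simpa [smul_eq_mul] using this
  have hI2 : ∀ e, Integrable (fun z ↦ v z * fderiv ℝ η z e) (volume : Measure (𝕏 × ℝ)) :=
    fun e ↦ by
      have := hv.integrable_smul_right_of_hasCompactSupport (hc2 e) (hηc.fderiv_apply ℝ e)
      simpa [smul_eq_mul] using this
  rw [hy]
  simp_rw [map_sum, map_smul, smul_eq_mul, Finset.mul_sum, Finset.sum_mul]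
  rw [integral_finsetSum, integral_finsetSum, ← Finset.sum_neg_distrib]
  · refine Finset.sum_congr rfl fun i _ ↦ ?_
    have := h i η hη hηc
    simp_rw [mul_left_comm (v _), mul_assoc]
    rw [integral_const_mul, integral_const_mul, this, mul_neg]
  · intro i _
    simp_rw [mul_assoc]
    exact (hI1 i).const_mul _
  · intro i _
    simp_rw [mul_left_comm (v _)]
    exact (hI2 _).const_mul _

theorem translationModulus_add_le {p : ℝ} (hp : 1 ≤ p) {v : 𝕏 × ℝ → ℝ}
    (hv : AEStronglyMeasurable v (volume : Measure (𝕏 × ℝ))) (x y : 𝕏 × ℝ) :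
    translationModulus volume p v (x + y) ≤ 2 ^ (p - 1) *
      (translationModulus volume p v x + translationModulus volume p v y) := by
  unfold translationModulus
  have hm : ∀ x : 𝕏 × ℝ, AEMeasurable (fun z ↦ ‖v (z - x) - v z‖ₑ) volume := fun x ↦
    ((hv.comp_quasiMeasurePreserving
      (measurePreserving_sub_const (μ := volume) x).quasiMeasurePreserving).sub hv).enorm
  have h1 : ∫⁻ z, ‖v (z - x) - v z‖ₑ ^ p = ∫⁻ z, ‖v (z - y - x) - v (z - y)‖ₑ ^ p :=
    (lintegral_sub_right_eq_self (fun z ↦ ‖v (z - x) - v z‖ₑ ^ p) y).symm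
  have hm2 : AEMeasurable (fun z ↦ ‖v (z - y - x) - v (z - y)‖ₑ ^ p) volume :=
    ((hm x).comp_quasiMeasurePreserving
      (measurePreserving_sub_const (μ := volume) y).quasiMeasurePreserving).pow_const p
  rw [h1, ← lintegral_add_left' hm2, ← lintegral_const_mul' _ _
    (ENNReal.rpow_ne_top_of_nonneg (by linarith) (by simp))]
  refine lintegral_mono fun z ↦ ?_
  refine le_trans ?_ (ENNReal.rpow_add_le_mul_rpow_add_rpow _ _ hp)
  refine ENNReal.rpow_le_rpow ?_ (by linarith)
  have : v (z - (x + y)) - v z = (v (z - y - x) - v (z - y)) + (v (z - y) - v z) := by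
    rw [show z - (x + y) = z - y - x by abel]
    ring
  rw [this]
  exact enorm_add_le _ _

/-- Only spatial weak derivatives of `v` are available in `Lᵖ`, so a linear rate holds for
translations in space alone. -/
theorem translationModulus_space_le {p : ℝ} (hp : 1 ≤ p) {v : 𝕏 × ℝ → ℝ}
    {w : Fin N → 𝕏 × ℝ → ℝ} (hv : Integrable v volume) (hw : ∀ i, Integrable (w i) volume)
    (h : ∀ i, HasWeakLineDeriv volume v (w i) (EuclideanSpace.single i 1, 0)) (y : 𝕏) :
    translationModulus volume p v (y, 0) ≤
      ‖y‖ₑ ^ p * ∫⁻ z, ‖∑ i, |w i z|‖ₑ ^ p := by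
  have hp0 : 0 ≤ p := by linarith
  refine ((HasWeakLineDeriv.sum_space (fun i ↦ (hw i).locallyIntegrable) hv.locallyIntegrable h
    y).translationModulus_le hv (integrable_finsetSum _ fun i _ ↦
      (hw i).const_mul _).locallyIntegrable hp).trans ?_
  rw [← lintegral_const_mul' _ _ (ENNReal.rpow_ne_top_of_nonneg hp0 enorm_ne_top)]
  refine lintegral_mono fun z ↦ ?_
  rw [← ENNReal.mul_rpow_of_nonneg _ _ hp0, ← enorm_norm y, ← enorm_mul]
  refine ENNReal.rpow_le_rpow ?_ hp0
  rw [← ofReal_norm, ← ofReal_norm]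
  refine ENNReal.ofReal_le_ofReal ?_
  rw [norm_mul, norm_norm, Real.norm_of_nonneg (Finset.sum_nonneg fun i _ ↦ abs_nonneg (w i z)),
    Finset.mul_sum]
  refine (norm_sum_le _ _).trans (Finset.sum_le_sum fun i _ ↦ ?_)
  rw [norm_mul, Real.norm_eq_abs (w i z)]
  gcongr
  exact PiLp.norm_apply_le y i

/-- Mollified approximations of `G(u)` whose spatial derivatives, weighted by `c`, stay bounded
in `Lᵖ`; here `c` is a weight for which the oscillation of `G(u)` is controlled by that of the
Sobolev function `v`. -/
theorem exists_lipschitz_approx {p : ℝ} (hp : 1 ≤ p) {u v c : 𝕏 × ℝ → ℝ}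
    {b w : Fin N → 𝕏 × ℝ → ℝ} (hu : Integrable u volume) (hb : ∀ i, Integrable (b i) volume)
    (hub : ∀ i, HasWeakLineDeriv volume u (b i) (EuclideanSpace.single i 1, 0))
    (hv : Integrable v volume) (hvp : MemLp v (ENNReal.ofReal p) volume)
    (hw : ∀ i, Integrable (w i) volume) (hwp : ∀ i, MemLp (w i) (ENNReal.ofReal p) volume)
    (hvw : ∀ i, HasWeakLineDeriv volume v (w i) (EuclideanSpace.single i 1, 0))
    {G G' : ℝ → ℝ} (hG : ∀ s, HasDerivAt G (G' s) s) (hG' : Continuous G') {L : ℝ}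
    (hL : ∀ s, |G' s| ≤ L) {B : ℝ} (hG0 : ∀ s, 0 ≤ G s) (hGB : ∀ s, G s ≤ B)
    (hc : ∀ z z', |c z| * |G (u z') - G (u z)| ≤ |v z' - v z|) :
    ∃ g : ℕ → 𝕏 × ℝ → ℝ, (∀ n, ∃ C, LipschitzWith C (g n)) ∧ (∀ n, Differentiable ℝ (g n)) ∧
      (∀ n z, 0 ≤ g n z) ∧ (∀ n z, g n z ≤ B) ∧
      (∀ᵐ z, Tendsto (fun n ↦ g n z) atTop (𝓝 (G (u z)))) ∧
      (∀ i, ∀ᵐ z, Tendsto (fun n ↦ fderiv ℝ (g n) z (EuclideanSpace.single i 1, 0)) atTop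
        (𝓝 (G' (u z) * b i z))) ∧
      ∃ A : ℝ≥0∞, A ≠ ⊤ ∧ ∀ n i,
        ∫⁻ z, ‖c z * fderiv ℝ (g n) z (EuclideanSpace.single i 1, 0)‖ₑ ^ p ≤ A := by
  have hp0 : 0 < p := by linarith
  have hL0 : 0 ≤ L := (abs_nonneg _).trans (hL 0)
  have hGc : Continuous G := continuous_iff_continuousAt.2 fun s ↦ (hG s).continuousAt
  obtain ⟨b₀, hb₀, hb₀s⟩ := exists_isMollifier (volume : Measure 𝕏) one_pos
  set W : ℝ≥0∞ := ∫⁻ z, ‖∑ i, |w i z|‖ₑ ^ p with hW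
  have hWtop : W ≠ ⊤ := by
    have h1 : MemLp (fun z ↦ ∑ i, |w i z|) (ENNReal.ofReal p) volume :=
      memLp_finsetSum _ fun i _ ↦ (hwp i).abs
    have h2 := h1.2
    rw [eLpNorm_sub_rpow hp0] at h2
    have := (ENNReal.rpow_lt_top_iff_of_pos (by positivity : 0 < 1 / p)).1 h2
    exact this.ne
  set r : ℕ → ℝ := fun n ↦ 1 / ((n : ℝ) + 1) with hr
  have hr0 : ∀ n, 0 < r n := fun n ↦ Nat.one_div_pos_of_nat
  have hrt : Tendsto r atTop (𝓝 0) := tendsto_one_div_add_atTop_nhds_zero_nat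
  -- time scales
  have hτ : ∀ n, ∃ τ, 0 < τ ∧ τ ≤ r n ∧ ∀ t : ℝ, |t| ≤ τ →
      translationModulus volume p v ((0 : 𝕏), t) ≤ ENNReal.ofReal (r n) ^ p := by
    intro n
    have h1 : Tendsto (fun t : ℝ ↦ translationModulus volume p v ((0 : 𝕏), t)) (𝓝 0) (𝓝 0) :=
      (tendsto_translationModulus hp hvp).comp
        ((Continuous.prodMk_right (0 : 𝕏)).tendsto' 0 0 rfl)
    obtain ⟨ρ, hρ, hρs⟩ := Metric.nhds_basis_closedBall.mem_iff.1
      (ENNReal.tendsto_nhds_zero.1 h1 (ENNReal.ofReal (r n) ^ p)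
        (ENNReal.rpow_pos (by simpa using hr0 n) ENNReal.ofReal_ne_top))
    refine ⟨min ρ (r n), lt_min hρ (hr0 n), min_le_right _ _, fun t ht ↦ hρs ?_⟩
    simpa using ht.trans (min_le_left _ _)
  choose τ hτ0 hτr hτm using hτ
  choose b₁ hb₁ hb₁s using fun n ↦ exists_isMollifier (volume : Measure ℝ) (hτ0 n)
  -- An anisotropic kernel: width `r n` in space and `τ n` in time, where `τ n` is so small that
  -- time translations of `v` cost no more than a spatial shift of size `r n` may cost.
  set k : ℕ → 𝕏 × ℝ → ℝ := fun n z ↦ rescale b₀ (r n) z.1 * b₁ n z.2 with hkdef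
  have hbr : ∀ n, IsMollifier volume (rescale b₀ (r n)) := fun n ↦ isMollifier_rescale hb₀ (hr0 n)
  have hk : ∀ n, IsMollifier volume (k n) := fun n ↦ (hbr n).prod (hb₁ n)
  have hkS : ∀ n, tsupport (k n) ⊆ Metric.closedBall 0 (r n) ×ˢ Metric.closedBall 0 (τ n) := by
    intro n
    refine closure_minimal (fun z hz ↦ ?_) (Metric.isClosed_closedBall.prod
      Metric.isClosed_closedBall)
    have hz' := mul_ne_zero_iff.1 hz
    exact ⟨support_rescale hb₀s (hr0 n) hz'.1, hb₁s n hz'.2⟩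
  have hkr : ∀ n, Function.support (k n) ⊆ Metric.closedBall 0 (r n) := by
    intro n z hz
    have := hkS n (subset_tsupport _ hz)
    rw [← Prod.mk_zero_zero, ← closedBall_prod_same]
    exact ⟨this.1, Metric.closedBall_subset_closedBall (hτr n) this.2⟩
  -- the functions to be mollified
  have hGu : Integrable (fun z ↦ G (u z) - G 0) volume := by
    refine (hu.norm.const_mul L).mono'
      ((hGc.comp_aestronglyMeasurable hu.1).sub aestronglyMeasurable_const)
      (Eventually.of_forall fun z ↦ ?_)
    have hlip : LipschitzWith L.toNNReal G := lipschitzWith_of_nnnorm_deriv_le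
      (fun s ↦ (hG s).differentiableAt) fun s ↦ by
        rw [(hG s).deriv, ← NNReal.coe_le_coe, Real.coe_toNNReal _ hL0]
        exact hL s
    have := hlip.dist_le_mul (u z) 0
    rwa [Real.dist_eq, dist_zero_right, Real.coe_toNNReal _ hL0] at this
  have hGb : ∀ i, Integrable (fun z ↦ G' (u z) * b i z) volume := fun i ↦
    (hb i).bdd_mul (hG'.comp_aestronglyMeasurable hu.1) (Eventually.of_forall fun z ↦ hL _)
  have hGl : LocallyIntegrable (fun z ↦ G (u z)) (volume : Measure (𝕏 × ℝ)) := by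
    refine (hGu.locallyIntegrable.add (locallyIntegrable_const (G 0))).congr ?_
    exact Eventually.of_forall fun z ↦ by simp
  have hGw : ∀ i, HasWeakLineDeriv volume (fun z ↦ G (u z) - G 0) (fun z ↦ G' (u z) * b i z)
      (EuclideanSpace.single i 1, 0) := fun i ↦
    (hub i).comp (H := fun s ↦ G s - G 0) hu (hb i) (fun s ↦ (hG s).sub_const _) hG' hL
  have hmoll : ∀ n z, moll volume (k n) (fun z ↦ G (u z)) z =
      moll volume (k n) (fun z ↦ G (u z) - G 0) z + G 0 := by
    intro n z
    have h1 := moll_sub (hk n).smooth.continuous (hk n).compact hGl z (G 0)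
    rw [(hk n).integral, one_mul] at h1
    rw [← sub_eq_iff_eq_add, h1]
    rfl
  have hfd : ∀ n i z, fderiv ℝ (moll volume (k n) (fun z ↦ G (u z))) z
      (EuclideanSpace.single i 1, 0) = moll volume (k n) (fun z ↦ G' (u z) * b i z) z := by
    intro n i z
    rw [← (hGw i).fderiv_moll hGu.locallyIntegrable (hk n)]
    have : moll volume (k n) (fun z ↦ G (u z)) =
      fun z ↦ moll volume (k n) (fun z ↦ G (u z) - G 0) z + G 0 := funext (hmoll n)
    rw [this, fderiv_add_const]
  obtain ⟨ns, hns, hae⟩ := exists_subseq_tendsto_moll_family hk hrt hkr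
    (u := fun o : Option (Fin N) ↦ o.elim (fun z ↦ G (u z) - G 0) fun i z ↦ G' (u z) * b i z)
    (by rintro (_ | i); exacts [hGu, hGb i])
  refine ⟨fun n ↦ moll volume (k (ns n)) fun z ↦ G (u z), fun n ↦ ?_, fun n z ↦ ?_, fun n z ↦ ?_,
    fun n z ↦ ?_, ?_, fun i ↦ ?_, ?_⟩
  · exact exists_lipschitzWith_moll_of_bounded (hk _).contDiff_one (hk _).compact hGl (B := B)
      fun z ↦ abs_le.2 ⟨by linarith [hG0 (u z), hGB (u z)], hGB _⟩
  · exact (hasFDerivAt_moll (hk _).contDiff_one (hk _).compact hGl z).differentiableAt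
  · exact (hk _).moll_nonneg (fun z ↦ hG0 _) z
  · exact (le_abs_self _).trans ((hk _).abs_moll_le
      (fun z ↦ abs_le.2 ⟨by linarith [hG0 (u z), hGB (u z)], hGB _⟩) z)
  · filter_upwards [hae none] with z hz
    simp_rw [hmoll]
    simpa using hz.add_const (G 0)
  · filter_upwards [hae (some i)] with z hz
    simp_rw [hfd]
    exact hz
  -- A spatial derivative of the kernel has `L¹` norm at most `D / r`, while `v` oscillates by
  -- `O(r)` in `Lᵖ` over the support of the kernel. The powers of `r` cancel, leaving a bound
  -- independent of `n`.
  · set D : ℝ := ∑ i, ∫ y, ‖fderiv ℝ b₀ y (EuclideanSpace.single i (1 : ℝ))‖ with hD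
    refine ⟨ENNReal.ofReal D ^ p * (2 ^ (p - 1) * (W + 1)), ?_, fun n i ↦ ?_⟩
    · refine ENNReal.mul_ne_top (ENNReal.rpow_ne_top_of_nonneg hp0.le ENNReal.ofReal_ne_top)
        (ENNReal.mul_ne_top (ENNReal.rpow_ne_top_of_nonneg (by linarith) (by simp)) ?_)
      exact ENNReal.add_ne_top.2 ⟨hWtop, by simp⟩
    set j := ns n
    set l : 𝕏 × ℝ → ℝ := fun ζ ↦ fderiv ℝ (k j) ζ (EuclideanSpace.single i 1, 0) with hl
    have hlc : Continuous l :=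
      ((hk j).contDiff_one.continuous_fderiv one_ne_zero).clm_apply continuous_const
    have hlS : Function.support l ⊆
        Metric.closedBall 0 (r j) ×ˢ Metric.closedBall 0 (τ j) := fun ζ hζ ↦
      hkS j (support_fderiv_subset ℝ fun h ↦ hζ (by simp [hl, h]))
    have hmod : ∀ ζ ∈ Metric.closedBall (0 : 𝕏) (r j) ×ˢ Metric.closedBall (0 : ℝ) (τ j),
        translationModulus volume p v ζ ≤
          2 ^ (p - 1) * (W + 1) * ENNReal.ofReal (r j) ^ p := by
      rintro ⟨y, t⟩ ⟨hy, ht⟩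
      have h1 := translationModulus_add_le hp hv.1 (y, 0) (0, t)
      simp only [Prod.mk_add_mk, add_zero, zero_add] at h1
      refine h1.trans ?_
      rw [mul_assoc]
      refine mul_le_mul_right ?_ _
      rw [add_mul, one_mul]
      refine add_le_add ((translationModulus_space_le hp hv hw hvw y).trans ?_)
        (hτm j t (by simpa using ht))
      rw [mul_comm]
      refine mul_le_mul_right (ENNReal.rpow_le_rpow ?_ hp0.le) _
      rw [← ofReal_norm]
      exact ENNReal.ofReal_le_ofReal (by simpa using hy)
    have h1 := lintegral_moll_sub_le (μ := volume) (c := c) (u := fun z ↦ G (u z)) hp hlc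
      ((hk j).compact.fderiv_apply ℝ _) hGl hv.1 hlS hmod
      (Eventually.of_forall fun z ↦ Eventually.of_forall fun ζ ↦ by
        rw [← enorm_mul, ← ofReal_norm, ← ofReal_norm, norm_mul]
        exact ENNReal.ofReal_le_ofReal (hc z _))
    have h0 : ∫ ζ, l ζ = 0 := integral_fderiv_eq_zero (hk j).contDiff_one (hk j).compact _
    rw [h0] at h1
    simp only [zero_mul, sub_zero] at h1
    have h2 : ∀ z, moll volume l (fun z ↦ G (u z)) z =
        fderiv ℝ (moll volume (k j) fun z ↦ G (u z)) z (EuclideanSpace.single i 1, 0) := fun z ↦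
      (fderiv_moll (hk j).contDiff_one (hk j).compact hGl z _).symm
    simp_rw [h2] at h1
    refine h1.trans ?_
    have h3 : ∫⁻ ζ, ‖l ζ‖ₑ ≤ ENNReal.ofReal (D / r j) := by
      have hlI : Integrable l volume := hlc.integrable_of_hasCompactSupport
        ((hk j).compact.fderiv_apply ℝ _)
      rw [← ofReal_integral_norm_eq_lintegral_enorm hlI]
      refine ENNReal.ofReal_le_ofReal ?_
      have h4 : ∀ ζ : 𝕏 × ℝ, ‖l ζ‖ =
          ‖fderiv ℝ (rescale b₀ (r j)) ζ.1 (EuclideanSpace.single i 1)‖ * b₁ j ζ.2 := by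
        intro ζ
        simp only [hl, hkdef]
        rw [fderiv_prod_mul (hbr j).contDiff_one (hb₁ j).contDiff_one, norm_mul,
          Real.norm_of_nonneg ((hb₁ j).nonneg _)]
      simp_rw [h4]
      rw [Measure.volume_eq_prod, integral_prod_mul
        (fun y ↦ ‖fderiv ℝ (rescale b₀ (r j)) y (EuclideanSpace.single i 1)‖) (b₁ j),
        (hb₁ j).integral, mul_one, integral_norm_fderiv_rescale hb₀ (hr0 j), mul_comm,
        ← div_eq_mul_inv]
      have : 0 ≤ r j := (hr0 j).le
      gcongr
      exact Finset.single_le_sum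
        (f := fun i ↦ ∫ y, ‖fderiv ℝ b₀ y (EuclideanSpace.single i (1 : ℝ))‖)
        (fun i _ ↦ integral_nonneg fun y ↦ norm_nonneg _) (Finset.mem_univ i)
    have hD0 : 0 ≤ D := Finset.sum_nonneg fun i _ ↦ integral_nonneg fun y ↦ norm_nonneg _
    calc _ ≤ ENNReal.ofReal (D / r j) ^ p *
          (2 ^ (p - 1) * (W + 1) * ENNReal.ofReal (r j) ^ p) := by gcongr
      _ = (ENNReal.ofReal (D / r j) * ENNReal.ofReal (r j)) ^ p * (2 ^ (p - 1) * (W + 1)) := by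
          rw [ENNReal.mul_rpow_of_nonneg _ _ hp0.le]
          ring
      _ = _ := by
          rw [← ENNReal.ofReal_mul (div_nonneg hD0 (hr0 j).le), div_mul_cancel₀ _ (hr0 j).ne']

end Approx

/-! ### Weak convergence from a.e. convergence and `Lᵖ` bounds -/

section WeakConv
open Filter Topology

/-- If `x y > l x^p'` then `x < (y / l)^(p-1)`, which gives the last term. For fixed `l` the minimum
is dominated by a function of `x` alone, and the last term is small for large `l` because `p > 1`;
this substitutes for Egorov's theorem. -/
theorem mul_le_min_add {p p' x y l : ℝ} (hpp : p.HolderConjugate p') (hx : 0 ≤ x) (hy : 0 ≤ y)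
    (hl : 0 < l) : x * y ≤ min (x * y) (l * x ^ p') + l ^ (1 - p) * y ^ p := by
  rcases le_total (x * y) (l * x ^ p') with h | h
  · rw [min_eq_left h]
    have : 0 ≤ l ^ (1 - p) * y ^ p := by positivity
    linarith
  · rw [min_eq_right h]
    have h0 : 0 ≤ l * x ^ p' := by positivity
    suffices x * y ≤ l ^ (1 - p) * y ^ p by linarith
    rcases hx.eq_or_lt with rfl | hx
    · rw [zero_mul]; positivity
    rcases hy.eq_or_lt with rfl | hy
    · rw [mul_zero]; positivity
    have h1 : x ^ (p' - 1) ≤ y / l := by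
      rw [Real.rpow_sub_one hx.ne', le_div_iff₀ hl, div_mul_eq_mul_div, div_le_iff₀ hx]
      linarith
    have h2 : x ≤ (y / l) ^ (p - 1) := by
      have h3 := Real.rpow_le_rpow (by positivity) h1 hpp.sub_one_pos.le
      rw [← Real.rpow_mul hx.le] at h3
      have h4 : (p' - 1) * (p - 1) = 1 := by
        have := hpp.mul_eq_add
        linarith
      rwa [h4, Real.rpow_one] at h3
    calc x * y ≤ (y / l) ^ (p - 1) * y := by gcongr
      _ = l ^ (1 - p) * y ^ p := by
        rw [Real.div_rpow hy.le hl.le, show 1 - p = -(p - 1) by ring, Real.rpow_neg hl.le,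
          Real.rpow_sub_one hy.ne']
        field_simp

/-- Almost everywhere convergence with bounds in `Lᵖ`, `p > 1`, implies weak convergence. -/
theorem tendsto_integral_mul_of_bounded {α : Type*} [MeasurableSpace α] {μ : Measure α}
    {p p' : ℝ} (hpp : p.HolderConjugate p') {F : α → ℝ} (hFm : AEStronglyMeasurable F μ)
    (hF : ∫⁻ z, ‖F z‖ₑ ^ p' ∂μ ≠ ⊤) {f : ℕ → α → ℝ} {f₀ : α → ℝ}
    (hfm : ∀ n, AEStronglyMeasurable (f n) μ) {A : ℝ≥0∞} (hA : A ≠ ⊤)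
    (hf : ∀ n, ∫⁻ z, ‖f n z‖ₑ ^ p ∂μ ≤ A)
    (hlim : ∀ᵐ z ∂μ, Tendsto (fun n ↦ f n z) atTop (𝓝 (f₀ z))) :
    Integrable (fun z ↦ F z * f₀ z) μ ∧ (∀ n, Integrable (fun z ↦ F z * f n z) μ) ∧
      Tendsto (fun n ↦ ∫ z, F z * f n z ∂μ) atTop (𝓝 (∫ z, F z * f₀ z ∂μ)) := by
  have hp0 := hpp.pos
  have hp1 := hpp.lt
  have hf₀m : AEStronglyMeasurable f₀ μ := aestronglyMeasurable_of_tendsto_ae _ hfm hlim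
  have hf₀ : ∫⁻ z, ‖f₀ z‖ₑ ^ p ∂μ ≤ A := by
    have : ∀ᵐ z ∂μ, ‖f₀ z‖ₑ ^ p = liminf (fun n ↦ ‖f n z‖ₑ ^ p) atTop := by
      filter_upwards [hlim] with z hz
      exact (((continuous_enorm.tendsto _).comp hz).ennrpow_const p).liminf_eq.symm
    rw [lintegral_congr_ae this]
    refine (lintegral_liminf_le' fun n ↦ (hfm n).enorm.pow_const p).trans ?_
    exact (liminf_le_liminf (Eventually.of_forall hf)).trans_eq (liminf_const _)
  have hint : ∀ {g : α → ℝ}, AEStronglyMeasurable g μ → ∫⁻ z, ‖g z‖ₑ ^ p ∂μ ≤ A →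
      Integrable (fun z ↦ F z * g z) μ := by
    intro g hg hgA
    refine ⟨hFm.mul hg, ?_⟩
    have h1 := ENNReal.lintegral_mul_le_Lp_mul_Lq μ hpp.symm hFm.enorm hg.enorm
    have h2 : ∫⁻ z, ‖F z * g z‖ₑ ∂μ = ∫⁻ z, ((fun z ↦ ‖F z‖ₑ) * fun z ↦ ‖g z‖ₑ) z ∂μ := by
      simp [enorm_mul]
    rw [HasFiniteIntegral, h2]
    refine h1.trans_lt (ENNReal.mul_lt_top ?_ ?_)
    · exact ENNReal.rpow_lt_top_of_nonneg (by have := hpp.symm.pos; positivity) hF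
    · exact ENNReal.rpow_lt_top_of_nonneg (by positivity) (hgA.trans_lt hA.lt_top).ne
  refine ⟨hint hf₀m hf₀, fun n ↦ hint (hfm n) (hf n), ?_⟩
  refine tendsto_integral_of_L1 _ (hFm.mul hf₀m)
    (Eventually.of_forall fun n ↦ hint (hfm n) (hf n)) ?_
  have hdA : ∀ n, ∫⁻ z, ‖f n z - f₀ z‖ₑ ^ p ∂μ ≤ 2 ^ (p - 1) * (A + A) := by
    intro n
    calc _ ≤ ∫⁻ z, 2 ^ (p - 1) * (‖f n z‖ₑ ^ p + ‖f₀ z‖ₑ ^ p) ∂μ := by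
          refine lintegral_mono fun z ↦ ?_
          refine le_trans (ENNReal.rpow_le_rpow enorm_sub_le hp0.le) ?_
          exact ENNReal.rpow_add_le_mul_rpow_add_rpow _ _ hp1.le
      _ = 2 ^ (p - 1) * (∫⁻ z, ‖f n z‖ₑ ^ p ∂μ + ∫⁻ z, ‖f₀ z‖ₑ ^ p ∂μ) := by
          rw [lintegral_const_mul' _ _ (ENNReal.rpow_ne_top_of_nonneg (by linarith) (by simp)),
            lintegral_add_left' ((hfm n).enorm.pow_const p)]
      _ ≤ _ := by
          gcongr
          exact hf n
  set A' := 2 ^ (p - 1) * (A + A) with hA'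
  have hA't : A' ≠ ⊤ := ENNReal.mul_ne_top (ENNReal.rpow_ne_top_of_nonneg (by linarith) (by simp))
    (ENNReal.add_ne_top.2 ⟨hA, hA⟩)
  -- The second term is small uniformly in `n` once `l` is large; for that fixed `l` the first tends
  -- to zero by dominated convergence, with majorant `l |F|^p'`.
  have key : ∀ l : ℝ, 0 < l → ∀ n, ∫⁻ z, ‖F z * f n z - F z * f₀ z‖ₑ ∂μ ≤
      ∫⁻ z, ENNReal.ofReal (min (‖F z‖ * ‖f n z - f₀ z‖) (l * ‖F z‖ ^ p')) ∂μ +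
        ENNReal.ofReal (l ^ (1 - p)) * A' := by
    intro l hl n
    have hm : AEMeasurable (fun z ↦ ENNReal.ofReal
        (min (‖F z‖ * ‖f n z - f₀ z‖) (l * ‖F z‖ ^ p'))) μ := by
      have h1 := hFm.norm.aemeasurable
      have h2 := ((hfm n).sub hf₀m).norm.aemeasurable
      exact ((h1.mul h2).min ((h1.pow_const p').const_mul l)).ennreal_ofReal
    calc _ ≤ ∫⁻ z, (ENNReal.ofReal (min (‖F z‖ * ‖f n z - f₀ z‖) (l * ‖F z‖ ^ p')) +
          ENNReal.ofReal (l ^ (1 - p)) * ‖f n z - f₀ z‖ₑ ^ p) ∂μ := by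
          refine lintegral_mono fun z ↦ ?_
          rw [← mul_sub, ← ofReal_norm, ← ofReal_norm,
            ENNReal.ofReal_rpow_of_nonneg (norm_nonneg _) hp0.le,
            ← ENNReal.ofReal_mul (by positivity), ← ENNReal.ofReal_add (by positivity)
              (by positivity), norm_mul]
          exact ENNReal.ofReal_le_ofReal
            (mul_le_min_add hpp (norm_nonneg _) (norm_nonneg _) hl)
      _ ≤ _ := by
          rw [lintegral_add_left' hm, lintegral_const_mul' _ _ ENNReal.ofReal_ne_top]
          gcongr
          exact hdA n
  have hmin : ∀ l : ℝ, 0 < l → Tendsto (fun n ↦ ∫⁻ z, ENNReal.ofReal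
      (min (‖F z‖ * ‖f n z - f₀ z‖) (l * ‖F z‖ ^ p')) ∂μ) atTop (𝓝 0) := by
    intro l hl
    have h1 := hFm.norm.aemeasurable
    have := tendsto_lintegral_of_dominated_convergence' (μ := μ) (f := fun _ ↦ 0)
      (F := fun n z ↦ ENNReal.ofReal (min (‖F z‖ * ‖f n z - f₀ z‖) (l * ‖F z‖ ^ p')))
      (fun z ↦ ENNReal.ofReal l * ‖F z‖ₑ ^ p') (fun n ↦ ?_)
      (fun n ↦ Eventually.of_forall fun z ↦ ?_) ?_ ?_
    · simpa using this
    · have h2 := ((hfm n).sub hf₀m).norm.aemeasurable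
      exact ((h1.mul h2).min ((h1.pow_const p').const_mul l)).ennreal_ofReal
    · simp only
      rw [← ofReal_norm, ENNReal.ofReal_rpow_of_nonneg (norm_nonneg _) hpp.symm.pos.le,
        ← ENNReal.ofReal_mul hl.le]
      exact ENNReal.ofReal_le_ofReal (min_le_right _ _)
    · rw [lintegral_const_mul' _ _ ENNReal.ofReal_ne_top]
      exact ENNReal.mul_ne_top ENNReal.ofReal_ne_top hF
    · filter_upwards [hlim] with z hz
      have h3 : Tendsto (fun n ↦ min (‖F z‖ * ‖f n z - f₀ z‖) (l * ‖F z‖ ^ p')) atTop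
          (𝓝 (min (‖F z‖ * ‖f₀ z - f₀ z‖) (l * ‖F z‖ ^ p'))) :=
        ((hz.sub_const _).norm.const_mul _).min tendsto_const_nhds
      have h4 : min (‖F z‖ * ‖f₀ z - f₀ z‖) (l * ‖F z‖ ^ p') = 0 := by
        rw [sub_self, norm_zero, mul_zero]
        exact min_eq_left (by positivity)
      rw [h4] at h3
      simpa using ENNReal.tendsto_ofReal h3
  rw [ENNReal.tendsto_nhds_zero]
  intro ε hε
  -- choose `l` large
  have hl : Tendsto (fun l : ℝ ↦ ENNReal.ofReal (l ^ (1 - p)) * A') atTop (𝓝 0) := by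
    have h1 : Tendsto (fun l : ℝ ↦ l ^ (1 - p)) atTop (𝓝 0) := by
      have := tendsto_rpow_neg_atTop (y := p - 1) (by linarith)
      simpa using this
    have h2 := ENNReal.Tendsto.mul_const (ENNReal.tendsto_ofReal h1) (Or.inr hA't)
    simpa using h2
  obtain ⟨l, hlε, hl0⟩ := ((ENNReal.tendsto_nhds_zero.1 hl (ε / 2)
    (ENNReal.half_pos hε.ne')).and (eventually_gt_atTop 0)).exists
  filter_upwards [ENNReal.tendsto_nhds_zero.1 (hmin l hl0) (ε / 2) (ENNReal.half_pos hε.ne')]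
    with n hn
  exact (key l hl0 n).trans ((add_le_add hn hlε).trans_eq (ENNReal.add_halves ε))

end WeakConv

/-! ### Weak derivatives on open sets -/

section Local
open Filter Topology

variable {E : Type*} [NormedAddCommGroup E] [NormedSpace ℝ E] [FiniteDimensional ℝ E]
  [MeasurableSpace E] [BorelSpace E] {μ : Measure E} [μ.IsAddHaarMeasure]

/-- `w` is the weak derivative of `u` in the direction `e` on the set `Ω`. -/
def HasWeakLineDerivOn (μ : Measure E) (Ω : Set E) (u w : E → ℝ) (e : E) : Prop :=
  ∀ η : E → ℝ, ContDiff ℝ ∞ η → HasCompactSupport η → tsupport η ⊆ Ω →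
    ∫ z, u z * fderiv ℝ η z e ∂μ = -∫ z, w z * η z ∂μ

/-- Smooth cutoff functions. -/
theorem exists_cutoff {K Ω : Set E} (hK : IsCompact K) (hΩ : IsOpen Ω) (h : K ⊆ Ω) :
    ∃ χ : E → ℝ, ContDiff ℝ ∞ χ ∧ HasCompactSupport χ ∧ tsupport χ ⊆ Ω ∧
      (∀ z, 0 ≤ χ z ∧ χ z ≤ 1) ∧ ∀ z ∈ K, χ =ᶠ[𝓝 z] 1 := by
  obtain ⟨K', hK', hKK', hK'Ω⟩ := exists_compact_between hK hΩ h
  obtain ⟨f, h1, h2, h3⟩ := exists_contMDiffMap_one_nhds_of_subset_interior (n := (⊤ : ℕ∞))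
    (modelWithCornersSelf ℝ E) hK.isClosed hKK'
  have hsupp : Function.support f ⊆ K' := by
    intro z hz
    by_contra hz'
    exact hz (h2 z hz')
  refine ⟨f, f.contMDiff.contDiff, HasCompactSupport.of_support_subset_isCompact hK' hsupp,
    (closure_minimal hsupp hK'.isClosed).trans hK'Ω, h3, fun z hz ↦ ?_⟩
  exact (h1.filter_mono (nhds_le_nhdsSet hz))

theorem integrable_mul_of_locallyIntegrableOn {Ω : Set E} {u χ : E → ℝ}
    (hu : LocallyIntegrableOn u Ω μ) (hχ : Continuous χ) (hχc : HasCompactSupport χ)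
    (hχΩ : tsupport χ ⊆ Ω) : Integrable (fun z ↦ χ z * u z) μ := by
  obtain ⟨B, hB⟩ := hχc.exists_bound_of_continuous hχ
  have h1 : IntegrableOn u (tsupport χ) μ :=
    hu.integrableOn_compact_subset hχΩ hχc
  have h2 : IntegrableOn (fun z ↦ χ z * u z) (tsupport χ) μ :=
    h1.bdd_mul hχ.aestronglyMeasurable (Eventually.of_forall hB)
  refine (integrableOn_iff_integrable_of_support_subset fun z hz ↦ ?_).1 h2
  have hz' : χ z * u z ≠ 0 := hz
  exact subset_tsupport _ (left_ne_zero_of_mul hz')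

theorem HasWeakLineDerivOn.cutoff {Ω : Set E} {u w : E → ℝ} {e : E}
    (h : HasWeakLineDerivOn μ Ω u w e) (hu : LocallyIntegrableOn u Ω μ)
    (hw : LocallyIntegrableOn w Ω μ) {χ : E → ℝ} (hχ : ContDiff ℝ ∞ χ)
    (hχc : HasCompactSupport χ) (hχΩ : tsupport χ ⊆ Ω) :
    Integrable (fun z ↦ χ z * u z) μ ∧ Integrable (fun z ↦ χ z * w z + fderiv ℝ χ z e * u z) μ ∧
      HasWeakLineDeriv μ (fun z ↦ χ z * u z) (fun z ↦ χ z * w z + fderiv ℝ χ z e * u z) e := by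
  have hχ1 : ContDiff ℝ 1 χ := hχ.of_le (by exact_mod_cast le_top)
  have hdc : Continuous fun z ↦ fderiv ℝ χ z e :=
    (hχ1.continuous_fderiv one_ne_zero).clm_apply continuous_const
  have hds : tsupport (fun z ↦ fderiv ℝ χ z e) ⊆ tsupport χ := tsupport_fderiv_apply_subset ℝ e
  have hi1 := integrable_mul_of_locallyIntegrableOn hw hχ.continuous hχc hχΩ
  have hi2 := integrable_mul_of_locallyIntegrableOn hu hdc (hχc.fderiv_apply ℝ e)
    (hds.trans hχΩ)
  refine ⟨integrable_mul_of_locallyIntegrableOn hu hχ.continuous hχc hχΩ, hi1.add hi2,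
    fun η hη hηc ↦ ?_⟩
  have hη1 : ContDiff ℝ 1 η := hη.of_le (by exact_mod_cast le_top)
  have h1 := h (fun z ↦ χ z * η z) (hχ.mul hη) hχc.mul_right
    ((tsupport_mul_subset_left).trans hχΩ)
  have h2 : ∀ z, fderiv ℝ (fun z ↦ χ z * η z) z e =
      χ z * fderiv ℝ η z e + fderiv ℝ χ z e * η z := by
    intro z
    have h3 : fderiv ℝ (fun z ↦ χ z * η z) z = _ :=
      (((hχ1.differentiable one_ne_zero) z).hasFDerivAt.mul
        ((hη1.differentiable one_ne_zero) z).hasFDerivAt).fderiv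
    rw [h3]
    simp [mul_comm]
  have hηb := hηc.exists_bound_of_continuous hη.continuous
  have hηd := (hηc.fderiv_apply ℝ e).exists_bound_of_continuous
    ((hη1.continuous_fderiv one_ne_zero).clm_apply continuous_const)
  obtain ⟨B, hB⟩ := hηb
  obtain ⟨B', hB'⟩ := hηd
  have hi3 : Integrable (fun z ↦ χ z * u z * fderiv ℝ η z e) μ :=
    (integrable_mul_of_locallyIntegrableOn hu hχ.continuous hχc hχΩ).mul_bdd
      ((hη1.continuous_fderiv one_ne_zero).clm_apply continuous_const).aestronglyMeasurable
      (Eventually.of_forall hB')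
  have hi4 : Integrable (fun z ↦ fderiv ℝ χ z e * u z * η z) μ :=
    hi2.mul_bdd hη.continuous.aestronglyMeasurable (Eventually.of_forall hB)
  have hi5 : Integrable (fun z ↦ χ z * w z * η z) μ :=
    hi1.mul_bdd hη.continuous.aestronglyMeasurable (Eventually.of_forall hB)
  simp_rw [h2] at h1
  have h4 : ∫ z, u z * (χ z * fderiv ℝ η z e + fderiv ℝ χ z e * η z) ∂μ =
      ∫ z, χ z * u z * fderiv ℝ η z e ∂μ + ∫ z, fderiv ℝ χ z e * u z * η z ∂μ := by
    rw [← integral_add hi3 hi4]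
    refine integral_congr_ae (Eventually.of_forall fun z ↦ ?_)
    ring
  have h5 : ∫ z, (χ z * w z + fderiv ℝ χ z e * u z) * η z ∂μ =
      ∫ z, χ z * w z * η z ∂μ + ∫ z, fderiv ℝ χ z e * u z * η z ∂μ := by
    rw [← integral_add hi5 hi4]
    refine integral_congr_ae (Eventually.of_forall fun z ↦ ?_)
    ring
  have h6 : ∫ z, w z * (χ z * η z) ∂μ = ∫ z, χ z * w z * η z ∂μ :=
    integral_congr_ae (Eventually.of_forall fun z ↦ by ring)
  rw [h4, h6] at h1
  rw [h5]
  linarith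

/-- Chain rule for weak derivatives on an open set, tested with Lipschitz functions. -/
theorem HasWeakLineDerivOn.integral_comp_mul_lineDeriv {Ω : Set E} (hΩ : IsOpen Ω) {u w : E → ℝ}
    {e : E} (h : HasWeakLineDerivOn μ Ω u w e) (hu : LocallyIntegrableOn u Ω μ)
    (hw : LocallyIntegrableOn w Ω μ) {H H' : ℝ → ℝ} (hH : ∀ s, HasDerivAt H (H' s) s)
    (hH' : Continuous H') {L : ℝ} (hL : ∀ s, |H' s| ≤ L) {η : E → ℝ} {C : NNReal}
    (hη : LipschitzWith C η) (hηc : HasCompactSupport η) (hηΩ : tsupport η ⊆ Ω) :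
    ∫ z, H (u z) * lineDeriv ℝ η z e ∂μ = -∫ z, H' (u z) * w z * η z ∂μ := by
  obtain ⟨χ, hχ, hχc, hχΩ, -, hχ1⟩ := exists_cutoff hηc hΩ hηΩ
  obtain ⟨h1, h2, h3⟩ := h.cutoff hu hw hχ hχc hχΩ
  have h4 := h3.integral_comp_mul_lineDeriv h1 h2 hH hH' hL hη hηc
  have hzero : ∀ z, z ∉ tsupport η → η z = 0 ∧ lineDeriv ℝ η z e = 0 := by
    intro z hz
    have : η =ᶠ[𝓝 z] fun _ ↦ 0 := notMem_tsupport_iff_eventuallyEq.1 hz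
    refine ⟨this.eq_of_nhds, ?_⟩
    rw [this.lineDeriv_eq]
    simp [lineDeriv]
  have h5 : ∀ z, H (χ z * u z) * lineDeriv ℝ η z e = H (u z) * lineDeriv ℝ η z e := by
    intro z
    by_cases hz : z ∈ tsupport η
    · rw [(hχ1 z hz).eq_of_nhds]; simp
    · simp [(hzero z hz).2]
  have h6 : ∀ z, H' (χ z * u z) * (χ z * w z + fderiv ℝ χ z e * u z) * η z =
      H' (u z) * w z * η z := by
    intro z
    by_cases hz : z ∈ tsupport η
    · have : fderiv ℝ χ z = 0 := by
        rw [(hχ1 z hz).fderiv_eq]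
        simp
      rw [(hχ1 z hz).eq_of_nhds, this]; simp
    · simp [(hzero z hz).1]
  simp_rw [h5, h6] at h4
  exact h4

end Local

/-! ### Powers of Sobolev functions -/

section Power
open Filter Topology

/-- A `C¹` function with bounded derivative that agrees with `s ↦ s ^ κ` for moderate `s ≥ 0`. -/
def truncPow (κ k s : ℝ) : ℝ := ∫ t in (0 : ℝ)..s, min (κ * |t| ^ (κ - 1)) k

theorem continuous_min_rpow {κ : ℝ} (hκ : 1 ≤ κ) (k : ℝ) :
    Continuous fun t : ℝ ↦ min (κ * |t| ^ (κ - 1)) k :=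
  (continuous_const.mul (continuous_abs.rpow_const fun _ ↦ Or.inr (by linarith))).min
    continuous_const

theorem hasDerivAt_truncPow {κ : ℝ} (hκ : 1 ≤ κ) (k s : ℝ) :
    HasDerivAt (truncPow κ k) (min (κ * |s| ^ (κ - 1)) k) s :=
  ((continuous_min_rpow hκ k).integral_hasStrictDerivAt 0 s).hasDerivAt

theorem integral_mul_abs_rpow {κ : ℝ} (hκ : 1 ≤ κ) {s : ℝ} (hs : 0 ≤ s) :
    ∫ t in (0 : ℝ)..s, κ * |t| ^ (κ - 1) = s ^ κ := by
  have h1 : ∫ t in (0 : ℝ)..s, κ * |t| ^ (κ - 1) = ∫ t in (0 : ℝ)..s, κ * t ^ (κ - 1) := by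
    refine intervalIntegral.integral_congr fun t ht ↦ ?_
    rw [uIcc_of_le hs] at ht
    simp only [abs_of_nonneg ht.1]
  rw [h1, intervalIntegral.integral_const_mul, integral_rpow (Or.inl (by linarith)),
    sub_add_cancel, Real.zero_rpow (by linarith), sub_zero]
  field_simp

theorem truncPow_nonneg {κ k s : ℝ} (hκ : 1 ≤ κ) (hk : 0 ≤ k) (hs : 0 ≤ s) :
    0 ≤ truncPow κ k s :=
  intervalIntegral.integral_nonneg hs fun t _ ↦ le_min (by positivity) hk

theorem truncPow_le {κ k s : ℝ} (hκ : 1 ≤ κ) (hs : 0 ≤ s) : truncPow κ k s ≤ s ^ κ := by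
  rw [← integral_mul_abs_rpow hκ hs]
  refine intervalIntegral.integral_mono_on hs
    ((continuous_min_rpow hκ k).intervalIntegrable _ _) ?_ fun t _ ↦ min_le_left _ _
  exact (continuous_const.mul (continuous_abs.rpow_const
    fun _ ↦ Or.inr (by linarith))).intervalIntegrable _ _

theorem truncPow_eq {κ k s : ℝ} (hκ : 1 ≤ κ) (hs : 0 ≤ s) (hk : κ * s ^ (κ - 1) ≤ k) :
    truncPow κ k s = s ^ κ := by
  rw [← integral_mul_abs_rpow hκ hs]
  refine intervalIntegral.integral_congr fun t ht ↦ ?_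
  rw [uIcc_of_le hs] at ht
  refine min_eq_left (le_trans ?_ hk)
  rw [abs_of_nonneg ht.1]
  gcongr
  · exact ht.1
  · exact ht.2

theorem real_rpow_add_le {a b p : ℝ} (ha : 0 ≤ a) (hb : 0 ≤ b) (hp : 1 ≤ p) :
    (a + b) ^ p ≤ 2 ^ (p - 1) * (a ^ p + b ^ p) := by
  lift a to NNReal using ha
  lift b to NNReal using hb
  exact_mod_cast NNReal.rpow_add_le_mul_rpow_add_rpow a b hp

/-- Write `x^κ = x^(κ-1) x` and use that `x^(κ-1)` is monotone. The weight involves only the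
endpoint `a`, so it can be taken outside an average over `b`, and nothing is divided by where `a`
vanishes. -/
theorem rpow_sub_one_mul_abs_sub_le {κ a b : ℝ} (hκ : 1 ≤ κ) (ha : 0 ≤ a) (hb : 0 ≤ b) :
    a ^ (κ - 1) * |b - a| ≤ |b ^ κ - a ^ κ| := by
  have hpow : ∀ x : ℝ, 0 ≤ x → x ^ κ = x ^ (κ - 1) * x := fun x hx ↦ by
    nth_rewrite 3 [← Real.rpow_one x]
    rw [← Real.rpow_add_of_nonneg hx (by linarith) zero_le_one, sub_add_cancel]
  rcases le_total a b with h | h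
  · rw [abs_of_nonneg (sub_nonneg.2 h)]
    refine le_trans ?_ (le_abs_self _)
    rw [hpow b hb, hpow a ha, mul_sub]
    have := Real.rpow_le_rpow ha h (by linarith : 0 ≤ κ - 1)
    nlinarith
  · rw [abs_of_nonpos (sub_nonpos.2 h)]
    refine le_trans ?_ (neg_le_abs _)
    rw [hpow b hb, hpow a ha]
    have := Real.rpow_le_rpow hb h (by linarith : 0 ≤ κ - 1)
    nlinarith

variable {E : Type*} [NormedAddCommGroup E] [NormedSpace ℝ E] [FiniteDimensional ℝ E]
  [MeasurableSpace E] [BorelSpace E] {μ : Measure E} [μ.IsAddHaarMeasure]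

theorem HasWeakLineDeriv.congr {u u' w w' : E → ℝ} {e : E} (h : HasWeakLineDeriv μ u w e)
    (hu : u =ᵐ[μ] u') (hw : w =ᵐ[μ] w') : HasWeakLineDeriv μ u' w' e := by
  intro η hη hηc
  have h1 : ∫ z, u' z * fderiv ℝ η z e ∂μ = ∫ z, u z * fderiv ℝ η z e ∂μ :=
    integral_congr_ae (by filter_upwards [hu] with z hz; rw [hz])
  have h2 : ∫ z, w' z * η z ∂μ = ∫ z, w z * η z ∂μ :=
    integral_congr_ae (by filter_upwards [hw] with z hz; rw [hz])
  rw [h1, h2]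
  exact h η hη hηc

theorem HasWeakLineDeriv.const_mul {u w : E → ℝ} {e : E} (h : HasWeakLineDeriv μ u w e) (c : ℝ) :
    HasWeakLineDeriv μ (fun z ↦ c * u z) (fun z ↦ c * w z) e := by
  intro η hη hηc
  simp_rw [mul_assoc]
  rw [integral_const_mul, integral_const_mul, h η hη hηc, mul_neg]

/-- The chain rule for bounded derivatives applies to `truncPow κ k`, which equals `s^κ` once `k ≥ κ
s^(κ-1)`; dominated convergence in `k` does the rest. -/
theorem HasWeakLineDeriv.rpow {u w : E → ℝ} {e : E} (h : HasWeakLineDeriv μ u w e)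
    (hu : Integrable u μ) (hw : Integrable w μ) (hu0 : ∀ z, 0 ≤ u z) {κ : ℝ} (hκ : 1 ≤ κ)
    (huκ : Integrable (fun z ↦ u z ^ κ) μ) (hwκ : Integrable (fun z ↦ u z ^ (κ - 1) * w z) μ) :
    HasWeakLineDeriv μ (fun z ↦ u z ^ κ) (fun z ↦ κ * (u z ^ (κ - 1) * w z)) e := by
  intro η hη hηc
  have hη1 : ContDiff ℝ 1 η := hη.of_le (by exact_mod_cast le_top)
  have hdc : Continuous fun z ↦ fderiv ℝ η z e :=
    (hη1.continuous_fderiv one_ne_zero).clm_apply continuous_const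
  obtain ⟨B, hB⟩ := hηc.exists_bound_of_continuous hη.continuous
  obtain ⟨B', hB'⟩ := (hηc.fderiv_apply ℝ e).exists_bound_of_continuous hdc
  have hid : ∀ k : ℕ, ∫ z, truncPow κ k (u z) * fderiv ℝ η z e ∂μ =
      -∫ z, min (κ * |u z| ^ (κ - 1)) k * w z * η z ∂μ := fun k ↦
    h.comp hu hw (H := truncPow κ k) (hasDerivAt_truncPow hκ k)
      (continuous_min_rpow hκ k) (L := k) (fun s ↦ by
        rw [abs_of_nonneg (le_min (by positivity) (by positivity))]
        exact min_le_right _ _) η hη hηc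
  have hev : ∀ z, ∀ᶠ k : ℕ in atTop, κ * u z ^ (κ - 1) ≤ k := fun z ↦
    tendsto_natCast_atTop_atTop.eventually_ge_atTop _
  have htc : ∀ k : ℕ, Continuous (truncPow κ k) := fun k ↦
    continuous_iff_continuousAt.2 fun s ↦ (hasDerivAt_truncPow hκ k s).continuousAt
  have h1 : Tendsto (fun k : ℕ ↦ ∫ z, truncPow κ k (u z) * fderiv ℝ η z e ∂μ) atTop
      (𝓝 (∫ z, u z ^ κ * fderiv ℝ η z e ∂μ)) := by
    refine tendsto_integral_of_dominated_convergence (fun z ↦ u z ^ κ * B')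
      (fun k ↦ ((htc k).comp_aestronglyMeasurable hu.1).mul hdc.aestronglyMeasurable)
      (huκ.mul_const B') (fun k ↦ Eventually.of_forall fun z ↦ ?_)
      (Eventually.of_forall fun z ↦ ?_)
    · rw [norm_mul, Real.norm_of_nonneg (truncPow_nonneg hκ k.cast_nonneg (hu0 z))]
      exact mul_le_mul (truncPow_le hκ (hu0 z)) (hB' z) (norm_nonneg _)
        (Real.rpow_nonneg (hu0 z) _)
    · refine tendsto_const_nhds.congr' ?_
      filter_upwards [hev z] with k hk
      rw [truncPow_eq hκ (hu0 z) hk]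
  have h2 : Tendsto (fun k : ℕ ↦ ∫ z, min (κ * |u z| ^ (κ - 1)) k * w z * η z ∂μ) atTop
      (𝓝 (∫ z, κ * (u z ^ (κ - 1) * w z) * η z ∂μ)) := by
    refine tendsto_integral_of_dominated_convergence (fun z ↦ κ * ‖u z ^ (κ - 1) * w z‖ * B)
      (fun k ↦ (((continuous_min_rpow hκ k).comp_aestronglyMeasurable hu.1).mul hw.1).mul
        hη.continuous.aestronglyMeasurable)
      ((hwκ.norm.const_mul κ).mul_const B) (fun k ↦ Eventually.of_forall fun z ↦ ?_)
      (Eventually.of_forall fun z ↦ ?_)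
    · rw [norm_mul, norm_mul, norm_mul, Real.norm_of_nonneg (Real.rpow_nonneg (hu0 z) _),
        Real.norm_of_nonneg (le_min (by positivity) (by positivity)), abs_of_nonneg (hu0 z),
        ← mul_assoc]
      have : 0 ≤ u z ^ (κ - 1) := Real.rpow_nonneg (hu0 z) _
      exact mul_le_mul (mul_le_mul_of_nonneg_right (min_le_left _ _) (norm_nonneg _)) (hB z)
        (norm_nonneg _) (by positivity)
    · refine tendsto_const_nhds.congr' ?_
      filter_upwards [hev z] with k hk
      rw [abs_of_nonneg (hu0 z), min_eq_left hk]
      ring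
  exact tendsto_nhds_unique h1 (h2.neg.congr fun k ↦ (hid k).symm)

theorem integrable_of_memLp_of_support {p : ℝ} (hp : 1 ≤ p) {f : E → ℝ}
    (hf : MemLp f (ENNReal.ofReal p) μ) {K : Set E} (hK : IsCompact K)
    (hs : Function.support f ⊆ K) : Integrable f μ := by
  have : IsFiniteMeasure (μ.restrict K) := ⟨by simpa using hK.measure_lt_top⟩
  have h1 : MemLp f 1 (μ.restrict K) := (hf.restrict K).mono_exponent (by simpa using hp)
  exact (integrableOn_iff_integrable_of_support_subset hs).1 (memLp_one_iff_integrable.1 h1)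

theorem memLp_of_rpow_le {p : ℝ} (hp : 0 < p) {Ω K : Set E} (hK : IsCompact K) (hKΩ : K ⊆ Ω)
    {f F : E → ℝ} (hs : Function.support f ⊆ K) (hf : AEStronglyMeasurable f μ)
    (hF : LocallyIntegrableOn F Ω μ) {C : ℝ} (h : ∀ᵐ z ∂μ, z ∈ K → |f z| ^ p ≤ C * F z) :
    MemLp f (ENNReal.ofReal p) μ := by
  refine ⟨hf, ?_⟩
  rw [eLpNorm_sub_rpow hp]
  refine ENNReal.rpow_lt_top_of_nonneg (by positivity) ?_
  have h1 : Integrable (K.indicator fun z ↦ C * F z) μ :=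
    (integrable_indicator_iff hK.measurableSet).2
      ((hF.integrableOn_compact_subset hKΩ hK).const_mul C)
  refine (lt_of_le_of_lt (lintegral_mono_ae ?_) h1.2).ne
  filter_upwards [h] with z hz
  by_cases hzK : z ∈ K
  · rw [indicator_of_mem hzK, ← ofReal_norm, ← ofReal_norm,
      ENNReal.ofReal_rpow_of_nonneg (norm_nonneg _) hp.le]
    exact ENNReal.ofReal_le_ofReal ((hz hzK).trans (le_abs_self _))
  · have : f z = 0 := by
      by_contra h0
      exact hzK (hs h0)
    simp [this, hp]

end Power

/-! ### The weighted approximation near a compact set -/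

section LocalApprox
open Filter Topology

variable {N : ℕ}

local notation "𝕏" => EuclideanSpace ℝ (Fin N)

/-- Approximation of `G(u)` near a compact set by Lipschitz functions whose spatial derivatives,
weighted by `u ^ ((m-1)/p)`, are bounded in `Lᵖ`. -/
theorem exists_lipschitz_approx_on {p m : ℝ} (hp : 1 < p) (hm : 1 ≤ m) {Ω K : Set (𝕏 × ℝ)}
    (hΩ : IsOpen Ω) (hK : IsCompact K) (hKΩ : K ⊆ Ω) {u : 𝕏 × ℝ → ℝ} {b : Fin N → 𝕏 × ℝ → ℝ}
    (hu : LocallyIntegrableOn u Ω) (hb : ∀ i, LocallyIntegrableOn (b i) Ω)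
    (hub : ∀ i, HasWeakLineDerivOn volume Ω u (b i) (EuclideanSpace.single i 1, 0))
    (hu0 : ∀ᵐ z, z ∈ Ω → 0 ≤ u z) (hup : LocallyIntegrableOn (fun z ↦ u z ^ (p + m - 1)) Ω)
    (hbp : ∀ i, LocallyIntegrableOn (fun z ↦ |b i z| ^ p * u z ^ (m - 1)) Ω)
    {G G' : ℝ → ℝ} (hG : ∀ s, HasDerivAt G (G' s) s) (hG' : Continuous G') {L : ℝ}
    (hL : ∀ s, |G' s| ≤ L) {B : ℝ} (hG0 : ∀ s, 0 ≤ G s) (hGB : ∀ s, G s ≤ B) :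
    ∃ g : ℕ → 𝕏 × ℝ → ℝ, (∀ n, ∃ C, LipschitzWith C (g n)) ∧ (∀ n, Differentiable ℝ (g n)) ∧
      (∀ n z, 0 ≤ g n z) ∧ (∀ n z, g n z ≤ B) ∧
      (∀ᵐ z, z ∈ K → Tendsto (fun n ↦ g n z) atTop (𝓝 (G (u z)))) ∧
      (∀ i, ∀ᵐ z, z ∈ K → Tendsto (fun n ↦ fderiv ℝ (g n) z (EuclideanSpace.single i 1, 0)) atTop
        (𝓝 (G' (u z) * b i z))) ∧
      ∃ A : ℝ≥0∞, A ≠ ⊤ ∧ ∀ n i, ∫⁻ z in K,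
        ‖u z ^ ((m - 1) / p) * fderiv ℝ (g n) z (EuclideanSpace.single i 1, 0)‖ₑ ^ p ≤ A := by
  have hp0 : 0 < p := by linarith
  have hL0 : 0 ≤ L := (abs_nonneg _).trans (hL 0)
  obtain ⟨χ, hχ, hχc, hχΩ, hχ01, hχ1⟩ := exists_cutoff hK hΩ hKΩ
  have hχ' : ContDiff ℝ 1 χ := hχ.of_le (by exact_mod_cast le_top)
  -- The exponent is chosen so that `κ p = p + m - 1` and `(κ - 1) p = m - 1`: then `u^κ` and its
  -- derivative `κ u^(κ-1) ∇u` lie in `Lᵖ` locally by exactly the two energy hypotheses.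
  set κ : ℝ := (p + m - 1) / p with hκdef
  have hκ : 1 ≤ κ := by rw [hκdef, le_div_iff₀ hp0]; linarith
  have hκ1 : κ - 1 = (m - 1) / p := by rw [hκdef]; field_simp; ring
  have hκp : κ * p = p + m - 1 := by rw [hκdef]; field_simp
  have hm1 : (κ - 1) * p = m - 1 := by rw [hκ1]; field_simp
  set T := tsupport χ with hT
  have hTc : IsCompact T := hχc
  have hχ0 : ∀ z, z ∉ T → χ z = 0 := fun z hz ↦ image_eq_zero_of_notMem_tsupport hz
  have hdχ0 : ∀ z e, z ∉ T → fderiv ℝ χ z e = 0 := fun z e hz ↦ by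
    have : χ =ᶠ[𝓝 z] fun _ ↦ 0 := notMem_tsupport_iff_eventuallyEq.1 hz
    rw [this.fderiv_eq]
    simp
  -- Taking the positive part makes the function nonnegative at every point, as the powers require;
  -- it alters `χ u` only on a null set.
  set ut : 𝕏 × ℝ → ℝ := fun z ↦ χ z * max (u z) 0 with hut
  have hut0 : ∀ z, 0 ≤ ut z := fun z ↦ mul_nonneg (hχ01 z).1 (le_max_right _ _)
  have hae : (fun z ↦ χ z * u z) =ᵐ[volume] ut := by
    filter_upwards [hu0] with z hz
    by_cases hzT : z ∈ T
    · simp only [hut]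
      rw [max_eq_left (hz (hχΩ hzT))]
    · simp [hut, hχ0 z hzT]
  set bt : Fin N → 𝕏 × ℝ → ℝ := fun i z ↦
    χ z * b i z + fderiv ℝ χ z (EuclideanSpace.single i 1, 0) * u z with hbt
  have hcut := fun i ↦ (hub i).cutoff hu (hb i) hχ hχc hχΩ
  have hbtI : ∀ i, Integrable (bt i) volume := fun i ↦ (hcut i).2.1
  have hutI : Integrable ut volume :=
    (integrable_mul_of_locallyIntegrableOn hu hχ.continuous hχc hχΩ).congr hae
  have hutb : ∀ i, HasWeakLineDeriv volume ut (bt i) (EuclideanSpace.single i 1, 0) := fun i ↦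
    (hcut i).2.2.congr hae Filter.EventuallyEq.rfl
  have hutT : ∀ z, z ∉ T → ut z = 0 := fun z hz ↦ by simp [hut, hχ0 z hz]
  have hbtT : ∀ i z, z ∉ T → bt i z = 0 := fun i z hz ↦ by simp [hbt, hχ0 z hz, hdχ0 z _ hz]
  -- Sobolev bounds for the power
  have hvp : MemLp (fun z ↦ ut z ^ κ) (ENNReal.ofReal p) volume := by
    refine memLp_of_rpow_le hp0 hTc hχΩ (C := 1) (fun z hz ↦ ?_)
      (hutI.1.aemeasurable.pow_const κ).aestronglyMeasurable hup ?_
    · by_contra hzT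
      exact hz (by simp only [hutT z hzT]; exact Real.zero_rpow (by linarith))
    · filter_upwards [hu0] with z hz hzT
      have hz0 := hz (hχΩ hzT)
      rw [abs_of_nonneg (Real.rpow_nonneg (hut0 z) _), ← Real.rpow_mul (hut0 z), hκp, one_mul]
      refine Real.rpow_le_rpow (hut0 z) ?_ (by linarith)
      simp only [hut]
      rw [max_eq_left hz0]
      exact mul_le_of_le_one_left hz0 (hχ01 z).2
  have hwp : ∀ i, MemLp (fun z ↦ ut z ^ (κ - 1) * bt i z) (ENNReal.ofReal p) volume := by
    intro i
    obtain ⟨D, hD⟩ := (hχc.fderiv_apply ℝ (EuclideanSpace.single i (1 : ℝ), (0 : ℝ))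
      ).exists_bound_of_continuous ((hχ'.continuous_fderiv one_ne_zero).clm_apply continuous_const)
    have hD0 : 0 ≤ D := (norm_nonneg _).trans (hD 0)
    refine memLp_of_rpow_le hp0 hTc hχΩ (C := 2 ^ (p - 1))
      (F := fun z ↦ |b i z| ^ p * u z ^ (m - 1) + D ^ p * u z ^ (p + m - 1)) (fun z hz ↦ ?_)
      ((hutI.1.aemeasurable.pow_const (κ - 1)).aestronglyMeasurable.mul (hbtI i).1)
      ((hbp i).add (hup.smul (D ^ p))) ?_
    · by_contra hzT
      exact hz (by simp only [hbtT i z hzT, mul_zero])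
    · filter_upwards [hu0] with z hz hzT
      have hz0 := hz (hχΩ hzT)
      have h1 : ut z ≤ u z := by
        simp only [hut]
        rw [max_eq_left hz0]
        exact mul_le_of_le_one_left hz0 (hχ01 z).2
      have h2 : |bt i z| ≤ |b i z| + D * u z := by
        simp only [hbt]
        refine (abs_add_le _ _).trans (add_le_add ?_ ?_)
        · rw [abs_mul, abs_of_nonneg (hχ01 z).1]
          exact mul_le_of_le_one_left (abs_nonneg _) (hχ01 z).2
        · rw [abs_mul, abs_of_nonneg hz0]
          exact mul_le_mul_of_nonneg_right (hD z) hz0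
      have h3 : (ut z ^ (κ - 1)) ^ p ≤ u z ^ (m - 1) := by
        rw [← Real.rpow_mul (hut0 z), hm1]
        exact Real.rpow_le_rpow (hut0 z) h1 (by linarith)
      have h4 : |bt i z| ^ p ≤ 2 ^ (p - 1) * (|b i z| ^ p + (D * u z) ^ p) := by
        refine (Real.rpow_le_rpow (abs_nonneg _) h2 hp0.le).trans ?_
        exact real_rpow_add_le (abs_nonneg _) (by positivity) hp.le
      have h5 : u z ^ (m - 1) * u z ^ p = u z ^ (p + m - 1) := by
        rw [← Real.rpow_add_of_nonneg hz0 (by linarith) hp0.le]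
        congr 1; ring
      rw [abs_mul, abs_of_nonneg (Real.rpow_nonneg (hut0 z) _),
        Real.mul_rpow (Real.rpow_nonneg (hut0 z) _) (abs_nonneg _)]
      calc _ ≤ u z ^ (m - 1) * (2 ^ (p - 1) * (|b i z| ^ p + (D * u z) ^ p)) := by
            gcongr
        _ = 2 ^ (p - 1) * (|b i z| ^ p * u z ^ (m - 1) + D ^ p * (u z ^ (m - 1) * u z ^ p)) := by
            rw [Real.mul_rpow hD0 hz0]; ring
        _ = _ := by rw [h5]
  have hvs : Function.support (fun z ↦ ut z ^ κ) ⊆ T := fun z hz ↦ by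
    by_contra hzT
    exact hz (by simp only [hutT z hzT]; exact Real.zero_rpow (by linarith))
  have hvI : Integrable (fun z ↦ ut z ^ κ) volume :=
    integrable_of_memLp_of_support hp.le hvp hTc hvs
  have hws : ∀ i, Function.support (fun z ↦ ut z ^ (κ - 1) * bt i z) ⊆ T := fun i z hz ↦ by
    by_contra hzT
    exact hz (by simp only [hbtT i z hzT, mul_zero])
  have hwI : ∀ i, Integrable (fun z ↦ ut z ^ (κ - 1) * bt i z) volume := fun i ↦
    integrable_of_memLp_of_support hp.le (hwp i) hTc (hws i)
  have hGlip : ∀ s t, |G s - G t| ≤ L * |s - t| := fun s t ↦ by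
    have hlip : LipschitzWith L.toNNReal G := lipschitzWith_of_nnnorm_deriv_le
      (fun s ↦ (hG s).differentiableAt) fun s ↦ by
        rw [(hG s).deriv, ← NNReal.coe_le_coe, Real.coe_toNNReal _ hL0]
        exact hL s
    have := hlip.dist_le_mul s t
    rwa [Real.dist_eq, Real.dist_eq, Real.coe_toNNReal _ hL0] at this
  -- The factor `L` in `v` absorbs the Lipschitz constant of `G` in the oscillation inequality.
  obtain ⟨g, h1, h2, h3, h4, h5, h6, A, hA, h7⟩ := exists_lipschitz_approx hp.le
    (c := fun z ↦ ut z ^ (κ - 1)) (v := fun z ↦ L * ut z ^ κ)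
    (w := fun i z ↦ L * (κ * (ut z ^ (κ - 1) * bt i z))) hutI hbtI hutb (hvI.const_mul L)
    (hvp.const_mul L) (fun i ↦ ((hwI i).const_mul κ).const_mul L)
    (fun i ↦ ((hwp i).const_mul κ).const_mul L)
    (fun i ↦ ((hutb i).rpow hutI (hbtI i) hut0 hκ hvI (hwI i)).const_mul L) hG hG' hL hG0 hGB
    (fun z z' ↦ by
      rw [abs_of_nonneg (Real.rpow_nonneg (hut0 z) _), ← mul_sub, abs_mul, abs_of_nonneg hL0]
      calc _ ≤ ut z ^ (κ - 1) * (L * |ut z' - ut z|) :=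
            mul_le_mul_of_nonneg_left (hGlip _ _) (Real.rpow_nonneg (hut0 z) _)
        _ = L * (ut z ^ (κ - 1) * |ut z' - ut z|) := by ring
        _ ≤ _ := mul_le_mul_of_nonneg_left
            (rpow_sub_one_mul_abs_sub_le hκ (hut0 z) (hut0 z')) hL0)
  have hutK : ∀ᵐ z, z ∈ K → ut z = u z := by
    filter_upwards [hu0] with z hz hzK
    simp only [hut]
    rw [(hχ1 z hzK).eq_of_nhds, max_eq_left (hz (hKΩ hzK))]
    simp
  refine ⟨g, h1, h2, h3, h4, ?_, fun i ↦ ?_, A, hA, fun n i ↦ ?_⟩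
  · filter_upwards [h5, hutK] with z hz hz2 hzK
    rw [← hz2 hzK]
    exact hz
  · filter_upwards [h6 i, hutK] with z hz hz2 hzK
    have : bt i z = b i z := by
      simp only [hbt]
      rw [(hχ1 z hzK).eq_of_nhds, (hχ1 z hzK).fderiv_eq]
      simp
    rw [← hz2 hzK, ← this]
    exact hz
  · refine le_trans ?_ (h7 n i)
    rw [← lintegral_indicator hK.measurableSet]
    refine lintegral_mono_ae ?_
    filter_upwards [hutK] with z hz2
    by_cases hzK : z ∈ K
    · rw [indicator_of_mem hzK, hz2 hzK, hκ1]
    · rw [indicator_of_notMem hzK]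
      exact zero_le

end LocalApprox

/-! ### Functions that are Lipschitz near a point -/

section LipschitzAt
open Filter Topology

/-- `f` is Lipschitz on a neighbourhood of `x`. -/
def LipAt {α : Type*} [PseudoEMetricSpace α] (f : α → ℝ) (x : α) : Prop :=
  ∃ C : NNReal, ∃ s ∈ 𝓝 x, LipschitzOnWith C f s

variable {α : Type*} [PseudoMetricSpace α] {f g : α → ℝ} {x : α}

theorem LipAt.mul (hf : LipAt f x) (hg : LipAt g x) : LipAt (fun y ↦ f y * g y) x := by
  obtain ⟨C, s, hs, hfs⟩ := hf
  obtain ⟨D, t, ht, hgt⟩ := hg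
  have hxs := mem_of_mem_nhds hs
  have hxt := mem_of_mem_nhds ht
  -- On the unit ball around `x` the factors are bounded by `|f x| + C` and `|g x| + D`; the
  -- constant is that of the product rule.
  refine ⟨(|f x| + C).toNNReal * D + (|g x| + D).toNNReal * C, s ∩ t ∩ Metric.ball x 1,
    inter_mem (inter_mem hs ht) (Metric.ball_mem_nhds x one_pos), ?_⟩
  refine LipschitzOnWith.of_dist_le_mul fun y hy z hz ↦ ?_
  have h1 := hfs.dist_le_mul y hy.1.1 z hz.1.1
  have h2 := hgt.dist_le_mul y hy.1.2 z hz.1.2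
  have h3 := hfs.dist_le_mul y hy.1.1 x hxs
  have h4 := hgt.dist_le_mul z hz.1.2 x hxt
  have hy1 : dist y x ≤ 1 := (Metric.mem_ball.1 hy.2).le
  have hz1 : dist z x ≤ 1 := (Metric.mem_ball.1 hz.2).le
  rw [Real.dist_eq] at h1 h2 h3 h4 ⊢
  have h5 : |f y| ≤ |f x| + C := by
    have := abs_sub_abs_le_abs_sub (f y) (f x)
    nlinarith [C.2, this, h3]
  have h6 : |g z| ≤ |g x| + D := by
    have := abs_sub_abs_le_abs_sub (g z) (g x)
    nlinarith [D.2, this, h4]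
  push_cast
  rw [Real.coe_toNNReal _ (by positivity), Real.coe_toNNReal _ (by positivity)]
  calc |f y * g y - f z * g z| = |f y * (g y - g z) + g z * (f y - f z)| := by ring_nf
    _ ≤ |f y| * |g y - g z| + |g z| * |f y - f z| := by
        refine (abs_add_le _ _).trans ?_
        rw [abs_mul, abs_mul]
    _ ≤ (|f x| + C) * (D * dist y z) + (|g x| + D) * (C * dist y z) := by gcongr
    _ = _ := by ring

theorem LipAt.congr (hf : LipAt f x) (h : f =ᶠ[𝓝 x] g) : LipAt g x := by
  obtain ⟨C, s, hs, hfs⟩ := hf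
  refine ⟨C, s ∩ {y | f y = g y}, inter_mem hs h, fun y hy z hz ↦ ?_⟩
  rw [← hy.2, ← hz.2]
  exact hfs hy.1 hz.1

theorem lipAt_of_notMem_tsupport (h : x ∉ tsupport f) : LipAt f x := by
  have : f =ᶠ[𝓝 x] fun _ ↦ 0 := notMem_tsupport_iff_eventuallyEq.1 h
  exact LipAt.congr ⟨0, univ, univ_mem, LipschitzOnWith.of_dist_le_mul (by simp)⟩ this.symm

theorem LipAt.comp {β : Type*} [PseudoMetricSpace β] {h : β → α} {y : β} (hf : LipAt f (h y))
    (hh : ∃ C : NNReal, ∃ s ∈ 𝓝 y, LipschitzOnWith C h s) : LipAt (f ∘ h) y := by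
  obtain ⟨C, s, hs, hfs⟩ := hf
  obtain ⟨D, t, ht, hht⟩ := hh
  have hc : ContinuousAt h y := hht.continuousOn.continuousAt ht
  exact ⟨C * D, t ∩ h ⁻¹' s, inter_mem ht (hc hs),
    hfs.comp (hht.mono inter_subset_left) fun z hz ↦ hz.2⟩

/-- A compactly supported locally Lipschitz function on a finite-dimensional space is Lipschitz. -/
theorem exists_lipschitzWith_of_lipAt {E : Type*} [NormedAddCommGroup E] [NormedSpace ℝ E]
    [FiniteDimensional ℝ E] {f : E → ℝ} (hf : ∀ z, LipAt f z) (hc : HasCompactSupport f) :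
    ∃ C, LipschitzWith C f := by
  have : ProperSpace E := FiniteDimensional.proper_rclike ℝ E
  have hll : LocallyLipschitz f := hf
  obtain ⟨R, hR⟩ := hc.isCompact.isBounded.subset_closedBall (0 : E)
  obtain ⟨B, hB⟩ := hc.exists_bound_of_continuous hll.continuous
  have hB0 : 0 ≤ B := (norm_nonneg _).trans (hB 0)
  obtain ⟨C, hC⟩ := (hll.locallyLipschitzOn (s := Metric.closedBall (0 : E) (R + 1))
    ).exists_lipschitzOnWith_of_compact (isCompact_closedBall _ _)
  -- Inside the ball of radius `R + 1` compactness provides the constant `C`. A point outside is at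
  -- distance at least `1` from the ball of radius `R` that contains the support, so there the sup
  -- bound `B` serves as a Lipschitz constant.
  have key : ∀ y z, y ∈ Metric.closedBall (0 : E) (R + 1) →
      dist (f y) (f z) ≤ max C B.toNNReal * dist y z := by
    intro y z hy
    by_cases hz : z ∈ Metric.closedBall (0 : E) (R + 1)
    · refine (hC.dist_le_mul y hy z hz).trans ?_
      gcongr
      exact_mod_cast le_max_left _ _
    · have hz0 : f z = 0 := by
        by_contra h
        exact hz (Metric.closedBall_subset_closedBall (by linarith) (hR (subset_tsupport _ h)))
      by_cases hy' : y ∈ Metric.closedBall (0 : E) R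
      · have h1 : 1 ≤ dist y z := by
          rw [mem_closedBall_zero_iff] at hy' hz
          rw [dist_eq_norm, norm_sub_rev]
          have := norm_sub_norm_le z y
          linarith
        rw [hz0, dist_zero_right]
        calc ‖f y‖ ≤ B * 1 := by rw [mul_one]; exact hB y
          _ ≤ max (C : ℝ) B.toNNReal * dist y z := by
              gcongr
              exact (Real.le_coe_toNNReal B).trans (le_max_right _ _)
      · have hy0 : f y = 0 := by
          by_contra h
          exact hy' (hR (subset_tsupport _ h))
        rw [hy0, hz0, dist_self]
        positivity
  refine ⟨max C B.toNNReal, LipschitzWith.of_dist_le_mul fun y z ↦ ?_⟩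
  by_cases hy : y ∈ Metric.closedBall (0 : E) (R + 1)
  · push_cast
    exact key y z hy
  by_cases hz : z ∈ Metric.closedBall (0 : E) (R + 1)
  · rw [dist_comm, dist_comm y]
    push_cast
    exact key z y hz
  · have h0 : ∀ y, y ∉ Metric.closedBall (0 : E) (R + 1) → f y = 0 := fun y hy ↦ by
      by_contra h
      exact hy (Metric.closedBall_subset_closedBall (by linarith) (hR (subset_tsupport _ h)))
    rw [h0 y hy, h0 z hz, dist_self]
    positivity

end LipschitzAt

/-! ### Testing with a function of the solution, in coordinates -/

section LocalLimit
open Filter Topology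

variable {N : ℕ}

local notation "𝕏" => EuclideanSpace ℝ (Fin N)

/-- The derivative of `h` in the space variable. -/
def spaceDeriv (h : 𝕏 × ℝ → ℝ) (z : 𝕏 × ℝ) (v : 𝕏) : ℝ :=
  fderiv ℝ (fun y ↦ h (y, z.2)) z.1 v

theorem spaceDeriv_eq_fderiv {h : 𝕏 × ℝ → ℝ} {z : 𝕏 × ℝ} (hh : DifferentiableAt ℝ h z) (v : 𝕏) :
    spaceDeriv h z v = fderiv ℝ h z (v, 0) := by
  have h1 : HasFDerivAt (fun y ↦ h (y, z.2)) _ z.1 :=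
    (show HasFDerivAt h (fderiv ℝ h z) (z.1, z.2) from hh.hasFDerivAt).comp z.1
      (hasFDerivAt_prodMk_left z.1 z.2)
  rw [spaceDeriv, h1.fderiv]
  rfl

theorem fderiv_space_eq_sum (L : 𝕏 × ℝ →L[ℝ] ℝ) (v : 𝕏) :
    L (v, 0) = ∑ i, v i * L (EuclideanSpace.single i 1, 0) := by
  have hy : ((v, 0) : 𝕏 × ℝ) = ∑ i, v i • (EuclideanSpace.single i (1 : ℝ), (0 : ℝ)) := by
    refine Prod.ext ?_ ?_
    · rw [Prod.fst_sum]
      ext j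
      simp [Pi.single_apply]
    · rw [Prod.snd_sum]
      simp
  rw [hy, map_sum]
  simp only [map_smul, smul_eq_mul]

theorem spaceDeriv_eq_zero {h : 𝕏 × ℝ → ℝ} {z : 𝕏 × ℝ} (hz : z ∉ tsupport h) (v : 𝕏) :
    spaceDeriv h z v = 0 := by
  have h1 : h =ᶠ[𝓝 z] fun _ ↦ 0 := notMem_tsupport_iff_eventuallyEq.1 hz
  rw [spaceDeriv_eq_fderiv ((differentiableAt_const (0 : ℝ)).congr_of_eventuallyEq h1),
    h1.fderiv_eq]
  simp

theorem lineDeriv_eq_zero_of_notMem_tsupport {h : 𝕏 × ℝ → ℝ} {z : 𝕏 × ℝ} (hz : z ∉ tsupport h)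
    (v : 𝕏 × ℝ) : lineDeriv ℝ h z v = 0 := by
  have h1 : h =ᶠ[𝓝 z] fun _ ↦ 0 := notMem_tsupport_iff_eventuallyEq.1 hz
  rw [h1.lineDeriv_eq]
  simp [lineDeriv]

/-- The weight does not depend on time, so it passes through the time derivative whether or not `h`
is differentiable. -/
theorem lineDeriv_fst_mul (ρ : 𝕏 → ℝ) (h : 𝕏 × ℝ → ℝ) (z : 𝕏 × ℝ) :
    lineDeriv ℝ (fun z ↦ ρ z.1 * h z) z (0, 1) = ρ z.1 * lineDeriv ℝ h z (0, 1) := by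
  simp [lineDeriv]

/-- Passage to the limit in the weak inequality, tested with `φ g` for `g` close to `G(u)`. -/
theorem local_weak_inequality {p p' m : ℝ} (hpp : p.HolderConjugate p') (hm : 1 ≤ m)
    {Ω : Set (𝕏 × ℝ)} (hΩ : IsOpen Ω) {u w : 𝕏 × ℝ → ℝ} {b : Fin N → 𝕏 × ℝ → ℝ}
    (hu : LocallyIntegrableOn u Ω) (hb : ∀ i, LocallyIntegrableOn (b i) Ω)
    (hw : LocallyIntegrableOn w Ω)
    (hub : ∀ i, HasWeakLineDerivOn volume Ω u (b i) (EuclideanSpace.single i 1, 0))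
    (huw : HasWeakLineDerivOn volume Ω u w (0, 1))
    (hu0 : ∀ᵐ z, z ∈ Ω → 0 ≤ u z) (hup : LocallyIntegrableOn (fun z ↦ u z ^ (p + m - 1)) Ω)
    (hbp : ∀ i, LocallyIntegrableOn (fun z ↦ |b i z| ^ p * u z ^ (m - 1)) Ω)
    {γ : 𝕏 × ℝ → 𝕏} {Θ S : 𝕏 × ℝ → ℝ} (hS : LocallyIntegrableOn S Ω)
    (hP : ∀ i, LocallyIntegrableOn (fun z ↦ γ z i * Θ z) Ω) {F : Fin N → 𝕏 × ℝ → ℝ}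
    (hFm : ∀ i, AEStronglyMeasurable (F i) (volume.restrict Ω))
    (hF : ∀ i, LocallyIntegrableOn (fun z ↦ |F i z| ^ p') Ω)
    (hPF : ∀ i, ∀ᵐ z, z ∈ Ω → γ z i * Θ z = F i z * u z ^ ((m - 1) / p))
    {ρ : 𝕏 → ℝ} (hρ : ∀ z ∈ Ω, LipAt (fun z : 𝕏 × ℝ ↦ ρ z.1) z)
    {φ : 𝕏 × ℝ → ℝ} {Cφ : NNReal} (hφ : LipschitzWith Cφ φ) (hφc : HasCompactSupport φ)
    (hφΩ : tsupport φ ⊆ Ω)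
    (hweak : ∀ g : 𝕏 × ℝ → ℝ, (∃ C, LipschitzWith C g) → Differentiable ℝ g → (∀ z, 0 ≤ g z) →
      ∫ z in Ω, φ z * g z * S z ≤ (∫ z in Ω, spaceDeriv (fun z ↦ φ z * g z) z (γ z) * Θ z) -
        ∫ z in Ω, ρ z.1 * lineDeriv ℝ (fun z ↦ φ z * g z) z (0, 1) * u z)
    {G G' J : ℝ → ℝ} (hG : ∀ s, HasDerivAt G (G' s) s) (hG' : Continuous G') {L : ℝ}
    (hL : ∀ s, |G' s| ≤ L) {B : ℝ} (hG0 : ∀ s, 0 ≤ G s) (hGB : ∀ s, G s ≤ B)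
    (hJ : ∀ s, HasDerivAt J (G s) s) :
    ∫ z in Ω, φ z * G (u z) * S z ≤
      (∫ z in Ω, (G (u z) * spaceDeriv φ z (γ z) + φ z * G' (u z) * ∑ i, γ z i * b i z) * Θ z) -
        ∫ z in Ω, ρ z.1 * lineDeriv ℝ φ z (0, 1) * J (u z) := by
  have hp := hpp.lt
  have hp0 := hpp.pos
  set K := tsupport φ with hK
  have hKc : IsCompact K := hφc
  have hKm : MeasurableSet K := hKc.measurableSet
  have hΩm : MeasurableSet Ω := hΩ.measurableSet
  have hφ0 : ∀ z, z ∉ K → φ z = 0 := fun z hz ↦ image_eq_zero_of_notMem_tsupport hz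
  have hGc : Continuous G := continuous_iff_continuousAt.2 fun s ↦ (hG s).continuousAt
  have hB0 : 0 ≤ B := (hG0 0).trans (hGB 0)
  have hGabs : ∀ s, |G s| ≤ B := fun s ↦ by rw [abs_of_nonneg (hG0 s)]; exact hGB s
  obtain ⟨Bφ, hBφ⟩ := hφc.exists_bound_of_continuous hφ.continuous
  have hBφ0 : 0 ≤ Bφ := (norm_nonneg _).trans (hBφ 0)
  have hφm : AEStronglyMeasurable φ (volume.restrict K) := hφ.continuous.aestronglyMeasurable
  -- integrals over `Ω` and `K`
  have hΩK : ∀ {H : 𝕏 × ℝ → ℝ}, (∀ z, z ∉ K → H z = 0) → ∫ z in Ω, H z = ∫ z in K, H z :=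
    fun hH ↦ setIntegral_eq_of_subset_of_forall_sdiff_eq_zero hΩm hφΩ fun z hz ↦ hH z hz.2
  have hKi : ∀ {H : 𝕏 × ℝ → ℝ}, (∀ z, z ∉ K → H z = 0) → ∫ z in K, H z = ∫ z, H z :=
    fun hH ↦ setIntegral_eq_integral_of_forall_compl_eq_zero hH
  obtain ⟨g, hg1, hg2, hg3, hg4, hg5, hg6, A, hA, hg7⟩ := exists_lipschitz_approx_on hp hm hΩ hKc
    hφΩ hu hb hub hu0 hup hbp hG hG' hL hG0 hGB
  have hdm : ∀ v : 𝕏 × ℝ, AEStronglyMeasurable (fun z ↦ lineDeriv ℝ φ z v) (volume.restrict K) :=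
    fun v ↦ aestronglyMeasurable_lineDeriv hφ.continuous _
  have hdb : ∀ (v z : 𝕏 × ℝ), ‖lineDeriv ℝ φ z v‖ ≤ Cφ * ‖v‖ := fun v z ↦
    norm_lineDeriv_le_of_lipschitz ℝ hφ
  have huK : IntegrableOn u K := hu.integrableOn_compact_subset hφΩ hKc
  have hwK : IntegrableOn w K := hw.integrableOn_compact_subset hφΩ hKc
  have hSK : IntegrableOn S K := hS.integrableOn_compact_subset hφΩ hKc
  have hPK : ∀ i, IntegrableOn (fun z ↦ γ z i * Θ z) K := fun i ↦
    (hP i).integrableOn_compact_subset hφΩ hKc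
  have hgm : ∀ n, AEStronglyMeasurable (g n) (volume.restrict K) := fun n ↦
    (hg2 n).continuous.aestronglyMeasurable
  have hgb : ∀ n z, ‖g n z‖ ≤ B := fun n z ↦ by
    rw [Real.norm_of_nonneg (hg3 n z)]; exact hg4 n z
  have hg5' : ∀ᵐ z ∂(volume.restrict K), Tendsto (fun n ↦ g n z) atTop (𝓝 (G (u z))) :=
    (ae_restrict_iff' hKm).2 hg5
  -- `ρ` is Lipschitz only near points of `Ω`; away from the support of `φ` the product vanishes
  -- identically.
  have hρφ : ∀ z, LipAt (fun z ↦ ρ z.1 * φ z) z := by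
    intro z
    by_cases hz : z ∈ K
    · exact (hρ z (hφΩ hz)).mul (hφ.locallyLipschitz z)
    · refine lipAt_of_notMem_tsupport fun h ↦ hz ?_
      exact (tsupport_mul_subset_right (f := fun z : 𝕏 × ℝ ↦ ρ z.1) (g := φ)) h
  have hρφc : HasCompactSupport (fun z ↦ ρ z.1 * φ z) := hφc.mul_left
  have hρφΩ : tsupport (fun z ↦ ρ z.1 * φ z) ⊆ Ω :=
    (tsupport_mul_subset_right (f := fun z : 𝕏 × ℝ ↦ ρ z.1) (g := φ)).trans hφΩ
  obtain ⟨Cρ, hCρ⟩ := exists_lipschitzWith_of_lipAt hρφ hρφc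
  obtain ⟨Bρ, hBρ⟩ := hρφc.exists_bound_of_continuous hCρ.continuous
  have hBρ0 : 0 ≤ Bρ := (norm_nonneg _).trans (hBρ 0)
  have hρφm : AEStronglyMeasurable (fun z ↦ ρ z.1 * φ z) (volume.restrict K) :=
    hCρ.continuous.aestronglyMeasurable
  -- the time term for the approximations
  have htime : ∀ n, ∫ z in Ω, ρ z.1 * lineDeriv ℝ (fun z ↦ φ z * g n z) z (0, 1) * u z =
      -∫ z in K, w z * (ρ z.1 * φ z) * g n z := by
    intro n
    obtain ⟨Cn, hCn⟩ := hg1 n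
    have hη : ∀ z, LipAt (fun z ↦ ρ z.1 * φ z * g n z) z := fun z ↦
      (hρφ z).mul (hCn.locallyLipschitz z)
    have hηc : HasCompactSupport (fun z ↦ ρ z.1 * φ z * g n z) := hρφc.mul_right
    have hηK : tsupport (fun z ↦ ρ z.1 * φ z * g n z) ⊆ K :=
      (tsupport_mul_subset_left (f := fun z ↦ ρ z.1 * φ z) (g := g n)).trans
        (tsupport_mul_subset_right (f := fun z : 𝕏 × ℝ ↦ ρ z.1) (g := φ))
    obtain ⟨C1, hC1⟩ := exists_lipschitzWith_of_lipAt hη hηc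
    have h1 := huw.integral_comp_mul_lineDeriv hΩ hu hw (H := fun s ↦ s) (H' := fun _ ↦ 1)
      (fun s ↦ hasDerivAt_id s) continuous_const (L := 1) (by simp) hC1 hηc (hηK.trans hφΩ)
    have h2 : ∀ z, lineDeriv ℝ (fun z ↦ ρ z.1 * φ z * g n z) z (0, 1) =
        ρ z.1 * lineDeriv ℝ (fun z ↦ φ z * g n z) z (0, 1) := by
      intro z
      rw [← lineDeriv_fst_mul]
      simp_rw [mul_assoc]
    have h3 : ∀ z, z ∉ K → ρ z.1 * lineDeriv ℝ (fun z ↦ φ z * g n z) z (0, 1) * u z = 0 := by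
      intro z hz
      rw [← h2, lineDeriv_eq_zero_of_notMem_tsupport fun h ↦ hz (hηK h), zero_mul]
    have h4 : ∀ z, z ∉ K → w z * (ρ z.1 * φ z) * g n z = 0 := fun z hz ↦ by simp [hφ0 z hz]
    rw [hΩK h3, hKi h3, hKi h4]
    simp_rw [h2, one_mul] at h1
    simp_rw [mul_comm _ (u _), mul_assoc] at h1 ⊢
    exact h1
  -- For the limit function the time derivative is moved back from `u` to `φ` by the chain rule for
  -- `J`, an antiderivative of `G`.
  have htime' : ∫ z in Ω, ρ z.1 * lineDeriv ℝ φ z (0, 1) * J (u z) =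
      -∫ z in K, w z * (ρ z.1 * φ z) * G (u z) := by
    have h1 := huw.integral_comp_mul_lineDeriv hΩ hu hw hJ hGc hGabs hCρ hρφc hρφΩ
    simp_rw [lineDeriv_fst_mul] at h1
    have h3 : ∀ z, z ∉ K → ρ z.1 * lineDeriv ℝ φ z (0, 1) * J (u z) = 0 := by
      intro z hz
      rw [lineDeriv_eq_zero_of_notMem_tsupport hz, mul_zero, zero_mul]
    have h4 : ∀ z, z ∉ K → w z * (ρ z.1 * φ z) * G (u z) = 0 := fun z hz ↦ by simp [hφ0 z hz]
    rw [hΩK h3, hKi h3, hKi h4]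
    simp_rw [mul_comm _ (J _)]
    rw [h1]
    congr 1
    exact integral_congr_ae (Eventually.of_forall fun z ↦ by ring)
  -- the spatial derivative of products
  have hdiff : ∀ᵐ z ∂(volume : Measure (𝕏 × ℝ)), DifferentiableAt ℝ φ z := hφ.ae_differentiableAt
  have hsp : ∀ᵐ z ∂(volume.restrict K), ∀ v, spaceDeriv φ z v =
      ∑ i, v i * lineDeriv ℝ φ z (EuclideanSpace.single i 1, 0) := by
    filter_upwards [ae_restrict_of_ae hdiff] with z hz v
    rw [spaceDeriv_eq_fderiv hz, fderiv_space_eq_sum]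
    simp_rw [hz.lineDeriv_eq_fderiv]
  have hspn : ∀ n, ∀ᵐ z ∂(volume.restrict K), spaceDeriv (fun z ↦ φ z * g n z) z (γ z) * Θ z =
      ∑ i, (g n z * (lineDeriv ℝ φ z (EuclideanSpace.single i 1, 0) * (γ z i * Θ z)) +
        φ z * (γ z i * Θ z) * fderiv ℝ (g n) z (EuclideanSpace.single i 1, 0)) := by
    intro n
    filter_upwards [ae_restrict_of_ae hdiff] with z hz
    have h1 : HasFDerivAt (fun z ↦ φ z * g n z) _ z := hz.hasFDerivAt.mul (hg2 n z).hasFDerivAt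
    rw [spaceDeriv_eq_fderiv h1.differentiableAt, h1.fderiv, fderiv_space_eq_sum, Finset.sum_mul]
    refine Finset.sum_congr rfl fun i _ ↦ ?_
    rw [hz.lineDeriv_eq_fderiv]
    simp only [_root_.add_apply, _root_.smul_apply, smul_eq_mul]
    ring
  -- limits of the four terms
  have hlimS : Tendsto (fun n ↦ ∫ z in Ω, φ z * g n z * S z) atTop
      (𝓝 (∫ z in Ω, φ z * G (u z) * S z)) := by
    simp_rw [fun n ↦ hΩK (H := fun z ↦ φ z * g n z * S z) fun z hz ↦ by simp [hφ0 z hz],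
      hΩK (H := fun z ↦ φ z * G (u z) * S z) fun z hz ↦ by simp [hφ0 z hz]]
    refine tendsto_integral_of_dominated_convergence (fun z ↦ Bφ * B * ‖S z‖)
      (fun n ↦ (hφm.mul (hgm n)).mul hSK.1) (hSK.norm.const_mul _)
      (fun n ↦ Eventually.of_forall fun z ↦ ?_) ?_
    · rw [norm_mul, norm_mul]
      have h1 := hBφ z
      have h2 := hgb n z
      gcongr
    · filter_upwards [hg5'] with z hz
      exact (hz.const_mul _).mul_const _
  have hlimw : Tendsto (fun n ↦ ∫ z in K, w z * (ρ z.1 * φ z) * g n z) atTop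
      (𝓝 (∫ z in K, w z * (ρ z.1 * φ z) * G (u z))) := by
    refine tendsto_integral_of_dominated_convergence (fun z ↦ ‖w z‖ * Bρ * B)
      (fun n ↦ (hwK.1.mul hρφm).mul (hgm n)) ((hwK.norm.mul_const _).mul_const _)
      (fun n ↦ Eventually.of_forall fun z ↦ ?_) ?_
    · rw [norm_mul, norm_mul]
      have h1 := hBρ z
      have h2 := hgb n z
      gcongr
    · filter_upwards [hg5'] with z hz
      exact hz.const_mul _
  have hA_int : ∀ (g' : 𝕏 × ℝ → ℝ), AEStronglyMeasurable g' (volume.restrict K) →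
      (∀ z, ‖g' z‖ ≤ B) → ∀ i, Integrable (fun z ↦ g' z *
        (lineDeriv ℝ φ z (EuclideanSpace.single i 1, 0) * (γ z i * Θ z))) (volume.restrict K) := by
    intro g' hg'm hg'b i
    exact ((hPK i).bdd_mul (hdm _) (Eventually.of_forall (hdb _))).bdd_mul hg'm
      (Eventually.of_forall hg'b)
  have hGum : AEStronglyMeasurable (fun z ↦ G (u z)) (volume.restrict K) :=
    hGc.comp_aestronglyMeasurable huK.1
  have hlimA : ∀ i, Tendsto (fun n ↦ ∫ z in K, g n z *
      (lineDeriv ℝ φ z (EuclideanSpace.single i 1, 0) * (γ z i * Θ z))) atTop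
      (𝓝 (∫ z in K, G (u z) *
        (lineDeriv ℝ φ z (EuclideanSpace.single i 1, 0) * (γ z i * Θ z)))) := by
    intro i
    have hI := (hPK i).bdd_mul (hdm (EuclideanSpace.single i 1, 0))
      (Eventually.of_forall (hdb (EuclideanSpace.single i 1, 0)))
    refine tendsto_integral_of_dominated_convergence
      (fun z ↦ B * ‖lineDeriv ℝ φ z (EuclideanSpace.single i 1, 0) * (γ z i * Θ z)‖)
      (fun n ↦ (hA_int _ (hgm n) (hgb n) i).1) (hI.norm.const_mul _)
      (fun n ↦ Eventually.of_forall fun z ↦ ?_) ?_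
    · rw [norm_mul]
      have h2 := hgb n z
      gcongr
    · filter_upwards [hg5'] with z hz
      exact hz.mul_const _
  have hPF' : ∀ i, ∀ᵐ z ∂(volume.restrict K), γ z i * Θ z = F i z * u z ^ ((m - 1) / p) :=
    fun i ↦ by
      refine (ae_restrict_iff' hKm).2 ?_
      filter_upwards [hPF i] with z hz hzK using hz (hφΩ hzK)
  -- The one term containing `∇gₙ`, for which no dominating function is at hand. It is `φ F`, with
  -- `F` in `L^(p')`, paired with `u^((m-1)/p) ∇gₙ`, which is bounded in `Lᵖ` and converges a.e.
  have hlimB : ∀ i, Integrable (fun z ↦ φ z * (γ z i * Θ z) * (G' (u z) * b i z))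
        (volume.restrict K) ∧
      (∀ n, Integrable (fun z ↦ φ z * (γ z i * Θ z) *
        fderiv ℝ (g n) z (EuclideanSpace.single i 1, 0)) (volume.restrict K)) ∧
      Tendsto (fun n ↦ ∫ z in K, φ z * (γ z i * Θ z) *
        fderiv ℝ (g n) z (EuclideanSpace.single i 1, 0)) atTop
      (𝓝 (∫ z in K, φ z * (γ z i * Θ z) * (G' (u z) * b i z))) := by
    intro i
    have hFmK : AEStronglyMeasurable (F i) (volume.restrict K) :=
      (hFm i).mono_measure (Measure.restrict_mono hφΩ le_rfl)
    have hFK : ∫⁻ z in K, ‖φ z * F i z‖ₑ ^ p' ≠ ⊤ := by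
      have h1 : IntegrableOn (fun z ↦ |F i z| ^ p') K :=
        (hF i).integrableOn_compact_subset hφΩ hKc
      have h2 : ∀ z, ‖φ z * F i z‖ₑ ^ p' ≤ ENNReal.ofReal (Bφ ^ p') * ‖|F i z| ^ p'‖ₑ := by
        intro z
        have hp'0 := hpp.symm.pos.le
        rw [← ofReal_norm, ← ofReal_norm, ENNReal.ofReal_rpow_of_nonneg (norm_nonneg _) hp'0,
          ← ENNReal.ofReal_mul (by have := (norm_nonneg _).trans (hBφ 0); positivity), norm_mul,
          Real.mul_rpow (norm_nonneg _) (norm_nonneg _),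
          Real.norm_of_nonneg (Real.rpow_nonneg (abs_nonneg _) _)]
        refine ENNReal.ofReal_le_ofReal (mul_le_mul_of_nonneg_right
          (Real.rpow_le_rpow (norm_nonneg _) (hBφ z) hp'0) (by positivity))
      refine (lt_of_le_of_lt (lintegral_mono h2) ?_).ne
      rw [lintegral_const_mul' _ _ ENNReal.ofReal_ne_top]
      exact ENNReal.mul_lt_top ENNReal.ofReal_lt_top h1.2
    obtain ⟨r1, r2, r3⟩ := tendsto_integral_mul_of_bounded (μ := volume.restrict K) hpp
      (F := fun z ↦ φ z * F i z) (hφm.mul hFmK) hFK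
      (f := fun n z ↦ u z ^ ((m - 1) / p) * fderiv ℝ (g n) z (EuclideanSpace.single i 1, 0))
      (f₀ := fun z ↦ u z ^ ((m - 1) / p) * (G' (u z) * b i z))
      (fun n ↦ (huK.1.aemeasurable.pow_const _).aestronglyMeasurable.mul
        (measurable_fderiv_apply_const ℝ (g n) _).aestronglyMeasurable) hA
      (fun n ↦ hg7 n i) (by
        filter_upwards [(ae_restrict_iff' hKm).2 (hg6 i)] with z hz
        exact hz.const_mul _)
    have hc1 : (fun z ↦ φ z * F i z * (u z ^ ((m - 1) / p) * (G' (u z) * b i z)))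
        =ᵐ[volume.restrict K] fun z ↦ φ z * (γ z i * Θ z) * (G' (u z) * b i z) := by
      filter_upwards [hPF' i] with z hz
      rw [hz]; ring
    have hc2 : ∀ n, (fun z ↦ φ z * F i z * (u z ^ ((m - 1) / p) *
        fderiv ℝ (g n) z (EuclideanSpace.single i 1, 0))) =ᵐ[volume.restrict K]
        fun z ↦ φ z * (γ z i * Θ z) * fderiv ℝ (g n) z (EuclideanSpace.single i 1, 0) := by
      intro n
      filter_upwards [hPF' i] with z hz
      rw [hz]; ring
    refine ⟨r1.congr hc1, fun n ↦ (r2 n).congr (hc2 n), ?_⟩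
    rw [← integral_congr_ae hc1]
    refine r3.congr fun n ↦ ?_
    exact integral_congr_ae (hc2 n)
  have hsum : ∀ n, ∫ z in Ω, spaceDeriv (fun z ↦ φ z * g n z) z (γ z) * Θ z =
      ∑ i, ((∫ z in K, g n z * (lineDeriv ℝ φ z (EuclideanSpace.single i 1, 0) * (γ z i * Θ z))) +
        ∫ z in K, φ z * (γ z i * Θ z) * fderiv ℝ (g n) z (EuclideanSpace.single i 1, 0)) := by
    intro n
    rw [hΩK (H := fun z ↦ spaceDeriv (fun z ↦ φ z * g n z) z (γ z) * Θ z) fun z hz ↦ by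
      rw [spaceDeriv_eq_zero fun h ↦ hz (tsupport_mul_subset_left (f := φ) (g := g n) h),
        zero_mul], integral_congr_ae (hspn n)]
    refine (integral_finsetSum _ fun i _ ↦
      (hA_int _ (hgm n) (hgb n) i).add ((hlimB i).2.1 n)).trans ?_
    exact Finset.sum_congr rfl fun i _ ↦
      integral_add (hA_int _ (hgm n) (hgb n) i) ((hlimB i).2.1 n)
  have hsum' : ∫ z in Ω, (G (u z) * spaceDeriv φ z (γ z) +
      φ z * G' (u z) * ∑ i, γ z i * b i z) * Θ z =
      ∑ i, ((∫ z in K, G (u z) *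
        (lineDeriv ℝ φ z (EuclideanSpace.single i 1, 0) * (γ z i * Θ z))) +
        ∫ z in K, φ z * (γ z i * Θ z) * (G' (u z) * b i z)) := by
    have hI := hA_int _ hGum (fun z ↦ hGabs _)
    rw [hΩK (H := fun z ↦ (G (u z) * spaceDeriv φ z (γ z) +
      φ z * G' (u z) * ∑ i, γ z i * b i z) * Θ z) fun z hz ↦ by
        rw [spaceDeriv_eq_zero hz, hφ0 z hz]; ring]
    have h1 : ∀ᵐ z ∂(volume.restrict K), (G (u z) * spaceDeriv φ z (γ z) +
        φ z * G' (u z) * ∑ i, γ z i * b i z) * Θ z =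
        ∑ i, (G (u z) * (lineDeriv ℝ φ z (EuclideanSpace.single i 1, 0) * (γ z i * Θ z)) +
          φ z * (γ z i * Θ z) * (G' (u z) * b i z)) := by
      filter_upwards [hsp] with z hz
      rw [hz, Finset.mul_sum, Finset.mul_sum, ← Finset.sum_add_distrib, Finset.sum_mul]
      refine Finset.sum_congr rfl fun i _ ↦ ?_
      ring
    rw [integral_congr_ae h1]
    refine (integral_finsetSum _ fun i _ ↦ (hI i).add (hlimB i).1).trans ?_
    exact Finset.sum_congr rfl fun i _ ↦ integral_add (hI i) (hlimB i).1
  have hlimflux : Tendsto (fun n ↦ ∫ z in Ω, spaceDeriv (fun z ↦ φ z * g n z) z (γ z) * Θ z) atTop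
      (𝓝 (∫ z in Ω, (G (u z) * spaceDeriv φ z (γ z) +
        φ z * G' (u z) * ∑ i, γ z i * b i z) * Θ z)) := by
    rw [hsum']
    simp_rw [hsum]
    exact tendsto_finsetSum _ fun i _ ↦ (hlimA i).add (hlimB i).2.2
  refine le_of_tendsto_of_tendsto' hlimS (hlimflux.sub ?_) fun n ↦ hweak (g n) (hg1 n) (hg2 n) (hg3 n)
  rw [htime']
  simp_rw [htime]
  exact hlimw.neg

end LocalLimit

/-! ### Weighted integrals, test functions and derivatives in a chart -/

section ChartTransfer
open Filter Topology
variable {N : ℕ} {M : Type*} [MetricSpace M] [ChartedSpace (EuclideanSpace ℝ (Fin N)) M]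
  [MeasurableSpace M] [BorelSpace M]
  [RiemannianBundle (fun x : M ↦ TangentSpace (𝓡 N) x)] [IsManifold (𝓡 N) ∞ M]
  [IsContMDiffRiemannianBundle (𝓡 N) ∞ (EuclideanSpace ℝ (Fin N))
      (fun x : M ↦ TangentSpace (𝓡 N) x)]
  [SecondCountableTopology M]

/-- The density of `a dμ` in the chart around `c`. -/
def chartWeight (a : M → ℝ) (c : M) (y : EuclideanSpace ℝ (Fin N)) : ℝ :=
  max (a ((chartAt (EuclideanSpace ℝ (Fin N)) c).symm y)) 0 * metricDensity c y

theorem weightedMeasure_prod {a : M → ℝ} (ha : Measurable a) :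
    (weightedMeasure N a).prod volume =
      (stMeasure N M).withDensity fun z ↦ ENNReal.ofReal (a z.1) := by
  rw [weightedMeasure, prod_withDensity_left ha.ennreal_ofReal]
  rfl

theorem measurableSet_cylinder : MeasurableSet (cylinder M) :=
  MeasurableSet.univ.prod measurableSet_Ioi

theorem stSource_subset_cylinder (c : M) : stSource N c ⊆ cylinder M :=
  prod_mono (subset_univ _) subset_rfl

/-- `ENNReal.ofReal` truncates `a` at zero; writing `max (a z.1) 0` keeps the identity exact without
assuming `a ≥ 0` everywhere. -/
theorem integrableOn_weighted_iff' {a : M → ℝ} (ha : Measurable a) {s : Set (M × ℝ)}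
    (hs : MeasurableSet s) {F : M × ℝ → ℝ} :
    IntegrableOn F s ((weightedMeasure N a).prod volume) ↔
      IntegrableOn (fun z ↦ max (a z.1) 0 * F z) s (stMeasure N M) := by
  have hm : Measurable fun z : M × ℝ ↦ ENNReal.ofReal (a z.1) :=
    (ha.comp measurable_fst).ennreal_ofReal
  rw [weightedMeasure_prod ha, IntegrableOn, restrict_withDensity hs,
    integrable_withDensity_iff_integrable_smul' hm
      (Eventually.of_forall fun _ ↦ ENNReal.ofReal_lt_top)]
  simp_rw [ENNReal.toReal_ofReal', smul_eq_mul]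
  rfl

theorem setIntegral_weighted' {a : M → ℝ} (ha : Measurable a) {s : Set (M × ℝ)}
    (hs : MeasurableSet s) (F : M × ℝ → ℝ) :
    ∫ z in s, F z ∂((weightedMeasure N a).prod volume) =
      ∫ z in s, max (a z.1) 0 * F z ∂(stMeasure N M) := by
  have hm : Measurable fun z : M × ℝ ↦ ENNReal.ofReal (a z.1) :=
    (ha.comp measurable_fst).ennreal_ofReal
  rw [weightedMeasure_prod ha, restrict_withDensity hs,
    integral_withDensity_eq_integral_toReal_smul hm
      (Eventually.of_forall fun _ ↦ ENNReal.ofReal_lt_top)]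
  simp_rw [ENNReal.toReal_ofReal', smul_eq_mul]

theorem setIntegral_weighted {a : M → ℝ} (ha : Measurable a) (c : M) {F : M × ℝ → ℝ}
    (hF : ∀ z, z ∉ stSource N c → F z = 0) :
    ∫ z in cylinder M, F z ∂((weightedMeasure N a).prod volume) =
      ∫ z in stDomain N c, chartWeight a c z.1 * F (stParam c z) := by
  rw [setIntegral_weighted' ha measurableSet_cylinder,
    setIntegral_cylinder_eq c fun z hz ↦ by rw [hF z hz, mul_zero]]
  refine integral_congr_ae (Eventually.of_forall fun z ↦ ?_)
  simp only [chartWeight, stParam]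
  ring

theorem integrableOn_weighted_iff {a : M → ℝ} (ha : Measurable a) (c : M) {F : M × ℝ → ℝ}
    (hF : ∀ z, z ∉ stSource N c → F z = 0) :
    IntegrableOn F (cylinder M) ((weightedMeasure N a).prod volume) ↔
      IntegrableOn (fun z ↦ chartWeight a c z.1 * F (stParam c z)) (stDomain N c) := by
  rw [integrableOn_weighted_iff' ha measurableSet_cylinder]
  have h1 : IntegrableOn (fun z ↦ max (a z.1) 0 * F z) (cylinder M) (stMeasure N M) ↔
      IntegrableOn (fun z ↦ max (a z.1) 0 * F z) (stSource N c) (stMeasure N M) := by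
    refine ⟨fun h ↦ h.mono_set (stSource_subset_cylinder c), fun h ↦ ?_⟩
    refine ((integrableOn_iff_integrable_of_support_subset fun z hz ↦ ?_).1 h).integrableOn
    by_contra hz'
    exact hz (by simp only [hF z hz', mul_zero])
  rw [h1, integrableOn_stSource_iff]
  have h2 : ∀ z : EuclideanSpace ℝ (Fin N) × ℝ, metricDensity c z.1 *
      (max (a (stParam c z).1) 0 * F (stParam c z)) = chartWeight a c z.1 * F (stParam c z) := by
    intro z
    simp only [chartWeight, stParam]
    ring
  simp_rw [h2]

/-- Unlike the Riemannian density, the weight `a` may vanish at some points and cannot be divided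
out, so it stays in the integrand. -/
theorem locallyIntegrableOn_chartWeight_mul {a : M → ℝ} (ha : Continuous a) (c : M)
    {F : M × ℝ → ℝ}
    (hF : LocallyIntegrableOn F (cylinder M) ((weightedMeasure N a).prod volume)) :
    LocallyIntegrableOn (fun z ↦ chartWeight a c z.1 * F (stParam c z)) (stDomain N c) := by
  rw [locallyIntegrableOn_iff (isOpen_stDomain c).isLocallyClosed]
  intro K hK hKc
  have hK' : IsCompact (stParam c '' K) := hKc.image_of_continuousOn
    ((continuousOn_stParam c).mono hK)
  have hsub : stParam c '' K ⊆ stSource N c := by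
    rintro _ ⟨z, hz, rfl⟩
    exact mapsTo_stParam c (hK hz)
  have h1 : IntegrableOn F (stParam c '' K) ((weightedMeasure N a).prod volume) :=
    hF.integrableOn_compact_subset (hsub.trans (stSource_subset_cylinder c)) hK'
  have h2 : IntegrableOn ((stParam c '' K).indicator F) (cylinder M)
      ((weightedMeasure N a).prod volume) :=
    ((integrable_indicator_iff hK'.measurableSet).2 h1).integrableOn
  rw [integrableOn_weighted_iff ha.measurable c fun z hz ↦
    indicator_of_notMem (fun h ↦ hz (hsub h)) F] at h2
  refine (h2.mono_set hK).congr_fun (fun z hz ↦ ?_) hKc.measurableSet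
  simp only
  rw [indicator_of_mem (mem_image_of_mem _ hz)]

theorem lipAt_of_contDiffAt {E : Type*} [NormedAddCommGroup E] [NormedSpace ℝ E] {f : E → ℝ}
    {x : E} (hf : ContDiffAt ℝ 1 f x) : LipAt f x :=
  hf.exists_lipschitzOnWith

variable [IsRiemannianManifold (𝓡 N) M]

theorem exists_lipschitzOnWith_fst {α β : Type*} [PseudoMetricSpace α] [PseudoMetricSpace β]
    (z : α × β) :
    ∃ C : NNReal, ∃ s ∈ 𝓝 z, LipschitzOnWith C (Prod.fst : α × β → α) s :=
  ⟨1, univ, univ_mem, LipschitzWith.prod_fst.lipschitzOnWith⟩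

theorem lipAt_chartWeight {a : M → ℝ} (ha : LocallyLipschitz a) (c : M)
    {z : EuclideanSpace ℝ (Fin N) × ℝ} (hz : z ∈ stDomain N c) :
    LipAt (fun z : EuclideanSpace ℝ (Fin N) × ℝ ↦ chartWeight a c z.1) z := by
  have h1 : LipAt (fun y ↦ max (a ((chartAt (EuclideanSpace ℝ (Fin N)) c).symm y)) 0) z.1 :=
    LipAt.comp (f := fun x ↦ max (a x) 0) (ha.max_const 0 _)
      (exists_lipschitzOnWith_chart_symm c hz.1)
  have h2 : LipAt (metricDensity (N := N) c) z.1 :=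
    lipAt_of_contDiffAt (((contDiffOn_metricDensity c).contDiffAt
      ((chartAt (EuclideanSpace ℝ (Fin N)) c).open_target.mem_nhds hz.1)).of_le
        (by exact_mod_cast le_top))
  exact LipAt.comp (f := chartWeight a c) (h1.mul h2) (exists_lipschitzOnWith_fst z)

theorem exists_lipschitzOnWith_prodMap {α β : Type*} [PseudoMetricSpace α] [PseudoMetricSpace β]
    {h : α → β} {z : α × ℝ} (hh : ∃ C : NNReal, ∃ s ∈ 𝓝 z.1, LipschitzOnWith C h s) :
    ∃ C : NNReal, ∃ s ∈ 𝓝 z, LipschitzOnWith C (fun z : α × ℝ ↦ (h z.1, z.2)) s := by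
  obtain ⟨C, s, hs, hhs⟩ := hh
  refine ⟨max C 1, Prod.fst ⁻¹' s, continuousAt_fst hs, LipschitzOnWith.of_dist_le_mul ?_⟩
  intro x hx y hy
  have h1 := hhs.dist_le_mul x.1 hx y.1 hy
  rw [Prod.dist_eq]
  push_cast
  refine max_le (h1.trans ?_) ?_
  · gcongr
    · exact le_max_left _ _
    · exact le_max_left _ _
  · calc dist x.2 y.2 ≤ 1 * dist x y := by rw [one_mul]; exact le_max_right _ _
      _ ≤ _ := by gcongr; exact le_max_right _ _

theorem exists_lipschitzOnWith_stParam (c : M) {z : EuclideanSpace ℝ (Fin N) × ℝ}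
    (hz : z ∈ stDomain N c) :
    ∃ C : NNReal, ∃ s ∈ 𝓝 z, LipschitzOnWith C (stParam (N := N) c) s :=
  exists_lipschitzOnWith_prodMap (exists_lipschitzOnWith_chart_symm c hz.1)

theorem exists_lipschitzOnWith_stChart (c : M) {z : M × ℝ} (hz : z ∈ stSource N c) :
    ∃ C : NNReal, ∃ s ∈ 𝓝 z, LipschitzOnWith C (stChart (N := N) c) s :=
  exists_lipschitzOnWith_prodMap (exists_lipschitzOnWith_chart c hz.1)

variable (N) in
/-- A function on `M × ℝ` in the chart around `c`, extended by zero. -/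
def chartPull (c : M) (φ : M × ℝ → ℝ) : EuclideanSpace ℝ (Fin N) × ℝ → ℝ :=
  (stDomain N c).indicator fun z ↦ φ (stParam c z)

theorem chartPull_of_mem (c : M) (φ : M × ℝ → ℝ) {z : EuclideanSpace ℝ (Fin N) × ℝ}
    (hz : z ∈ stDomain N c) : chartPull N c φ z = φ (stParam c z) :=
  indicator_of_mem hz _

theorem support_chartPull_subset (c : M) (φ : M × ℝ → ℝ) (hs : tsupport φ ⊆ stSource N c) :
    Function.support (chartPull N c φ) ⊆ stChart c '' tsupport φ := by
  intro z hz
  have hzΩ : z ∈ stDomain N c := by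
    by_contra h
    exact hz (indicator_of_notMem h _)
  have hz' : φ (stParam c z) ≠ 0 := by
    rw [← chartPull_of_mem c φ hzΩ]
    exact hz
  exact ⟨stParam c z, subset_tsupport _ hz', stChart_stParam c hzΩ⟩

theorem isCompact_stChart_image (c : M) {φ : M × ℝ → ℝ} (hφ : HasCompactSupport φ)
    (hs : tsupport φ ⊆ stSource N c) : IsCompact (stChart (N := N) c '' tsupport φ) :=
  hφ.isCompact.image_of_continuousOn ((continuousOn_stChart c).mono hs)

theorem hasCompactSupport_chartPull (c : M) {φ : M × ℝ → ℝ} (hφ : HasCompactSupport φ)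
    (hs : tsupport φ ⊆ stSource N c) : HasCompactSupport (chartPull N c φ) :=
  HasCompactSupport.of_support_subset_isCompact (isCompact_stChart_image c hφ hs)
    (support_chartPull_subset c φ hs)

theorem tsupport_chartPull_subset (c : M) {φ : M × ℝ → ℝ} (hφ : HasCompactSupport φ)
    (hs : tsupport φ ⊆ stSource N c) : tsupport (chartPull N c φ) ⊆ stDomain N c := by
  refine (closure_minimal (support_chartPull_subset c φ hs)
    (isCompact_stChart_image c hφ hs).isClosed).trans ?_
  rintro _ ⟨z, hz, rfl⟩
  exact mapsTo_stChart c (hs hz)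

theorem exists_lipschitzWith_chartPull (c : M) {φ : M × ℝ → ℝ} (hφl : LocallyLipschitz φ)
    (hφ : HasCompactSupport φ) (hs : tsupport φ ⊆ stSource N c) :
    ∃ C, LipschitzWith C (chartPull N c φ) := by
  refine exists_lipschitzWith_of_lipAt (fun z ↦ ?_) (hasCompactSupport_chartPull c hφ hs)
  by_cases hz : z ∈ tsupport (chartPull N c φ)
  · have hzΩ := tsupport_chartPull_subset c hφ hs hz
    have h1 : LipAt (φ ∘ stParam c) z :=
      LipAt.comp (hφl _) (exists_lipschitzOnWith_stParam c hzΩ)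
    refine h1.congr ?_
    filter_upwards [(isOpen_stDomain c).mem_nhds hzΩ] with y hy
    rw [chartPull_of_mem c φ hy]
    rfl
  · exact lipAt_of_notMem_tsupport hz

/-- The approximations of `G(u)` live in coordinates. Pulled back by the chart they are Lipschitz
only over its domain, but multiplied by `φ` they become admissible test functions on the manifold.
-/
theorem IsTestFunction.mul_chart {φ : M → ℝ → ℝ} (hφ : IsTestFunction φ) (c : M)
    (hs : tsupport (fun z : M × ℝ ↦ φ z.1 z.2) ⊆ stSource N c)
    {g : EuclideanSpace ℝ (Fin N) × ℝ → ℝ} (hg : ∃ C, LipschitzWith C g) (hg0 : ∀ z, 0 ≤ g z) :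
    IsTestFunction fun x t ↦ φ x t * g (stChart c (x, t)) := by
  obtain ⟨C, hC⟩ := hg
  have hsub : tsupport (fun z : M × ℝ ↦ φ z.1 z.2 * g (stChart c (z.1, z.2))) ⊆
      tsupport fun z : M × ℝ ↦ φ z.1 z.2 :=
    tsupport_mul_subset_left (f := fun z : M × ℝ ↦ φ z.1 z.2)
      (g := fun z : M × ℝ ↦ g (stChart c (z.1, z.2)))
  refine ⟨fun z ↦ ?_, hφ.compact.mul_right, hsub.trans hφ.support,
    fun x t ↦ mul_nonneg (hφ.nonneg x t) (hg0 _)⟩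
  by_cases hz : z ∈ tsupport fun z : M × ℝ ↦ φ z.1 z.2
  · refine LipAt.mul (f := fun z : M × ℝ ↦ φ z.1 z.2)
      (g := fun z : M × ℝ ↦ g (stChart c (z.1, z.2))) (hφ.lip z) ?_
    exact LipAt.comp (f := g) (h := stChart c) (hC.locallyLipschitz _)
      (exists_lipschitzOnWith_stChart c (hs hz))
  · exact lipAt_of_notMem_tsupport fun h ↦ hz (hsub h)

/-- The spatial differential in the chart around `c`. -/
theorem mfderiv_stParam_apply (c : M) {ψ : M → ℝ → ℝ} {h : EuclideanSpace ℝ (Fin N) × ℝ → ℝ}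
    (hψ : ∀ z ∈ stDomain N c, ψ (stParam c z).1 (stParam c z).2 = h z)
    {z : EuclideanSpace ℝ (Fin N) × ℝ} (hz : z ∈ stDomain N c)
    (v : TangentSpace (𝓡 N) ((chartAt (EuclideanSpace ℝ (Fin N)) c).symm z.1)) :
    (show ℝ from mfderiv (𝓡 N) 𝓘(ℝ, ℝ) (fun x ↦ ψ x z.2)
      ((chartAt (EuclideanSpace ℝ (Fin N)) c).symm z.1) v) =
      spaceDeriv h z (chartDeriv c _ v) := by
  rw [mfderiv_chart_symm_apply c hz.1, spaceDeriv]
  have : (fun y ↦ ψ ((chartAt (EuclideanSpace ℝ (Fin N)) c).symm y) z.2) =ᶠ[𝓝 z.1]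
      fun y ↦ h (y, z.2) := by
    filter_upwards [(chartAt (EuclideanSpace ℝ (Fin N)) c).open_target.mem_nhds hz.1] with y hy
    exact hψ (y, z.2) ⟨hy, hz.2⟩
  rw [this.fderiv_eq]

theorem mdifferentiableAt_stParam (c : M) {ψ : M → ℝ → ℝ}
    {h : EuclideanSpace ℝ (Fin N) × ℝ → ℝ}
    (hψ : ∀ z ∈ stDomain N c, ψ (stParam c z).1 (stParam c z).2 = h z)
    {z : EuclideanSpace ℝ (Fin N) × ℝ} (hz : z ∈ stDomain N c) (hh : DifferentiableAt ℝ h z) :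
    MDifferentiableAt (𝓡 N) 𝓘(ℝ, ℝ) (fun x ↦ ψ x z.2)
      ((chartAt (EuclideanSpace ℝ (Fin N)) c).symm z.1) := by
  rw [mdifferentiableAt_iff_chart c hz.1]
  have h1 : DifferentiableAt ℝ (fun y ↦ h (y, z.2)) z.1 :=
    (show DifferentiableAt ℝ h (z.1, z.2) from hh).comp z.1
      (hasFDerivAt_prodMk_left z.1 z.2).differentiableAt
  refine h1.congr_of_eventuallyEq ?_
  filter_upwards [(chartAt (EuclideanSpace ℝ (Fin N)) c).open_target.mem_nhds hz.1] with y hy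
  exact hψ (y, z.2) ⟨hy, hz.2⟩

theorem deriv_stParam (c : M) {ψ : M → ℝ → ℝ} {h : EuclideanSpace ℝ (Fin N) × ℝ → ℝ}
    (hψ : ∀ z ∈ stDomain N c, ψ (stParam c z).1 (stParam c z).2 = h z)
    {z : EuclideanSpace ℝ (Fin N) × ℝ} (hz : z ∈ stDomain N c) :
    deriv (fun t ↦ ψ ((chartAt (EuclideanSpace ℝ (Fin N)) c).symm z.1) t) z.2 =
      lineDeriv ℝ h z (0, 1) := by
  have h1 : lineDeriv ℝ h z (0, 1) = deriv (fun t ↦ h (z.1, t)) z.2 := by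
    have := deriv_comp_const_add (fun t ↦ h (z.1, t)) z.2 0
    rw [add_zero] at this
    rw [← this, lineDeriv]
    congr 1
    ext t
    simp only [Prod.smul_mk, smul_zero, smul_eq_mul, mul_one]
    congr 1
    ext <;> simp
  rw [h1]
  refine Filter.EventuallyEq.deriv_eq ?_
  filter_upwards [isOpen_Ioi.mem_nhds hz.2] with t ht
  exact hψ (z.1, t) ⟨hz.1, ht⟩

theorem differentiableAt_time_stParam (c : M) {ψ : M → ℝ → ℝ}
    {h : EuclideanSpace ℝ (Fin N) × ℝ → ℝ}
    (hψ : ∀ z ∈ stDomain N c, ψ (stParam c z).1 (stParam c z).2 = h z)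
    {z : EuclideanSpace ℝ (Fin N) × ℝ} (hz : z ∈ stDomain N c) (hh : DifferentiableAt ℝ h z) :
    DifferentiableAt ℝ (fun t ↦ ψ ((chartAt (EuclideanSpace ℝ (Fin N)) c).symm z.1) t) z.2 := by
  have h1 : DifferentiableAt ℝ (fun t ↦ h (z.1, t)) z.2 :=
    (show DifferentiableAt ℝ h (z.1, z.2) from hh).comp z.2
      (hasFDerivAt_prodMk_right z.1 z.2).differentiableAt
  refine h1.congr_of_eventuallyEq ?_
  filter_upwards [isOpen_Ioi.mem_nhds hz.2] with t ht
  exact hψ (z.1, t) ⟨hz.1, ht⟩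

end ChartTransfer

/-! ### The gradient field in coordinates -/

section ChartEnergy
open Filter Topology

theorem locallyIntegrableOn_of_bound {E : Type*} [TopologicalSpace E] [T2Space E]
    [LocallyCompactSpace E] [MeasurableSpace E] [BorelSpace E]
    {μ : Measure E} {Ω : Set E} (hΩ : IsOpen Ω) {f F : E → ℝ}
    (hf : AEStronglyMeasurable f (μ.restrict Ω)) (hF : LocallyIntegrableOn F Ω μ)
    (h : ∀ K ⊆ Ω, IsCompact K → ∃ C : ℝ, ∀ᵐ z ∂μ, z ∈ K → |f z| ≤ C * F z) :
    LocallyIntegrableOn f Ω μ := by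
  rw [locallyIntegrableOn_iff hΩ.isLocallyClosed]
  intro K hK hKc
  obtain ⟨C, hC⟩ := h K hK hKc
  exact Integrable.mono' ((hF.integrableOn_compact_subset hK hKc).const_mul C)
    (hf.mono_measure (Measure.restrict_mono hK le_rfl))
    ((ae_restrict_iff' hKc.measurableSet).2 hC)

variable {N : ℕ} {M : Type*} [MetricSpace M] [ChartedSpace (EuclideanSpace ℝ (Fin N)) M]
  [RiemannianBundle (fun x : M ↦ TangentSpace (𝓡 N) x)]

/-- The coordinates of the vector field `G` in the chart around `c`. -/
def chartGrad (c : M) (G : (x : M) → ℝ → TangentSpace (𝓡 N) x)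
    (z : EuclideanSpace ℝ (Fin N) × ℝ) : EuclideanSpace ℝ (Fin N) :=
  chartDeriv c _ (G ((chartAt (EuclideanSpace ℝ (Fin N)) c).symm z.1) z.2)

/-- The pairings of the vector field `G` with the coordinate vector fields. -/
def chartPartial (c : M) (G : (x : M) → ℝ → TangentSpace (𝓡 N) x) (i : Fin N)
    (z : EuclideanSpace ℝ (Fin N) × ℝ) : ℝ :=
  inner ℝ (G ((chartAt (EuclideanSpace ℝ (Fin N)) c).symm z.1) z.2) (coordVec c i z.1)

/-- The Riemannian norm of `G` in the chart around `c`. -/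
def chartNorm (c : M) (G : (x : M) → ℝ → TangentSpace (𝓡 N) x)
    (z : EuclideanSpace ℝ (Fin N) × ℝ) : ℝ :=
  ‖G ((chartAt (EuclideanSpace ℝ (Fin N)) c).symm z.1) z.2‖

variable [IsManifold (𝓡 N) ∞ M]
  [IsContMDiffRiemannianBundle (𝓡 N) ∞ (EuclideanSpace ℝ (Fin N))
      (fun x : M ↦ TangentSpace (𝓡 N) x)]

theorem chartNorm_nonneg (c : M) (G : (x : M) → ℝ → TangentSpace (𝓡 N) x)
    (z : EuclideanSpace ℝ (Fin N) × ℝ) : 0 ≤ chartNorm c G z := norm_nonneg _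

theorem chartSymmDeriv_chartGrad (c : M) (G : (x : M) → ℝ → TangentSpace (𝓡 N) x)
    {z : EuclideanSpace ℝ (Fin N) × ℝ} (hz : z ∈ stDomain N c) :
    chartSymmDeriv c z.1 (chartGrad c G z) =
      G ((chartAt (EuclideanSpace ℝ (Fin N)) c).symm z.1) z.2 :=
  chartSymmDeriv_chartDeriv c hz.1 _

theorem chartPartial_eq (c : M) (G : (x : M) → ℝ → TangentSpace (𝓡 N) x) (i : Fin N)
    {z : EuclideanSpace ℝ (Fin N) × ℝ} (hz : z ∈ stDomain N c) :
    chartPartial c G i z = ∑ j, chartGrad c G z j * metricMatrix c z.1 j i := by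
  rw [chartPartial, ← chartSymmDeriv_chartGrad c G hz]
  refine (inner_chartSymmDeriv c z.1 _ (EuclideanSpace.single i 1)).trans ?_
  refine Finset.sum_congr rfl fun j _ ↦ ?_
  simp

theorem chartNorm_sq (c : M) (G : (x : M) → ℝ → TangentSpace (𝓡 N) x)
    {z : EuclideanSpace ℝ (Fin N) × ℝ} (hz : z ∈ stDomain N c) :
    ∑ i, chartGrad c G z i * chartPartial c G i z = chartNorm c G z ^ 2 := by
  rw [chartNorm, ← real_inner_self_eq_norm_sq, ← chartSymmDeriv_chartGrad c G hz,
    inner_chartSymmDeriv]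
  simp_rw [fun i ↦ chartPartial_eq c G i hz, Finset.mul_sum]
  rw [Finset.sum_comm]
  refine Finset.sum_congr rfl fun i _ ↦ Finset.sum_congr rfl fun j _ ↦ by ring

/-- The definition of the weak gradient supplies measurability only for the pairings with coordinate
fields. The components are recovered by inverting the metric matrix, written with determinant and
adjugate so that continuity of the coefficients is evident. -/
theorem chartGrad_eq (c : M) (G : (x : M) → ℝ → TangentSpace (𝓡 N) x) (i : Fin N)
    {z : EuclideanSpace ℝ (Fin N) × ℝ} (hz : z ∈ stDomain N c) :
    chartGrad c G z i = ∑ j, chartPartial c G j z *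
      ((metricMatrix c z.1).det⁻¹ * (metricMatrix c z.1).adjugate j i) := by
  have hdet : IsUnit (metricMatrix c z.1).det := (posDef_metricMatrix c hz.1).det_pos.ne'.isUnit
  have h1 : (fun j ↦ chartPartial c G j z) =
      Matrix.vecMul (fun j ↦ chartGrad c G z j) (metricMatrix c z.1) := by
    ext j
    rw [chartPartial_eq c G j hz]
    rfl
  have h2 : Matrix.vecMul (fun j ↦ chartPartial c G j z) (metricMatrix c z.1)⁻¹ =
      fun j ↦ chartGrad c G z j := by
    rw [h1, Matrix.vecMul_vecMul, Matrix.mul_nonsing_inv _ hdet, Matrix.vecMul_one]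
  rw [← congrFun h2 i, Matrix.inv_def, Ring.inverse_eq_inv']
  rfl

theorem continuousOn_inverse_metric (c : M) (i j : Fin N) :
    ContinuousOn (fun y ↦ (metricMatrix c y).det⁻¹ * (metricMatrix c y).adjugate j i)
      (chartAt (EuclideanSpace ℝ (Fin N)) c).target := by
  have h1 : ContinuousOn (fun y ↦ metricMatrix c y)
      (chartAt (EuclideanSpace ℝ (Fin N)) c).target :=
    continuousOn_pi.2 fun i ↦ continuousOn_pi.2 fun j ↦ (contDiffOn_metricMatrix c i j).continuousOn
  have h2 : Continuous fun A : Matrix (Fin N) (Fin N) ℝ ↦ A.adjugate j i :=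
    (continuous_id.matrix_adjugate).matrix_elem j i
  exact ((contDiffOn_det_metricMatrix c).continuousOn.inv₀
    fun y hy ↦ (posDef_metricMatrix c hy).det_pos.ne').mul (h2.comp_continuousOn h1)

theorem aestronglyMeasurable_chartGrad (c : M) {G : (x : M) → ℝ → TangentSpace (𝓡 N) x}
    (hb : ∀ i, AEStronglyMeasurable (chartPartial c G i) (volume.restrict (stDomain N c)))
    (i : Fin N) :
    AEStronglyMeasurable (fun z ↦ chartGrad c G z i) (volume.restrict (stDomain N c)) := by
  have hm := (isOpen_stDomain (N := N) c).measurableSet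
  have h1 : AEStronglyMeasurable (fun z : EuclideanSpace ℝ (Fin N) × ℝ ↦
      ∑ j, chartPartial c G j z *
        ((metricMatrix c z.1).det⁻¹ * (metricMatrix c z.1).adjugate j i))
      (volume.restrict (stDomain N c)) := by
    refine Finset.aestronglyMeasurable_fun_sum _ fun j _ ↦ (hb j).mul ?_
    exact ((continuousOn_inverse_metric c i j).comp continuousOn_fst
      fun z hz ↦ hz.1).aestronglyMeasurable hm
  refine h1.congr ?_
  filter_upwards [ae_restrict_mem hm] with z hz
  exact (chartGrad_eq c G i hz).symm

theorem aestronglyMeasurable_chartNorm (c : M) {G : (x : M) → ℝ → TangentSpace (𝓡 N) x}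
    (hb : ∀ i, AEStronglyMeasurable (chartPartial c G i) (volume.restrict (stDomain N c))) :
    AEStronglyMeasurable (chartNorm c G) (volume.restrict (stDomain N c)) := by
  have h1 : AEStronglyMeasurable (fun z ↦ √(∑ i, chartGrad c G z i * chartPartial c G i z))
      (volume.restrict (stDomain N c)) :=
    Real.continuous_sqrt.comp_aestronglyMeasurable (Finset.aestronglyMeasurable_fun_sum _
      fun i _ ↦ (aestronglyMeasurable_chartGrad c hb i).mul (hb i))
  refine h1.congr ?_
  filter_upwards [ae_restrict_mem (isOpen_stDomain (N := N) c).measurableSet] with z hz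
  rw [chartNorm_sq c G hz, Real.sqrt_sq (chartNorm_nonneg c G z)]

theorem exists_chart_bounds (c : M) (G : (x : M) → ℝ → TangentSpace (𝓡 N) x)
    {K : Set (EuclideanSpace ℝ (Fin N) × ℝ)} (hK : IsCompact K) (hKt : K ⊆ stDomain N c) :
    ∃ C : ℝ, 0 < C ∧ ∀ z ∈ K, ‖chartGrad c G z‖ ≤ C * chartNorm c G z ∧
      ∀ i, |chartPartial c G i z| ≤ C * chartNorm c G z := by
  obtain ⟨C, hC, h⟩ := exists_norm_chartSymmDeriv_bounds c (hK.image continuous_fst)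
    (image_subset_iff.2 fun z hz ↦ (hKt hz).1)
  refine ⟨C, hC, fun z hz ↦ ⟨?_, fun i ↦ ?_⟩⟩
  · have h1 := (h z.1 (mem_image_of_mem _ hz) (chartGrad c G z)).2
    rwa [chartSymmDeriv_chartGrad c G (hKt hz)] at h1
  · have h1 := (h z.1 (mem_image_of_mem _ hz) (EuclideanSpace.single i 1)).1
    rw [PiLp.norm_single, norm_one, mul_one] at h1
    refine (abs_real_inner_le_norm _ _).trans ?_
    rw [mul_comm C]
    exact mul_le_mul_of_nonneg_left h1 (norm_nonneg _)

end ChartEnergy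

/-! ### Solutions, the terms of the tested inequality, and elementary powers -/

section Solution
open Filter Topology

variable {N : ℕ} {M : Type*} [MetricSpace M] [ChartedSpace (EuclideanSpace ℝ (Fin N)) M]
  [MeasurableSpace M] [RiemannianBundle (fun x : M ↦ TangentSpace (𝓡 N) x)]

/-- The pairing `⟨∇ψ, G⟩`. -/
def gradPairing (G : (x : M) → ℝ → TangentSpace (𝓡 N) x) (ψ : M → ℝ → ℝ) (z : M × ℝ) : ℝ :=
  show ℝ from mfderiv (𝓡 N) 𝓘(ℝ, ℝ) (fun x ↦ ψ x z.2) z.1 (G z.1 z.2)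

/-- A weak solution together with its weak gradient and time derivative. -/
structure IsSolutionTriple (p q m : ℝ) (f : ℝ → ℝ) (a : M → ℝ) (V u : M → ℝ → ℝ)
    (G : (x : M) → ℝ → TangentSpace (𝓡 N) x) (w : M → ℝ → ℝ) : Prop where
  nonneg : ∀ᵐ z ∂(stMeasure N M).restrict (cylinder M), 0 ≤ u z.1 z.2
  source : LocInt (fun x t ↦ u x t ^ q * V x t) (weightedMeasure N a)
  derivs : HasWeakDerivs u G w
  power : LocInt (fun x t ↦ u x t ^ (p + m - 1)) (riemannianMeasure N M)
  energy : LocInt (fun x t ↦ ‖G x t‖ ^ p * u x t ^ (m - 1)) (riemannianMeasure N M)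
  weak : ∀ ψ : M → ℝ → ℝ, IsTestFunction ψ →
      ∫ z in cylinder M, ψ z.1 z.2 * u z.1 z.2 ^ q * V z.1 z.2
          ∂((weightedMeasure N a).prod volume) ≤
        (∫ z in cylinder M,
          gradPairing G ψ z *
            u z.1 z.2 ^ (m - 1) * ‖G z.1 z.2‖ ^ (p - 2) * f ‖G z.1 z.2‖
          ∂((weightedMeasure N a).prod volume)) -
        ∫ z in cylinder M, deriv (fun t ↦ ψ z.1 t) z.2 * u z.1 z.2
          ∂((weightedMeasure N a).prod volume)

/-- The scalar factor of the flux. -/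
def fluxFactor (p m : ℝ) (f : ℝ → ℝ) (u : M → ℝ → ℝ) (G : (x : M) → ℝ → TangentSpace (𝓡 N) x)
    (z : M × ℝ) : ℝ :=
  u z.1 z.2 ^ (m - 1) * ‖G z.1 z.2‖ ^ (p - 2) * f ‖G z.1 z.2‖

/-- The source term of the inequality tested with `φ H(u)`. -/
def sourceTerm (q : ℝ) (V u : M → ℝ → ℝ) (H : ℝ → ℝ) (φ : M → ℝ → ℝ) (z : M × ℝ) : ℝ :=
  φ z.1 z.2 * H (u z.1 z.2) * (u z.1 z.2 ^ q * V z.1 z.2)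

/-- The flux term of the inequality tested with `φ H(u)`. -/
def fluxTerm (p m : ℝ) (f : ℝ → ℝ) (u : M → ℝ → ℝ) (G : (x : M) → ℝ → TangentSpace (𝓡 N) x)
    (H H' : ℝ → ℝ) (φ : M → ℝ → ℝ) (z : M × ℝ) : ℝ :=
  (H (u z.1 z.2) * gradPairing G φ z +
    φ z.1 z.2 * H' (u z.1 z.2) * ‖G z.1 z.2‖ ^ 2) * fluxFactor p m f u G z

/-- The time term of the inequality tested with `φ H(u)`. -/
def timeTerm (u : M → ℝ → ℝ) (J : ℝ → ℝ) (φ : M → ℝ → ℝ) (z : M × ℝ) : ℝ :=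
  deriv (fun t ↦ φ z.1 t) z.2 * J (u z.1 z.2)

/-- The inequality tested with `φ H(u)`, with the integrability of its terms. -/
structure TestedInequality (p q m : ℝ) (f : ℝ → ℝ) (a : M → ℝ) (V u : M → ℝ → ℝ)
    (G : (x : M) → ℝ → TangentSpace (𝓡 N) x) (H H' J : ℝ → ℝ) (φ : M → ℝ → ℝ) : Prop where
  diff : ∀ᵐ z ∂(stMeasure N M).restrict (cylinder M),
    MDifferentiableAt (𝓡 N) 𝓘(ℝ, ℝ) (fun x ↦ φ x z.2) z.1 ∧
      DifferentiableAt ℝ (fun t ↦ φ z.1 t) z.2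
  source : IntegrableOn (sourceTerm q V u H φ) (cylinder M) ((weightedMeasure N a).prod volume)
  flux : IntegrableOn (fluxTerm p m f u G H H' φ) (cylinder M)
    ((weightedMeasure N a).prod volume)
  time : IntegrableOn (timeTerm u J φ) (cylinder M) ((weightedMeasure N a).prod volume)
  ineq : ∫ z in cylinder M, sourceTerm q V u H φ z ∂((weightedMeasure N a).prod volume) ≤
    (∫ z in cylinder M, fluxTerm p m f u G H H' φ z ∂((weightedMeasure N a).prod volume)) -
      ∫ z in cylinder M, timeTerm u J φ z ∂((weightedMeasure N a).prod volume)

/-- For `1 < p < 2` the power is singular at `n = 0`, but the factor `n` makes the value assigned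
there irrelevant; degenerate and singular diffusion are thus treated alike. -/
theorem mul_rpow_sub_two {n p : ℝ} (hn : 0 ≤ n) (hp : 1 < p) : n * n ^ (p - 2) = n ^ (p - 1) := by
  rcases hn.eq_or_lt with rfl | hn
  · rw [zero_mul, Real.zero_rpow (by linarith)]
  · rw [← Real.rpow_one_add' hn.le (by linarith)]
    ring_nf

theorem sq_mul_rpow_sub_two {n p : ℝ} (hn : 0 ≤ n) (hp : 1 < p) : n ^ 2 * n ^ (p - 2) = n ^ p := by
  rw [sq, mul_assoc, mul_rpow_sub_two hn hp, ← Real.rpow_one_add' hn (by linarith)]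
  ring_nf

theorem rpow_le_one_add_rpow {n r s : ℝ} (hn : 0 ≤ n) (hr : 0 ≤ r) (hrs : r ≤ s) :
    n ^ r ≤ 1 + n ^ s := by
  rcases le_total n 1 with h | h
  · have h1 := Real.rpow_le_one hn h hr
    have h2 := Real.rpow_nonneg hn s
    linarith
  · have h1 := Real.rpow_le_rpow_of_exponent_le h hrs
    linarith

section Vanish
theorem eventuallyEq_zero_space {φ : M → ℝ → ℝ} {z : M × ℝ}
    (hz : z ∉ tsupport fun z : M × ℝ ↦ φ z.1 z.2) : (fun x ↦ φ x z.2) =ᶠ[𝓝 z.1] fun _ ↦ 0 := by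
  have h1 : (fun z : M × ℝ ↦ φ z.1 z.2) =ᶠ[𝓝 z] fun _ ↦ 0 :=
    notMem_tsupport_iff_eventuallyEq.1 hz
  exact (Continuous.prodMk_left z.2).continuousAt.eventually h1

theorem eventuallyEq_zero_time {φ : M → ℝ → ℝ} {z : M × ℝ}
    (hz : z ∉ tsupport fun z : M × ℝ ↦ φ z.1 z.2) : (fun t ↦ φ z.1 t) =ᶠ[𝓝 z.2] fun _ ↦ 0 := by
  have h1 : (fun z : M × ℝ ↦ φ z.1 z.2) =ᶠ[𝓝 z] fun _ ↦ 0 :=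
    notMem_tsupport_iff_eventuallyEq.1 hz
  exact (Continuous.prodMk_right z.1).continuousAt.eventually h1

theorem gradPairing_eq_zero {φ : M → ℝ → ℝ} {z : M × ℝ}
    (hz : z ∉ tsupport fun z : M × ℝ ↦ φ z.1 z.2) (G : (x : M) → ℝ → TangentSpace (𝓡 N) x) :
    gradPairing G φ z = 0 := by
  have := (eventuallyEq_zero_space hz).mfderiv_eq (I := 𝓡 N) (I' := 𝓘(ℝ, ℝ))
  rw [mfderiv_const] at this
  exact congrArg (fun L : EuclideanSpace ℝ (Fin N) →L[ℝ] ℝ ↦ L (G z.1 z.2)) this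

theorem deriv_eq_zero_of_notMem_tsupport {φ : M → ℝ → ℝ} {z : M × ℝ}
    (hz : z ∉ tsupport fun z : M × ℝ ↦ φ z.1 z.2) : deriv (fun t ↦ φ z.1 t) z.2 = 0 := by
  rw [(eventuallyEq_zero_time hz).deriv_eq, deriv_const]

end Vanish

end Solution

/-! ### Integrability of the flux in a chart -/

section ChartInequality
open Filter Topology

variable {N : ℕ} {M : Type*} [MetricSpace M] [ChartedSpace (EuclideanSpace ℝ (Fin N)) M]
  [MeasurableSpace M] [BorelSpace M]
  [RiemannianBundle (fun x : M ↦ TangentSpace (𝓡 N) x)] [IsManifold (𝓡 N) ∞ M]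
  [IsContMDiffRiemannianBundle (𝓡 N) ∞ (EuclideanSpace ℝ (Fin N))
      (fun x : M ↦ TangentSpace (𝓡 N) x)]
  [SecondCountableTopology M] [IsRiemannianManifold (𝓡 N) M]

local notation "𝕏" => EuclideanSpace ℝ (Fin N)

/-- The local integrability in a chart of everything that enters the weak inequality. -/
theorem locallyIntegrableOn_chart_energy {p q m K : ℝ} (hp : 1 < p) (hm : 1 ≤ m) {f : ℝ → ℝ}
    (hf_meas : Measurable f) (hf : ∀ s, 0 ≤ s → 0 ≤ f s ∧ f s ≤ K) {a : M → ℝ}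
    (ha : LocallyLipschitz a) {V u : M → ℝ → ℝ} {G : (x : M) → ℝ → TangentSpace (𝓡 N) x}
    {w : M → ℝ → ℝ} (hu : IsSolutionTriple p q m f a V u G w) (c : M) {p' : ℝ}
    (hpp : p.HolderConjugate p') :
    let U : 𝕏 × ℝ → ℝ := fun z ↦ u (stParam c z).1 (stParam c z).2
    let Θ : 𝕏 × ℝ → ℝ := fun z ↦ chartWeight a c z.1 * fluxFactor p m f u G (stParam c z)
    let F : Fin N → 𝕏 × ℝ → ℝ := fun i z ↦ chartWeight a c z.1 * (chartGrad c G z i *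
      U z ^ ((m - 1) / p') * (chartNorm c G z ^ (p - 2) * f (chartNorm c G z)))
    (∀ i, LocallyIntegrableOn (fun z ↦ |chartPartial c G i z| ^ p * U z ^ (m - 1))
      (stDomain N c)) ∧
    (∀ i, LocallyIntegrableOn (fun z ↦ chartGrad c G z i * Θ z) (stDomain N c)) ∧
    LocallyIntegrableOn (fun z ↦ chartNorm c G z ^ 2 * Θ z) (stDomain N c) ∧
    (∀ i, AEStronglyMeasurable (F i) (volume.restrict (stDomain N c))) ∧
    (∀ i, LocallyIntegrableOn (fun z ↦ |F i z| ^ p') (stDomain N c)) ∧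
    (∀ i, ∀ᵐ z, z ∈ stDomain N c → chartGrad c G z i * Θ z = F i z * U z ^ ((m - 1) / p)) := by
  intro U Θ F
  have hp0 : 0 < p := by linarith
  have hm0 : 0 ≤ m - 1 := by linarith
  have hK0 : 0 ≤ K := (hf 0 le_rfl).1.trans (hf 0 le_rfl).2
  have hΩ := isOpen_stDomain (N := N) c
  have hΩm := hΩ.measurableSet
  have hU0 : ∀ᵐ z, z ∈ stDomain N c → 0 ≤ U z :=
    (ae_restrict_iff' hΩm).1 (ae_chart_of_cylinder hu.nonneg c)
  have hUm : AEStronglyMeasurable U (volume.restrict (stDomain N c)) :=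
    (hu.derivs.locInt c).aestronglyMeasurable
  have hbm : ∀ i, AEStronglyMeasurable (chartPartial c G i) (volume.restrict (stDomain N c)) :=
    fun i ↦ (hu.derivs.locInt_grad c i).aestronglyMeasurable
  have hnm := aestronglyMeasurable_chartNorm c hbm
  have hγm := aestronglyMeasurable_chartGrad c hbm
  have hrpow : ∀ {g : 𝕏 × ℝ → ℝ} (r : ℝ), AEStronglyMeasurable g (volume.restrict (stDomain N c)) →
      AEStronglyMeasurable (fun z ↦ g z ^ r) (volume.restrict (stDomain N c)) := fun r hg ↦
    (hg.aemeasurable.pow_const r).aestronglyMeasurable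
  have hfm : AEStronglyMeasurable (fun z ↦ f (chartNorm c G z)) (volume.restrict (stDomain N c)) :=
    (hf_meas.comp_aemeasurable hnm.aemeasurable).aestronglyMeasurable
  have hρc : ContinuousOn (fun z : 𝕏 × ℝ ↦ chartWeight a c z.1) (stDomain N c) := by
    intro z hz
    obtain ⟨C, s, hs, hC⟩ := lipAt_chartWeight ha c hz
    exact (hC.continuousOn.continuousAt hs).continuousWithinAt
  have hρm := hρc.aestronglyMeasurable (μ := volume) hΩm
  -- The energy is needed without the weight `a`, since the approximation lemma requires it also
  -- near the zeros of `a`.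
  have hEn : LocallyIntegrableOn (fun z ↦ chartNorm c G z ^ p * U z ^ (m - 1)) (stDomain N c) :=
    locallyIntegrableOn_stParam c hu.energy
  have hUp : LocallyIntegrableOn (fun z ↦ U z ^ (p + m - 1)) (stDomain N c) :=
    locallyIntegrableOn_stParam c hu.power
  -- A majorant for the flux, with `n` the norm of the gradient: `n^(p-1) U^(m-1) ≤ n^p U^(m-1) +
  -- U^(m-1)` and `U^(m-1) ≤ 1 + U^(p+m-1)`.
  have hsum : LocallyIntegrableOn (fun z ↦ chartNorm c G z ^ p * U z ^ (m - 1) +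
      (1 + U z ^ (p + m - 1))) (stDomain N c) :=
    hEn.add ((continuous_const.locallyIntegrable.locallyIntegrableOn _).add hUp)
  have hρb : ∀ K ⊆ stDomain N c, IsCompact K → ∃ C : ℝ, 0 ≤ C ∧
      ∀ z ∈ K, |chartWeight a c z.1| ≤ C := by
    intro K hK hKc
    obtain ⟨C, hC⟩ := hKc.exists_bound_of_continuousOn (hρc.mono hK)
    exact ⟨max C 0, le_max_right _ _, fun z hz ↦ (hC z hz).trans (le_max_left _ _)⟩
  have hn0 := chartNorm_nonneg c G
  have hγi : ∀ z i, |chartGrad c G z i| ≤ ‖chartGrad c G z‖ := fun z i ↦ by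
    rw [← Real.norm_eq_abs]; exact PiLp.norm_apply_le _ i
  have hfb : ∀ z, |f (chartNorm c G z)| ≤ K := fun z ↦ by
    rw [abs_of_nonneg (hf _ (hn0 z)).1]; exact (hf _ (hn0 z)).2
  have hΘ : ∀ z, Θ z = chartWeight a c z.1 *
      (U z ^ (m - 1) * chartNorm c G z ^ (p - 2) * f (chartNorm c G z)) := fun z ↦ rfl
  have hΘm : AEStronglyMeasurable Θ (volume.restrict (stDomain N c)) :=
    hρm.mul (((hrpow _ hUm).mul (hrpow _ hnm)).mul hfm)
  refine ⟨fun i ↦ ?_, fun i ↦ ?_, ?_, fun i ↦ ?_, fun i ↦ ?_, fun i ↦ ?_⟩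
  · refine locallyIntegrableOn_of_bound hΩ
      ((hrpow p (hbm i).norm).mul (hrpow _ hUm)) hEn fun K hK hKc ↦ ?_
    obtain ⟨C, hC, h⟩ := exists_chart_bounds c G hKc hK
    refine ⟨C ^ p, ?_⟩
    filter_upwards [hU0] with z hz hzK
    have h1 := Real.rpow_nonneg (hz (hK hzK)) (m - 1)
    rw [abs_of_nonneg (by positivity), ← mul_assoc, ← Real.mul_rpow hC.le (hn0 z)]
    gcongr
    exact (h z hzK).2 i
  · refine locallyIntegrableOn_of_bound hΩ ((hγm i).mul hΘm) hsum fun L hL hLc ↦ ?_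
    obtain ⟨C, hC, h⟩ := exists_chart_bounds c G hLc hL
    obtain ⟨B, hB, hb⟩ := hρb L hL hLc
    refine ⟨C * B * K, ?_⟩
    filter_upwards [hU0] with z hz hzL
    have hUz := hz (hL hzL)
    have h1 := Real.rpow_nonneg hUz (m - 1)
    have h2 := Real.rpow_nonneg (hn0 z) (p - 2)
    have h3 : |chartGrad c G z i| ≤ C * chartNorm c G z := (hγi z i).trans (h z hzL).1
    have h4 := rpow_le_one_add_rpow (hn0 z) (r := p - 1) (s := p) (by linarith) (by linarith)
    have h5 := rpow_le_one_add_rpow hUz hm0 (s := p + m - 1) (by linarith)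
    rw [hΘ, abs_mul, abs_mul, abs_mul, abs_mul, abs_of_nonneg h1, abs_of_nonneg h2]
    calc |chartGrad c G z i| * (|chartWeight a c z.1| *
          (U z ^ (m - 1) * chartNorm c G z ^ (p - 2) * |f (chartNorm c G z)|))
        ≤ (C * chartNorm c G z) * (B * (U z ^ (m - 1) * chartNorm c G z ^ (p - 2) * K)) := by
          gcongr
          · exact mul_nonneg hC.le (hn0 z)
          · exact hb z hzL
          · exact hfb z
      _ = C * B * K * ((chartNorm c G z * chartNorm c G z ^ (p - 2)) * U z ^ (m - 1)) := by ring
      _ ≤ C * B * K * (chartNorm c G z ^ p * U z ^ (m - 1) + (1 + U z ^ (p + m - 1))) := by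
          rw [mul_rpow_sub_two (hn0 z) hp]
          gcongr
          calc chartNorm c G z ^ (p - 1) * U z ^ (m - 1)
              ≤ (1 + chartNorm c G z ^ p) * U z ^ (m - 1) := by gcongr
            _ ≤ _ := by linarith
  · refine locallyIntegrableOn_of_bound hΩ ((hnm.pow 2).mul hΘm) hEn fun L hL hLc ↦ ?_
    obtain ⟨B, hB, hb⟩ := hρb L hL hLc
    refine ⟨B * K, ?_⟩
    filter_upwards [hU0] with z hz hzL
    have hUz := hz (hL hzL)
    have h1 := Real.rpow_nonneg hUz (m - 1)
    have h2 := Real.rpow_nonneg (hn0 z) (p - 2)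
    rw [hΘ, abs_mul, abs_mul, abs_mul, abs_mul, abs_of_nonneg h1, abs_of_nonneg h2,
      abs_of_nonneg (sq_nonneg _)]
    calc chartNorm c G z ^ 2 * (|chartWeight a c z.1| *
          (U z ^ (m - 1) * chartNorm c G z ^ (p - 2) * |f (chartNorm c G z)|))
        ≤ chartNorm c G z ^ 2 * (B * (U z ^ (m - 1) * chartNorm c G z ^ (p - 2) * K)) := by
          gcongr
          · exact hb z hzL
          · exact hfb z
      _ = B * K * ((chartNorm c G z ^ 2 * chartNorm c G z ^ (p - 2)) * U z ^ (m - 1)) := by ring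
      _ = _ := by rw [sq_mul_rpow_sub_two (hn0 z) hp]
  · exact hρm.mul (((hγm i).mul (hrpow _ hUm)).mul ((hrpow _ hnm).mul hfm))
  · refine locallyIntegrableOn_of_bound hΩ
      (hrpow p' (hρm.mul (((hγm i).mul (hrpow _ hUm)).mul ((hrpow _ hnm).mul hfm))).norm) hEn
      fun L hL hLc ↦ ?_
    obtain ⟨C, hC, h⟩ := exists_chart_bounds c G hLc hL
    obtain ⟨B, hB, hb⟩ := hρb L hL hLc
    refine ⟨(C * B * K) ^ p', ?_⟩
    filter_upwards [hU0] with z hz hzL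
    have hUz := hz (hL hzL)
    have hp'0 := hpp.symm.pos
    have h1 := Real.rpow_nonneg hUz ((m - 1) / p')
    have h2 := Real.rpow_nonneg (hn0 z) (p - 2)
    have h3 : |chartGrad c G z i| ≤ C * chartNorm c G z := (hγi z i).trans (h z hzL).1
    have h6 := Real.rpow_nonneg (hn0 z) (p - 1)
    -- Since `(p - 1) p' = p`, the `p'`-th power of this bound is a multiple of the energy density.
    have h4 : |F i z| ≤ (C * B * K) * (chartNorm c G z ^ (p - 1) * U z ^ ((m - 1) / p')) := by
      simp only [F]
      rw [abs_mul, abs_mul, abs_mul, abs_mul, abs_of_nonneg h1, abs_of_nonneg h2]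
      calc |chartWeight a c z.1| * (|chartGrad c G z i| * U z ^ ((m - 1) / p') *
            (chartNorm c G z ^ (p - 2) * |f (chartNorm c G z)|))
          ≤ B * ((C * chartNorm c G z) * U z ^ ((m - 1) / p') *
            (chartNorm c G z ^ (p - 2) * K)) := by
            have := mul_nonneg hC.le (hn0 z)
            gcongr
            · exact hb z hzL
            · exact hfb z
        _ = C * B * K * ((chartNorm c G z * chartNorm c G z ^ (p - 2)) *
            U z ^ ((m - 1) / p')) := by ring
        _ = _ := by rw [mul_rpow_sub_two (hn0 z) hp]
    rw [abs_of_nonneg (by positivity)]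
    refine (Real.rpow_le_rpow (abs_nonneg _) h4 hp'0.le).trans_eq ?_
    rw [Real.mul_rpow (by positivity) (by positivity), Real.mul_rpow h6 h1,
      ← Real.rpow_mul (hn0 z), ← Real.rpow_mul hUz, hpp.sub_one_mul_conj,
      div_mul_cancel₀ _ hp'0.ne']
  · filter_upwards [hU0] with z hz hzΩ
    have hUz := hz hzΩ
    have hp'0 := hpp.symm.pos
    have h1 : U z ^ (m - 1) = U z ^ ((m - 1) / p') * U z ^ ((m - 1) / p) := by
      rw [← Real.rpow_add_of_nonneg hUz (by positivity) (by positivity)]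
      congr 1
      have := hpp.inv_add_inv_eq_one
      rw [div_eq_mul_inv, div_eq_mul_inv, ← mul_add, add_comm p'⁻¹, this, mul_one]
    rw [hΘ, h1]
    simp only [F]
    ring

end ChartInequality

/-! ### The tested inequality for cutoffs supported over one chart -/

section ChartTested
open Filter Topology

variable {N : ℕ} {M : Type*} [MetricSpace M] [ChartedSpace (EuclideanSpace ℝ (Fin N)) M]
  [MeasurableSpace M] [BorelSpace M]
  [RiemannianBundle (fun x : M ↦ TangentSpace (𝓡 N) x)] [IsManifold (𝓡 N) ∞ M]
  [IsContMDiffRiemannianBundle (𝓡 N) ∞ (EuclideanSpace ℝ (Fin N))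
      (fun x : M ↦ TangentSpace (𝓡 N) x)]
  [SecondCountableTopology M] [IsRiemannianManifold (𝓡 N) M]

local notation "𝕏" => EuclideanSpace ℝ (Fin N)

theorem gradPairing_stParam (c : M) {ψ : M → ℝ → ℝ} {h : 𝕏 × ℝ → ℝ}
    (hψ : ∀ z ∈ stDomain N c, ψ (stParam c z).1 (stParam c z).2 = h z)
    (G : (x : M) → ℝ → TangentSpace (𝓡 N) x) {z : 𝕏 × ℝ} (hz : z ∈ stDomain N c) :
    gradPairing G ψ (stParam c z) = spaceDeriv h z (chartGrad c G z) :=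
  mfderiv_stParam_apply c hψ hz _

/-- The weak inequality in a chart. -/
theorem chart_weak_inequality {p q m : ℝ} {f : ℝ → ℝ} {a : M → ℝ}
    (ha : LocallyLipschitz a) {V u : M → ℝ → ℝ} {G : (x : M) → ℝ → TangentSpace (𝓡 N) x}
    {w : M → ℝ → ℝ} (hu : IsSolutionTriple p q m f a V u G w) (c : M)
    {φ : M → ℝ → ℝ} (hφ : IsTestFunction φ)
    (hs : tsupport (fun z : M × ℝ ↦ φ z.1 z.2) ⊆ stSource N c)
    {g : 𝕏 × ℝ → ℝ} (hg : ∃ C, LipschitzWith C g) (hg0 : ∀ z, 0 ≤ g z) :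
    ∫ z in stDomain N c, chartPull N c (fun z ↦ φ z.1 z.2) z * g z *
        (chartWeight a c z.1 * (u (stParam c z).1 (stParam c z).2 ^ q *
          V (stParam c z).1 (stParam c z).2)) ≤
      (∫ z in stDomain N c,
        spaceDeriv (fun z ↦ chartPull N c (fun z ↦ φ z.1 z.2) z * g z) z (chartGrad c G z) *
          (chartWeight a c z.1 * fluxFactor p m f u G (stParam c z))) -
      ∫ z in stDomain N c, chartWeight a c z.1 *
        lineDeriv ℝ (fun z ↦ chartPull N c (fun z ↦ φ z.1 z.2) z * g z) z (0, 1) *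
          u (stParam c z).1 (stParam c z).2 := by
  obtain ⟨ψ, hψdef⟩ : ∃ ψ : M → ℝ → ℝ, ψ = fun x t ↦ φ x t * g (stChart c (x, t)) := ⟨_, rfl⟩
  have hψ : IsTestFunction ψ := hψdef ▸ hφ.mul_chart c hs hg hg0
  have hsub : tsupport (fun z : M × ℝ ↦ ψ z.1 z.2) ⊆ stSource N c := by
    subst hψdef
    exact (tsupport_mul_subset_left (f := fun z : M × ℝ ↦ φ z.1 z.2)
      (g := fun z : M × ℝ ↦ g (stChart c (z.1, z.2)))).trans hs
  have hψz : ∀ z ∈ stDomain N c, ψ (stParam c z).1 (stParam c z).2 =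
        chartPull N c (fun z ↦ φ z.1 z.2) z * g z := by
    intro z hz
    rw [hψdef, chartPull_of_mem c _ hz]
    simp only [Prod.mk.eta]
    rw [stChart_stParam c hz]
  have h := hu.weak _ hψ
  have hm := (isOpen_stDomain (N := N) c).measurableSet
  rw [setIntegral_weighted ha.continuous.measurable c, setIntegral_weighted
    ha.continuous.measurable c, setIntegral_weighted ha.continuous.measurable c] at h
  · refine (le_of_eq ?_).trans (h.trans (le_of_eq ?_))
    · refine setIntegral_congr_fun hm fun z hz ↦ ?_
      beta_reduce
      rw [hψz z hz]
      ring
    · congr 1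
      · refine setIntegral_congr_fun hm fun z hz ↦ ?_
        beta_reduce
        rw [gradPairing_stParam c hψz G hz, fluxFactor]
        ring
      · refine setIntegral_congr_fun hm fun z hz ↦ ?_
        have h1 := deriv_stParam (M := M) c hψz hz
        simp only [stParam] at h1 ⊢
        rw [h1]
        ring
  · intro z hz
    rw [deriv_eq_zero_of_notMem_tsupport fun h' ↦ hz (hsub h'), zero_mul]
  · intro z hz
    rw [gradPairing_eq_zero (fun h' ↦ hz (hsub h')), zero_mul, zero_mul, zero_mul]
  · intro z hz
    rw [image_eq_zero_of_notMem_tsupport (f := fun z : M × ℝ ↦ ψ z.1 z.2)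
      fun h' ↦ hz (hsub h'), zero_mul, zero_mul]

/-- The inequality tested with `φ H(u)` for `φ` supported in a chart domain. -/
theorem testedInequality_of_chart {p q m K : ℝ} (hp : 1 < p) (hm : 1 ≤ m) {f : ℝ → ℝ}
    (hf_meas : Measurable f) (hf : ∀ s, 0 ≤ s → 0 ≤ f s ∧ f s ≤ K) {a : M → ℝ}
    (ha : LocallyLipschitz a) {V u : M → ℝ → ℝ} {G : (x : M) → ℝ → TangentSpace (𝓡 N) x}
    {w : M → ℝ → ℝ} (hu : IsSolutionTriple p q m f a V u G w)
    {H H' J : ℝ → ℝ} (hH : ∀ s, HasDerivAt H (H' s) s) (hH' : Continuous H') {L : ℝ}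
    (hL : ∀ s, |H' s| ≤ L) {B : ℝ} (hH0 : ∀ s, 0 ≤ H s) (hHB : ∀ s, H s ≤ B)
    (hJ : ∀ s, HasDerivAt J (H s) s) (hJB : ∀ s, |J s| ≤ B * |s|) (c : M)
    {φ : M → ℝ → ℝ} (hφ : IsTestFunction φ)
    (hs : tsupport (fun z : M × ℝ ↦ φ z.1 z.2) ⊆ stSource N c) :
    TestedInequality p q m f a V u G H H' J φ := by
  have hpp : p.HolderConjugate (p / (p - 1)) := Real.HolderConjugate.conjExponent hp
  obtain ⟨e1, e2, e3, e4, e5, e6⟩ := locallyIntegrableOn_chart_energy hp hm hf_meas hf ha hu c hpp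
  set Φ := chartPull N c (fun z ↦ φ z.1 z.2) with hΦ
  have hΩ := isOpen_stDomain (N := N) c
  have hΩm := hΩ.measurableSet
  have ham := ha.continuous.measurable
  obtain ⟨Cφ, hΦl⟩ := exists_lipschitzWith_chartPull (N := N) c hφ.lip hφ.compact hs
  have hΦc := hasCompactSupport_chartPull (N := N) c hφ.compact hs
  have hΦs := tsupport_chartPull_subset (N := N) c hφ.compact hs
  have hφΦ : ∀ z ∈ stDomain N c, φ (stParam c z).1 (stParam c z).2 = Φ z := fun z hz ↦
    (chartPull_of_mem c (fun z ↦ φ z.1 z.2) hz).symm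
  have hdiffΦ : ∀ᵐ z ∂(volume : Measure (𝕏 × ℝ)), DifferentiableAt ℝ Φ z :=
    hΦl.ae_differentiableAt
  have hS := locallyIntegrableOn_chartWeight_mul ha.continuous c hu.source
  have huΩ := hu.derivs.locInt c
  have hu0 : ∀ᵐ z, z ∈ stDomain N c → 0 ≤ u (stParam c z).1 (stParam c z).2 :=
    (ae_restrict_iff' hΩm).1 (ae_chart_of_cylinder hu.nonneg c)
  have hineq := local_weak_inequality hpp hm hΩ huΩ (hu.derivs.locInt_grad c)
    (hu.derivs.locInt_time c) (hu.derivs.grad c) (hu.derivs.time c) hu0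
    (locallyIntegrableOn_stParam c hu.power) e1 hS e2 e4 e5 e6
    (fun z hz ↦ lipAt_chartWeight ha c hz) hΦl hΦc hΦs
    (fun g hg _ hg0 ↦ chart_weak_inequality ha hu c hφ hs hg hg0) hH hH' hL hH0 hHB hJ
  -- values of the three terms
  have hsrc0 : ∀ z, z ∉ stSource N c → sourceTerm q V u H φ z = 0 := fun z hz ↦ by
    rw [sourceTerm, image_eq_zero_of_notMem_tsupport (f := fun z : M × ℝ ↦ φ z.1 z.2)
      fun h' ↦ hz (hs h'), zero_mul, zero_mul]
  have hflux0 : ∀ z, z ∉ stSource N c → fluxTerm p m f u G H H' φ z = 0 := fun z hz ↦ by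
    rw [fluxTerm, gradPairing_eq_zero (fun h' ↦ hz (hs h')),
      image_eq_zero_of_notMem_tsupport (f := fun z : M × ℝ ↦ φ z.1 z.2)
      fun h' ↦ hz (hs h')]
    ring
  have htime0 : ∀ z, z ∉ stSource N c → timeTerm u J φ z = 0 := fun z hz ↦ by
    rw [timeTerm, deriv_eq_zero_of_notMem_tsupport fun h' ↦ hz (hs h'), zero_mul]
  have hsrc : ∀ z ∈ stDomain N c, chartWeight a c z.1 * sourceTerm q V u H φ (stParam c z) =
      Φ z * H (u (stParam c z).1 (stParam c z).2) * (chartWeight a c z.1 *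
        (u (stParam c z).1 (stParam c z).2 ^ q * V (stParam c z).1 (stParam c z).2)) := by
    intro z hz
    rw [sourceTerm, hφΦ z hz]
    ring
  have hflux : ∀ z ∈ stDomain N c, chartWeight a c z.1 * fluxTerm p m f u G H H' φ (stParam c z) =
      (H (u (stParam c z).1 (stParam c z).2) * spaceDeriv Φ z (chartGrad c G z) +
        Φ z * H' (u (stParam c z).1 (stParam c z).2) *
          ∑ i, chartGrad c G z i * chartPartial c G i z) *
      (chartWeight a c z.1 * fluxFactor p m f u G (stParam c z)) := by
    intro z hz
    have h1 : ‖G (stParam c z).1 (stParam c z).2‖ = chartNorm c G z := rfl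
    rw [chartNorm_sq c G hz, fluxTerm, hφΦ z hz, gradPairing_stParam c hφΦ G hz, h1]
    ring
  have htime : ∀ z ∈ stDomain N c, chartWeight a c z.1 * timeTerm u J φ (stParam c z) =
      chartWeight a c z.1 * lineDeriv ℝ Φ z (0, 1) * J (u (stParam c z).1 (stParam c z).2) := by
    intro z hz
    have h1 := deriv_stParam (M := M) c hφΦ hz
    simp only [timeTerm, stParam] at h1 ⊢
    rw [h1]
    ring
  -- integrability
  set T := tsupport Φ with hT
  have hTc : IsCompact T := hΦc
  have hHc : Continuous H := continuous_iff_continuousAt.2 fun s ↦ (hH s).continuousAt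
  have hJc : Continuous J := continuous_iff_continuousAt.2 fun s ↦ (hJ s).continuousAt
  have hB0 : 0 ≤ B := (hH0 0).trans (hHB 0)
  have hHabs : ∀ s, |H s| ≤ B := fun s ↦ by rw [abs_of_nonneg (hH0 s)]; exact hHB s
  have hUm := (huΩ.integrableOn_compact_subset hΦs hTc).1
  have hint : ∀ {F : 𝕏 × ℝ → ℝ}, (∀ z, z ∉ T → F z = 0) → IntegrableOn F T →
      IntegrableOn F (stDomain N c) := fun hF0 hF ↦
    ((integrableOn_iff_integrable_of_support_subset fun z hz ↦ by
      by_contra h; exact hz (hF0 z h)).1 hF).integrableOn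
  have hρc : ContinuousOn (fun z : 𝕏 × ℝ ↦ chartWeight a c z.1) (stDomain N c) := by
    intro z hz
    obtain ⟨C, s, hs, hC⟩ := lipAt_chartWeight ha c hz
    exact (hC.continuousOn.continuousAt hs).continuousWithinAt
  obtain ⟨Bρ, hBρ⟩ := hTc.exists_bound_of_continuousOn (hρc.mono hΦs)
  obtain ⟨BΦ, hBΦ⟩ := hΦc.exists_bound_of_continuous hΦl.continuous
  have hT0 : ∀ z, z ∉ T → Φ z = 0 := fun z hz ↦ image_eq_zero_of_notMem_tsupport hz
  have hdm : ∀ v : 𝕏 × ℝ, AEStronglyMeasurable (fun z ↦ lineDeriv ℝ Φ z v) (volume.restrict T) :=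
    fun v ↦ aestronglyMeasurable_lineDeriv hΦl.continuous _
  have hdb : ∀ (v z : 𝕏 × ℝ), ‖lineDeriv ℝ Φ z v‖ ≤ Cφ * ‖v‖ := fun v z ↦
    norm_lineDeriv_le_of_lipschitz ℝ hΦl
  have hHm : AEStronglyMeasurable (fun z ↦ H (u (stParam c z).1 (stParam c z).2))
      (volume.restrict T) := hHc.comp_aestronglyMeasurable hUm
  have hH'm : AEStronglyMeasurable (fun z ↦ H' (u (stParam c z).1 (stParam c z).2))
      (volume.restrict T) := hH'.comp_aestronglyMeasurable hUm
  have hΦm : AEStronglyMeasurable Φ (volume.restrict T) := hΦl.continuous.aestronglyMeasurable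
  have hi1 : IntegrableOn (fun z ↦ Φ z * H (u (stParam c z).1 (stParam c z).2) *
      (chartWeight a c z.1 * (u (stParam c z).1 (stParam c z).2 ^ q *
        V (stParam c z).1 (stParam c z).2))) (stDomain N c) := by
    refine hint (fun z hz ↦ by rw [hT0 z hz, zero_mul, zero_mul]) ?_
    refine (hS.integrableOn_compact_subset hΦs hTc).bdd_mul (hΦm.mul hHm)
      (c := BΦ * B) (Eventually.of_forall fun z ↦ ?_)
    rw [norm_mul]
    have := (norm_nonneg _).trans (hBΦ z)
    gcongr
    · exact hBΦ z
    · exact hHabs _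
  have hi2 : IntegrableOn (fun z ↦
      (H (u (stParam c z).1 (stParam c z).2) * spaceDeriv Φ z (chartGrad c G z) +
        Φ z * H' (u (stParam c z).1 (stParam c z).2) *
          ∑ i, chartGrad c G z i * chartPartial c G i z) *
      (chartWeight a c z.1 * fluxFactor p m f u G (stParam c z))) (stDomain N c) := by
    refine hint (fun z hz ↦ by rw [hT0 z hz, spaceDeriv_eq_zero hz]; ring) ?_
    have h1 : IntegrableOn (fun z ↦ (∑ i, H (u (stParam c z).1 (stParam c z).2) *
        lineDeriv ℝ Φ z (EuclideanSpace.single i 1, 0) * (chartGrad c G z i *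
          (chartWeight a c z.1 * fluxFactor p m f u G (stParam c z)))) +
        Φ z * H' (u (stParam c z).1 (stParam c z).2) * (chartNorm c G z ^ 2 *
          (chartWeight a c z.1 * fluxFactor p m f u G (stParam c z)))) T := by
      refine Integrable.add (integrable_finsetSum _ fun i _ ↦ ?_) ?_
      · refine ((e2 i).integrableOn_compact_subset hΦs hTc).bdd_mul (hHm.mul (hdm _))
          (c := B * (Cφ * ‖((EuclideanSpace.single i 1, 0) : 𝕏 × ℝ)‖))
          (Eventually.of_forall fun z ↦ ?_)
        rw [norm_mul]
        exact mul_le_mul (hHabs _) (hdb _ _) (norm_nonneg _) hB0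
      · refine (e3.integrableOn_compact_subset hΦs hTc).bdd_mul (hΦm.mul hH'm)
          (c := BΦ * L) (Eventually.of_forall fun z ↦ ?_)
        rw [norm_mul]
        exact mul_le_mul (hBΦ z) (hL _) (norm_nonneg _) ((norm_nonneg _).trans (hBΦ z))
    refine Integrable.congr h1 ?_
    filter_upwards [ae_restrict_of_ae hdiffΦ, ae_restrict_mem hTc.measurableSet] with z hz hzT
    rw [spaceDeriv_eq_fderiv hz, fderiv_space_eq_sum, chartNorm_sq c G (hΦs hzT), add_mul,
      Finset.mul_sum, Finset.sum_mul]
    congr 1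
    · refine Finset.sum_congr rfl fun i _ ↦ ?_
      rw [hz.lineDeriv_eq_fderiv]
      ring
    · ring
  have hi3 : IntegrableOn (fun z ↦ chartWeight a c z.1 * lineDeriv ℝ Φ z (0, 1) *
      J (u (stParam c z).1 (stParam c z).2)) (stDomain N c) := by
    refine hint (fun z hz ↦ by rw [lineDeriv_eq_zero_of_notMem_tsupport hz]; ring) ?_
    have hJi : IntegrableOn (fun z ↦ J (u (stParam c z).1 (stParam c z).2)) T := by
      refine Integrable.mono' (((huΩ.integrableOn_compact_subset hΦs hTc).norm).const_mul B)
        (hJc.comp_aestronglyMeasurable hUm) (Eventually.of_forall fun z ↦ hJB _)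
    refine hJi.bdd_mul (((hρc.mono hΦs).aestronglyMeasurable hTc.measurableSet).mul (hdm _))
      (c := Bρ * (Cφ * ‖((0, 1) : 𝕏 × ℝ)‖)) ?_
    filter_upwards [ae_restrict_mem hTc.measurableSet] with z hz
    rw [norm_mul]
    exact mul_le_mul (hBρ z hz) (hdb _ _) (norm_nonneg _) ((norm_nonneg _).trans (hBρ z hz))
  refine ⟨?_, ?_, ?_, ?_, ?_⟩
  -- Rademacher's theorem, applied to the coordinate expression of `φ`; off the chart domain `φ`
  -- vanishes near every point.
  · rw [ae_restrict_iff' measurableSet_cylinder]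
    have h1 : ∀ᵐ z ∂(stMeasure N M).restrict (stSource N c),
        MDifferentiableAt (𝓡 N) 𝓘(ℝ, ℝ) (fun x ↦ φ x z.2) z.1 ∧
          DifferentiableAt ℝ (fun t ↦ φ z.1 t) z.2 := by
      rw [ae_stSource_iff]
      filter_upwards [ae_restrict_of_ae hdiffΦ, ae_restrict_mem hΩm] with z hz hzΩ
      exact ⟨mdifferentiableAt_stParam c hφΦ hzΩ hz, differentiableAt_time_stParam c hφΦ hzΩ hz⟩
    rw [ae_restrict_iff' (isOpen_stSource c).measurableSet] at h1
    filter_upwards [h1] with z hz _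
    by_cases hzc : z ∈ stSource N c
    · exact hz hzc
    · have hzt : z ∉ tsupport fun z : M × ℝ ↦ φ z.1 z.2 := fun h ↦ hzc (hs h)
      exact ⟨(mdifferentiableAt_const (c := (0 : ℝ))).congr_of_eventuallyEq
        (eventuallyEq_zero_space hzt),
        (differentiableAt_const (0 : ℝ)).congr_of_eventuallyEq (eventuallyEq_zero_time hzt)⟩
  · rw [integrableOn_weighted_iff ham c hsrc0]
    exact hi1.congr_fun (fun z hz ↦ (hsrc z hz).symm) hΩm
  · rw [integrableOn_weighted_iff ham c hflux0]
    exact hi2.congr_fun (fun z hz ↦ (hflux z hz).symm) hΩm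
  · rw [integrableOn_weighted_iff ham c htime0]
    exact hi3.congr_fun (fun z hz ↦ (htime z hz).symm) hΩm
  · rw [setIntegral_weighted ham c hsrc0, setIntegral_weighted ham c hflux0,
      setIntegral_weighted ham c htime0, setIntegral_congr_fun hΩm hsrc,
      setIntegral_congr_fun hΩm hflux, setIntegral_congr_fun hΩm htime]
    exact hineq

end ChartTested

/-! ### From one chart to arbitrary test functions -/

section Globalize
open Filter Topology

/-- A truncated affine function of the distance to `A`, equal to `1` within `δ / 2` of `A` and to
`0` beyond `δ`, where `δ` is so small that the closed `δ`-thickenings of `A` and `B` are disjoint.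
The thresholds leave room because the closed supports have to be separated. -/
theorem exists_separating_cutoff {X : Type*} [PseudoMetricSpace X] {A B : Set X}
    (hA : IsCompact A) (hAne : A.Nonempty) (hB : IsClosed B) (hAB : Disjoint A B) :
    ∃ θ : X → ℝ, (∀ x, LipAt θ x) ∧ (∀ x, LipAt (fun y ↦ 1 - θ y) x) ∧
      (∀ x, 0 ≤ θ x) ∧ (∀ x, θ x ≤ 1) ∧
      Disjoint (tsupport θ) B ∧ Disjoint (tsupport fun x ↦ 1 - θ x) A := by
  obtain ⟨δ, hδ, hd⟩ := hAB.exists_cthickenings hA hB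
  have hl : LipschitzWith 1 fun x ↦ Metric.infDist x A := Metric.lipschitz_infDist_pt A
  have h1 : LipschitzWith (Real.toNNReal (2 / δ)) fun x ↦ 2 - 2 / δ * Metric.infDist x A := by
    refine LipschitzWith.of_dist_le_mul fun x y ↦ ?_
    have := hl.dist_le_mul x y
    rw [Real.dist_eq] at this ⊢
    rw [Real.coe_toNNReal _ (by positivity), show 2 - 2 / δ * Metric.infDist x A -
      (2 - 2 / δ * Metric.infDist y A) = -(2 / δ * (Metric.infDist x A - Metric.infDist y A)) by
        ring, abs_neg, abs_mul, abs_of_pos (by positivity)]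
    gcongr
    simpa using this
  have h2 : LipschitzWith (Real.toNNReal (2 / δ))
      fun x ↦ max 0 (min 1 (2 - 2 / δ * Metric.infDist x A)) := (h1.const_min 1).const_max 0
  refine ⟨fun x ↦ max 0 (min 1 (2 - 2 / δ * Metric.infDist x A)), h2.locallyLipschitz, fun x ↦ ?_,
    fun x ↦ le_max_left _ _, fun x ↦ max_le zero_le_one (min_le_left _ _), ?_, ?_⟩
  · obtain ⟨C, s, hs, hC⟩ := h2.locallyLipschitz x
    refine ⟨C, s, hs, LipschitzOnWith.of_dist_le_mul fun y hy z hz ↦ ?_⟩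
    rw [dist_sub_left]
    exact hC.dist_le_mul y hy z hz
  · refine Set.disjoint_left.2 fun x hx hxB ↦ ?_
    have h3 : tsupport (fun x ↦ max 0 (min 1 (2 - 2 / δ * Metric.infDist x A))) ⊆
        {x | Metric.infDist x A ≤ δ} := by
      refine closure_minimal (fun x hx ↦ ?_) (isClosed_le hl.continuous continuous_const)
      by_contra h
      refine hx (max_eq_left ((min_le_right _ _).trans ?_))
      rw [mem_ofPred_eq, not_le] at h
      have : 2 ≤ 2 / δ * Metric.infDist x A := by
        calc (2 : ℝ) = 2 / δ * δ := by field_simp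
          _ ≤ _ := by gcongr
      linarith
    have h4 : x ∈ Metric.cthickening δ A := by
      rw [Metric.mem_cthickening_iff, ← ENNReal.ofReal_toReal (Metric.infEDist_ne_top hAne)]
      exact ENNReal.ofReal_le_ofReal (h3 hx)
    exact Set.disjoint_left.1 hd h4 (Metric.self_subset_cthickening B hxB)
  · refine Set.disjoint_left.2 fun x hx hxA ↦ ?_
    have h3 : tsupport (fun x ↦ 1 - max 0 (min 1 (2 - 2 / δ * Metric.infDist x A))) ⊆
        {x | δ / 2 ≤ Metric.infDist x A} := by
      refine closure_minimal (fun x hx ↦ ?_) (isClosed_le continuous_const hl.continuous)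
      by_contra h
      rw [mem_ofPred_eq, not_le] at h
      have : 2 / δ * Metric.infDist x A ≤ 1 := by
        calc 2 / δ * Metric.infDist x A ≤ 2 / δ * (δ / 2) := by gcongr
          _ = 1 := by field_simp
      refine hx ?_
      beta_reduce
      rw [min_eq_left (by linarith), max_eq_right zero_le_one, sub_self]
    have h4 := h3 hx
    rw [mem_ofPred_eq, Metric.infDist_zero_of_mem hxA] at h4
    linarith

theorem IsTestFunction.mul {M : Type*} [MetricSpace M] {φ θ : M → ℝ → ℝ} (hφ : IsTestFunction φ)
    (hθ : ∀ z, LipAt (fun z : M × ℝ ↦ θ z.1 z.2) z) (hθ0 : ∀ x t, 0 ≤ θ x t) :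
    IsTestFunction fun x t ↦ φ x t * θ x t := by
  have hsub : tsupport (fun z : M × ℝ ↦ φ z.1 z.2 * θ z.1 z.2) ⊆
      tsupport fun z : M × ℝ ↦ φ z.1 z.2 :=
    tsupport_mul_subset_left (f := fun z : M × ℝ ↦ φ z.1 z.2) (g := fun z : M × ℝ ↦ θ z.1 z.2)
  exact ⟨fun z ↦ LipAt.mul (f := fun z : M × ℝ ↦ φ z.1 z.2) (hφ.lip z) (hθ z),
    hφ.compact.mul_right, hsub.trans hφ.support, fun x t ↦ mul_nonneg (hφ.nonneg x t) (hθ0 x t)⟩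

variable {N : ℕ} {M : Type*} [MetricSpace M] [ChartedSpace (EuclideanSpace ℝ (Fin N)) M]
  [MeasurableSpace M] [BorelSpace M]
  [RiemannianBundle (fun x : M ↦ TangentSpace (𝓡 N) x)] [IsManifold (𝓡 N) ∞ M]
  [IsContMDiffRiemannianBundle (𝓡 N) ∞ (EuclideanSpace ℝ (Fin N))
      (fun x : M ↦ TangentSpace (𝓡 N) x)]
  [SecondCountableTopology M] [IsRiemannianManifold (𝓡 N) M]

theorem weighted_absolutelyContinuous {a : M → ℝ} (ha : Measurable a) :
    ((weightedMeasure N a).prod volume).restrict (cylinder M) ≪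
      (stMeasure N M).restrict (cylinder M) := by
  rw [weightedMeasure_prod ha]
  exact (withDensity_absolutelyContinuous _ _).restrict _

/-- All terms are linear in the cutoff wherever it is differentiable; this is why a.e.
differentiability and integrability are part of `TestedInequality`. -/
theorem TestedInequality.add {p q m : ℝ} {f : ℝ → ℝ} {a : M → ℝ} (ha : Measurable a)
    {V u : M → ℝ → ℝ} {G : (x : M) → ℝ → TangentSpace (𝓡 N) x} {H H' J : ℝ → ℝ}
    {φ ψ χ : M → ℝ → ℝ} (hφ : TestedInequality p q m f a V u G H H' J φ)
    (hψ : TestedInequality p q m f a V u G H H' J ψ) (hχ : ∀ x t, χ x t = φ x t + ψ x t) :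
    TestedInequality p q m f a V u G H H' J χ := by
  obtain rfl : χ = fun x t ↦ φ x t + ψ x t := by
    ext x t
    exact hχ x t
  have h1 : ∀ z, sourceTerm q V u H (fun x t ↦ φ x t + ψ x t) z =
      sourceTerm q V u H φ z + sourceTerm q V u H ψ z := fun z ↦ by
    simp only [sourceTerm]
    ring
  have hd := hφ.diff.and hψ.diff
  have h2 : ∀ᵐ z ∂((weightedMeasure N a).prod volume).restrict (cylinder M),
      fluxTerm p m f u G H H' (fun x t ↦ φ x t + ψ x t) z =
        fluxTerm p m f u G H H' φ z + fluxTerm p m f u G H H' ψ z := by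
    filter_upwards [weighted_absolutelyContinuous ha hd] with z hz
    have h3 : gradPairing G (fun x t ↦ φ x t + ψ x t) z =
        gradPairing G φ z + gradPairing G ψ z := by
      have h4 := (hz.1.1.hasMFDerivAt.add hz.2.1.hasMFDerivAt).mfderiv
      exact congrArg (fun L : EuclideanSpace ℝ (Fin N) →L[ℝ] ℝ ↦ L (G z.1 z.2)) h4
    simp only [fluxTerm, h3]
    ring
  have h3 : ∀ᵐ z ∂((weightedMeasure N a).prod volume).restrict (cylinder M),
      timeTerm u J (fun x t ↦ φ x t + ψ x t) z = timeTerm u J φ z + timeTerm u J ψ z := by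
    filter_upwards [weighted_absolutelyContinuous ha hd] with z hz
    simp only [timeTerm]
    rw [deriv_fun_add hz.1.2 hz.2.2, add_mul]
  refine ⟨?_, ?_, ?_, ?_, ?_⟩
  · filter_upwards [hd] with z hz
    exact ⟨hz.1.1.add hz.2.1, hz.1.2.add hz.2.2⟩
  · exact (hφ.source.add hψ.source).congr (Eventually.of_forall fun z ↦ (h1 z).symm)
  · exact (hφ.flux.add hψ.flux).congr (h2.mono fun z hz ↦ hz.symm)
  · exact (hφ.time.add hψ.time).congr (h3.mono fun z hz ↦ hz.symm)
  · rw [integral_congr_ae (Eventually.of_forall h1), integral_congr_ae h2, integral_congr_ae h3,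
      integral_add hφ.source hψ.source, integral_add hφ.flux hψ.flux,
      integral_add hφ.time hψ.time]
    linarith [hφ.ineq, hψ.ineq]

/-- The weak inequality may be tested with `φ H(u)`. -/
theorem IsSolutionTriple.testedInequality [Nonempty M] {p q m K : ℝ} (hp : 1 < p) (hm : 1 ≤ m)
    {f : ℝ → ℝ} (hf_meas : Measurable f) (hf : ∀ s, 0 ≤ s → 0 ≤ f s ∧ f s ≤ K) {a : M → ℝ}
    (ha : LocallyLipschitz a) {V u : M → ℝ → ℝ} {G : (x : M) → ℝ → TangentSpace (𝓡 N) x}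
    {w : M → ℝ → ℝ} (hu : IsSolutionTriple p q m f a V u G w)
    {H H' J : ℝ → ℝ} (hH : ∀ s, HasDerivAt H (H' s) s) (hH' : Continuous H') {L : ℝ}
    (hL : ∀ s, |H' s| ≤ L) {B : ℝ} (hH0 : ∀ s, 0 ≤ H s) (hHB : ∀ s, H s ≤ B)
    (hJ : ∀ s, HasDerivAt J (H s) s) (hJB : ∀ s, |J s| ≤ B * |s|)
    {φ : M → ℝ → ℝ} (hφ : IsTestFunction φ) :
    TestedInequality p q m f a V u G H H' J φ := by
  -- A Lipschitz partition of unity is built one chart at a time, by induction on the charts that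
  -- cover the support.
  have key : ∀ (s : Finset M) (φ : M → ℝ → ℝ), IsTestFunction φ →
      tsupport (fun z : M × ℝ ↦ φ z.1 z.2) ⊆ ⋃ c ∈ s, stSource N c →
      TestedInequality p q m f a V u G H H' J φ := by
    classical
    intro s
    induction s using Finset.induction_on with
    | empty =>
      intro φ hφ hs
      -- The support is empty here, so any chart will do.
      obtain ⟨c⟩ := ‹Nonempty M›
      refine testedInequality_of_chart hp hm hf_meas hf ha hu hH hH' hL hH0 hHB hJ hJB c hφ ?_
      refine hs.trans ?_
      simp
    | insert c s _ ih =>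
      intro φ hφ hs
      set T := tsupport (fun z : M × ℝ ↦ φ z.1 z.2) with hT
      have hTc : IsCompact T := hφ.compact
      set W := ⋃ c ∈ s, stSource N c with hW
      have hWo : IsOpen W := isOpen_biUnion fun c _ ↦ isOpen_stSource c
      rw [Finset.set_biUnion_insert] at hs
      rcases (T \ W).eq_empty_or_nonempty with hA | hA
      · exact ih φ hφ (sdiff_eq_empty.1 hA)
      -- The part of the support outside `W` must be handled by the chart `c`, and the part outside
      -- the domain of `c` by the others. With `θ` separating the two, `φ θ` lives over the chart
      -- `c` and `φ (1 - θ)` in `W`.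
      have hdis : Disjoint (T \ W) (T \ stSource N c) := by
        refine Set.disjoint_left.2 fun z hz hz' ↦ ?_
        rcases hs hz.1 with h | h
        · exact hz'.2 h
        · exact hz.2 h
      obtain ⟨θ, h1, h2, h3, h4, h5, h6⟩ := exists_separating_cutoff (hTc.diff hWo) hA
        (hTc.diff (isOpen_stSource c)).isClosed hdis
      have hφ1 : IsTestFunction fun x t ↦ φ x t * θ (x, t) :=
        hφ.mul (θ := fun x t ↦ θ (x, t)) h1 fun x t ↦ h3 _
      have hφ2 : IsTestFunction fun x t ↦ φ x t * (1 - θ (x, t)) :=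
        hφ.mul (θ := fun x t ↦ 1 - θ (x, t)) h2 fun x t ↦ sub_nonneg.2 (h4 _)
      refine TestedInequality.add ha.continuous.measurable
        (testedInequality_of_chart hp hm hf_meas hf ha hu hH hH' hL hH0 hHB hJ hJB c hφ1 ?_)
        (ih _ hφ2 ?_) fun x t ↦ by ring
      · intro z hz
        by_contra h
        exact Set.disjoint_left.1 h5
          (tsupport_mul_subset_right (f := fun z : M × ℝ ↦ φ z.1 z.2) (g := θ) hz)
          ⟨tsupport_mul_subset_left (f := fun z : M × ℝ ↦ φ z.1 z.2) (g := θ) hz, h⟩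
      · intro z hz
        by_contra h
        exact Set.disjoint_left.1 h6
          (tsupport_mul_subset_right (f := fun z : M × ℝ ↦ φ z.1 z.2) (g := fun z ↦ 1 - θ z) hz)
          ⟨tsupport_mul_subset_left (f := fun z : M × ℝ ↦ φ z.1 z.2) (g := fun z ↦ 1 - θ z) hz, h⟩
  obtain ⟨s, hs⟩ := hφ.compact.isCompact.elim_finite_subcover (fun c : M ↦ stSource N c)
    (fun c ↦ isOpen_stSource c) fun z hz ↦ mem_iUnion.2
      ⟨z.1, mem_chart_source (EuclideanSpace ℝ (Fin N)) z.1, (hφ.support hz).2⟩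
  exact key s φ hφ hs

end Globalize

/-! ### Young-type inequalities with constants uniform in `β` -/

section ScalarInequalities

/-- Either the left side is at most `Y y^b`, or `y^(b-a) < X / Y`, which bounds `y^a`. This form of
Young's inequality has no constants depending on the exponents, which matters because the exponents
will vary with `β`. -/
theorem young_rpow {X Y y a b : ℝ} (hX : 0 ≤ X) (hY : 0 < Y) (hy : 0 < y) (ha : 0 ≤ a)
    (hab : a < b) :
    X * y ^ a ≤ Y * y ^ b + X ^ (b / (b - a)) * Y ^ (-(a / (b - a))) := by
  have hba : 0 < b - a := sub_pos.2 hab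
  have hya := Real.rpow_pos_of_pos hy a
  rcases hX.eq_or_lt with rfl | hX
  · have := Real.rpow_nonneg le_rfl (b / (b - a)) (x := (0 : ℝ))
    rw [zero_mul]
    positivity
  rcases le_or_gt (X * y ^ a) (Y * y ^ b) with h | h
  · refine h.trans (le_add_of_nonneg_right ?_)
    positivity
  · have h1 : y ^ (b - a) ≤ X / Y := by
      rw [Real.rpow_sub hy, div_le_div_iff₀ hya hY]
      linarith
    have h2 : y ^ a ≤ (X / Y) ^ (a / (b - a)) := by
      calc y ^ a = (y ^ (b - a)) ^ (a / (b - a)) := by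
            rw [← Real.rpow_mul hy.le]
            congr 1
            field_simp
        _ ≤ _ := Real.rpow_le_rpow (by positivity) h1 (by positivity)
    have h3 : X ^ (b / (b - a)) * Y ^ (-(a / (b - a))) = X * (X / Y) ^ (a / (b - a)) := by
      rw [Real.div_rpow hX.le hY.le, Real.rpow_neg hY.le, show b / (b - a) = 1 + a / (b - a) by
        field_simp; ring, Real.rpow_add hX, Real.rpow_one]
      ring
    rw [h3]
    have : 0 ≤ Y * y ^ b := by positivity
    nlinarith [mul_le_mul_of_nonneg_left h2 hX.le]

/-- If `A ≤ w n` the left side is nonpositive; otherwise `n < A / w`. Here `w` will be the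
coefficient of the good gradient term and `A` that of the cutoff term. -/
theorem young_gradient {p A n w : ℝ} (hp : 1 < p) (hA : 0 ≤ A) (hn : 0 ≤ n) (hw : 0 < w) :
    A * n ^ (p - 1) - w * n ^ p ≤ A ^ p * w ^ (1 - p) := by
  have h0 : 0 ≤ A ^ p * w ^ (1 - p) := by positivity
  have h1 : n ^ p = n * n ^ (p - 1) := by
    rw [← Real.rpow_one_add' hn (by linarith)]
    ring_nf
  have h2 := Real.rpow_nonneg hn (p - 1)
  rcases le_or_gt A (w * n) with h | h
  · refine le_trans ?_ h0
    rw [h1]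
    nlinarith [mul_le_mul_of_nonneg_right h h2]
  · have h3 : n ≤ A / w := by
      rw [le_div_iff₀ hw]
      linarith
    calc A * n ^ (p - 1) - w * n ^ p ≤ A * n ^ (p - 1) := by
          have : 0 ≤ w * n ^ p := by positivity
          linarith
      _ ≤ A * (A / w) ^ (p - 1) := by gcongr
      _ = A ^ p * w ^ (1 - p) := by
          have h4 : A ^ p = A * A ^ (p - 1) := by
            rw [← Real.rpow_one_add' hA (by linarith)]
            ring_nf
          rw [Real.div_rpow hA hw.le, show 1 - p = -(p - 1) by ring, Real.rpow_neg hw.le, h4]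
          ring

/-- The flux term tested with `φ₀ ^ k (u + δ) ^ (-β)`, after Young's inequality; `y` stands for
`u + δ` and `g` for `⟨∇φ₀ ^ k, ∇u⟩`. -/
theorem flux_le {p m K β φ₀ P u y n fn g : ℝ} {k : ℕ} (hp : 1 < p) (hm : 1 ≤ m) (hβ : 0 < β)
    (hφ₀ : 0 ≤ φ₀) (hP : 0 ≤ P) (hu : 0 ≤ u) (hy : 0 < y) (huy : u ≤ y) (hn : 0 ≤ n)
    (hf0 : 0 ≤ fn) (hfK : fn ≤ K) (hk : 2 ≤ k) (hg : |g| ≤ k * φ₀ ^ (k - 1) * P * n) :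
    (y ^ (-β) * g + φ₀ ^ k * (-β * y ^ (-β - 1)) * n ^ 2) * (u ^ (m - 1) * n ^ (p - 2) * fn) ≤
      K * β ^ (1 - p) * (k * P) ^ p * φ₀ ^ ((k : ℝ) - p) * y ^ (p + m - 2 - β) := by
  have hK : 0 ≤ K := hf0.trans hfK
  -- At `φ₀ = 0` the left side vanishes because `k ≥ 2`; the main computation splits powers of `φ₀`
  -- and needs positivity.
  rcases hφ₀.eq_or_lt with rfl | hφ
  · have h1 : g = 0 := by
      rw [zero_pow (by omega), mul_zero, zero_mul, zero_mul] at hg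
      exact abs_eq_zero.1 (le_antisymm hg (abs_nonneg _))
    rw [h1, zero_pow (by omega)]
    have := Real.rpow_nonneg (le_refl (0 : ℝ)) ((k : ℝ) - p)
    simp only [mul_zero, zero_mul, add_zero]
    positivity
  set A := k * φ₀ ^ (k - 1) * P with hA
  have hA0 : 0 ≤ A := by positivity
  have hw : 0 < β * φ₀ ^ k := by positivity
  have h1 := young_gradient hp (mul_nonneg hA0 hy.le) hn hw
  -- After the common factor is extracted, the term `-β φ₀^k n^p` coming from the derivative of
  -- `y^(-β)` stands against the cutoff term, ready for `young_gradient`.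
  have h2 : (y ^ (-β) * g + φ₀ ^ k * (-β * y ^ (-β - 1)) * n ^ 2) *
      (u ^ (m - 1) * n ^ (p - 2) * fn) ≤
      u ^ (m - 1) * fn * y ^ (-β - 1) * (A * y * n ^ (p - 1) - β * φ₀ ^ k * n ^ p) := by
    have h3 : y ^ (-β) = y ^ (-β - 1) * y := by
      rw [Real.rpow_sub_one hy.ne']
      field_simp
    have hn2 := Real.rpow_nonneg hn (p - 2)
    rw [← mul_rpow_sub_two hn hp, ← sq_mul_rpow_sub_two hn hp, h3]
    have h4 : (y ^ (-β - 1) * y * g + φ₀ ^ k * (-β * y ^ (-β - 1)) * n ^ 2) *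
      (u ^ (m - 1) * n ^ (p - 2) * fn) = u ^ (m - 1) * fn * y ^ (-β - 1) *
        (g * y * n ^ (p - 2) - β * φ₀ ^ k * (n ^ 2 * n ^ (p - 2))) := by ring
    rw [h4, show A * y * (n * n ^ (p - 2)) = (A * n) * y * n ^ (p - 2) by ring]
    gcongr
    exact (le_abs_self g).trans hg
  refine h2.trans ?_
  have hum : u ^ (m - 1) ≤ y ^ (m - 1) := Real.rpow_le_rpow hu huy (by linarith)
  calc u ^ (m - 1) * fn * y ^ (-β - 1) * (A * y * n ^ (p - 1) - β * φ₀ ^ k * n ^ p)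
      ≤ u ^ (m - 1) * fn * y ^ (-β - 1) * ((A * y) ^ p * (β * φ₀ ^ k) ^ (1 - p)) := by gcongr
    _ ≤ y ^ (m - 1) * K * y ^ (-β - 1) * ((A * y) ^ p * (β * φ₀ ^ k) ^ (1 - p)) := by gcongr
    _ = _ := by
        have h5 : φ₀ ^ ((k : ℝ) - p) = (φ₀ ^ (k - 1)) ^ p * (φ₀ ^ k) ^ (1 - p) := by
          rw [← Real.rpow_natCast, ← Real.rpow_natCast, ← Real.rpow_mul hφ.le,
            ← Real.rpow_mul hφ.le, ← Real.rpow_add hφ]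
          congr 1
          rw [Nat.cast_sub (by omega)]
          push_cast
          ring
        have h6 : y ^ (p + m - 2 - β) = y ^ (m - 1) * y ^ (-β - 1) * y ^ p := by
          rw [← Real.rpow_add hy, ← Real.rpow_add hy]
          congr 1
          ring
        rw [h5, h6, hA, Real.mul_rpow (by positivity) hy.le, Real.mul_rpow hβ.le (by positivity),
          show (k : ℝ) * φ₀ ^ (k - 1) * P = φ₀ ^ (k - 1) * (k * P) by ring,
          Real.mul_rpow (by positivity) (by positivity)]
        ring

/-- Absorption of a lower order term into the source term. -/
theorem absorb_le {q β φ X u δ h a : ℝ} (hq : 0 ≤ q) (hφ : 0 < φ) (hX : 0 ≤ X) (hu : 0 ≤ u)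
    (hδ : 0 < δ) (hh : 0 < h) (ha : 0 ≤ a) (haq : a < q - β) :
    X * (u + δ) ^ a ≤ 4⁻¹ * (φ * (u + δ) ^ (-β) * (u ^ q * h)) +
      X ^ ((q - β) / (q - β - a)) * ((4 * 2 ^ q)⁻¹ * φ * h) ^ (-(a / (q - β - a))) +
      X * (2 * δ) ^ a := by
  have hy : 0 < u + δ := by linarith
  have hY : 0 < (4 * 2 ^ q)⁻¹ * φ * h := by positivity
  -- For `u ≥ δ` one has `u + δ ≤ 2u`, so `(u+δ)^q` is comparable to `u^q` at the cost of `2^q`. For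
  -- `u ≤ δ` the whole term is at most `X (2δ)^a`, which tends to zero with `δ` when `a > 0`.
  rcases le_total δ u with h1 | h1
  · have h2 := young_rpow hX hY hy ha haq
    have h3 : (4 * 2 ^ q)⁻¹ * φ * h * (u + δ) ^ (q - β) ≤
        4⁻¹ * (φ * (u + δ) ^ (-β) * (u ^ q * h)) := by
      have h4 : (u + δ) ^ q ≤ 2 ^ q * u ^ q := by
        rw [← Real.mul_rpow two_pos.le hu]
        exact Real.rpow_le_rpow hy.le (by linarith) hq
      have h5 : (u + δ) ^ (q - β) = (u + δ) ^ q * (u + δ) ^ (-β) := by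
        rw [← Real.rpow_add hy]
        rfl
      have h6 : (2 : ℝ) ^ q ≠ 0 := by positivity
      calc (4 * 2 ^ q)⁻¹ * φ * h * (u + δ) ^ (q - β)
          = (4 * 2 ^ q)⁻¹ * φ * h * (u + δ) ^ (-β) * (u + δ) ^ q := by rw [h5]; ring
        _ ≤ (4 * 2 ^ q)⁻¹ * φ * h * (u + δ) ^ (-β) * (2 ^ q * u ^ q) := by gcongr
        _ = _ := by field_simp
    have h7 : 0 ≤ X * (2 * δ) ^ a := by positivity
    linarith
  · have h2 : X * (u + δ) ^ a ≤ X * (2 * δ) ^ a := by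
      gcongr
      linarith
    have h3 : 0 ≤ 4⁻¹ * (φ * (u + δ) ^ (-β) * (u ^ q * h)) := by positivity
    have h4 : 0 ≤ X ^ ((q - β) / (q - β - a)) *
        ((4 * 2 ^ q)⁻¹ * φ * h) ^ (-(a / (q - β - a))) := by positivity
    linarith

theorem rpow_le_max_one_rpow {c r s : ℝ} (hc : 0 ≤ c) (hr : 0 ≤ r) (hrs : r ≤ s) :
    c ^ r ≤ max 1 c ^ s :=
  (Real.rpow_le_rpow hc (le_max_right _ _) hr).trans
    (Real.rpow_le_rpow_of_exponent_le (le_max_left _ _) hrs)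

theorem rpow_neg_self_le {β : ℝ} (hβ : 0 < β) : β ^ (-β) ≤ Real.exp 1 := by
  rw [Real.rpow_def_of_pos hβ]
  refine Real.exp_le_exp.2 ?_
  have h1 := Real.log_le_sub_one_of_pos (inv_pos.2 hβ)
  rw [Real.log_inv] at h1
  have h2 : β * (β⁻¹ - 1) = 1 - β := by field_simp
  nlinarith [mul_le_mul_of_nonneg_left h1 hβ.le]

/-- The size of the remainder left by `absorb_le`, with a constant independent of `β`. -/
theorem exists_remainder_le {q e c μ j C α : ℝ} (hq : 0 < q) (he : 0 < e) (heq : e < q)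
    (hc : 0 ≤ c) (hμ : 0 ≤ μ) (hC : 0 < C) (hα : 0 ≤ α) {k : ℕ} (hj : 0 ≤ j)
    (hk : j * q / (q - e) ≤ k) :
    ∃ C₁ : ℝ, 0 ≤ C₁ ∧ ∀ β φ₀ ϱ h X : ℝ, 0 < β → β < 1 → β < e → 0 < φ₀ → φ₀ ≤ 1 → 1 ≤ ϱ →
      Real.log ϱ ≤ 2 / β → 0 < h → h ≤ C * (1 + ϱ) ^ α → 0 ≤ X →
      X ≤ c * β * ϱ ^ (-μ) * φ₀ ^ ((k : ℝ) - j) →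
      X ^ ((q - β) / (q - β - (e - β))) * ((4 * 2 ^ q)⁻¹ * φ₀ ^ k * h) ^
          (-((e - β) / (q - β - (e - β)))) ≤
        C₁ * β ^ (q / (q - e)) * ϱ ^ (-(μ * q / (q - e))) * h ^ (-(e / (q - e))) := by
  set d := q - e with hd
  have hd0 : 0 < d := sub_pos.2 heq
  -- One factor for each of the bounds `f1`, `f5`, `f2`, `f3`, `f6` below, while `f4` contributes
  -- `1`. None depends on `β`.
  refine ⟨max 1 c ^ (q / d) * (4 * 2 ^ q) ^ (e / d) * Real.exp 1 ^ (1 / d) *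
    Real.exp 2 ^ (μ / d) * (max 1 (C * 2 ^ α) ^ (1 / d) * Real.exp 2 ^ (α / d)), by positivity, ?_⟩
  intro β φ₀ ϱ h X hβ hβ1 hβe hφ hφ1 hϱ hϱβ hh hhC hX hXc
  have hϱ0 : 0 < ϱ := by linarith
  rw [show q - β - (e - β) = d by rw [hd]; ring]
  have hqβ : 0 ≤ (q - β) / d := div_nonneg (by linarith) hd0.le
  have heβ : 0 ≤ (e - β) / d := div_nonneg (by linarith) hd0.le
  have h42 : (1 : ℝ) ≤ 4 * 2 ^ q := by
    have : (1 : ℝ) ≤ 2 ^ q := Real.one_le_rpow (by norm_num) hq.le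
    linarith
  -- the factors
  have hϱβ' : ϱ ^ β ≤ Real.exp 2 := by
    rw [Real.rpow_def_of_pos hϱ0]
    refine Real.exp_le_exp.2 ?_
    calc Real.log ϱ * β ≤ 2 / β * β := by gcongr
      _ = 2 := by field_simp
  have f1 : c ^ ((q - β) / d) ≤ max 1 c ^ (q / d) :=
    rpow_le_max_one_rpow hc hqβ (by gcongr; linarith)
  have f2 : β ^ ((q - β) / d) ≤ β ^ (q / d) * Real.exp 1 ^ (1 / d) := by
    have : (q - β) / d = q / d + -β * (1 / d) := by ring
    rw [this, Real.rpow_add hβ, Real.rpow_mul hβ.le]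
    gcongr
    exact rpow_neg_self_le hβ
  have f3 : (ϱ ^ (-μ)) ^ ((q - β) / d) ≤ ϱ ^ (-(μ * q / d)) * Real.exp 2 ^ (μ / d) := by
    have : -μ * ((q - β) / d) = -(μ * q / d) + β * (μ / d) := by ring
    rw [← Real.rpow_mul hϱ0.le, this, Real.rpow_add hϱ0, Real.rpow_mul hϱ0.le]
    gcongr
  -- The lower bound on `k` makes the total exponent of `φ₀` nonnegative, so the cutoff disappears
  -- from the remainder.
  have f4 : (φ₀ ^ ((k : ℝ) - j)) ^ ((q - β) / d) * (φ₀ ^ k) ^ (-((e - β) / d)) ≤ 1 := by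
    rw [← Real.rpow_natCast, ← Real.rpow_mul hφ.le, ← Real.rpow_mul hφ.le, ← Real.rpow_add hφ]
    refine Real.rpow_le_one hφ.le hφ1 ?_
    have h1 : ((k : ℝ) - j) * ((q - β) / d) + k * -((e - β) / d) =
        (k * (q - e) - j * (q - β)) / d := by ring
    rw [h1, ← hd]
    refine div_nonneg ?_ hd0.le
    rw [div_le_iff₀ hd0] at hk
    nlinarith [mul_nonneg hj hβ.le]
  have f5 : ((4 * 2 ^ q : ℝ)⁻¹) ^ (-((e - β) / d)) ≤ (4 * 2 ^ q) ^ (e / d) := by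
    rw [Real.inv_rpow (by positivity), ← Real.rpow_neg (by positivity), neg_neg]
    exact Real.rpow_le_rpow_of_exponent_le h42 (by gcongr; linarith)
  -- The exponent of `h` misses the desired one by `β / d`; since `h` grows at most polynomially and
  -- `ϱ^β ≤ e²`, the excess `h^(β/d)` is bounded.
  have f6 : h ^ (-((e - β) / d)) ≤ h ^ (-(e / d)) *
      (max 1 (C * 2 ^ α) ^ (1 / d) * Real.exp 2 ^ (α / d)) := by
    have : -((e - β) / d) = -(e / d) + β / d := by ring
    rw [this, Real.rpow_add hh]
    gcongr
    have h1 : h ≤ C * 2 ^ α * ϱ ^ α := by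
      rw [mul_assoc, ← Real.mul_rpow two_pos.le hϱ0.le]
      refine hhC.trans ?_
      gcongr
      linarith
    calc h ^ (β / d) ≤ (C * 2 ^ α * ϱ ^ α) ^ (β / d) := by gcongr
      _ = (C * 2 ^ α) ^ (β / d) * (ϱ ^ β) ^ (α / d) := by
          rw [Real.mul_rpow (by positivity) (by positivity), ← Real.rpow_mul hϱ0.le,
            ← Real.rpow_mul hϱ0.le]
          congr 2
          ring
      _ ≤ _ := by
          gcongr
          exact rpow_le_max_one_rpow (by positivity) (by positivity) (by gcongr)
  calc X ^ ((q - β) / d) * ((4 * 2 ^ q)⁻¹ * φ₀ ^ k * h) ^ (-((e - β) / d))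
      ≤ (c * β * ϱ ^ (-μ) * φ₀ ^ ((k : ℝ) - j)) ^ ((q - β) / d) *
          ((4 * 2 ^ q)⁻¹ * φ₀ ^ k * h) ^ (-((e - β) / d)) := by gcongr
    _ = c ^ ((q - β) / d) * β ^ ((q - β) / d) * (ϱ ^ (-μ)) ^ ((q - β) / d) *
          ((φ₀ ^ ((k : ℝ) - j)) ^ ((q - β) / d) * (φ₀ ^ k) ^ (-((e - β) / d))) *
          ((4 * 2 ^ q : ℝ)⁻¹) ^ (-((e - β) / d)) * h ^ (-((e - β) / d)) := by
        rw [Real.mul_rpow (by positivity) (by positivity),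
          Real.mul_rpow (by positivity) (by positivity), Real.mul_rpow hc hβ.le,
          Real.mul_rpow (by positivity) hh.le, Real.mul_rpow (by positivity) (by positivity)]
        ring
    _ ≤ max 1 c ^ (q / d) * (β ^ (q / d) * Real.exp 1 ^ (1 / d)) *
          (ϱ ^ (-(μ * q / d)) * Real.exp 2 ^ (μ / d)) * 1 * (4 * 2 ^ q) ^ (e / d) *
          (h ^ (-(e / d)) * (max 1 (C * 2 ^ α) ^ (1 / d) * Real.exp 2 ^ (α / d))) := by gcongr
    _ = _ := by ring

end ScalarInequalities

/-! ### The regularized negative power -/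

section RegularizedPower

/-- A bounded `C¹` extension to the real line of `s ↦ (s + δ) ^ (-β)`, with an antiderivative. -/
theorem exists_regularized_power {β δ : ℝ} (hβ : 0 < β) (hβ1 : β < 1) (hδ : 0 < δ) :
    ∃ (H H' J : ℝ → ℝ) (L B : ℝ), (∀ s, HasDerivAt H (H' s) s) ∧ Continuous H' ∧
      (∀ s, |H' s| ≤ L) ∧ (∀ s, 0 ≤ H s) ∧ (∀ s, H s ≤ B) ∧ (∀ s, HasDerivAt J (H s) s) ∧
      (∀ s, |J s| ≤ B * |s|) ∧
      ∀ s, 0 ≤ s → H s = (s + δ) ^ (-β) ∧ H' s = -β * (s + δ) ^ (-β - 1) ∧ 0 ≤ J s ∧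
        J s ≤ (s + δ) ^ (1 - β) / (1 - β) := by
  -- The derivative is extended evenly, so that `H - δ^(-β)` is odd and `H` remains between `0` and
  -- `2 δ^(-β)` on the whole line.
  set H' : ℝ → ℝ := fun s ↦ -β * (|s| + δ) ^ (-β - 1) with hH'
  have hpos : ∀ s : ℝ, 0 < |s| + δ := fun s ↦ by positivity
  have hc : Continuous H' := continuous_const.mul
    ((continuous_abs.add continuous_const).rpow_const fun s ↦ Or.inl (hpos s).ne')
  set H : ℝ → ℝ := fun s ↦ δ ^ (-β) + ∫ t in (0 : ℝ)..s, H' t with hH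
  have hHd : ∀ s, HasDerivAt H (H' s) s := fun s ↦
    (hc.integral_hasStrictDerivAt 0 s).hasDerivAt.const_add _
  have hHc : Continuous H := continuous_iff_continuousAt.2 fun s ↦ (hHd s).continuousAt
  have hpow : ∀ r : ℝ, ∀ s, 0 ≤ s → HasDerivAt (fun t ↦ (t + δ) ^ r) (r * (s + δ) ^ (r - 1)) s := by
    intro r s hs
    have h1 : HasDerivAt (fun t ↦ t + δ) 1 s := (hasDerivAt_id s).add_const δ
    have h2 := h1.rpow_const (p := r) (Or.inl (by positivity))
    simpa using h2
  have hHpos : ∀ s, 0 ≤ s → H s = (s + δ) ^ (-β) := by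
    intro s hs
    have h1 : ∫ t in (0 : ℝ)..s, H' t = (s + δ) ^ (-β) - (0 + δ) ^ (-β) := by
      refine intervalIntegral.integral_eq_sub_of_hasDerivAt (f := fun t ↦ (t + δ) ^ (-β))
        (fun t ht ↦ ?_) (hc.intervalIntegrable _ _)
      rw [uIcc_of_le hs] at ht
      have := hpow (-β) t ht.1
      simpa only [hH', abs_of_nonneg ht.1] using this
    simp only [hH]
    rw [h1, zero_add]
    ring
  have hHneg : ∀ s, H (-s) = 2 * δ ^ (-β) - H s := by
    intro s
    have h1 : ∫ t in (0 : ℝ)..-s, H' t = -∫ t in (0 : ℝ)..s, H' t := by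
      have h2 := intervalIntegral.integral_comp_neg (a := 0) (b := s) H'
      have h3 : ∀ t, H' (-t) = H' t := fun t ↦ by simp only [hH', abs_neg]
      simp_rw [h3] at h2
      rw [h2, neg_zero, intervalIntegral.integral_symm]
    simp only [hH]
    rw [h1]
    ring
  have hHb : ∀ s, 0 ≤ s → 0 ≤ H s ∧ H s ≤ δ ^ (-β) := by
    intro s hs
    rw [hHpos s hs]
    exact ⟨by positivity, Real.rpow_le_rpow_of_nonpos hδ (by linarith) (by linarith)⟩
  have hδβ : 0 < δ ^ (-β) := by positivity
  have hHB : ∀ s, 0 ≤ H s ∧ H s ≤ 2 * δ ^ (-β) := by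
    intro s
    rcases le_total 0 s with hs | hs
    · exact ⟨(hHb s hs).1, (hHb s hs).2.trans (by linarith)⟩
    · have h1 := hHneg (-s)
      have h2 := hHb (-s) (by linarith)
      rw [neg_neg] at h1
      constructor <;> linarith [h2.1, h2.2]
  refine ⟨H, H', fun s ↦ ∫ t in (0 : ℝ)..s, H t, β * δ ^ (-β - 1), 2 * δ ^ (-β), hHd, hc,
    fun s ↦ ?_, fun s ↦ (hHB s).1, fun s ↦ (hHB s).2,
    fun s ↦ (hHc.integral_hasStrictDerivAt 0 s).hasDerivAt, fun s ↦ ?_, fun s hs ↦ ⟨hHpos s hs,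
      by simp only [hH', abs_of_nonneg hs], ?_, ?_⟩⟩
  · simp only [hH']
    rw [abs_mul, abs_neg, abs_of_pos hβ, abs_of_pos (by have := hpos s; positivity)]
    exact mul_le_mul_of_nonneg_left
      (Real.rpow_le_rpow_of_nonpos hδ (by linarith [abs_nonneg s]) (by linarith)) hβ.le
  · have h1 := intervalIntegral.norm_integral_le_of_norm_le_const (a := 0) (b := s) (f := H)
      (C := 2 * δ ^ (-β)) fun t _ ↦ by
        rw [Real.norm_of_nonneg (hHB t).1]
        exact (hHB t).2
    rwa [sub_zero] at h1
  · exact intervalIntegral.integral_nonneg hs fun t _ ↦ (hHB t).1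
  · have h1 : ∫ t in (0 : ℝ)..s, H t =
        (s + δ) ^ (1 - β) / (1 - β) - (0 + δ) ^ (1 - β) / (1 - β) := by
      refine intervalIntegral.integral_eq_sub_of_hasDerivAt
        (f := fun t ↦ (t + δ) ^ (1 - β) / (1 - β)) (fun t ht ↦ ?_) (hHc.intervalIntegrable _ _)
      rw [uIcc_of_le hs] at ht
      have h2 := (hpow (1 - β) t ht.1).div_const (1 - β)
      have h3 : (1 - β) * (t + δ) ^ (1 - β - 1) / (1 - β) = H t := by
        rw [hHpos t ht.1, mul_div_cancel_left₀ _ (by linarith)]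
        congr 1
        ring
      rwa [h3] at h2
    beta_reduce
    rw [h1]
    have : 0 ≤ (0 + δ) ^ (1 - β) / (1 - β) := div_nonneg (by positivity) (by linarith)
    linarith

end RegularizedPower

/-! ### The logarithmic space-time cutoff and its slopes -/

section Cutoff
open Filter Topology

variable {M : Type*} [MetricSpace M]

theorem LipAt.max {α : Type*} [PseudoMetricSpace α] {f g : α → ℝ} {x : α} (hf : LipAt f x)
    (hg : LipAt g x) : LipAt (fun y ↦ max (f y) (g y)) x := by
  obtain ⟨C, s, hs, hfs⟩ := hf
  obtain ⟨D, t, ht, hgt⟩ := hg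
  refine ⟨Max.max C D, s ∩ t, inter_mem hs ht, LipschitzOnWith.of_dist_le_mul fun y hy z hz ↦ ?_⟩
  have h1 := hfs.dist_le_mul y hy.1 z hz.1
  have h2 := hgt.dist_le_mul y hy.2 z hz.2
  rw [Real.dist_eq] at h1 h2 ⊢
  refine (abs_max_sub_max_le_max _ _ _ _).trans (max_le (h1.trans ?_) (h2.trans ?_))
  · gcongr
    exact le_max_left _ _
  · gcongr
    exact le_max_right _ _

theorem LipAt.min {α : Type*} [PseudoMetricSpace α] {f g : α → ℝ} {x : α} (hf : LipAt f x)
    (hg : LipAt g x) : LipAt (fun y ↦ min (f y) (g y)) x := by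
  obtain ⟨C, s, hs, hfs⟩ := hf
  obtain ⟨D, t, ht, hgt⟩ := hg
  refine ⟨Max.max C D, s ∩ t, inter_mem hs ht, LipschitzOnWith.of_dist_le_mul fun y hy z hz ↦ ?_⟩
  have h1 := hfs.dist_le_mul y hy.1 z hz.1
  have h2 := hgt.dist_le_mul y hy.2 z hz.2
  rw [Real.dist_eq] at h1 h2 ⊢
  refine (abs_min_sub_min_le_max _ _ _ _).trans (max_le (h1.trans ?_) (h2.trans ?_))
  · gcongr
    exact le_max_left _ _
  · gcongr
    exact le_max_right _ _

/-- The parabolic radius `max(1, r(x), t ^ (1/θ))`. -/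
def cutRadius (x₀ : M) (θ : ℝ) (x : M) (t : ℝ) : ℝ := max 1 (max (dist x₀ x) (t ^ (1 / θ)))

/-- The logarithmic cutoff: `1` for `t ≥ 2ε` and `cutRadius ≤ exp (1/β)`, and `0` for `t ≤ ε` or
`cutRadius ≥ exp (2/β)`. -/
def cutBase (x₀ : M) (θ β ε : ℝ) (x : M) (t : ℝ) : ℝ :=
  max 0 (min (min 1 ((t - ε) / ε)) (2 - β * Real.log (cutRadius x₀ θ x t)))

variable {x₀ x : M} {θ β ε t : ℝ}

theorem one_le_cutRadius (x₀ : M) (θ : ℝ) (x : M) (t : ℝ) : 1 ≤ cutRadius x₀ θ x t :=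
  le_max_left _ _

theorem dist_le_cutRadius (x₀ : M) (θ : ℝ) (x : M) (t : ℝ) : dist x₀ x ≤ cutRadius x₀ θ x t :=
  (le_max_left _ _).trans (le_max_right _ _)

theorem le_cutRadius_rpow (hθ : 0 < θ) (ht : 0 ≤ t) : t ≤ cutRadius x₀ θ x t ^ θ := by
  calc t = (t ^ (1 / θ)) ^ θ := by
        rw [← Real.rpow_mul ht, one_div_mul_cancel hθ.ne', Real.rpow_one]
    _ ≤ _ := Real.rpow_le_rpow (by positivity)
        ((le_max_right _ _).trans (le_max_right _ _)) hθ.le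

theorem cutBase_nonneg (x₀ : M) (θ β ε : ℝ) (x : M) (t : ℝ) : 0 ≤ cutBase x₀ θ β ε x t :=
  le_max_left _ _

theorem cutBase_le_one (x₀ : M) (θ β ε : ℝ) (x : M) (t : ℝ) : cutBase x₀ θ β ε x t ≤ 1 :=
  max_le zero_le_one ((min_le_left _ _).trans (min_le_left _ _))

theorem lt_of_cutBase_pos (hε : 0 < ε) (h : 0 < cutBase x₀ θ β ε x t) :
    ε < t ∧ β * Real.log (cutRadius x₀ θ x t) < 2 := by
  rw [cutBase, lt_max_iff] at h
  rcases h with h | h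
  · exact absurd h (lt_irrefl 0)
  · rw [lt_min_iff, lt_min_iff] at h
    refine ⟨?_, by linarith [h.2]⟩
    have := (div_pos_iff_of_pos_right hε).1 h.1.2
    linarith

theorem cutBase_eq_zero (hε : 0 < ε) (ht : t ≤ ε) : cutBase x₀ θ β ε x t = 0 := by
  by_contra h
  exact absurd (lt_of_cutBase_pos hε (lt_of_le_of_ne (cutBase_nonneg _ _ _ _ _ _) (Ne.symm h))).1
    (not_lt.2 ht)

theorem cutRadius_le (x₀ : M) (θ t : ℝ) (x y : M) :
    cutRadius x₀ θ y t ≤ cutRadius x₀ θ x t + dist y x := by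
  have h1 := dist_triangle x₀ x y
  rw [dist_comm x y] at h1
  have h2 := dist_nonneg (x := y) (y := x)
  refine max_le ?_ (max_le ?_ ?_)
  · linarith [one_le_cutRadius x₀ θ x t]
  · linarith [dist_le_cutRadius x₀ θ x t]
  · have h3 : t ^ (1 / θ) ≤ cutRadius x₀ θ x t := (le_max_right _ _).trans (le_max_right _ _)
    linarith

theorem log_sub_log_le {a b : ℝ} (ha : 0 < a) (hb : 0 < b) :
    Real.log b - Real.log a ≤ (b - a) / a := by
  rw [← Real.log_div hb.ne' ha.ne']
  refine (Real.log_le_sub_one_of_pos (div_pos hb ha)).trans_eq ?_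
  field_simp

theorem max_min_sub_le {a e e' c : ℝ} (hc : 0 ≤ c) (h : e - c ≤ e') :
    max 0 (min a e) - c ≤ max 0 (min a e') := by
  rw [sub_le_iff_le_add]
  refine max_le (by positivity) ?_
  rcases le_total a e' with h1 | h1
  · rw [min_eq_left h1]
    linarith [min_le_left a e, le_max_right 0 a]
  · rw [min_eq_right h1]
    linarith [min_le_right a e, le_max_right 0 e']

/-- The slope of the cutoff in space. -/
def cutSlope (x₀ : M) (θ β : ℝ) (x : M) (t : ℝ) : ℝ :=
  if β * Real.log (cutRadius x₀ θ x t) < 1 then 0 else β / cutRadius x₀ θ x t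

/-- The slope of the cutoff in time. -/
def cutTimeSlope (x₀ : M) (θ β : ℝ) (x : M) (t : ℝ) : ℝ :=
  if β * Real.log (cutRadius x₀ θ x t) < 1 then 0 else β / (θ * cutRadius x₀ θ x t ^ θ)

theorem cutSlope_nonneg (hβ : 0 < β) : 0 ≤ cutSlope x₀ θ β x t := by
  have := one_le_cutRadius x₀ θ x t
  rw [cutSlope]
  split_ifs
  · exact le_rfl
  · positivity

theorem cutTimeSlope_nonneg (hβ : 0 < β) (hθ : 0 < θ) : 0 ≤ cutTimeSlope x₀ θ β x t := by
  have := one_le_cutRadius x₀ θ x t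
  rw [cutTimeSlope]
  split_ifs
  · exact le_rfl
  · positivity

/-- Where `β log ϱ < 1` the logarithmic branch exceeds `1` nearby and is inactive, so the cutoff is
locally constant in space. Elsewhere `ϱ` is `1`-Lipschitz in `x` and concavity of the logarithm
gives the slope `β / ϱ`. -/
theorem cutBase_sub_ge_space (hβ : 0 < β) :
    ∀ᶠ y in 𝓝 x, -(cutSlope x₀ θ β x t * dist y x) ≤
      cutBase x₀ θ β ε y t - cutBase x₀ θ β ε x t := by
  have hϱ0 : 0 < cutRadius x₀ θ x t := one_pos.trans_le (one_le_cutRadius x₀ θ x t)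
  have hE : ∀ y, 2 - β * Real.log (cutRadius x₀ θ x t) - β / cutRadius x₀ θ x t * dist y x ≤
      2 - β * Real.log (cutRadius x₀ θ y t) := by
    intro y
    have h1 := log_sub_log_le hϱ0 (one_pos.trans_le (one_le_cutRadius x₀ θ y t))
    have h2 : (cutRadius x₀ θ y t - cutRadius x₀ θ x t) / cutRadius x₀ θ x t ≤
        dist y x / cutRadius x₀ θ x t := by
      gcongr
      linarith [cutRadius_le x₀ θ t x y]
    have h3 := mul_le_mul_of_nonneg_left (h1.trans h2) hβ.le
    have h4 : β / cutRadius x₀ θ x t * dist y x = β * (dist y x / cutRadius x₀ θ x t) := by ring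
    linarith
  rw [cutSlope]
  split_ifs with h
  · have hc : ContinuousAt (fun y ↦ β * Real.log (cutRadius x₀ θ y t)) x := by
      refine continuousAt_const.mul (ContinuousAt.log ?_ hϱ0.ne')
      unfold cutRadius
      fun_prop
    filter_upwards [hc.eventually_lt continuousAt_const h] with y hy
    have h1 : ∀ y, β * Real.log (cutRadius x₀ θ y t) < 1 →
        cutBase x₀ θ β ε y t = max 0 (min 1 ((t - ε) / ε)) := by
      intro y hy
      rw [cutBase, min_eq_left ((min_le_left _ _).trans (by linarith))]
    rw [h1 y hy, h1 x h]
    simp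
  · refine Eventually.of_forall fun y ↦ ?_
    have := max_min_sub_le (a := min 1 ((t - ε) / ε)) (by positivity) (hE y)
    rw [cutBase, cutBase]
    linarith

/-- Either time does not determine the radius at `t'`, and then the radius has not increased; or
`log ϱ = (1/θ) log t'` there, and concavity of the logarithm at `ϱ^θ ≥ t` applies. -/
theorem log_cutRadius_sub_le (hθ : 0 < θ) {t' : ℝ} (ht : 0 < t) (htt' : t ≤ t') :
    Real.log (cutRadius x₀ θ x t') - Real.log (cutRadius x₀ θ x t) ≤
      (t' - t) / (θ * cutRadius x₀ θ x t ^ θ) := by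
  have hϱ0 : 0 < cutRadius x₀ θ x t := one_pos.trans_le (one_le_cutRadius x₀ θ x t)
  have hS := le_cutRadius_rpow (x₀ := x₀) (x := x) hθ ht.le
  rcases le_total (t' ^ (1 / θ)) (max 1 (dist x₀ x)) with h | h
  · have h1 : cutRadius x₀ θ x t' ≤ cutRadius x₀ θ x t := by
      rw [cutRadius, ← max_assoc, max_eq_left h]
      exact max_le (one_le_cutRadius _ _ _ _) (dist_le_cutRadius _ _ _ _)
    have h2 := Real.log_le_log (one_pos.trans_le (one_le_cutRadius x₀ θ x t')) h1
    have h3 : 0 ≤ (t' - t) / (θ * cutRadius x₀ θ x t ^ θ) :=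
      div_nonneg (by linarith) (by positivity)
    linarith
  · have h1 : cutRadius x₀ θ x t' = t' ^ (1 / θ) := by
      rw [cutRadius, ← max_assoc, max_eq_right h]
    have ht' : 0 < t' := ht.trans_le htt'
    rw [h1, Real.log_rpow ht']
    have h2 := log_sub_log_le (a := cutRadius x₀ θ x t ^ θ) (by positivity) ht'
    rw [Real.log_rpow hϱ0] at h2
    have h3 : (t' - cutRadius x₀ θ x t ^ θ) / cutRadius x₀ θ x t ^ θ ≤
        (t' - t) / cutRadius x₀ θ x t ^ θ := by gcongr
    have h4 : (t' - t) / (θ * cutRadius x₀ θ x t ^ θ) =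
        1 / θ * ((t' - t) / cutRadius x₀ θ x t ^ θ) := by field_simp
    rw [h4]
    calc 1 / θ * Real.log t' - Real.log (cutRadius x₀ θ x t)
        = 1 / θ * (Real.log t' - θ * Real.log (cutRadius x₀ θ x t)) := by field_simp
      _ ≤ _ := by gcongr; exact h2.trans h3

theorem continuousAt_cutRadius_time (ht : 0 < t) : ContinuousAt (cutRadius x₀ θ x) t := by
  unfold cutRadius
  exact continuousAt_const.max (continuousAt_const.max
    (Real.continuousAt_rpow_const _ _ (Or.inl ht.ne')))

/-- Only a decrease forward in time matters, because `∂ₜφ` enters the inequality with a minus sign.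
The initial ramp `(t - ε) / ε` is increasing and never contributes to it, so the bound is
independent of `ε` and no initial condition is involved. -/
theorem cutBase_sub_ge_time (hβ : 0 < β) (hθ : 0 < θ) (hε : 0 < ε) (ht : 0 < t) :
    ∀ᶠ t' in 𝓝[>] t, -(cutTimeSlope x₀ θ β x t * (t' - t)) ≤
      cutBase x₀ θ β ε x t' - cutBase x₀ θ β ε x t := by
  have hϱ0 : 0 < cutRadius x₀ θ x t := one_pos.trans_le (one_le_cutRadius x₀ θ x t)
  have hmono : ∀ t', t < t' → min 1 ((t - ε) / ε) ≤ min 1 ((t' - ε) / ε) := fun t' h ↦ by gcongr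
  rw [cutTimeSlope]
  split_ifs with h
  · have hc : ContinuousAt (fun t ↦ β * Real.log (cutRadius x₀ θ x t)) t :=
      continuousAt_const.mul (ContinuousAt.log (continuousAt_cutRadius_time ht) hϱ0.ne')
    filter_upwards [nhdsWithin_le_nhds (hc.eventually_lt continuousAt_const h),
      self_mem_nhdsWithin] with t' ht' htt'
    have h1 : ∀ t, β * Real.log (cutRadius x₀ θ x t) < 1 →
        cutBase x₀ θ β ε x t = max 0 (min 1 ((t - ε) / ε)) := by
      intro y hy
      rw [cutBase, min_eq_left ((min_le_left _ _).trans (by linarith))]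
    rw [h1 t' ht', h1 t h, zero_mul, neg_zero, sub_nonneg]
    exact max_le_max le_rfl (hmono t' htt')
  · filter_upwards [self_mem_nhdsWithin] with t' htt'
    have htt'' : t < t' := htt'
    have h1 := mul_le_mul_of_nonneg_left (log_cutRadius_sub_le (x₀ := x₀) (x := x) hθ ht htt''.le)
      hβ.le
    have h2 : β / (θ * cutRadius x₀ θ x t ^ θ) * (t' - t) =
        β * ((t' - t) / (θ * cutRadius x₀ θ x t ^ θ)) := by ring
    have h3 := max_min_sub_le (a := min 1 ((t - ε) / ε))
      (e := 2 - β * Real.log (cutRadius x₀ θ x t)) (e' := 2 - β * Real.log (cutRadius x₀ θ x t'))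
      (c := β / (θ * cutRadius x₀ θ x t ^ θ) * (t' - t))
      (mul_nonneg (by positivity) (by linarith)) (by linarith)
    have h4 : max 0 (min (min 1 ((t - ε) / ε)) (2 - β * Real.log (cutRadius x₀ θ x t'))) ≤
        cutBase x₀ θ β ε x t' := max_le_max le_rfl (min_le_min_right _ (hmono t' htt'))
    rw [cutBase] at h4 ⊢
    rw [cutBase]
    linarith

/-- The convex function `s^k` lies above its tangent line at `b`, by Bernoulli's inequality. It
turns a lower bound on increments of the base into one for the power. -/
theorem pow_sub_pow_ge {a b : ℝ} (ha : 0 ≤ a) (hb : 0 ≤ b) {k : ℕ} (hk : 2 ≤ k) :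
    k * b ^ (k - 1) * (a - b) ≤ a ^ k - b ^ k := by
  rcases hb.eq_or_lt with rfl | hb
  · rw [zero_pow (by omega), zero_pow (by omega)]
    simp only [mul_zero, zero_mul, sub_zero]
    positivity
  · have h1 := one_add_mul_le_pow (a := a / b - 1) (by
      have := div_nonneg ha hb.le
      linarith) k
    have h2 : b ^ k = b ^ (k - 1) * b := by rw [← pow_succ]; congr 1; omega
    have h3 : b ^ k * (1 + (a / b - 1)) ^ k = a ^ k := by
      rw [← mul_pow]
      congr 1
      field_simp
      ring
    have h4 := mul_le_mul_of_nonneg_left h1 (pow_nonneg hb.le k)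
    rw [h3] at h4
    have h5 : b ^ k * (1 + k * (a / b - 1)) = b ^ k + k * b ^ (k - 1) * (a - b) := by
      rw [h2]
      field_simp
    linarith

/-- The cutoff used to test the inequality. -/
def cutFun (x₀ : M) (θ β ε : ℝ) (k : ℕ) (x : M) (t : ℝ) : ℝ := cutBase x₀ θ β ε x t ^ k

theorem neg_deriv_cutFun_le (hβ : 0 < β) (hθ : 0 < θ) (hε : 0 < ε) (ht : 0 < t) {k : ℕ}
    (hk : 2 ≤ k) :
    -deriv (fun t ↦ cutFun x₀ θ β ε k x t) t ≤
      k * cutBase x₀ θ β ε x t ^ (k - 1) * cutTimeSlope x₀ θ β x t := by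
  have h0 := cutBase_nonneg x₀ θ β ε x t
  have hL := cutTimeSlope_nonneg (x₀ := x₀) (x := x) (t := t) hβ hθ
  have hc0 : 0 ≤ k * cutBase x₀ θ β ε x t ^ (k - 1) * cutTimeSlope x₀ θ β x t := by positivity
  by_cases hd : DifferentiableAt ℝ (fun t ↦ cutFun x₀ θ β ε k x t) t
  · have h1 := (hasDerivWithinAt_iff_tendsto_slope' self_notMem_Ioi).1
      (hd.hasDerivAt.hasDerivWithinAt (s := Ioi t))
    rw [neg_le]
    refine ge_of_tendsto h1 ?_
    filter_upwards [cutBase_sub_ge_time (x₀ := x₀) (x := x) hβ hθ hε ht,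
      self_mem_nhdsWithin] with t' ht' htt'
    have htt'' : 0 < t' - t := sub_pos.2 htt'
    rw [slope_def_field, le_div_iff₀ htt'']
    refine le_trans ?_ (pow_sub_pow_ge (cutBase_nonneg x₀ θ β ε x t') h0 hk)
    have := mul_le_mul_of_nonneg_left ht' (by positivity : 0 ≤ k * cutBase x₀ θ β ε x t ^ (k - 1))
    linarith
  · rw [deriv_zero_of_not_differentiableAt hd, neg_zero]
    exact hc0

/-- Completeness is used here: the support lies in a closed ball times a compact interval, and the
ball is compact by Hopf–Rinow. -/
theorem isTestFunction_cutFun {N : ℕ} [CompleteSpace M] [ChartedSpace (EuclideanSpace ℝ (Fin N)) M]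
    [RiemannianBundle (fun x : M ↦ TangentSpace (𝓡 N) x)] [IsManifold (𝓡 N) ∞ M]
    [IsContMDiffRiemannianBundle (𝓡 N) ∞ (EuclideanSpace ℝ (Fin N))
      (fun x : M ↦ TangentSpace (𝓡 N) x)] [IsRiemannianManifold (𝓡 N) M]
    (hβ : 0 < β) (hθ : 0 < θ) (hε : 0 < ε) {k : ℕ} (hk : 2 ≤ k) :
    IsTestFunction (cutFun x₀ θ β ε k) ∧
      tsupport (fun z : M × ℝ ↦ cutFun x₀ θ β ε k z.1 z.2) ⊆
        Metric.closedBall x₀ (Real.exp (2 / β)) ×ˢ Icc ε (Real.exp (2 / β) ^ θ) := by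
  have hKc : IsCompact (Metric.closedBall x₀ (Real.exp (2 / β)) ×ˢ
      Icc ε (Real.exp (2 / β) ^ θ)) :=
    (isCompact_closedBall_of_complete N x₀ _).prod isCompact_Icc
  have hsupp : Function.support (fun z : M × ℝ ↦ cutFun x₀ θ β ε k z.1 z.2) ⊆
      Metric.closedBall x₀ (Real.exp (2 / β)) ×ˢ Icc ε (Real.exp (2 / β) ^ θ) := by
    rintro ⟨x, t⟩ hz
    have h0 : 0 < cutBase x₀ θ β ε x t := by
      refine lt_of_le_of_ne (cutBase_nonneg _ _ _ _ _ _) fun h ↦ hz ?_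
      simp only [cutFun, ← h]
      exact zero_pow (by omega)
    obtain ⟨h1, h2⟩ := lt_of_cutBase_pos hε h0
    have hϱ0 : 0 < cutRadius x₀ θ x t := one_pos.trans_le (one_le_cutRadius x₀ θ x t)
    have h3 : cutRadius x₀ θ x t ≤ Real.exp (2 / β) := by
      rw [← Real.log_le_iff_le_exp hϱ0, le_div_iff₀ hβ]
      linarith
    refine ⟨?_, h1.le, ?_⟩
    · rw [Metric.mem_closedBall, dist_comm]
      exact (dist_le_cutRadius x₀ θ x t).trans h3
    · exact (le_cutRadius_rpow hθ (hε.trans h1).le).trans (Real.rpow_le_rpow hϱ0.le h3 hθ.le)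
  have hts := closure_minimal hsupp hKc.isClosed
  refine ⟨⟨fun z ↦ ?_, HasCompactSupport.of_support_subset_isCompact hKc hsupp,
    hts.trans fun z hz ↦ ⟨mem_univ _, hε.trans_le hz.2.1⟩,
    fun x t ↦ pow_nonneg (cutBase_nonneg _ _ _ _ _ _) k⟩, hts⟩
  -- The power `t^(1/θ)` may fail to be Lipschitz at `t = 0`; for `t < ε` the cutoff vanishes, and
  -- for `t ≥ ε` the power is smooth.
  rcases lt_or_ge z.2 ε with hz | hz
  · have h1 : (fun _ ↦ 0) =ᶠ[𝓝 z] fun z : M × ℝ ↦ cutFun x₀ θ β ε k z.1 z.2 := by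
      filter_upwards [continuousAt_snd.eventually_lt continuousAt_const hz] with y hy
      rw [cutFun, cutBase_eq_zero hε (le_of_lt hy), zero_pow (by omega)]
    exact LipAt.congr ⟨0, univ, univ_mem, LipschitzOnWith.of_dist_le_mul (by simp)⟩ h1
  · have hz0 : 0 < z.2 := hε.trans_le hz
    have hconst : ∀ c : ℝ, LipAt (fun _ : M × ℝ ↦ c) z := fun c ↦
      ⟨0, univ, univ_mem, LipschitzOnWith.of_dist_le_mul (by simp)⟩
    have hsnd : LipAt (fun z : M × ℝ ↦ z.2) z :=
      ⟨1, univ, univ_mem, LipschitzWith.prod_snd.lipschitzOnWith⟩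
    have hr : LipAt (fun z : M × ℝ ↦ dist x₀ z.1) z := by
      have : LipschitzWith 1 fun z : M × ℝ ↦ dist x₀ z.1 := by
        simpa [Function.comp_def] using (LipschitzWith.dist_right x₀).comp LipschitzWith.prod_fst
      exact this.locallyLipschitz z
    have hϱ : LipAt (fun z : M × ℝ ↦ cutRadius x₀ θ z.1 z.2) z :=
      (hconst 1).max (hr.max (LipAt.comp (f := fun t : ℝ ↦ t ^ (1 / θ))
        (lipAt_of_contDiffAt (Real.contDiffAt_rpow_const_of_ne hz0.ne')) hsnd))
    have hϱ0 : cutRadius x₀ θ z.1 z.2 ≠ 0 :=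
      (one_pos.trans_le (one_le_cutRadius x₀ θ z.1 z.2)).ne'
    have hE : LipAt (fun z : M × ℝ ↦ 2 - β * Real.log (cutRadius x₀ θ z.1 z.2)) z :=
      LipAt.comp (f := fun s : ℝ ↦ 2 - β * Real.log s) (lipAt_of_contDiffAt
        (contDiffAt_const.sub (contDiffAt_const.mul (Real.contDiffAt_log.2 hϱ0)))) hϱ
    have hτ : LipAt (fun z : M × ℝ ↦ (z.2 - ε) / ε) z :=
      LipAt.comp (f := fun s : ℝ ↦ (s - ε) / ε) (lipAt_of_contDiffAt
        ((contDiffAt_id.sub contDiffAt_const).div_const _)) hsnd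
    exact LipAt.comp (f := fun s : ℝ ↦ s ^ k) (lipAt_of_contDiffAt (contDiffAt_id.pow k))
      ((hconst 0).max (((hconst 1).min hτ).min hE))

theorem abs_gradPairing_cutFun_le {N : ℕ} [ChartedSpace (EuclideanSpace ℝ (Fin N)) M]
    [RiemannianBundle (fun x : M ↦ TangentSpace (𝓡 N) x)] [IsManifold (𝓡 N) ∞ M]
    [IsContMDiffRiemannianBundle (𝓡 N) ∞ (EuclideanSpace ℝ (Fin N))
      (fun x : M ↦ TangentSpace (𝓡 N) x)] [IsRiemannianManifold (𝓡 N) M]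
    (hβ : 0 < β) {k : ℕ} (hk : 2 ≤ k) (G : (x : M) → ℝ → TangentSpace (𝓡 N) x) :
    |gradPairing G (cutFun x₀ θ β ε k) (x, t)| ≤
      k * cutBase x₀ θ β ε x t ^ (k - 1) * cutSlope x₀ θ β x t * ‖G x t‖ := by
  have h0 := cutBase_nonneg x₀ θ β ε x t
  have hP := cutSlope_nonneg (x₀ := x₀) (x := x) (t := t) (θ := θ) hβ
  refine abs_mfderiv_le (ψ := fun x ↦ cutFun x₀ θ β ε k x t) (by positivity) ?_ (G x t)
  filter_upwards [cutBase_sub_ge_space (x₀ := x₀) (x := x) (θ := θ) (t := t) (ε := ε) hβ] with y hy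
  refine le_trans ?_ (pow_sub_pow_ge (cutBase_nonneg x₀ θ β ε y t) h0 hk)
  have := mul_le_mul_of_nonneg_left hy (by positivity : 0 ≤ k * cutBase x₀ θ β ε x t ^ (k - 1))
  linarith

end Cutoff

/-! ### Integrals over the shell from the volume growth conditions -/

section Shell
open Filter Topology

variable {M : Type*} [MetricSpace M] [MeasurableSpace M] [BorelSpace M]
  [SecondCountableTopology M]

theorem measurable_cutRadius (x₀ : M) (θ : ℝ) :
    Measurable fun z : M × ℝ ↦ cutRadius x₀ θ z.1 z.2 := by
  unfold cutRadius
  fun_prop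

/-- The space-time shell on which the cutoff varies. -/
def shell (x₀ : M) (θ R : ℝ) : Set (M × ℝ) :=
  {z | 0 < z.2 ∧ R ≤ cutRadius x₀ θ z.1 z.2 ∧ cutRadius x₀ θ z.1 z.2 ≤ R ^ 2}

theorem measurableSet_shell (x₀ : M) (θ R : ℝ) : MeasurableSet (shell x₀ θ R) :=
  (measurableSet_lt measurable_const measurable_snd).inter
    ((measurableSet_le measurable_const (measurable_cutRadius x₀ θ)).inter
      (measurableSet_le (measurable_cutRadius x₀ θ) measurable_const))

/-- The dyadic pieces of the shell. -/
def dyadicPiece (x₀ : M) (θ ρ : ℝ) : Set (M × ℝ) :=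
  {z | 0 < z.2 ∧ ρ ≤ cutRadius x₀ θ z.1 z.2 ∧ cutRadius x₀ θ z.1 z.2 < 2 * ρ}

/-- The piece lies in the ball of radius `2ρ` times a time interval of length `(2ρ)^θ`, and the
weight is at most `ρ^(-A)` on it. -/
theorem lintegral_dyadicPiece_le {μ : Measure M} [SFinite μ] (x₀ : M) {θ A ρ : ℝ} (hθ : 0 < θ)
    (hA : 0 ≤ A) (hρ : 0 < ρ) {g : M → ℝ≥0∞} (hg : AEMeasurable g μ) :
    ∫⁻ z in dyadicPiece x₀ θ ρ, ENNReal.ofReal (cutRadius x₀ θ z.1 z.2 ^ (-A)) * g z.1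
        ∂(μ.prod volume) ≤
      ENNReal.ofReal (ρ ^ (-A) * (2 * ρ) ^ θ) * ∫⁻ x in Metric.ball x₀ (2 * ρ), g x ∂μ := by
  have hm : MeasurableSet (dyadicPiece x₀ θ ρ) :=
    (measurableSet_lt measurable_const measurable_snd).inter
      ((measurableSet_le measurable_const (measurable_cutRadius x₀ θ)).inter
        (measurableSet_lt (measurable_cutRadius x₀ θ) measurable_const))
  have hsub : dyadicPiece x₀ θ ρ ⊆ Metric.ball x₀ (2 * ρ) ×ˢ Ioc 0 ((2 * ρ) ^ θ) := by
    rintro ⟨x, t⟩ ⟨h1, _, h3⟩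
    refine ⟨?_, h1, ?_⟩
    · rw [Metric.mem_ball, dist_comm]
      exact (dist_le_cutRadius x₀ θ x t).trans_lt h3
    · exact (le_cutRadius_rpow hθ (le_of_lt h1)).trans (Real.rpow_le_rpow
        (zero_le_one.trans (one_le_cutRadius x₀ θ x t)) h3.le hθ.le)
  calc ∫⁻ z in dyadicPiece x₀ θ ρ, ENNReal.ofReal (cutRadius x₀ θ z.1 z.2 ^ (-A)) * g z.1
        ∂(μ.prod volume)
      ≤ ∫⁻ z in dyadicPiece x₀ θ ρ, ENNReal.ofReal (ρ ^ (-A)) * g z.1 ∂(μ.prod volume) := by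
        refine setLIntegral_mono' hm fun z hz ↦ ?_
        gcongr ENNReal.ofReal ?_ * _
        exact Real.rpow_le_rpow_of_nonpos hρ hz.2.1 (by linarith)
    _ ≤ ∫⁻ z in Metric.ball x₀ (2 * ρ) ×ˢ Ioc 0 ((2 * ρ) ^ θ),
          ENNReal.ofReal (ρ ^ (-A)) * g z.1 ∂(μ.prod volume) := lintegral_mono_set hsub
    _ = ENNReal.ofReal (ρ ^ (-A)) * ∫⁻ z, g z.1 * 1 ∂((μ.restrict (Metric.ball x₀ (2 * ρ))).prod
          (volume.restrict (Ioc 0 ((2 * ρ) ^ θ)))) := by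
        rw [lintegral_const_mul' _ _ ENNReal.ofReal_ne_top, Measure.prod_restrict]
        simp_rw [mul_one]
    _ = _ := by
        rw [lintegral_prod_mul (g := fun _ ↦ 1) hg.restrict aemeasurable_const, lintegral_one,
          Measure.restrict_apply_univ, Real.volume_Ioc, sub_zero,
          ENNReal.ofReal_mul (by positivity)]
        ring

/-- About `log R` dyadic pieces cover the shell. Because `A ≥ θ + σ`, the powers of the radius
cancel and each piece contributes a multiple of `(log R)^δ`; the number of pieces adds `1` to the
exponent. -/
theorem exists_lintegral_shell_le {μ : Measure M} [SFinite μ] (x₀ : M) {θ A σ δ C R₀ : ℝ}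
    (hθ : 0 < θ) (hA : 0 ≤ A) (hσ : 0 ≤ σ) (hδ : 0 ≤ δ) (hC : 0 < C) (hA' : θ + σ ≤ A)
    {g : M → ℝ≥0∞} (hg : AEMeasurable g μ)
    (hint : ∀ R, R₀ ≤ R → ∫⁻ x in Metric.ball x₀ R, g x ∂μ ≤
      ENNReal.ofReal (C * R ^ σ * Real.log R ^ δ)) :
    ∃ C' : ℝ, 0 ≤ C' ∧ ∀ R, max R₀ 2 ≤ R →
      ∫⁻ z in shell x₀ θ R, ENNReal.ofReal (cutRadius x₀ θ z.1 z.2 ^ (-A)) * g z.1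
        ∂(μ.prod volume) ≤ ENNReal.ofReal (C' * Real.log R ^ (1 + δ)) := by
  -- The first `3` counts the pieces, `n + 1 ≤ 3 log R`; `2^(θ+σ)` comes from the outer radius `2ρ`;
  -- and `3^δ` from `log (2ρ) ≤ 3 log R`, as `2ρ ≤ R³`.
  refine ⟨3 * (2 ^ (θ + σ) * C * 3 ^ δ), by positivity, fun R hR ↦ ?_⟩
  have hR2 : 2 ≤ R := (le_max_right _ _).trans hR
  have hRR₀ : R₀ ≤ R := (le_max_left _ _).trans hR
  have hR0 : 0 < R := by linarith
  have hlog2 : (1 / 2 : ℝ) ≤ Real.log 2 := by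
    have := Real.log_two_gt_d9
    linarith
  have hlogR : Real.log 2 ≤ Real.log R := Real.log_le_log two_pos hR2
  have hlogR0 : 0 < Real.log R := by linarith
  obtain ⟨n, hn1, hn2⟩ := exists_nat_pow_near (by linarith : 1 ≤ R) (one_lt_two : (1 : ℝ) < 2)
  have hcov : shell x₀ θ R ⊆ ⋃ j : Fin (n + 1), dyadicPiece x₀ θ (2 ^ (j : ℕ) * R) := by
    intro z hz
    obtain ⟨j, hj1, hj2⟩ := exists_nat_pow_near
      (by rw [le_div_iff₀ hR0]; linarith [hz.2.1] : 1 ≤ cutRadius x₀ θ z.1 z.2 / R)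
      (one_lt_two : (1 : ℝ) < 2)
    rw [le_div_iff₀ hR0] at hj1
    rw [div_lt_iff₀ hR0, pow_succ] at hj2
    have hjn : j < n + 1 := by
      have h1 : (2 : ℝ) ^ j * R < 2 ^ (n + 1) * R := by
        calc (2 : ℝ) ^ j * R ≤ R ^ 2 := hj1.trans hz.2.2
          _ = R * R := sq R
          _ < _ := by gcongr
      exact (pow_lt_pow_iff_right₀ one_lt_two).1 (lt_of_mul_lt_mul_right h1 hR0.le)
    exact mem_iUnion.2 ⟨⟨j, hjn⟩, hz.1, hj1, by linarith⟩
  have hpiece : ∀ j : Fin (n + 1), ∫⁻ z in dyadicPiece x₀ θ (2 ^ (j : ℕ) * R),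
      ENNReal.ofReal (cutRadius x₀ θ z.1 z.2 ^ (-A)) * g z.1 ∂(μ.prod volume) ≤
      ENNReal.ofReal (2 ^ (θ + σ) * C * 3 ^ δ * Real.log R ^ δ) := by
    intro j
    set ρ := 2 ^ (j : ℕ) * R with hρ
    have h2j : (1 : ℝ) ≤ 2 ^ (j : ℕ) := one_le_pow₀ one_le_two
    have hRρ : R ≤ ρ := by rw [hρ]; nlinarith
    have hρ0 : 0 < ρ := by linarith
    have hρR : 2 * ρ ≤ R ^ 3 := by
      have h1 : (2 : ℝ) ^ (j : ℕ) ≤ R :=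
        (pow_le_pow_right₀ one_le_two (Nat.lt_succ_iff.1 j.2)).trans hn1
      calc 2 * ρ ≤ R * (R * R) := by rw [hρ]; gcongr
        _ = R ^ 3 := by ring
    have hlogρ : Real.log (2 * ρ) ≤ 3 * Real.log R := by
      have := Real.log_le_log (by positivity) hρR
      rwa [Real.log_pow] at this
    have hlogρ0 : 0 ≤ Real.log (2 * ρ) := Real.log_nonneg (by linarith)
    refine (lintegral_dyadicPiece_le x₀ hθ hA hρ0 hg).trans ?_
    refine (mul_le_mul_right (hint (2 * ρ) (by linarith)) _).trans ?_
    rw [← ENNReal.ofReal_mul (by positivity)]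
    refine ENNReal.ofReal_le_ofReal ?_
    have h3 : ρ ^ (-A) * (2 * ρ) ^ θ * (2 * ρ) ^ σ ≤ 2 ^ (θ + σ) := by
      rw [mul_assoc, ← Real.rpow_add (by positivity), Real.mul_rpow two_pos.le hρ0.le]
      have : ρ ^ (-A) * ρ ^ (θ + σ) ≤ 1 := by
        rw [← Real.rpow_add hρ0]
        exact Real.rpow_le_one_of_one_le_of_nonpos (by linarith) (by linarith)
      nlinarith [Real.rpow_pos_of_pos two_pos (θ + σ)]
    calc ρ ^ (-A) * (2 * ρ) ^ θ * (C * (2 * ρ) ^ σ * Real.log (2 * ρ) ^ δ)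
        = (ρ ^ (-A) * (2 * ρ) ^ θ * (2 * ρ) ^ σ) * C * Real.log (2 * ρ) ^ δ := by ring
      _ ≤ 2 ^ (θ + σ) * C * (3 * Real.log R) ^ δ := by gcongr
      _ = _ := by rw [Real.mul_rpow (by norm_num) hlogR0.le]; ring
  have hnlog : ((n + 1 : ℕ) : ℝ) ≤ 3 * Real.log R := by
    have h1 := Real.log_le_log (by positivity) hn1
    rw [Real.log_pow] at h1
    push_cast
    nlinarith [mul_le_mul_of_nonneg_left hlog2 (Nat.cast_nonneg (α := ℝ) n), Real.log_two_gt_d9]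
  calc ∫⁻ z in shell x₀ θ R, ENNReal.ofReal (cutRadius x₀ θ z.1 z.2 ^ (-A)) * g z.1 ∂(μ.prod volume)
      ≤ ∫⁻ z in ⋃ j : Fin (n + 1), dyadicPiece x₀ θ (2 ^ (j : ℕ) * R),
          ENNReal.ofReal (cutRadius x₀ θ z.1 z.2 ^ (-A)) * g z.1 ∂(μ.prod volume) :=
        lintegral_mono_set hcov
    _ ≤ ∑' j : Fin (n + 1), ∫⁻ z in dyadicPiece x₀ θ (2 ^ (j : ℕ) * R),
          ENNReal.ofReal (cutRadius x₀ θ z.1 z.2 ^ (-A)) * g z.1 ∂(μ.prod volume) :=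
        lintegral_iUnion_le _ _
    _ ≤ ∑ _j : Fin (n + 1), ENNReal.ofReal (2 ^ (θ + σ) * C * 3 ^ δ * Real.log R ^ δ) := by
        rw [tsum_fintype]
        exact Finset.sum_le_sum fun j _ ↦ hpiece j
    _ = ENNReal.ofReal (((n + 1 : ℕ) : ℝ) * (2 ^ (θ + σ) * C * 3 ^ δ * Real.log R ^ δ)) := by
        rw [Finset.sum_const, Finset.card_univ, Fintype.card_fin, nsmul_eq_mul,
          ENNReal.ofReal_mul (p := ((n + 1 : ℕ) : ℝ)) (by positivity), ENNReal.ofReal_natCast]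
    _ ≤ _ := by
        refine ENNReal.ofReal_le_ofReal ?_
        rw [Real.rpow_one_add' hlogR0.le (by linarith)]
        calc ((n + 1 : ℕ) : ℝ) * (2 ^ (θ + σ) * C * 3 ^ δ * Real.log R ^ δ)
            ≤ (3 * Real.log R) * (2 ^ (θ + σ) * C * 3 ^ δ * Real.log R ^ δ) := by gcongr
          _ = _ := by ring

end Shell

/-! ### The pointwise estimate -/

section Pointwise

/-- The pointwise form of the a priori estimate: the flux and time terms are absorbed into the
source term, up to remainders independent of the solution. -/
theorem exists_pointwise_estimate {p m q K θ C α : ℝ} {k : ℕ} (hp : 1 < p) (hm : 1 ≤ m)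
    (hq : max (p + m - 2) 1 < q) (hK : 0 ≤ K) (hθ : 0 < θ) (hC : 0 < C) (hα : 0 ≤ α) (hk : 2 ≤ k)
    (hkp : p < k) (hk₁ : p * q / (q - (p + m - 2)) ≤ k) (hk₂ : 1 * q / (q - 1) ≤ k) :
    ∃ C₁ C₂ : ℝ, 0 ≤ C₁ ∧ 0 ≤ C₂ ∧ ∀ β, 0 < β → β ≤ 1 / 2 → β < p + m - 2 →
      ∃ E₁ E₂ : ℝ, 0 ≤ E₁ ∧ 0 ≤ E₂ ∧ ∀ δ φ₀ ϱ P L u h V n fn g dt J : ℝ, 0 < δ → 0 ≤ φ₀ → φ₀ ≤ 1 →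
        1 ≤ ϱ → (P = if β * Real.log ϱ < 1 then 0 else β / ϱ) →
        (L = if β * Real.log ϱ < 1 then 0 else β / (θ * ϱ ^ θ)) →
        (0 < φ₀ → β * Real.log ϱ < 2) → 0 ≤ u → 0 < h → h ≤ C * (1 + ϱ) ^ α → h ≤ V → 0 ≤ n →
        0 ≤ fn → fn ≤ K → |g| ≤ k * φ₀ ^ (k - 1) * P * n → -dt ≤ k * φ₀ ^ (k - 1) * L →
        0 ≤ J → J ≤ (u + δ) ^ (1 - β) / (1 - β) →
        ((u + δ) ^ (-β) * g + φ₀ ^ k * (-β * (u + δ) ^ (-β - 1)) * n ^ 2) *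
            (u ^ (m - 1) * n ^ (p - 2) * fn) - dt * J ≤
          2⁻¹ * (φ₀ ^ k * (u + δ) ^ (-β) * (u ^ q * V)) +
          (if 0 < φ₀ ∧ 1 ≤ β * Real.log ϱ then
            C₁ * β ^ (q / (q - (p + m - 2))) * (ϱ ^ (-(p * q / (q - (p + m - 2)))) *
              h ^ (-((p + m - 2) / (q - (p + m - 2))))) +
            C₂ * β ^ (q / (q - 1)) * (ϱ ^ (-(θ * q / (q - 1))) * h ^ (-(1 / (q - 1)))) else 0) +
          (if 0 < φ₀ then E₁ * (2 * δ) ^ (p + m - 2 - β) + E₂ * (2 * δ) ^ (1 - β) else 0) := by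
  have hqκ : p + m - 2 < q := (le_max_left _ _).trans_lt hq
  have hq1 : 1 < q := (le_max_right _ _).trans_lt hq
  have hκ : 0 < p + m - 2 := by linarith
  have hk0 : (0 : ℝ) < k := by positivity
  -- The flux gives the remainder with `e = p + m - 2` and `μ = j = p`, the time term the one with
  -- `e = 1`, `μ = θ`, `j = 1`. The `2` in the constant `2k / θ` bounds `1 / (1 - β)` for `β ≤ 1/2`.
  obtain ⟨C₁, hC₁, h₁⟩ := exists_remainder_le (q := q) (e := p + m - 2) (c := K * k ^ p) (μ := p)
    (j := p) (C := C) (α := α) (k := k) (by linarith) hκ hqκ (by positivity) (by linarith) hC hα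
    (by linarith) hk₁
  obtain ⟨C₂, hC₂, h₂⟩ := exists_remainder_le (q := q) (e := 1) (c := 2 * k / θ) (μ := θ)
    (j := 1) (C := C) (α := α) (k := k) (by linarith) one_pos hq1 (by positivity) hθ.le hC hα
    zero_le_one hk₂
  refine ⟨C₁, C₂, hC₁, hC₂, fun β hβ hβ2 hβκ ↦ ?_⟩
  -- Upper bounds for `X₁` and `X₂` from `P ≤ β`, `L ≤ β / θ` and `φ₀ ≤ 1`. They may depend on `β`,
  -- since `δ → 0` is taken with `β` fixed.
  refine ⟨K * β ^ (1 - p) * (k * β) ^ p, k * (β / θ) / (1 - β), by positivity,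
    div_nonneg (by positivity) (by linarith), ?_⟩
  intro δ φ₀ ϱ P L u h V n fn g dt J hδ hφ hφ1 hϱ hP hL hϱβ hu hh hhC hhV hn hf0 hfK hg hdt hJ0 hJ
  have hϱ0 : 0 < ϱ := by linarith
  have hy : 0 < u + δ := by linarith
  have hβ1 : 0 < 1 - β := by linarith
  have hP0 : 0 ≤ P := by
    rw [hP]
    split_ifs
    · exact le_rfl
    · positivity
  have hL0 : 0 ≤ L := by
    rw [hL]
    split_ifs
    · exact le_rfl
    · positivity
  set X₁ := K * β ^ (1 - p) * (k * P) ^ p * φ₀ ^ ((k : ℝ) - p) with hX₁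
  set X₂ := k * φ₀ ^ (k - 1) * L / (1 - β) with hX₂
  have hX₁0 : 0 ≤ X₁ := by positivity
  have hX₂0 : 0 ≤ X₂ := by positivity
  have hflux := flux_le (k := k) hp hm hβ hφ hP0 hu hy (by linarith) hn hf0 hfK hk hg
  rw [← hX₁] at hflux
  have htime : -(dt * J) ≤ X₂ * (u + δ) ^ (1 - β) := by
    calc -(dt * J) = -dt * J := by ring
      _ ≤ (k * φ₀ ^ (k - 1) * L) * J := by gcongr
      _ ≤ (k * φ₀ ^ (k - 1) * L) * ((u + δ) ^ (1 - β) / (1 - β)) := by gcongr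
      _ = _ := by rw [hX₂]; ring
  have hlhs : ((u + δ) ^ (-β) * g + φ₀ ^ k * (-β * (u + δ) ^ (-β - 1)) * n ^ 2) *
      (u ^ (m - 1) * n ^ (p - 2) * fn) - dt * J ≤
        X₁ * (u + δ) ^ (p + m - 2 - β) + X₂ * (u + δ) ^ (1 - β) := by linarith
  refine hlhs.trans ?_
  rcases hφ.eq_or_lt with rfl | hφ0
  · have e1 : X₁ = 0 := by rw [hX₁, Real.zero_rpow (by linarith), mul_zero]
    have e2 : X₂ = 0 := by rw [hX₂, zero_pow (by omega)]; ring
    rw [e1, e2, zero_pow (by omega)]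
    simp
  have hϱβ' := hϱβ hφ0
  have hS0 : 0 ≤ φ₀ ^ k * (u + δ) ^ (-β) * u ^ q := by positivity
  have hS : φ₀ ^ k * (u + δ) ^ (-β) * (u ^ q * h) ≤ φ₀ ^ k * (u + δ) ^ (-β) * (u ^ q * V) := by
    gcongr
  have hS1 : 0 ≤ φ₀ ^ k * (u + δ) ^ (-β) * (u ^ q * h) := by positivity
  rw [if_pos hφ0]
  -- In the inner region both slopes vanish and there is no remainder; the remainder is confined to
  -- `β log ϱ ≥ 1`.
  by_cases hlog : β * Real.log ϱ < 1
  · rw [if_neg (fun h' ↦ absurd h'.2 (not_le.2 hlog))]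
    rw [if_pos hlog] at hP hL
    have e1 : X₁ = 0 := by
      rw [hX₁, hP, mul_zero, Real.zero_rpow (by linarith)]; ring
    have e2 : X₂ = 0 := by rw [hX₂, hL]; ring
    rw [e1, e2]
    have : 0 ≤ K * β ^ (1 - p) * (k * β) ^ p * (2 * δ) ^ (p + m - 2 - β) +
      k * (β / θ) / (1 - β) * (2 * δ) ^ (1 - β) := by positivity
    linarith
  · rw [if_pos ⟨hφ0, not_lt.1 hlog⟩]
    rw [if_neg hlog] at hP hL
    have hϱlog : Real.log ϱ ≤ 2 / β := by
      rw [le_div_iff₀ hβ]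
      linarith
    have hX₁le : X₁ ≤ K * k ^ p * β * ϱ ^ (-p) * φ₀ ^ ((k : ℝ) - p) := by
      refine le_of_eq ?_
      have : β ^ (1 - p) * β ^ p = β := by
        rw [← Real.rpow_add hβ, sub_add_cancel, Real.rpow_one]
      rw [hX₁, hP, Real.mul_rpow hk0.le (by positivity), Real.div_rpow hβ.le hϱ0.le,
        Real.rpow_neg hϱ0.le]
      linear_combination (K * k ^ p * (ϱ ^ p)⁻¹ * φ₀ ^ ((k : ℝ) - p)) * this
    have hφk : φ₀ ^ (k - 1) = φ₀ ^ ((k : ℝ) - 1) := by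
      rw [← Real.rpow_natCast, Nat.cast_sub (by omega), Nat.cast_one]
    have hX₂le : X₂ ≤ 2 * k / θ * β * ϱ ^ (-θ) * φ₀ ^ ((k : ℝ) - 1) := by
      rw [hX₂, hL, hφk, div_le_iff₀ hβ1, Real.rpow_neg hϱ0.le]
      have h1 : k * φ₀ ^ ((k : ℝ) - 1) * (β / (θ * ϱ ^ θ)) =
        (k / θ * β * (ϱ ^ θ)⁻¹ * φ₀ ^ ((k : ℝ) - 1)) * 1 := by field_simp
      have h2 : 2 * k / θ * β * (ϱ ^ θ)⁻¹ * φ₀ ^ ((k : ℝ) - 1) * (1 - β) =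
        (k / θ * β * (ϱ ^ θ)⁻¹ * φ₀ ^ ((k : ℝ) - 1)) * (2 * (1 - β)) := by ring
      rw [h1, h2]
      gcongr
      linarith
    have hr₁ := h₁ β φ₀ ϱ h X₁ hβ (by linarith) hβκ hφ0 hφ1 hϱ hϱlog hh hhC hX₁0 hX₁le
    have hr₂ := h₂ β φ₀ ϱ h X₂ hβ (by linarith) (by linarith) hφ0 hφ1 hϱ hϱlog hh hhC hX₂0 hX₂le
    -- Each absorption spends a quarter of the source term, together the half on the right.
    have ha₁ := absorb_le (q := q) (β := β) (a := p + m - 2 - β) (by linarith)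
      (pow_pos hφ0 k) hX₁0 hu hδ hh (by linarith) (by linarith)
    have ha₂ := absorb_le (q := q) (β := β) (a := 1 - β) (by linarith)
      (pow_pos hφ0 k) hX₂0 hu hδ hh (by linarith) (by linarith)
    have hE₁ : X₁ ≤ K * β ^ (1 - p) * (k * β) ^ p := by
      have h1 : P ≤ β := by rw [hP]; exact div_le_self hβ.le hϱ
      calc X₁ ≤ K * β ^ (1 - p) * (k * β) ^ p * 1 := by
            rw [hX₁]
            gcongr
            exact Real.rpow_le_one hφ hφ1 (by linarith)
        _ = _ := mul_one _
    have hE₂ : X₂ ≤ k * (β / θ) / (1 - β) := by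
      have h1 : L ≤ β / θ := by
        rw [hL]
        gcongr
        exact le_mul_of_one_le_right hθ.le (Real.one_le_rpow hϱ hθ.le)
      calc X₂ ≤ k * 1 * (β / θ) / (1 - β) := by
            rw [hX₂]
            gcongr
            exact pow_le_one₀ hφ hφ1
        _ = _ := by ring
    have hE₁' : X₁ * (2 * δ) ^ (p + m - 2 - β) ≤
        K * β ^ (1 - p) * (k * β) ^ p * (2 * δ) ^ (p + m - 2 - β) := by gcongr
    have hE₂' : X₂ * (2 * δ) ^ (1 - β) ≤ k * (β / θ) / (1 - β) * (2 * δ) ^ (1 - β) := by gcongr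
    rw [mul_assoc _ (ϱ ^ _)] at hr₁ hr₂
    linarith

end Pointwise

/-! ### Integrating the pointwise estimate -/

section Integrated
open Filter Topology

theorem ofReal_integral_le_lintegral_ofReal {α : Type*} [MeasurableSpace α] {μ : Measure α}
    {f : α → ℝ} (hf : Integrable f μ) :
    ENNReal.ofReal (∫ x, f x ∂μ) ≤ ∫⁻ x, ENNReal.ofReal (f x) ∂μ := by
  rw [integral_eq_lintegral_pos_part_sub_lintegral_neg_part hf]
  refine (ENNReal.ofReal_le_ofReal (sub_le_self _ ENNReal.toReal_nonneg)).trans ?_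
  exact ENNReal.ofReal_toReal_le

variable {N : ℕ} {M : Type*} [MetricSpace M] [ChartedSpace (EuclideanSpace ℝ (Fin N)) M]
  [MeasurableSpace M] [BorelSpace M]
  [RiemannianBundle (fun x : M ↦ TangentSpace (𝓡 N) x)] [IsManifold (𝓡 N) ∞ M]
  [IsContMDiffRiemannianBundle (𝓡 N) ∞ (EuclideanSpace ℝ (Fin N))
      (fun x : M ↦ TangentSpace (𝓡 N) x)]
  [SecondCountableTopology M] [IsRiemannianManifold (𝓡 N) M] [CompleteSpace M]

theorem weighted_lt_top_of_isCompact {a : M → ℝ} (ha : LocallyLipschitz a) {T : Set (M × ℝ)}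
    (hT : IsCompact T) : (weightedMeasure N a).prod volume T < ⊤ := by
  have : IsLocallyFiniteMeasure (weightedMeasure N a) :=
    IsLocallyFiniteMeasure.withDensity_ofReal ha.continuous
  exact hT.measure_lt_top

theorem ae_weighted_of_ae {a : M → ℝ} (ha : Measurable a) {P : M → Prop}
    (h : ∀ᵐ x ∂(riemannianMeasure N M), P x) :
    ∀ᵐ z ∂((weightedMeasure N a).prod volume).restrict (cylinder M), P z.1 := by
  have h1 : ∀ᵐ z ∂(stMeasure N M), P z.1 := Measure.quasiMeasurePreserving_fst.ae h
  exact weighted_absolutelyContinuous ha (ae_restrict_of_ae h1)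

/-- Absorbing the flux and time terms, for a given parameter `δ` of regularization. -/
theorem lintegral_source_le_remainder {p m q K : ℝ} (hp : 1 < p) (hm : 1 ≤ m)
    {f : ℝ → ℝ} (hf_meas : Measurable f) (hf : ∀ s, 0 ≤ s → 0 ≤ f s ∧ f s ≤ K) {a : M → ℝ}
    (ha : LocallyLipschitz a) {V u : M → ℝ → ℝ} {G : (x : M) → ℝ → TangentSpace (𝓡 N) x}
    {w : M → ℝ → ℝ} (hu : IsSolutionTriple p q m f a V u G w) (x₀ : M) {h : M → ℝ}
    (hVh : ∀ᵐ z ∂(stMeasure N M).restrict (cylinder M), h z.1 ≤ V z.1 z.2) {C α θ : ℝ}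
    (hh : ∀ᵐ x ∂(riemannianMeasure N M), 0 < h x ∧ h x ≤ C * (1 + dist x₀ x) ^ α)
    (hC : 0 < C) (hα : 0 ≤ α) (hθ : 0 < θ) {β δ ε : ℝ} (hβ : 0 < β) (hβ1 : β < 1) (hδ : 0 < δ)
    (hδ1 : δ ≤ 1) (hε : 0 < ε) {k : ℕ} (hk : 2 ≤ k) {Z : M × ℝ → ℝ}
    (hZ : ∀ z : M × ℝ, 0 < z.2 → ∀ u V n fn g dt J : ℝ, 0 ≤ u → 0 < h z.1 →
      h z.1 ≤ C * (1 + cutRadius x₀ θ z.1 z.2) ^ α → h z.1 ≤ V → 0 ≤ n → 0 ≤ fn → fn ≤ K →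
      |g| ≤ k * cutBase x₀ θ β ε z.1 z.2 ^ (k - 1) * cutSlope x₀ θ β z.1 z.2 * n →
      -dt ≤ k * cutBase x₀ θ β ε z.1 z.2 ^ (k - 1) * cutTimeSlope x₀ θ β z.1 z.2 →
      0 ≤ J → J ≤ (u + δ) ^ (1 - β) / (1 - β) →
      ((u + δ) ^ (-β) * g + cutBase x₀ θ β ε z.1 z.2 ^ k * (-β * (u + δ) ^ (-β - 1)) * n ^ 2) *
          (u ^ (m - 1) * n ^ (p - 2) * fn) - dt * J ≤
        2⁻¹ * (cutBase x₀ θ β ε z.1 z.2 ^ k * (u + δ) ^ (-β) * (u ^ q * V)) + Z z) :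
    ∫⁻ z in cylinder M, ENNReal.ofReal (2⁻¹ * (cutFun x₀ θ β ε k z.1 z.2 *
        (u z.1 z.2 + 1) ^ (-β) * (u z.1 z.2 ^ q * h z.1))) ∂((weightedMeasure N a).prod volume) ≤
      ∫⁻ z in cylinder M, ENNReal.ofReal (Z z) ∂((weightedMeasure N a).prod volume) := by
  have : Nonempty M := ⟨x₀⟩
  have ham := ha.continuous.measurable
  obtain ⟨H, H', J, L, B, hH, hH', hL, hH0, hHB, hJ, hJB, hHJ⟩ :=
    exists_regularized_power hβ hβ1 hδ
  have hφ := (isTestFunction_cutFun (N := N) (x₀ := x₀) hβ hθ hε hk).1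
  have hT := hu.testedInequality hp hm hf_meas hf ha hH hH' hL hH0 hHB hJ hJB hφ
  set ν := ((weightedMeasure N a).prod volume).restrict (cylinder M) with hν
  have hac := weighted_absolutelyContinuous (N := N) ham
  have hfacts : ∀ᵐ z ∂ν, 0 < z.2 ∧ 0 ≤ u z.1 z.2 ∧ h z.1 ≤ V z.1 z.2 ∧
      0 < h z.1 ∧ h z.1 ≤ C * (1 + dist x₀ z.1) ^ α := by
    filter_upwards [ae_restrict_mem measurableSet_cylinder, hac hu.nonneg, hac hVh,
      ae_weighted_of_ae ham hh] with z h1 h2 h3 h4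
    exact ⟨h1.2, h2, h3, h4⟩
  -- Since `δ ≤ 1`, replacing `(u+δ)^(-β)` by `(u+1)^(-β)` only decreases the source; the left side
  -- no longer depends on `δ`.
  have hsrc : ∀ᵐ z ∂ν, 0 ≤ sourceTerm q V u H (cutFun x₀ θ β ε k) z ∧
      cutFun x₀ θ β ε k z.1 z.2 * (u z.1 z.2 + 1) ^ (-β) * (u z.1 z.2 ^ q * h z.1) ≤
        sourceTerm q V u H (cutFun x₀ θ β ε k) z := by
    filter_upwards [hfacts] with z hz
    obtain ⟨hz0, hu0, hhV, hh0, -⟩ := hz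
    have h1 := hφ.nonneg z.1 z.2
    rw [sourceTerm, (hHJ _ hu0).1]
    have h2 : 0 ≤ V z.1 z.2 := hh0.le.trans hhV
    refine ⟨by positivity, ?_⟩
    have h3 : (u z.1 z.2 + 1) ^ (-β) ≤ (u z.1 z.2 + δ) ^ (-β) :=
      Real.rpow_le_rpow_of_nonpos (by positivity) (by linarith) (by linarith)
    gcongr
  have hpt : ∀ᵐ z ∂ν, fluxTerm p m f u G H H' (cutFun x₀ θ β ε k) z -
      timeTerm u J (cutFun x₀ θ β ε k) z -
        2⁻¹ * sourceTerm q V u H (cutFun x₀ θ β ε k) z ≤ Z z := by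
    filter_upwards [hfacts] with z hz
    obtain ⟨hz0, hu0, hhV, hh0, hhC⟩ := hz
    obtain ⟨e1, e2, e3, e4⟩ := hHJ _ hu0
    have hn := norm_nonneg (G z.1 z.2)
    have hhC' : h z.1 ≤ C * (1 + cutRadius x₀ θ z.1 z.2) ^ α := by
      refine hhC.trans ?_
      gcongr
      exact dist_le_cutRadius _ _ _ _
    have := hZ z hz0 (u z.1 z.2) (V z.1 z.2) ‖G z.1 z.2‖ (f ‖G z.1 z.2‖)
      (gradPairing G (cutFun x₀ θ β ε k) z) (deriv (fun t ↦ cutFun x₀ θ β ε k z.1 t) z.2)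
      (J (u z.1 z.2)) hu0 hh0 hhC' hhV hn (hf _ hn).1 (hf _ hn).2
      (abs_gradPairing_cutFun_le hβ hk G) (neg_deriv_cutFun_le hβ hθ hε hz0 hk) e3 e4
    rw [fluxTerm, timeTerm, sourceTerm, fluxFactor, e1, e2]
    simp only [cutFun] at this ⊢
    linarith
  have hi : Integrable (fun z ↦ fluxTerm p m f u G H H' (cutFun x₀ θ β ε k) z -
      timeTerm u J (cutFun x₀ θ β ε k) z -
        2⁻¹ * sourceTerm q V u H (cutFun x₀ θ β ε k) z) ν :=
    (hT.flux.sub hT.time).sub (hT.source.const_mul _)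
  -- Half of the source is subtracted from both sides, which is legitimate because its integral is
  -- finite.
  have hineq : ∫ z, 2⁻¹ * sourceTerm q V u H (cutFun x₀ θ β ε k) z ∂ν ≤
      ∫ z, (fluxTerm p m f u G H H' (cutFun x₀ θ β ε k) z -
      timeTerm u J (cutFun x₀ θ β ε k) z -
        2⁻¹ * sourceTerm q V u H (cutFun x₀ θ β ε k) z) ∂ν := by
    have h1 : ∫ z, (fluxTerm p m f u G H H' (cutFun x₀ θ β ε k) z -
      timeTerm u J (cutFun x₀ θ β ε k) z) ∂ν = _ := integral_sub hT.flux hT.time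
    have h2 : ∫ z, (fluxTerm p m f u G H H' (cutFun x₀ θ β ε k) z -
      timeTerm u J (cutFun x₀ θ β ε k) z -
        2⁻¹ * sourceTerm q V u H (cutFun x₀ θ β ε k) z) ∂ν = _ :=
      integral_sub (hT.flux.sub hT.time) (hT.source.const_mul _)
    have h3 := hT.ineq
    rw [h2, integral_const_mul]
    rw [h1]
    linarith
  calc ∫⁻ z, ENNReal.ofReal (2⁻¹ * (cutFun x₀ θ β ε k z.1 z.2 *
        (u z.1 z.2 + 1) ^ (-β) * (u z.1 z.2 ^ q * h z.1))) ∂ν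
      ≤ ∫⁻ z, ENNReal.ofReal (2⁻¹ * sourceTerm q V u H (cutFun x₀ θ β ε k) z) ∂ν := by
        refine lintegral_mono_ae ?_
        filter_upwards [hsrc] with z hz
        exact ENNReal.ofReal_le_ofReal (mul_le_mul_of_nonneg_left hz.2 (by norm_num))
    _ = ENNReal.ofReal (∫ z, 2⁻¹ * sourceTerm q V u H (cutFun x₀ θ β ε k) z ∂ν) := by
        refine (ofReal_integral_eq_lintegral_ofReal (hT.source.const_mul _) ?_).symm
        filter_upwards [hsrc] with z hz
        exact mul_nonneg (by norm_num) hz.1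
    _ ≤ _ := ENNReal.ofReal_le_ofReal hineq
    _ ≤ _ := ofReal_integral_le_lintegral_ofReal hi
    _ ≤ _ := by
        refine lintegral_mono_ae ?_
        filter_upwards [hpt] with z hz
        exact ENNReal.ofReal_le_ofReal hz

end Integrated

/-! ### The a priori estimate -/

section APriori
open Filter Topology

variable {N : ℕ} {M : Type*} [MetricSpace M] [ChartedSpace (EuclideanSpace ℝ (Fin N)) M]
  [MeasurableSpace M] [BorelSpace M]
  [RiemannianBundle (fun x : M ↦ TangentSpace (𝓡 N) x)] [IsManifold (𝓡 N) ∞ M]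
  [IsContMDiffRiemannianBundle (𝓡 N) ∞ (EuclideanSpace ℝ (Fin N))
      (fun x : M ↦ TangentSpace (𝓡 N) x)]
  [SecondCountableTopology M] [IsRiemannianManifold (𝓡 N) M] [CompleteSpace M]

instance sFinite_weightedMeasure (a : M → ℝ) : SFinite (weightedMeasure N a) := by
  unfold weightedMeasure; infer_instance

/-- The integral of a remainder supported in a shell, plus a constant on a compact set. -/
theorem lintegral_remainder_le {μ : Measure M} [SFinite μ] (x₀ : M) {θ R A₁ A₂ b₁ b₂ e : ℝ}
    {h₁ h₂ : M → ℝ} (hb₁ : 0 ≤ b₁) (hb₂ : 0 ≤ b₂)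
    (hm₁ : AEMeasurable (fun x ↦ ENNReal.ofReal (h₁ x)) μ)
    (hm₂ : AEMeasurable (fun x ↦ ENNReal.ofReal (h₂ x)) μ) {T : Set (M × ℝ)}
    (hT : MeasurableSet T) {Z : M × ℝ → ℝ} {Ω : Set (M × ℝ)}
    (hZ : ∀ᵐ z ∂(μ.prod volume).restrict Ω, Z z ≤ (shell x₀ θ R).indicator (fun z ↦
      b₁ * (cutRadius x₀ θ z.1 z.2 ^ (-A₁) * h₁ z.1) +
        b₂ * (cutRadius x₀ θ z.1 z.2 ^ (-A₂) * h₂ z.1)) z + T.indicator (fun _ ↦ e) z) :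
    ∫⁻ z in Ω, ENNReal.ofReal (Z z) ∂(μ.prod volume) ≤
      ENNReal.ofReal b₁ * ∫⁻ z in shell x₀ θ R,
        ENNReal.ofReal (cutRadius x₀ θ z.1 z.2 ^ (-A₁)) * ENNReal.ofReal (h₁ z.1) ∂(μ.prod volume) +
      ENNReal.ofReal b₂ * ∫⁻ z in shell x₀ θ R,
        ENNReal.ofReal (cutRadius x₀ θ z.1 z.2 ^ (-A₂)) * ENNReal.ofReal (h₂ z.1) ∂(μ.prod volume) +
      ENNReal.ofReal e * μ.prod volume T := by
  have hϱ : ∀ (A : ℝ) (z : M × ℝ), 0 ≤ cutRadius x₀ θ z.1 z.2 ^ (-A) := fun A z ↦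
    Real.rpow_nonneg (zero_le_one.trans (one_le_cutRadius x₀ θ z.1 z.2)) _
  set F₁ : M × ℝ → ℝ≥0∞ := fun z ↦
    ENNReal.ofReal (cutRadius x₀ θ z.1 z.2 ^ (-A₁)) * ENNReal.ofReal (h₁ z.1) with hF₁
  set F₂ : M × ℝ → ℝ≥0∞ := fun z ↦
    ENNReal.ofReal (cutRadius x₀ θ z.1 z.2 ^ (-A₂)) * ENNReal.ofReal (h₂ z.1) with hF₂
  have hF₁m : AEMeasurable F₁ (μ.prod volume) :=
    ((measurable_cutRadius x₀ θ).pow_const _).ennreal_ofReal.aemeasurable.mul hm₁.comp_fst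
  have hpt : ∀ᵐ z ∂(μ.prod volume).restrict Ω, ENNReal.ofReal (Z z) ≤ (shell x₀ θ R).indicator
      (fun z ↦ ENNReal.ofReal b₁ * F₁ z + ENNReal.ofReal b₂ * F₂ z) z +
        T.indicator (fun _ ↦ ENNReal.ofReal e) z := by
    filter_upwards [hZ] with z hz
    refine (ENNReal.ofReal_le_ofReal hz).trans (ENNReal.ofReal_add_le.trans ?_)
    refine add_le_add ?_ ?_
    · by_cases h : z ∈ shell x₀ θ R
      · rw [indicator_of_mem h, indicator_of_mem h]
        refine ENNReal.ofReal_add_le.trans ?_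
        rw [ENNReal.ofReal_mul hb₁, ENNReal.ofReal_mul hb₂, ENNReal.ofReal_mul (hϱ _ _),
          ENNReal.ofReal_mul (hϱ _ _)]
      · rw [indicator_of_notMem h, indicator_of_notMem h, ENNReal.ofReal_zero]
    · by_cases h : z ∈ T
      · rw [indicator_of_mem h, indicator_of_mem h]
      · rw [indicator_of_notMem h, indicator_of_notMem h, ENNReal.ofReal_zero]
  calc ∫⁻ z in Ω, ENNReal.ofReal (Z z) ∂(μ.prod volume)
      ≤ ∫⁻ z in Ω, ((shell x₀ θ R).indicator
          (fun z ↦ ENNReal.ofReal b₁ * F₁ z + ENNReal.ofReal b₂ * F₂ z) z +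
            T.indicator (fun _ ↦ ENNReal.ofReal e) z) ∂(μ.prod volume) :=
        lintegral_mono_ae hpt
    _ ≤ ∫⁻ z, ((shell x₀ θ R).indicator
          (fun z ↦ ENNReal.ofReal b₁ * F₁ z + ENNReal.ofReal b₂ * F₂ z) z +
            T.indicator (fun _ ↦ ENNReal.ofReal e) z) ∂(μ.prod volume) :=
        setLIntegral_le_lintegral _ _
    _ = _ := by
        rw [lintegral_add_right _ (measurable_const.indicator hT),
          lintegral_indicator (measurableSet_shell x₀ θ R), lintegral_indicator_const hT,
          lintegral_add_left' (hF₁m.restrict.const_mul _),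
          lintegral_const_mul' _ _ ENNReal.ofReal_ne_top,
          lintegral_const_mul' _ _ ENNReal.ofReal_ne_top]

/-- The a priori estimate for nonnegative weak solutions. -/
theorem exists_a_priori_estimate {p m q K : ℝ} (hp : 1 < p) (hm : 1 ≤ m)
    (hq : max (p + m - 2) 1 < q) (hK : 0 ≤ K)
    {f : ℝ → ℝ} (hf_meas : Measurable f) (hf : ∀ s, 0 ≤ s → 0 ≤ f s ∧ f s ≤ K) {a : M → ℝ}
    (ha : LocallyLipschitz a) {V u : M → ℝ → ℝ} {G : (x : M) → ℝ → TangentSpace (𝓡 N) x}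
    {w : M → ℝ → ℝ} (hu : IsSolutionTriple p q m f a V u G w) (x₀ : M) {h : M → ℝ}
    (hh_meas : AEMeasurable h (riemannianMeasure N M))
    (hVh : ∀ᵐ z ∂(stMeasure N M).restrict (cylinder M), h z.1 ≤ V z.1 z.2)
    {C α σ₁ σ₂ δ₁ δ₂ R₀ : ℝ} (hC : 0 < C) (hα : 0 ≤ α) (hσ₁ : 0 ≤ σ₁) (hσ₂ : 0 ≤ σ₂)
    (hδ₁ : 0 ≤ δ₁) (hδ₂ : 0 ≤ δ₂)
    (hh : ∀ᵐ x ∂(riemannianMeasure N M), 0 < h x ∧ h x ≤ C * (1 + dist x₀ x) ^ α)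
    (hint₁ : ∀ R, R₀ ≤ R →
      ∫⁻ x in Metric.ball x₀ R, ENNReal.ofReal (h x ^ (-(1 / (q - 1)))) ∂(weightedMeasure N a) ≤
        ENNReal.ofReal (C * R ^ σ₁ * Real.log R ^ δ₁))
    (hint₂ : ∀ R, R₀ ≤ R →
      ∫⁻ x in Metric.ball x₀ R, ENNReal.ofReal (h x ^ (-((p + m - 2) / (q - (p + m - 2)))))
          ∂(weightedMeasure N a) ≤
        ENNReal.ofReal (C * R ^ σ₂ * Real.log R ^ δ₂))
    (hσ₂_lt : σ₂ < p * q / (q - (p + m - 2)))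
    (hσ₁_le : σ₁ ≤ 1 / (q - 1) * (p * q / (q - (p + m - 2)) - σ₂)) :
    ∃ (θ C' R₁ : ℝ) (k : ℕ), 0 < θ ∧ 0 ≤ C' ∧ 2 ≤ k ∧ 2 ≤ R₁ ∧ ∀ R, R₁ ≤ R → ∀ ε, 0 < ε →
      ∫⁻ z in cylinder M, ENNReal.ofReal (2⁻¹ * (cutFun x₀ θ (Real.log R)⁻¹ ε k z.1 z.2 *
          (u z.1 z.2 + 1) ^ (-(Real.log R)⁻¹) * (u z.1 z.2 ^ q * h z.1)))
          ∂((weightedMeasure N a).prod volume) ≤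
        ENNReal.ofReal (C' * (Real.log R ^ (1 + δ₂ - q / (q - (p + m - 2))) +
          Real.log R ^ (1 + δ₁ - q / (q - 1)))) := by
  have hqκ : p + m - 2 < q := (le_max_left _ _).trans_lt hq
  have hq1 : 1 < q := (le_max_right _ _).trans_lt hq
  have hκ : 0 < p + m - 2 := by linarith
  have hD : 0 < q - (p + m - 2) := by linarith
  have hq10 : 0 < q - 1 := by linarith
  -- This `θ` makes the flux remainder exactly critical, `θ + σ₂ = p q / (q - (p + m - 2))`. For the
  -- time remainder, `θ q / (q - 1) = θ + θ / (q - 1) ≥ θ + σ₁` is the hypothesis on `σ₁`.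
  set θ := p * q / (q - (p + m - 2)) - σ₂ with hθdef
  have hθ : 0 < θ := by linarith
  -- A sum of ceilings, plus `2`, meets all the lower bounds on `k` at once, including the strict `p
  -- < k`.
  set k : ℕ := ⌈p⌉₊ + ⌈p * q / (q - (p + m - 2))⌉₊ + ⌈1 * q / (q - 1)⌉₊ + 2 with hkdef
  have hk2 : 2 ≤ k := by omega
  have hkp : p < k := by
    have := Nat.le_ceil p
    rw [hkdef]; push_cast; linarith [Nat.cast_nonneg (α := ℝ) ⌈p * q / (q - (p + m - 2))⌉₊,
      Nat.cast_nonneg (α := ℝ) ⌈1 * q / (q - 1)⌉₊]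
  have hk₁ : p * q / (q - (p + m - 2)) ≤ k := by
    have := Nat.le_ceil (p * q / (q - (p + m - 2)))
    rw [hkdef]; push_cast; linarith [Nat.cast_nonneg (α := ℝ) ⌈p⌉₊,
      Nat.cast_nonneg (α := ℝ) ⌈1 * q / (q - 1)⌉₊]
  have hk₂ : 1 * q / (q - 1) ≤ k := by
    have := Nat.le_ceil (1 * q / (q - 1))
    rw [hkdef]; push_cast; linarith [Nat.cast_nonneg (α := ℝ) ⌈p⌉₊,
      Nat.cast_nonneg (α := ℝ) ⌈p * q / (q - (p + m - 2))⌉₊]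
  obtain ⟨C₁, C₂, hC₁, hC₂, hpoint⟩ := exists_pointwise_estimate (α := α) hp hm hq hK hθ hC hα hk2
    hkp hk₁ hk₂
  have ham := ha.continuous.measurable
  have hhm : AEMeasurable h (weightedMeasure N a) :=
    hh_meas.mono_ac (withDensity_absolutelyContinuous _ _)
  have hg : ∀ r : ℝ, AEMeasurable (fun x ↦ ENNReal.ofReal (h x ^ r)) (weightedMeasure N a) :=
    fun r ↦ (hhm.pow_const r).ennreal_ofReal
  obtain ⟨B₂, hB₂, hs₂⟩ := exists_lintegral_shell_le (μ := weightedMeasure N a) x₀ hθ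
    (A := p * q / (q - (p + m - 2))) (by positivity) hσ₂ hδ₂ hC (by linarith) (hg _) hint₂
  obtain ⟨B₁, hB₁, hs₁⟩ := exists_lintegral_shell_le (μ := weightedMeasure N a) x₀ hθ
    (A := θ * q / (q - 1)) (by positivity) hσ₁ hδ₁ hC (by
      have : θ * q / (q - 1) = θ + 1 / (q - 1) * θ := by field_simp; ring
      linarith) (hg _) hint₁
  -- The threshold makes `log R` at least `2` and `2 / (p + m - 2)`, so that `β = 1 / log R`
  -- satisfies `β ≤ 1/2` and `β < p + m - 2`.
  refine ⟨θ, C₁ * B₂ + C₂ * B₁, max (max R₀ 2) (Real.exp (max 2 (2 / (p + m - 2)))), k, hθ,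
    by positivity, hk2, (le_max_right _ _).trans (le_max_left _ _), fun R hR ε hε ↦ ?_⟩
  have hR2 : max R₀ 2 ≤ R := (le_max_left _ _).trans hR
  have hR0 : 0 < R := two_pos.trans_le ((le_max_right _ _).trans hR2)
  have hlogR : max 2 (2 / (p + m - 2)) ≤ Real.log R := by
    rw [Real.le_log_iff_exp_le hR0]
    exact (le_max_right _ _).trans hR
  have hl2 : 2 ≤ Real.log R := (le_max_left _ _).trans hlogR
  have hl0 : 0 < Real.log R := by linarith
  set β := (Real.log R)⁻¹ with hβdef
  have hβ : 0 < β := inv_pos.2 hl0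
  have hβ2 : β ≤ 1 / 2 := by
    rw [hβdef, one_div]
    exact inv_anti₀ two_pos hl2
  have hβκ : β < p + m - 2 := by
    have h1 : 2 / (p + m - 2) ≤ Real.log R := (le_max_right _ _).trans hlogR
    rw [hβdef, inv_lt_iff_one_lt_mul₀ hl0]
    rw [div_le_iff₀ hκ] at h1
    linarith
  obtain ⟨E₁, E₂, hE₁, hE₂, hpt⟩ := hpoint β hβ hβ2 hβκ
  set T := tsupport (fun z : M × ℝ ↦ cutFun x₀ θ β ε k z.1 z.2) with hTdef
  have hTc : IsCompact T := (isTestFunction_cutFun (N := N) (x₀ := x₀) hβ hθ hε hk2).1.compact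
  have hβR : ∀ ϱ : ℝ, 0 < ϱ → 1 ≤ β * Real.log ϱ → R ≤ ϱ := by
    intro ϱ hϱ h1
    rw [hβdef, inv_mul_eq_div, le_div_iff₀ hl0, one_mul] at h1
    exact (Real.log_le_log_iff hR0 hϱ).1 h1
  have hβR2 : ∀ ϱ : ℝ, 0 < ϱ → β * Real.log ϱ < 2 → ϱ ≤ R ^ 2 := by
    intro ϱ hϱ h1
    rw [hβdef, inv_mul_eq_div, div_lt_iff₀ hl0] at h1
    refine (Real.log_le_log_iff hϱ (by positivity)).1 ?_
    rw [Real.log_pow]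
    push_cast
    exact h1.le
  set bound := ENNReal.ofReal (C₁ * β ^ (q / (q - (p + m - 2)))) *
      ENNReal.ofReal (B₂ * Real.log R ^ (1 + δ₂)) +
    ENNReal.ofReal (C₂ * β ^ (q / (q - 1))) * ENNReal.ofReal (B₁ * Real.log R ^ (1 + δ₁))
    with hbound
  -- The error from `u ≤ δ` is a constant on the compact support `T`, which has finite measure. Both
  -- exponents of `2δ` are positive, so the error disappears as `δ → 0` with `R` and `ε` fixed.
  have hmain : ∀ δ, 0 < δ → δ ≤ 1 →
      ∫⁻ z in cylinder M, ENNReal.ofReal (2⁻¹ * (cutFun x₀ θ β ε k z.1 z.2 *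
          (u z.1 z.2 + 1) ^ (-β) * (u z.1 z.2 ^ q * h z.1)))
          ∂((weightedMeasure N a).prod volume) ≤
        bound + ENNReal.ofReal (E₁ * (2 * δ) ^ (p + m - 2 - β) + E₂ * (2 * δ) ^ (1 - β)) *
          (weightedMeasure N a).prod volume T := by
    intro δ hδ hδ1
    have h1 := lintegral_source_le_remainder hp hm hf_meas hf ha hu x₀ hVh hh hC hα hθ hβ
      (by linarith) hδ hδ1 hε hk2
      (Z := fun z ↦ (if 0 < cutBase x₀ θ β ε z.1 z.2 ∧ 1 ≤ β * Real.log (cutRadius x₀ θ z.1 z.2)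
        then C₁ * β ^ (q / (q - (p + m - 2))) *
            (cutRadius x₀ θ z.1 z.2 ^ (-(p * q / (q - (p + m - 2)))) *
              h z.1 ^ (-((p + m - 2) / (q - (p + m - 2))))) +
            C₂ * β ^ (q / (q - 1)) * (cutRadius x₀ θ z.1 z.2 ^ (-(θ * q / (q - 1))) *
              h z.1 ^ (-(1 / (q - 1)))) else 0) +
          (if 0 < cutBase x₀ θ β ε z.1 z.2 then
            E₁ * (2 * δ) ^ (p + m - 2 - β) + E₂ * (2 * δ) ^ (1 - β) else 0))
      (fun z _ u V n fn g dt J hu hh hhC hhV hn hf0 hfK hg hdt hJ0 hJ ↦ by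
        rw [← add_assoc]
        exact hpt δ _ _ _ _ u (h z.1) V n fn g dt J hδ (cutBase_nonneg _ _ _ _ _ _)
          (cutBase_le_one _ _ _ _ _ _) (one_le_cutRadius _ _ _ _) rfl rfl
          (fun h ↦ (lt_of_cutBase_pos hε h).2) hu hh hhC hhV hn hf0 hfK hg hdt hJ0 hJ)
    refine h1.trans ((lintegral_remainder_le x₀ (θ := θ) (R := R)
      (A₁ := p * q / (q - (p + m - 2))) (A₂ := θ * q / (q - 1))
      (b₁ := C₁ * β ^ (q / (q - (p + m - 2)))) (b₂ := C₂ * β ^ (q / (q - 1)))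
      (h₁ := fun x ↦ h x ^ (-((p + m - 2) / (q - (p + m - 2)))))
      (h₂ := fun x ↦ h x ^ (-(1 / (q - 1))))
      (e := E₁ * (2 * δ) ^ (p + m - 2 - β) + E₂ * (2 * δ) ^ (1 - β))
      (by positivity) (by positivity) (hg _) (hg _) hTc.measurableSet ?_).trans ?_)
    rotate_left
    · rw [hbound]
      gcongr
      · exact hs₂ R hR2
      · exact hs₁ R hR2
    · filter_upwards [ae_weighted_of_ae ham hh, ae_restrict_mem measurableSet_cylinder]
        with z hhz hz
      refine add_le_add ?_ ?_
      · by_cases hc : 0 < cutBase x₀ θ β ε z.1 z.2 ∧ 1 ≤ β * Real.log (cutRadius x₀ θ z.1 z.2)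
        · have hϱ0 := one_pos.trans_le (one_le_cutRadius x₀ θ z.1 z.2)
          have hz' : z ∈ shell x₀ θ R :=
            ⟨hz.2, hβR _ hϱ0 hc.2, hβR2 _ hϱ0 (lt_of_cutBase_pos hε hc.1).2⟩
          rw [if_pos hc, indicator_of_mem hz']
        · rw [if_neg hc]
          refine indicator_apply_nonneg fun _ ↦ ?_
          have hϱ0 := one_pos.trans_le (one_le_cutRadius x₀ θ z.1 z.2)
          have hhz0 := hhz.1
          positivity
      · have hE : 0 ≤ E₁ * (2 * δ) ^ (p + m - 2 - β) + E₂ * (2 * δ) ^ (1 - β) := by positivity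
        by_cases hc : 0 < cutBase x₀ θ β ε z.1 z.2
        · rw [if_pos hc, indicator_of_mem]
          refine subset_tsupport _ ?_
          exact (pow_pos hc k).ne'
        · rw [if_neg hc]
          exact indicator_nonneg (fun _ _ ↦ hE) z
  have hlim : Tendsto (fun δ : ℝ ↦ bound +
      ENNReal.ofReal (E₁ * (2 * δ) ^ (p + m - 2 - β) + E₂ * (2 * δ) ^ (1 - β)) *
          (weightedMeasure N a).prod volume T) (𝓝[>] 0) (𝓝 (bound + 0)) := by
    refine tendsto_const_nhds.add ?_
    have h1 : Tendsto (fun δ : ℝ ↦ E₁ * (2 * δ) ^ (p + m - 2 - β) + E₂ * (2 * δ) ^ (1 - β))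
        (𝓝[>] 0) (𝓝 0) := by
      have hpow : ∀ r : ℝ, 0 < r → ContinuousAt (fun δ : ℝ ↦ (2 * δ) ^ r) 0 := fun r hr ↦
        (continuousAt_const.mul continuousAt_id).rpow_const (Or.inr hr.le)
      have h2 : ContinuousAt (fun δ : ℝ ↦ E₁ * (2 * δ) ^ (p + m - 2 - β) + E₂ * (2 * δ) ^ (1 - β))
          0 := (continuousAt_const.mul (hpow _ (by linarith))).add
        (continuousAt_const.mul (hpow _ (by linarith)))
      have h3 := h2.tendsto
      rw [mul_zero, Real.zero_rpow (by linarith), Real.zero_rpow (by linarith), mul_zero, mul_zero,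
        add_zero] at h3
      exact h3.mono_left nhdsWithin_le_nhds
    have h4 := ENNReal.Tendsto.mul_const (b := (weightedMeasure N a).prod volume T)
      (ENNReal.tendsto_ofReal h1) (Or.inr (weighted_lt_top_of_isCompact ha hTc).ne)
    rwa [ENNReal.ofReal_zero, zero_mul] at h4
  have hfin := ge_of_tendsto hlim (b := ∫⁻ z in cylinder M,
      ENNReal.ofReal (2⁻¹ * (cutFun x₀ θ β ε k z.1 z.2 *
          (u z.1 z.2 + 1) ^ (-β) * (u z.1 z.2 ^ q * h z.1)))
          ∂((weightedMeasure N a).prod volume)) (by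
    filter_upwards [Ioc_mem_nhdsGT one_pos] with δ hδ
    exact hmain δ hδ.1 hδ.2)
  refine hfin.trans ?_
  have hpw : ∀ r s : ℝ, β ^ r * Real.log R ^ s = Real.log R ^ (s - r) := by
    intro r s
    rw [hβdef, Real.inv_rpow hl0.le, ← Real.rpow_neg hl0.le, ← Real.rpow_add hl0]
    congr 1
    ring
  rw [add_zero, hbound, ← ENNReal.ofReal_mul (by positivity), ← ENNReal.ofReal_mul (by positivity),
    ← ENNReal.ofReal_add (by positivity) (by positivity)]
  refine ENNReal.ofReal_le_ofReal ?_
  have e1 : C₁ * β ^ (q / (q - (p + m - 2))) * (B₂ * Real.log R ^ (1 + δ₂)) =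
      C₁ * B₂ * Real.log R ^ (1 + δ₂ - q / (q - (p + m - 2))) := by
    rw [← hpw]; ring
  have e2 : C₂ * β ^ (q / (q - 1)) * (B₁ * Real.log R ^ (1 + δ₁)) =
      C₂ * B₁ * Real.log R ^ (1 + δ₁ - q / (q - 1)) := by
    rw [← hpw]; ring
  rw [e1, e2]
  have h1 : 0 ≤ Real.log R ^ (1 + δ₂ - q / (q - (p + m - 2))) := by positivity
  have h2 : 0 ≤ Real.log R ^ (1 + δ₁ - q / (q - 1)) := by positivity
  have h3 : 0 ≤ C₁ * B₂ := by positivity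
  have h4 : 0 ≤ C₂ * B₁ := by positivity
  nlinarith [mul_nonneg h3 h2, mul_nonneg h4 h1]

end APriori

/-! ### Vanishing of solutions -/

section Liouville
open Filter Topology

theorem tendsto_cutFun {M : Type*} [MetricSpace M] (x₀ : M) (θ : ℝ) (k : ℕ) (x : M) {t : ℝ}
    (ht : 0 < t) :
    Tendsto (fun n : ℕ ↦ cutFun x₀ θ (n : ℝ)⁻¹ (n : ℝ)⁻¹ k x t) atTop (𝓝 1) := by
  refine tendsto_const_nhds.congr' ?_
  have hn : Tendsto (fun n : ℕ ↦ (n : ℝ)) atTop atTop := tendsto_natCast_atTop_atTop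
  filter_upwards [hn.eventually_ge_atTop (2 / t), hn.eventually_ge_atTop 1,
    hn.eventually_ge_atTop (Real.log (cutRadius x₀ θ x t))] with n h1 h2 h3
  have hn0 : (0 : ℝ) < n := by linarith
  have h4 : 1 ≤ (t - (n : ℝ)⁻¹) / (n : ℝ)⁻¹ := by
    rw [div_le_iff₀ ht] at h1
    rw [div_inv_eq_mul, sub_mul, inv_mul_cancel₀ hn0.ne']
    linarith
  have h5 : (n : ℝ)⁻¹ * Real.log (cutRadius x₀ θ x t) ≤ 1 := by
    rw [inv_mul_eq_div, div_le_iff₀ hn0]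
    linarith
  have h6 : cutBase x₀ θ (n : ℝ)⁻¹ (n : ℝ)⁻¹ x t = 1 := by
    rw [cutBase, min_eq_left h4, min_eq_left (by linarith), max_eq_right zero_le_one]
  rw [cutFun, h6, one_pow]

theorem tendsto_add_one_rpow {u : ℝ} (hu : 0 ≤ u) :
    Tendsto (fun n : ℕ ↦ (u + 1) ^ (-(n : ℝ)⁻¹)) atTop (𝓝 1) := by
  have h1 : Tendsto (fun n : ℕ ↦ -(n : ℝ)⁻¹) atTop (𝓝 (-0)) :=
    tendsto_inv_atTop_nhds_zero_nat.neg
  have h2 := tendsto_const_nhds (x := u + 1) (f := atTop (α := ℕ)) |>.rpow h1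
    (Or.inl (by linarith))
  rwa [neg_zero, Real.rpow_zero] at h2

theorem tendsto_rpow_add_rpow {C r s : ℝ} (hr : r < 0) (hs : s < 0) :
    Tendsto (fun n : ℕ ↦ ENNReal.ofReal (C * ((n : ℝ) ^ r + (n : ℝ) ^ s))) atTop (𝓝 0) := by
  have h : ∀ r : ℝ, r < 0 → Tendsto (fun n : ℕ ↦ (n : ℝ) ^ r) atTop (𝓝 0) := fun r hr ↦ by
    have := (tendsto_rpow_neg_atTop (neg_pos.2 hr)).comp tendsto_natCast_atTop_atTop
    simpa only [neg_neg, Function.comp_def] using this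
  have h1 := ENNReal.tendsto_ofReal (((h r hr).add (h s hs)).const_mul C)
  rwa [add_zero, mul_zero, ENNReal.ofReal_zero] at h1

variable {N : ℕ} {M : Type*} [MetricSpace M] [ChartedSpace (EuclideanSpace ℝ (Fin N)) M]
  [MeasurableSpace M] [BorelSpace M]
  [RiemannianBundle (fun x : M ↦ TangentSpace (𝓡 N) x)] [IsManifold (𝓡 N) ∞ M]
  [IsContMDiffRiemannianBundle (𝓡 N) ∞ (EuclideanSpace ℝ (Fin N))
      (fun x : M ↦ TangentSpace (𝓡 N) x)]
  [SecondCountableTopology M] [IsRiemannianManifold (𝓡 N) M] [CompleteSpace M]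

/-- Since `a > 0` almost everywhere, passing to `a dμ` creates no new null sets. -/
theorem ae_of_ae_weighted {a : M → ℝ} (ha : Measurable a)
    (ha_pos : ∀ᵐ x ∂(riemannianMeasure N M), 0 < a x) {P : M × ℝ → Prop}
    (h : ∀ᵐ z ∂((weightedMeasure N a).prod volume).restrict (cylinder M), P z) :
    ∀ᵐ z ∂(stMeasure N M).restrict (cylinder M), P z := by
  have hm : Measurable fun z : M × ℝ ↦ ENNReal.ofReal (a z.1) :=
    (ha.comp measurable_fst).ennreal_ofReal
  rw [weightedMeasure_prod ha, restrict_withDensity measurableSet_cylinder,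
    ae_withDensity_iff hm] at h
  have h1 : ∀ᵐ z ∂(stMeasure N M), 0 < a z.1 := Measure.quasiMeasurePreserving_fst.ae ha_pos
  filter_upwards [h, ae_restrict_of_ae h1] with z hz haz
  exact hz (ENNReal.ofReal_pos.2 haz).ne'

/-- Nonnegative weak solutions vanish. -/
theorem IsSolutionTriple.ae_eq_zero {p m q K : ℝ} (hp : 1 < p) (hm : 1 ≤ m)
    (hq : max (p + m - 2) 1 < q) (hK : 0 ≤ K)
    {f : ℝ → ℝ} (hf_meas : Measurable f) (hf : ∀ s, 0 ≤ s → 0 ≤ f s ∧ f s ≤ K) {a : M → ℝ}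
    (ha : LocallyLipschitz a) (ha_pos : ∀ᵐ x ∂(riemannianMeasure N M), 0 < a x)
    {V u : M → ℝ → ℝ} {G : (x : M) → ℝ → TangentSpace (𝓡 N) x}
    {w : M → ℝ → ℝ} (hu : IsSolutionTriple p q m f a V u G w) (x₀ : M) {h : M → ℝ}
    (hh_meas : AEMeasurable h (riemannianMeasure N M))
    (hVh : ∀ᵐ z ∂(stMeasure N M).restrict (cylinder M), h z.1 ≤ V z.1 z.2)
    {C α σ₁ σ₂ δ₁ δ₂ R₀ : ℝ} (hC : 0 < C) (hα : 0 ≤ α) (hσ₁ : 0 ≤ σ₁) (hσ₂ : 0 ≤ σ₂)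
    (hδ₁ : 0 ≤ δ₁) (hδ₂ : 0 ≤ δ₂)
    (hh : ∀ᵐ x ∂(riemannianMeasure N M), 0 < h x ∧ h x ≤ C * (1 + dist x₀ x) ^ α)
    (hint₁ : ∀ R, R₀ ≤ R →
      ∫⁻ x in Metric.ball x₀ R, ENNReal.ofReal (h x ^ (-(1 / (q - 1)))) ∂(weightedMeasure N a) ≤
        ENNReal.ofReal (C * R ^ σ₁ * Real.log R ^ δ₁))
    (hint₂ : ∀ R, R₀ ≤ R →
      ∫⁻ x in Metric.ball x₀ R, ENNReal.ofReal (h x ^ (-((p + m - 2) / (q - (p + m - 2)))))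
          ∂(weightedMeasure N a) ≤
        ENNReal.ofReal (C * R ^ σ₂ * Real.log R ^ δ₂))
    (hδ₁_lt : δ₁ < 1 / (q - 1)) (hδ₂_lt : δ₂ < (p + m - 2) / (q - (p + m - 2)))
    (hσ₂_lt : σ₂ < p * q / (q - (p + m - 2)))
    (hσ₁_le : σ₁ ≤ 1 / (q - 1) * (p * q / (q - (p + m - 2)) - σ₂)) :
    ∀ᵐ z ∂(stMeasure N M).restrict (cylinder M), u z.1 z.2 = 0 := by
  have hq1 : 0 < q - 1 := sub_pos.2 ((le_max_right _ _).trans_lt hq)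
  have hD : 0 < q - (p + m - 2) := sub_pos.2 ((le_max_left _ _).trans_lt hq)
  have ham := ha.continuous.measurable
  obtain ⟨θ, C', R₁, k, hθ, -, hk, -, hest⟩ := exists_a_priori_estimate hp hm hq hK hf_meas hf ha hu
    x₀ hh_meas hVh hC hα hσ₁ hσ₂ hδ₁ hδ₂ hh hint₁ hint₂ hσ₂_lt hσ₁_le
  set ν := ((weightedMeasure N a).prod volume).restrict (cylinder M) with hν
  have hac : ν ≪ (stMeasure N M).restrict (cylinder M) := weighted_absolutelyContinuous ham
  have hum : AEMeasurable (fun z : M × ℝ ↦ u z.1 z.2) ν :=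
    ((aestronglyMeasurable_cylinder_of_chart fun c ↦
      (hu.derivs.locInt c).aestronglyMeasurable).mono_ac hac).aemeasurable
  have hhm : AEMeasurable (fun z : M × ℝ ↦ h z.1) ν :=
    ((hh_meas.comp_quasiMeasurePreserving Measure.quasiMeasurePreserving_fst :
      AEMeasurable (fun z : M × ℝ ↦ h z.1) (stMeasure N M)).restrict).mono_ac hac
  -- Take `R = exp n`, so that `β = 1/n`, and `ε = 1/n` as well. Below, the index is shifted by one
  -- to avoid `n = 0`, where these parameters degenerate.
  set F : ℕ → M × ℝ → ℝ≥0∞ := fun n z ↦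
    ENNReal.ofReal (2⁻¹ * (cutFun x₀ θ (n : ℝ)⁻¹ (n : ℝ)⁻¹ k z.1 z.2 *
      (u z.1 z.2 + 1) ^ (-(n : ℝ)⁻¹) * (u z.1 z.2 ^ q * h z.1))) with hF
  have hFm : ∀ n : ℕ, AEMeasurable (F (n + 1)) ν := fun n ↦ by
    have h0 : (0 : ℝ) < ((n + 1 : ℕ) : ℝ)⁻¹ := by positivity
    have h1 := (isTestFunction_cutFun (N := N) (x₀ := x₀) h0 hθ h0 hk).1.lip.continuous.measurable
    exact (((h1.aemeasurable.mul ((hum.add_const 1).pow_const _)).mul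
      ((hum.pow_const q).mul hhm)).const_mul 2⁻¹).ennreal_ofReal
  have hlim : ∀ᵐ z ∂ν, liminf (fun n ↦ F (n + 1) z) atTop =
      ENNReal.ofReal (2⁻¹ * (u z.1 z.2 ^ q * h z.1)) := by
    filter_upwards [hac hu.nonneg, ae_restrict_mem measurableSet_cylinder] with z hz hz'
    have h1 := ENNReal.tendsto_ofReal ((((tendsto_cutFun x₀ θ k z.1 hz'.2).mul
      (tendsto_add_one_rpow hz)).mul_const (u z.1 z.2 ^ q * h z.1)).const_mul 2⁻¹)
    rw [one_mul, one_mul] at h1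
    exact ((tendsto_add_atTop_iff_nat 1).2 h1).liminf_eq
  have hbd : ∀ᶠ n : ℕ in atTop, ∫⁻ z, F (n + 1) z ∂ν ≤
      ENNReal.ofReal (C' * (((n + 1 : ℕ) : ℝ) ^ (1 + δ₂ - q / (q - (p + m - 2))) +
        ((n + 1 : ℕ) : ℝ) ^ (1 + δ₁ - q / (q - 1)))) := by
    have h1 : Tendsto (fun n : ℕ ↦ Real.exp ((n + 1 : ℕ) : ℝ)) atTop atTop :=
      Real.tendsto_exp_atTop.comp
        (tendsto_natCast_atTop_atTop.comp (tendsto_add_atTop_nat 1))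
    filter_upwards [h1.eventually_ge_atTop R₁] with n hn
    have h2 := hest _ hn ((n + 1 : ℕ) : ℝ)⁻¹ (by positivity)
    rwa [Real.log_exp] at h2
  -- Since `q / (q - e) = 1 + e / (q - e)`, the exponent is `δ₂ - e / (q - e)` with `e = p + m - 2`,
  -- negative by the hypothesis on `δ₂`; likewise with `e = 1` for `δ₁`.
  have he₂ : 1 + δ₂ - q / (q - (p + m - 2)) < 0 := by
    have : q / (q - (p + m - 2)) = 1 + (p + m - 2) / (q - (p + m - 2)) := by
      field_simp
      ring
    linarith
  have he₁ : 1 + δ₁ - q / (q - 1) < 0 := by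
    have : q / (q - 1) = 1 + 1 / (q - 1) := by
      field_simp
      ring
    linarith
  -- Fatou's lemma: the integrands converge to half of `u^q h`, while their integrals tend to zero.
  have hzero : ∫⁻ z, ENNReal.ofReal (2⁻¹ * (u z.1 z.2 ^ q * h z.1)) ∂ν = 0 := by
    refine le_antisymm ?_ zero_le
    rw [← lintegral_congr_ae hlim]
    refine (lintegral_liminf_le' hFm).trans ((liminf_le_liminf hbd).trans_eq ?_)
    exact ((tendsto_add_atTop_iff_nat 1).2 (tendsto_rpow_add_rpow (C := C') he₂ he₁)).liminf_eq
  replace hzero := (lintegral_eq_zero_iff'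
    (((hum.pow_const q).mul hhm).const_mul 2⁻¹).ennreal_ofReal).1 hzero
  refine ae_of_ae_weighted ham ha_pos ?_
  filter_upwards [hzero, hac hu.nonneg, ae_weighted_of_ae ham hh] with z hz hz0 hzh
  by_contra hne
  have hpos : 0 < u z.1 z.2 := lt_of_le_of_ne hz0 (Ne.symm hne)
  have := hzh.1
  have h3 : 0 < 2⁻¹ * (u z.1 z.2 ^ q * h z.1) := by positivity
  exact (ENNReal.ofReal_pos.2 h3).ne' hz

end Liouville

end ParabolicIneq

end

/-- The volume conditions are lower integrals with values in `[0, ∞]`, so their bounds include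
integrability over balls. Although `f` is defined on the whole line, it is evaluated only at norms,
where its bounds apply. -/
theorem mainTheorem6 {N : ℕ} {M : Type*} [MetricSpace M] [CompleteSpace M] [NoncompactSpace M]
    [SecondCountableTopology M] [MeasurableSpace M] [BorelSpace M]
    [ChartedSpace (EuclideanSpace ℝ (Fin N)) M] [IsManifold (𝓡 N) ∞ M]
    [RiemannianBundle (fun x : M ↦ TangentSpace (𝓡 N) x)]
    [IsContMDiffRiemannianBundle (𝓡 N) ∞ (EuclideanSpace ℝ (Fin N))
      (fun x : M ↦ TangentSpace (𝓡 N) x)]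
    [IsRiemannianManifold (𝓡 N) M]
    (x₀ : M) (p q m : ℝ) (hp : 1 < p) (hm : 1 ≤ m) (hq : max (p + m - 2) 1 < q)
    (f : ℝ → ℝ) (K : ℝ) (hK : 0 < K) (hf_meas : Measurable f)
    (hf : ∀ s, 0 ≤ s → 0 ≤ f s ∧ f s ≤ K)
    (a : M → ℝ) (ha_lip : LocallyLipschitz a)
    (ha_pos : ∀ᵐ x ∂(ParabolicIneq.riemannianMeasure N M), 0 < a x)
    (V : M → ℝ → ℝ) (hV : ParabolicIneq.LocInt V (ParabolicIneq.riemannianMeasure N M))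
    (h : M → ℝ) (hh_meas : AEMeasurable h (ParabolicIneq.riemannianMeasure N M))
    (hVh : ∀ᵐ z ∂((ParabolicIneq.riemannianMeasure N M).prod volume).restrict
      (ParabolicIneq.cylinder M), h z.1 ≤ V z.1 z.2)
    (C α σ₁ σ₂ δ₁ δ₂ : ℝ) (hC : 0 < C) (hα : 0 ≤ α) (hσ₁ : 0 ≤ σ₁) (hσ₂ : 0 ≤ σ₂)
    (hδ₁ : 0 ≤ δ₁) (hδ₂ : 0 ≤ δ₂)
    (hh : ∀ᵐ x ∂(ParabolicIneq.riemannianMeasure N M),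
      0 < h x ∧ h x ≤ C * (1 + dist x₀ x) ^ α)
    (R₀ : ℝ)
    (hint₁ : ∀ R, R₀ ≤ R →
      ∫⁻ x in Metric.ball x₀ R, ENNReal.ofReal (h x ^ (-(1 / (q - 1))))
          ∂(ParabolicIneq.weightedMeasure N a) ≤
        ENNReal.ofReal (C * R ^ σ₁ * Real.log R ^ δ₁))
    (hint₂ : ∀ R, R₀ ≤ R →
      ∫⁻ x in Metric.ball x₀ R, ENNReal.ofReal (h x ^ (-((p + m - 2) / (q - p - m + 2))))
          ∂(ParabolicIneq.weightedMeasure N a) ≤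
        ENNReal.ofReal (C * R ^ σ₂ * Real.log R ^ δ₂))
    (hδ₁_lt : δ₁ < 1 / (q - 1)) (hδ₂_lt : δ₂ < (p + m - 2) / (q - p - m + 2))
    (hσ₂_lt : σ₂ < p * q / (q - p - m + 2))
    (hσ₁_le : σ₁ ≤ 1 / (q - 1) * (p * q / (q - p - m + 2) - σ₂)) :
    ¬ ∃ u : M → ℝ → ℝ, ParabolicIneq.IsWeakSolution N p q m f a V u ∧
      ¬ (∀ᵐ z ∂((ParabolicIneq.riemannianMeasure N M).prod volume).restrict
        (ParabolicIneq.cylinder M), u z.1 z.2 = 0) := by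
  rintro ⟨u, ⟨hu_nonneg, hu_source, G, w, hu_derivs, hu_power, hu_energy, -, hu_weak⟩, hu_ne⟩
  rw [show q - p - m + 2 = q - (p + m - 2) by ring] at hδ₂_lt hσ₂_lt hσ₁_le hint₂
  exact hu_ne (ParabolicIneq.IsSolutionTriple.ae_eq_zero hp hm hq hK.le hf_meas hf ha_lip ha_pos
    ⟨hu_nonneg, hu_source, hu_derivs, hu_power, hu_energy, hu_weak⟩ x₀ hh_meas hVh hC hα hσ₁ hσ₂
    hδ₁ hδ₂ hh hint₁ hint₂ hδ₁_lt hδ₂_lt hσ₂_lt hσ₁_le)
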